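/- Let $d,m$ be the space dimension and the number of auxiliary variables, let $\beta>0$, $\alpha_1,\dots,\alpha_m>0$, $\lambda_1,\dots,\lambda_m\in\mathbb R$, and let $x=(q,p,z)$, $z=(z_1,\dots,z_m)$, range over $X=\mathbb T^d\times\mathbb R^d\times\mathbb R^{dm}$, where $\mathbb T^d=(\mathbb R/\ell\mathbb Z)^d$ for some $\ell>0$, or over $Y=\mathbb R^d\times\mathbb R^d\times\mathbb R^{dm}$. For a potential $V$ let $\mu_\beta(dx)=Z^{-1}e^{-\beta(V(q)+\frac12|p|^2+\frac12|z|^2)}\,dx$ be the Gibbs probability measure, $L^2_\rho=L^2(\mu_\beta)$ (real-valued functions), $$B=-p\cdot\nabla_q+\nabla V\cdot\nabla_p-\sum_{j=1}^m\lambda_j\,(z_j\cdot\nabla_p-p\cdot\nabla_{z_j}),\qquad \mathcal L=B+\sum_{j=1}^m\alpha_j\,(z_j\cdot\nabla_{z_j}-\beta^{-1}\Delta_{z_j}),$$ so that $-\mathcal L$ is the generator of the Markovian generalized Langevin system $$\dot q=p,\qquad \dot p=-\nabla V(q)+\sum_j\lambda_jz_j,\qquad \dot z_j=-\lambda_jp-\alpha_jz_j+\sqrt{2\alpha_j\beta^{-1}}\,\dot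 W_j .$$ Let $C_0=A=(-\partial_{z_{j,i}})_{1\le j\le m,\,1\le i\le d}$, $C_1=[A,B]$ and $C_2=[C_1,B]$ (componentwise commutators); explicitly $C_1=(\lambda_j\partial_{p_i})_{j,i}$ and $C_2=\big(\lambda_j\big(\sum_{l}\lambda_l\partial_{z_{l,i}}-\partial_{q_i}\big)\big)_{j,i}$, so for $d=m=\lambda_1=1$ one has $C_0=-\partial_z$, $C_1=\partial_p$, $C_2=\partial_z-\partial_q$. The operators $\mathcal L$ and $C_k$ are identified with the closures in $L^2_\rho$ of their restrictions to smooth compactly supported functions. Assume either (a) the phase space is $X$ and $V\in C^2(\mathbb T^d)$; or (b) the phase space is $Y$, and $V\in C^2(\mathbb R^d)$ is confining, i.e. $V(q)\to\infty$ as $|q|\to\infty$ and $e^{-\beta V}\in L^1(\mathbb R^d)$, and has bounded second derivatives: $\sup_q\|\nabla^2V(q)\|<\infty$. Then $-\mathcal L$ generates a unique strongly continuous semigroup $e^{-t\mathcal L}$ on $L^2_\rho$, and there is a constant $C$ such that for every $t\in(0,1]$, every $k\in\{0,1,2\}$ and every $f\in L^2_\rho$ the function $e^{-t\mathcal L}f$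 lies in the domain of $C_k$, and $$\|C_k\,e^{-t\mathcal L}\|_{L^2_\rho\to L^2_\rho}\le C\,t^{-\frac{1+2k}{2}},$$ where for the vector of operators $C_k$ the norm of the target is that of $L^2_\rho\otimes\mathbb R^{dm}$. -/

import Mathlib

open MeasureTheory Filter Topology

namespace GLE

/-- `ℝ^d` with its Euclidean structure. -/
abbrev Vec (d : ℕ) : Type := EuclideanSpace ℝ (Fin d)

/-- The torus `(ℝ / ℓℤ)^d`. -/
abbrev Torus (d : ℕ) (ℓ : ℝ) : Type := Fin d → AddCircle ℓ

/-- The covering map `ℝ^d → (ℝ / ℓℤ)^d`. -/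
def torusMk (d : ℕ) (ℓ : ℝ) (q : Vec d) : Torus d ℓ := fun i => (q i : AddCircle ℓ)

/-- Points `x = (q, p, z)` with position `q` in `Q` (which is `ℝ^d` or the torus), momentum
`p ∈ ℝ^d` and auxiliary variables `z = (z_1, …, z_m) ∈ (ℝ^d)^m`. -/
abbrev Phase (Q : Type) (d m : ℕ) : Type := Q × Vec d × (Fin m → Vec d)

section Operators

/- `π : ℝ^d → Q` is the covering map of the position space: the identity if `Q = ℝ^d`,
the quotient map if `Q` is the torus. -/
variable {Q : Type} [AddCommGroup Q] {d m : ℕ} (π : Vec d → Q)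

/-- Derivative of `f` at `x` in the direction `v`. -/
noncomputable def dir (v : Phase (Vec d) d m) (f : Phase Q d m → ℝ) (x : Phase Q d m) : ℝ :=
  deriv (fun s : ℝ => f (x.1 + π (s • v.1), x.2.1 + s • v.2.1, x.2.2 + s • v.2.2)) 0

/-- `∂/∂q_i`. -/
noncomputable def dq (i : Fin d) : (Phase Q d m → ℝ) → Phase Q d m → ℝ :=
  dir π (EuclideanSpace.single i 1, 0, 0)

/-- `∂/∂p_i`. -/
noncomputable def dp (i : Fin d) : (Phase Q d m → ℝ) → Phase Q d m → ℝ :=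
  dir π (0, EuclideanSpace.single i 1, 0)

/-- `∂/∂z_{j,i}`, the derivative in the `i`-th component of `z_j ∈ ℝ^d`. -/
noncomputable def dz (j : Fin m) (i : Fin d) : (Phase Q d m → ℝ) → Phase Q d m → ℝ :=
  dir π (0, 0, Pi.single j (EuclideanSpace.single i 1))

/-- The `i`-th component of `∇V`. -/
noncomputable def gradV (V : Q → ℝ) (i : Fin d) (q : Q) : ℝ :=
  deriv (fun s : ℝ => V (q + π (s • EuclideanSpace.single i 1))) 0

variable (V : Q → ℝ) (α lam : Fin m → ℝ) (β : ℝ)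

/-- `B = -p·∇_q + ∇V·∇_p - ∑_j λ_j (z_j·∇_p - p·∇_{z_j})`. -/
noncomputable def opB (f : Phase Q d m → ℝ) (x : Phase Q d m) : ℝ :=
  ∑ i : Fin d, (-(x.2.1 i * dq π i f x) + gradV π V i x.1 * dp π i f x
    - ∑ j : Fin m, lam j * (x.2.2 j i * dp π i f x - x.2.1 i * dz π j i f x))

/-- The operator `𝓛 = B + ∑_j α_j (z_j·∇_{z_j} - β⁻¹ Δ_{z_j})`, i.e. `-𝓛` is the generator of
`dq = p dt`, `dp = (-∇V(q) + ∑_j λ_j z_j) dt`,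
`dz_j = (-λ_j p - α_j z_j) dt + √(2 α_j β⁻¹) dW_j`. -/
noncomputable def opL (f : Phase Q d m → ℝ) (x : Phase Q d m) : ℝ :=
  opB π V lam f x + ∑ j : Fin m, ∑ i : Fin d,
    α j * (x.2.2 j i * dz π j i f x - β⁻¹ * dz π j i (dz π j i f) x)

/-- The vectors of operators `C_0 = A = (-∂/∂z_{j,i})_{j,i}` and `C_{k+1} = [C_k, B]`. -/
noncomputable def opC : ℕ → Fin m × Fin d → (Phase Q d m → ℝ) → Phase Q d m → ℝ
  | 0, ji, f => fun x => -dz π ji.1 ji.2 f x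
  | k + 1, ji, f => fun x => opC k ji (opB π V lam f) x - opB π V lam (opC k ji f) x

/-- Test functions: smooth functions with compact support. -/
def IsTest [TopologicalSpace Q] (φ : Phase Q d m → ℝ) : Prop :=
  ContDiff ℝ ((⊤ : ℕ∞) : WithTop ℕ∞) (fun y : Phase (Vec d) d m => φ (π y.1, y.2)) ∧
    HasCompactSupport φ

end Operators

section Gibbs

variable {Q : Type} [MeasureSpace Q] {d : ℕ} (m : ℕ) (V : Q → ℝ) (β : ℝ)

/-- The Gibbs probability measure `μ_β`, with density
`Z⁻¹ exp(-β (V(q) + |p|²/2 + |z|²/2))`, `Z = ∫ exp(-β (V(q) + |p|²/2 + |z|²/2))`. -/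
noncomputable def gibbs : Measure (Phase Q d m) :=
  (volume : Measure (Phase Q d m)).tilted fun x =>
    -β * (V x.1 + ‖x.2.1‖ ^ 2 / 2 + (∑ j : Fin m, ‖x.2.2 j‖ ^ 2) / 2)

/-- The space `L²_ρ = L²(μ_β)`. -/
abbrev L2 (d : ℕ) {Q : Type} [MeasureSpace Q] (m : ℕ) (V : Q → ℝ) (β : ℝ) : Type :=
  Lp ℝ 2 (gibbs (d := d) m V β)

end Gibbs

section Semigroup

variable {Q : Type} [AddCommGroup Q] [TopologicalSpace Q] [MeasureSpace Q] {d m : ℕ}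
  (π : Vec d → Q) (V : Q → ℝ) (α lam : Fin m → ℝ) (β : ℝ)

/-- The graph of the closure in `L²_ρ` of the operator `𝓛` on test functions. -/
def closureL : Set (L2 d m V β × L2 d m V β) :=
  closure {r | ∃ φ : Phase Q d m → ℝ, IsTest π φ ∧
    r.1 =ᵐ[gibbs m V β] φ ∧ r.2 =ᵐ[gibbs m V β] opL π V α lam β φ}

/-- The graph of the closure of the vector of operators `C_k`, defined on test functions,
as an operator from `L²_ρ` to `L²_ρ ⊗ ℝ^{dm}` (with its Hilbert norm). -/
def closureC (k : ℕ) : Set (L2 d m V β × PiLp 2 fun _ : Fin m × Fin d => L2 d m V β) :=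
  closure {r | ∃ φ : Phase Q d m → ℝ, IsTest π φ ∧
    r.1 =ᵐ[gibbs m V β] φ ∧ ∀ ji, r.2 ji =ᵐ[gibbs m V β] opC π V lam k ji φ}

/-- `T` is a strongly continuous one-parameter semigroup of bounded operators on the Banach
space `E`. -/
structure IsC0Semigroup {E : Type*} [NormedAddCommGroup E] [NormedSpace ℝ E]
    (T : NNReal → E →L[ℝ] E) : Prop where
  zero : T 0 = ContinuousLinearMap.id ℝ E
  add : ∀ s t, T (s + t) = (T s).comp (T t)
  continuous : ∀ u, Continuous fun t => T t u

/-- `T t = e^{-t𝓛}`: `T` is a strongly continuous semigroup on `L²_ρ` whose infinitesimal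
generator `u ↦ lim_{h → 0+} (T_h u - u)/h`, on the set of all `u` for which this limit exists,
is minus the closure of `𝓛`. -/
structure IsExpNegL (T : NNReal → L2 d m V β →L[ℝ] L2 d m V β) : Prop
    extends IsC0Semigroup T where
  generator : ∀ u g : L2 d m V β,
    Tendsto (fun h : NNReal => (h : ℝ)⁻¹ • (T h u - u)) (𝓝[>] 0) (𝓝 g) ↔
      (u, -g) ∈ closureL π V α lam β

end Semigroup

/-- `V` is confining at inverse temperature `β`: `V(q) → ∞` as `|q| → ∞`, and the Gibbs weight
`e^{-βV}` is integrable. -/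
def IsConfining {d : ℕ} (β : ℝ) (V : Vec d → ℝ) : Prop :=
  Tendsto V (cocompact (Vec d)) atTop ∧ Integrable fun q => Real.exp (-β * V q)

/-- The second derivatives of `V` are bounded (in the operator norm). -/
def HasBoundedHessian {d : ℕ} (V : Vec d → ℝ) : Prop :=
  ∃ c : ℝ, ∀ q, ‖fderiv ℝ (fderiv ℝ V) q‖ ≤ c

end GLE

/-! The smoothing estimate is a hypocoercivity argument with time weights. Along a solution of `u' =
-𝓛u` one follows F(t) = ‖u‖² + a t ‖C_0 u‖² + 2b t² ⟨C_0 u, C_1 u⟩ + c t³ ‖C_1 u‖² + 2d t⁴ ⟨C_1 u,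
C_2 u⟩ + e t⁵ ‖C_2 u‖². The noise alone dissipates only C_0 u. Commuting C_0 and C_1 with `𝓛` in the
two cross terms produces -‖C_1 u‖² and -‖C_2 u‖². The commutator of C_2 with `𝓛` involves only C_0
and C_1, with bounded coefficients because the Hessian of V is bounded, so the hierarchy closes. For
suitably ordered small weights F is nonincreasing on [0,1], F(0) = ‖u(0)‖², and F dominates half of
its diagonal terms, which gives the rates t^{-1/2}, t^{-3/2}, t^{-5/2}. The algebra is in
`IsWeight.dissipation_le` and the application to `𝓛` in `IsSetting.exists_lyapunovDeriv_le`.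

The analytic difficulty is that V is only C², so solutions need not be smooth. One fact supplies all
that is needed: for all large l, the range of l + 𝓛 on test functions is dense in the norm of the
first order Sobolev space over the Gibbs measure (`IsSetting.exists_norm_sobolev_resolvent_lt`).
With the Hille-Yosida theorem `IsAccretive.exists_semigroup` it yields the semigroup on L². It also
yields, since `𝓛` is accretive up to a constant in the Sobolev space, a flow there whose orbits
solve the equation in the closure of the graph. The dissipation inequality contains only first
derivatives of u and of `𝓛u`, hence extends from test functions to this closure
(`IsSetting.exists_norm_tupleC_le`). Uniqueness for accretive evolutions identifies the Sobolev flow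
with the semigroup on L². Density of test functions and closability of C_k, which has a densely
defined formal adjoint, give the estimate for all initial data.

For the density of the range an approximate solution is constructed by hand. The force is mollified
at scale δ, the diffusion is replaced by a Markov chain with time step τ and finitely many noise
values, and the resolvent of the chain is replaced by a truncated Neumann series, which is a test
function. The derivatives of order j of the Jacobian of the mollified drift are of size δ^{-j}. In
norms weighted accordingly (`DerLE`) the chain grows at a rate independent of δ, so the threshold
for l does not depend on δ either. Mollification with an even kernel changes the force by o(δ),
which beats the size δ^{-1} of the second derivatives of the approximate solution. The
discretization error and the tail of the series then vanish as τ tends to 0 and the length of the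
series to infinity. -/

namespace GLE

/-! ### Accretive operators given on a core: closures and resolvents. -/

section Accretive

open scoped InnerProductSpace

/-- A continuous curve whose right derivative makes a nonpositive angle with it has
nonincreasing norm. -/
theorem norm_le_of_inner_rightDeriv_nonpos {H : Type*} [NormedAddCommGroup H]
    [InnerProductSpace ℝ H] {w g : ℝ → H} (hw : Continuous w)
    (hd : ∀ t, 0 ≤ t → HasDerivWithinAt w (g t) (Set.Ici t) t)
    (h : ∀ t, 0 ≤ t → ⟪w t, g t⟫_ℝ ≤ 0) {t : ℝ} (ht : 0 ≤ t) : ‖w t‖ ≤ ‖w 0‖ := by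
  -- Semigroup orbits are only known to be right differentiable, so the comparison of ‖w‖² with a
  -- constant uses its one-sided version.
  have key := image_le_of_deriv_right_le_deriv_boundary (f := fun s => ‖w s‖ ^ 2)
    (f' := fun s => 2 * ⟪w s, g s⟫_ℝ) (a := 0) (b := t) (B := fun _ => ‖w 0‖ ^ 2)
    (B' := fun _ => 0) (by fun_prop) (fun x hx => (hd x hx.1).norm_sq) le_rfl
    (by fun_prop) (fun x _ => hasDerivWithinAt_const _ _ _)
    (fun x hx => by nlinarith [h x hx.1]) (Set.right_mem_Icc.2 ht)
  exact (pow_le_pow_iff_left₀ (norm_nonneg _) (norm_nonneg _) two_ne_zero).1 key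

variable {D H : Type*} [AddCommGroup D] [Module ℝ D] [NormedAddCommGroup H]
  [InnerProductSpace ℝ H]

/-- The closure in `H × H` of the graph of the operator `K φ ↦ A φ`. -/
def graphClosure (K A : D →ₗ[ℝ] H) : Submodule ℝ (H × H) :=
  (LinearMap.range (K.prod A)).topologicalClosure

/-- The operator `K φ ↦ A φ` is densely defined, accretive, and `c K + A` has dense range for
all large `c`. -/
structure IsAccretive (K A : D →ₗ[ℝ] H) : Prop where
  nonneg : ∀ φ, 0 ≤ ⟪K φ, A φ⟫_ℝ
  dense : DenseRange K
  range : ∀ᶠ c : ℝ in atTop, DenseRange (c • K + A)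

variable {K A : D →ₗ[ℝ] H}

/-- Closed conditions need only be tested on the core; every passage from test functions to the
domain of a closure has this form. -/
theorem graphClosure_induction {p : H × H → Prop} (hp : IsClosed {r | p r})
    (h : ∀ φ, p (K φ, A φ)) {r : H × H} (hr : r ∈ graphClosure K A) : p r := by
  have : closure (LinearMap.range (K.prod A) : Set (H × H)) ⊆ {r | p r} := by
    refine hp.closure_subset_iff.2 ?_
    rintro _ ⟨φ, rfl⟩
    exact h φ
  exact this hr

theorem mem_graphClosure (φ : D) : (K φ, A φ) ∈ graphClosure K A :=
  subset_closure ⟨φ, rfl⟩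

theorem mem_graphClosure_iff {r : H × H} :
    r ∈ graphClosure K A ↔ r ∈ closure (Set.range fun φ => (K φ, A φ)) := by
  have : (Set.range fun φ => (K φ, A φ)) = (LinearMap.range (K.prod A) : Set (H × H)) := by
    ext x; simp [LinearMap.prod_apply]
  rw [this]; rfl

namespace IsAccretive

variable (hA : IsAccretive K A)
include hA

theorem inner_nonneg {r : H × H} (hr : r ∈ graphClosure K A) : 0 ≤ ⟪r.1, r.2⟫_ℝ :=
  graphClosure_induction (p := fun r => 0 ≤ ⟪r.1, r.2⟫_ℝ)
    (isClosed_le continuous_const (by fun_prop)) hA.nonneg hr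

/-- Pair `c • r.1 + r.2` with `r.1` and apply Cauchy-Schwarz. This one bound gives injectivity,
closedness of the range and the resolvent estimate 1/c. -/
theorem le_norm {r : H × H} (hr : r ∈ graphClosure K A) (c : ℝ) :
    c * ‖r.1‖ ≤ ‖c • r.1 + r.2‖ := by
  have h1 := hA.inner_nonneg hr
  have h2 : c * ‖r.1‖ ^ 2 ≤ ⟪r.1, c • r.1 + r.2⟫_ℝ := by
    rw [inner_add_right, inner_smul_right, real_inner_self_eq_norm_sq]; linarith
  have h3 := real_inner_le_norm r.1 (c • r.1 + r.2)
  rcases (norm_nonneg r.1).eq_or_lt with h | h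
  · rw [← h]; simp
  · nlinarith

theorem eq_of_solution {c : ℝ} (hc : 0 < c) {r s : H × H} (hr : r ∈ graphClosure K A)
    (hs : s ∈ graphClosure K A) (h : c • r.1 + r.2 = c • s.1 + s.2) : r.1 = s.1 := by
  have h1 := hA.le_norm (sub_mem hr hs) c
  have h2 : c • (r - s).1 + (r - s).2 = 0 := by
    simp only [Prod.fst_sub, Prod.snd_sub, smul_sub]
    rw [← sub_eq_zero] at h
    rw [← h]; abel
  rw [h2, norm_zero] at h1
  have h3 : ‖(r - s).1‖ ≤ 0 := by nlinarith [norm_nonneg (r - s).1]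
  simpa [sub_eq_zero] using h3

variable [CompleteSpace H]

/-- On the closed graph the map `r ↦ c • r.1 + r.2` is bounded below, so its range is closed; the
range contains a dense set and hence is everything. -/
theorem exists_solution {c : ℝ} (hc : 0 < c) (hr : DenseRange (c • K + A)) (f : H) :
    ∃ r ∈ graphClosure K A, c • r.1 + r.2 = f := by
  let Φ : graphClosure K A →ₗ[ℝ] H :=
    (c • LinearMap.fst ℝ H H + LinearMap.snd ℝ H H) ∘ₗ (graphClosure K A).subtype
  have hΦ : ∀ r, Φ r = c • r.1.1 + r.1.2 := fun r => rfl
  have hcl : IsClosed (graphClosure K A : Set (H × H)) := Submodule.isClosed_topologicalClosure _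
  have : CompleteSpace (graphClosure K A) := hcl.completeSpace_coe
  have hcont : Continuous Φ := by
    have : (Φ : graphClosure K A → H) = fun r => c • r.1.1 + r.1.2 := rfl
    rw [this]; fun_prop
  -- The first component is bounded by ‖Φ r‖/c and the second by ‖Φ r‖ + c‖r.1‖ ≤ 2‖Φ r‖; the
  -- constant covers both.
  have hanti : AntilipschitzWith (⟨2 + 1 / c, by positivity⟩ : NNReal) Φ := by
    refine AddMonoidHomClass.antilipschitz_of_bound Φ fun r => ?_
    have h1 := hA.le_norm r.2 c
    rw [← hΦ] at h1
    have h2 : ‖r.1.2‖ ≤ ‖Φ r‖ + c * ‖r.1.1‖ := by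
      have : r.1.2 = Φ r - c • r.1.1 := by rw [hΦ]; abel
      rw [this]
      refine (norm_sub_le _ _).trans ?_
      rw [norm_smul, Real.norm_of_nonneg hc.le]
    have h3 : ‖r.1.1‖ ≤ ‖Φ r‖ / c := by rw [le_div_iff₀ hc]; linarith
    have h4 : 0 ≤ ‖Φ r‖ := norm_nonneg _
    have h5 : (2 + 1 / c) * ‖Φ r‖ = 2 * ‖Φ r‖ + ‖Φ r‖ / c := by ring
    have h6 : 0 ≤ ‖Φ r‖ / c := by positivity
    change ‖r.1‖ ≤ (2 + 1 / c) * ‖Φ r‖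
    rw [Prod.norm_def, h5]
    refine max_le (by linarith) ?_
    refine h2.trans ?_
    linarith
  have hrange : IsClosed (Set.range Φ) :=
    hanti.isClosed_range (uniformContinuous_addMonoidHom_of_continuous hcont)
  have huniv : Set.range Φ = Set.univ := by
    refine Set.eq_univ_of_univ_subset ?_
    rw [← hr.closure_range]
    refine hrange.closure_subset_iff.2 ?_
    rintro _ ⟨φ, rfl⟩
    exact ⟨⟨_, mem_graphClosure φ⟩, rfl⟩
  obtain ⟨r, hr⟩ := huniv ▸ Set.mem_univ f
  exact ⟨r.1, r.2, hr⟩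

/-- The resolvent exists for all large `c`. -/
theorem exists_resolvent {c : ℝ} (hc : 0 < c) (hr : DenseRange (c • K + A)) :
    ∃ R : H →L[ℝ] H, (∀ f, (R f, f - c • R f) ∈ graphClosure K A) ∧
      ∀ r ∈ graphClosure K A, R (c • r.1 + r.2) = r.1 := by
  choose r hr1 hr2 using hA.exists_solution hc hr
  have huniq : ∀ s ∈ graphClosure K A, (r (c • s.1 + s.2)).1 = s.1 := fun s hs =>
    hA.eq_of_solution hc (hr1 _) hs (hr2 _)
  let R : H →ₗ[ℝ] H :=
    { toFun := fun f => (r f).1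
      map_add' := fun f g => by
        have := huniq _ (add_mem (hr1 f) (hr1 g))
        rw [Prod.fst_add, Prod.snd_add, smul_add, add_add_add_comm, hr2, hr2] at this
        exact this
      map_smul' := fun a f => by
        simp only [RingHom.id_apply]
        have := huniq _ ((graphClosure K A).smul_mem a (hr1 f))
        rw [Prod.smul_fst, Prod.smul_snd, smul_comm, ← smul_add, hr2] at this
        exact this }
  have hR : ∀ f, ‖R f‖ ≤ c⁻¹ * ‖f‖ := fun f => by
    have := hA.le_norm (hr1 f) c
    rw [hr2] at this
    rw [inv_mul_eq_div, le_div_iff₀ hc, mul_comm]; exact this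
  refine ⟨R.mkContinuous _ hR, fun f => ?_, fun s hs => huniq s hs⟩
  have : f - c • (r f).1 = (r f).2 := by nth_rw 1 [← hr2 f]; abel
  change ((r f).1, f - c • (r f).1) ∈ _
  rw [this]; exact hr1 f

end IsAccretive

end Accretive

/-! ### Exponentials of bounded monotone operators and their strong limits. -/

section HilleYosida

open scoped InnerProductSpace
open NormedSpace

variable {H : Type*} [NormedAddCommGroup H] [InnerProductSpace ℝ H] [CompleteSpace H]

theorem hasDerivAt_exp_neg_smul_apply (P : H →L[ℝ] H) (u : H) (t : ℝ) :
    HasDerivAt (fun s : ℝ => exp (s • (-P)) u) (-(P (exp (t • (-P)) u))) t := by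
  have h := (hasDerivAt_exp_smul_const' (𝕂 := ℝ) (-P) t).clm_apply (hasDerivAt_const t u)
  simpa using h

theorem norm_exp_neg_smul_apply_le {P : H →L[ℝ] H} (hP : ∀ u, 0 ≤ ⟪u, P u⟫_ℝ) {t : ℝ}
    (ht : 0 ≤ t) (u : H) : ‖exp (t • (-P)) u‖ ≤ ‖u‖ := by
  have hd := hasDerivAt_exp_neg_smul_apply P u
  have h := norm_le_of_inner_rightDeriv_nonpos (w := fun s : ℝ => exp (s • (-P)) u)
    (continuous_iff_continuousAt.2 fun s => (hd s).continuousAt)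
    (fun s _ => (hd s).hasDerivWithinAt) (fun s _ => by
      rw [inner_neg_right]; linarith [hP (exp (s • (-P)) u)]) ht
  simpa using h

theorem exp_add_neg_smul (P : H →L[ℝ] H) (s t : ℝ) :
    exp ((s + t) • (-P)) = exp (s • (-P)) * exp (t • (-P)) := by
  let _ : NormedAlgebra ℚ (H →L[ℝ] H) := NormedAlgebra.restrictScalars ℚ ℝ _
  rw [add_smul, exp_add_of_commute]
  exact ((Commute.refl (-P)).smul_left s).smul_right t

/-- Duhamel: interpolate by s ↦ exp(-(t-s)Q) exp(-sP) u. Since P and Q commute, its derivative is a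
product of contractions applied to Q u - P u. -/
theorem norm_exp_sub_exp_le {P Q : H →L[ℝ] H} (hP : ∀ u, 0 ≤ ⟪u, P u⟫_ℝ)
    (hQ : ∀ u, 0 ≤ ⟪u, Q u⟫_ℝ) (hPQ : Commute P Q) {t : ℝ} (ht : 0 ≤ t) (u : H) :
    ‖exp (t • (-P)) u - exp (t • (-Q)) u‖ ≤ t * ‖P u - Q u‖ := by
  have hd : ∀ s : ℝ, HasDerivAt (fun s : ℝ => exp ((t - s) • (-Q)) (exp (s • (-P)) u))
      (exp ((t - s) • (-Q)) (exp (s • (-P)) (Q u - P u))) s := fun s => by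
    have h1 := (hasDerivAt_exp_smul_const (𝕂 := ℝ) (-Q) (t - s)).scomp s
      ((hasDerivAt_id s).const_sub t)
    have h2 := h1.clm_apply (hasDerivAt_exp_neg_smul_apply P u s)
    have h3 : P (exp (s • (-P)) u) = exp (s • (-P)) (P u) :=
      DFunLike.congr_fun ((Commute.refl P).neg_right.smul_right s).exp_right.eq u
    have h4 : Q (exp (s • (-P)) u) = exp (s • (-P)) (Q u) :=
      DFunLike.congr_fun (hPQ.symm.neg_right.smul_right s).exp_right.eq u
    have h5 : ((-1 : ℝ) • (exp ((t - s) • (-Q)) * -Q)) (exp (s • (-P)) u) =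
        exp ((t - s) • (-Q)) (Q (exp (s • (-P)) u)) := by simp
    refine h2.congr_deriv ?_
    rw [h5, h3, h4, Function.comp_apply, map_sub, map_sub, map_neg]
    exact (sub_eq_add_neg _ _).symm
  have h := norm_image_sub_le_of_norm_deriv_le_segment' (a := 0) (b := t)
    (C := ‖P u - Q u‖) (fun s _ => (hd s).hasDerivWithinAt) (fun s hs => ?_) t
    (Set.right_mem_Icc.2 ht)
  · simpa [mul_comm] using h
  · refine (norm_exp_neg_smul_apply_le hQ (by linarith [hs.2]) _).trans ?_
    refine (norm_exp_neg_smul_apply_le hP hs.1 _).trans ?_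
    rw [norm_sub_rev]

theorem norm_exp_sub_self_le {P : H →L[ℝ] H} (hP : ∀ u, 0 ≤ ⟪u, P u⟫_ℝ) {t : ℝ} (ht : 0 ≤ t)
    (u : H) : ‖exp (t • (-P)) u - u‖ ≤ t * ‖P u‖ := by
  have h := norm_exp_sub_exp_le hP (Q := 0) (by simp) (Commute.zero_right P) ht u
  simpa using h

/-- A quantitative derivative at time 0, to be used when P approximates an unbounded operator with
value g at u. The auxiliary vector v stands for a point of the domain close to g, where ‖P v‖ stays
bounded, so the right side survives the limit in P. -/
theorem norm_exp_sub_add_le {P : H →L[ℝ] H} (hP : ∀ u, 0 ≤ ⟪u, P u⟫_ℝ) {t : ℝ} (ht : 0 ≤ t)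
    (u g v : H) : ‖exp (t • (-P)) u - u + t • g‖ ≤
      t * (‖P u - g‖ + 2 * ‖g - v‖ + t * ‖P v‖) := by
  have hd : ∀ s : ℝ, HasDerivAt (fun s : ℝ => exp (s • (-P)) u + s • g)
      (g - exp (s • (-P)) (P u)) s := fun s => by
    have h3 : P (exp (s • (-P)) u) = exp (s • (-P)) (P u) :=
      DFunLike.congr_fun ((Commute.refl P).neg_right.smul_right s).exp_right.eq u
    have := (hasDerivAt_exp_neg_smul_apply P u s).add ((hasDerivAt_id s).smul_const g)
    refine this.congr_deriv ?_
    rw [h3, one_smul]; abel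
  have h := norm_image_sub_le_of_norm_deriv_le_segment' (a := 0) (b := t)
    (C := ‖P u - g‖ + 2 * ‖g - v‖ + t * ‖P v‖) (fun s _ => (hd s).hasDerivWithinAt)
    (fun s hs => ?_) t (Set.right_mem_Icc.2 ht)
  · have e : exp (t • (-P)) u + t • g - (exp ((0 : ℝ) • (-P)) u + (0 : ℝ) • g) =
        exp (t • (-P)) u - u + t • g := by simp; abel
    rw [e] at h
    linarith
  · have e : g - exp (s • (-P)) (P u) = -(exp (s • (-P)) (P u - g)) +
        ((g - v) - exp (s • (-P)) (g - v)) - (exp (s • (-P)) v - v) := by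
      simp only [map_sub]; abel
    have h1 := norm_exp_neg_smul_apply_le hP hs.1 (P u - g)
    have h2 := norm_exp_neg_smul_apply_le hP hs.1 (g - v)
    have h3 := norm_exp_sub_self_le hP hs.1 v
    have h4 : s * ‖P v‖ ≤ t * ‖P v‖ := by gcongr; exact hs.2.le
    rw [e]
    refine (norm_sub_le _ _).trans ?_
    have h5 := norm_add_le (-(exp (s • (-P)) (P u - g))) ((g - v) - exp (s • (-P)) (g - v))
    have h6 := norm_sub_le (g - v) (exp (s • (-P)) (g - v))
    rw [norm_neg] at h5
    linarith

/-- If bounded commuting monotone operators `P n` converge to an operator on a dense domain,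
boundedly in its graph norm, then the semigroups `exp (-t P n)` converge to a contraction
semigroup whose generator extends minus that operator. -/
theorem exists_contraction_semigroup {P : ℕ → H →L[ℝ] H} (hP : ∀ n u, 0 ≤ ⟪u, P n u⟫_ℝ)
    (hcomm : ∀ n k, Commute (P n) (P k)) {G : Set (H × H)}
    (hdense : Dense {u | ∃ g, (u, g) ∈ G})
    (hlim : ∀ r ∈ G, Tendsto (fun n => P n r.1) atTop (𝓝 r.2))
    (hbd : ∀ r ∈ G, ∀ n, ‖P n r.1‖ ≤ ‖r.2‖) :
    ∃ T : NNReal → H →L[ℝ] H, IsC0Semigroup T ∧ (∀ t u, ‖T t u‖ ≤ ‖u‖) ∧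
      ∀ r ∈ G, Tendsto (fun h : NNReal => (h : ℝ)⁻¹ • (T h r.1 - r.1)) (𝓝[>] 0) (𝓝 (-r.2)) := by
  let S : ℕ → NNReal → H →L[ℝ] H := fun n t => exp ((t : ℝ) • (-(P n)))
  have hS : ∀ n t u, ‖S n t u‖ ≤ ‖u‖ := fun n t u => norm_exp_neg_smul_apply_le (hP n) t.coe_nonneg u
  have happrox : ∀ (g : H) (e : ℝ), 0 < e → ∃ r ∈ G, ‖g - r.1‖ < e := fun g e he => by
    obtain ⟨v, ⟨a, hv⟩, h⟩ := Metric.mem_closure_iff.1 (hdense g) e he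
    exact ⟨(v, a), hv, by rwa [← dist_eq_norm]⟩
  -- On the dense domain the exponentials are compared through the convergence of `P n r.1`;
  -- contractivity takes care of the distance from u to the domain.
  have hcauchy : ∀ t u, CauchySeq fun n => S n t u := fun t u => by
    refine Metric.cauchySeq_iff.2 fun e he => ?_
    obtain ⟨r, hr, hur⟩ := happrox u (e / 4) (by positivity)
    obtain ⟨N, hN⟩ := Metric.cauchySeq_iff.1 (hlim r hr).cauchySeq (e / (2 * (t + 1)))
      (by positivity)
    refine ⟨N, fun n hn k hk => ?_⟩
    have h1 := hN n hn k hk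
    rw [dist_eq_norm] at h1 ⊢
    have h2 := norm_exp_sub_exp_le (hP n) (hP k) (hcomm n k) t.coe_nonneg r.1
    have h3 : (t : ℝ) * ‖P n r.1 - P k r.1‖ ≤ t * (e / (2 * (t + 1))) := by gcongr
    have h4 : (t : ℝ) * (e / (2 * (t + 1))) ≤ e / 2 := by
      have : (t : ℝ) * (e / (2 * (t + 1))) = (t / (t + 1)) * (e / 2) := by
        field_simp
      rw [this]
      have : (t : ℝ) / (t + 1) ≤ 1 := (div_le_one (by positivity)).2 (by linarith)
      nlinarith
    have e1 : S n t u - S k t u = S n t (u - r.1) - S k t (u - r.1) +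
        (S n t r.1 - S k t r.1) := by simp only [map_sub]; abel
    rw [e1]
    have h5 := norm_add_le (S n t (u - r.1) - S k t (u - r.1)) (S n t r.1 - S k t r.1)
    have h6 := norm_sub_le (S n t (u - r.1)) (S k t (u - r.1))
    have h7 := hS n t (u - r.1)
    have h8 := hS k t (u - r.1)
    have h9 : ‖S n t r.1 - S k t r.1‖ ≤ e / 2 := (h2.trans h3).trans h4
    linarith
  choose F hF using fun t u => cauchySeq_tendsto_of_complete (hcauchy t u)
  have hFn : ∀ t u, ‖F t u‖ ≤ ‖u‖ := fun t u =>
    le_of_tendsto (hF t u).norm (Eventually.of_forall fun n => hS n t u)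
  let T : NNReal → H →L[ℝ] H := fun t => LinearMap.mkContinuous
    { toFun := F t
      map_add' := fun u v => tendsto_nhds_unique (hF t (u + v))
        (by simpa using (hF t u).add (hF t v))
      map_smul' := fun a u => tendsto_nhds_unique (hF t (a • u))
        (by simpa using (hF t u).const_smul a) } 1 (fun u => by simpa using hFn t u)
  have hT : ∀ t u, Tendsto (fun n => S n t u) atTop (𝓝 (T t u)) := hF
  have hTn : ∀ t u, ‖T t u‖ ≤ ‖u‖ := hFn
  have hzero : T 0 = ContinuousLinearMap.id ℝ H := by
    ext u
    refine tendsto_nhds_unique (hT 0 u) ?_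
    simp [S]
  have hadd : ∀ s t, T (s + t) = (T s).comp (T t) := fun s t => by
    ext u
    refine tendsto_nhds_unique (hT (s + t) u) ?_
    have e : ∀ n, S n (s + t) u = S n s (S n t u - T t u) + S n s (T t u) := fun n => by
      have : S n (s + t) = S n s * S n t := by
        simpa [S] using exp_add_neg_smul (P n) s t
      rw [this]; simp
    simp only [e]
    have h1 : Tendsto (fun n => S n s (S n t u - T t u)) atTop (𝓝 0) := by
      refine squeeze_zero_norm (fun n => hS n s _) ?_
      exact tendsto_iff_norm_sub_tendsto_zero.1 (hT t u)
    simpa using h1.add (hT s (T t u))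
  -- The estimate at level n has a right side controlled by `hbd`, so it passes to the limit. It
  -- shows that -r.2 is the derivative at 0 once r'.1 approximates r.2.
  have hgen : ∀ r ∈ G, ∀ r' ∈ G, ∀ t : NNReal, ‖T t r.1 - r.1 + (t : ℝ) • r.2‖ ≤
      t * (2 * ‖r.2 - r'.1‖ + t * ‖r'.2‖) := fun r hr r' hr' t => by
    have h1 := (((hT t r.1).sub_const r.1).add_const ((t : ℝ) • r.2)).norm
    have h2 : Tendsto (fun n => (t : ℝ) * (‖P n r.1 - r.2‖ + 2 * ‖r.2 - r'.1‖ + t * ‖r'.2‖))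
        atTop (𝓝 (t * (0 + 2 * ‖r.2 - r'.1‖ + t * ‖r'.2‖))) :=
      (((tendsto_iff_norm_sub_tendsto_zero.1 (hlim r hr)).add_const _).add_const _).const_mul _
    rw [zero_add] at h2
    refine le_of_tendsto_of_tendsto' h1 h2 fun n => ?_
    refine (norm_exp_sub_add_le (hP n) t.coe_nonneg r.1 r.2 r'.1).trans ?_
    have := hbd r' hr' n
    have ht : (0 : ℝ) ≤ t := t.coe_nonneg
    gcongr
  have hlip : ∀ r ∈ G, ∀ t : NNReal, ‖T t r.1 - r.1‖ ≤ t * ‖r.2‖ := fun r hr t => by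
    refine le_of_tendsto ((hT t r.1).sub_const r.1).norm (Eventually.of_forall fun n => ?_)
    refine (norm_exp_sub_self_le (hP n) t.coe_nonneg r.1).trans ?_
    have := hbd r hr n
    have ht : (0 : ℝ) ≤ t := t.coe_nonneg
    gcongr
  -- Contractivity reduces continuity at every time to continuity at time 0.
  have hmono : ∀ u, ∀ s t : NNReal, s ≤ t → ‖T t u - T s u‖ ≤ ‖T (t - s) u - u‖ :=
    fun u s t hst => by
    have : T t u - T s u = T s (T (t - s) u - u) := by
      rw [map_sub, ← ContinuousLinearMap.comp_apply, ← hadd, add_tsub_cancel_of_le hst]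
    rw [this]; exact hTn _ _
  have hcont0 : ∀ u, ∀ e > 0, ∃ d > 0, ∀ t : NNReal, (t : ℝ) < d → ‖T t u - u‖ < e :=
    fun u e he => by
    obtain ⟨r, hr, hur⟩ := happrox u (e / 3) (by positivity)
    refine ⟨e / (3 * (‖r.2‖ + 1)), by positivity, fun t ht => ?_⟩
    have e1 : T t u - u = T t (u - r.1) - (u - r.1) + (T t r.1 - r.1) := by
      simp only [map_sub]; abel
    have h5 := norm_add_le (T t (u - r.1) - (u - r.1)) (T t r.1 - r.1)
    have h6 := norm_sub_le (T t (u - r.1)) (u - r.1)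
    have h7 := hTn t (u - r.1)
    have h8 := hlip r hr t
    have h9 : (t : ℝ) * ‖r.2‖ ≤ e / 3 := by
      rw [lt_div_iff₀ (by positivity)] at ht
      nlinarith [norm_nonneg r.2, t.2]
    rw [e1]; linarith
  refine ⟨T, ⟨hzero, hadd, fun u => ?_⟩, hTn, fun r hr => ?_⟩
  · refine Metric.continuous_iff.2 fun s e he => ?_
    obtain ⟨d, hd, h⟩ := hcont0 u e he
    refine ⟨d, hd, fun t ht => ?_⟩
    rw [NNReal.dist_eq] at ht
    rcases le_total s t with hst | hst
    · rw [dist_eq_norm]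
      refine (hmono u s t hst).trans_lt (h _ ?_)
      rw [NNReal.coe_sub hst]; exact (le_abs_self _).trans_lt ht
    · rw [dist_comm, dist_eq_norm]
      refine (hmono u t s hst).trans_lt (h _ ?_)
      rw [NNReal.coe_sub hst]; rw [abs_sub_comm] at ht; exact (le_abs_self _).trans_lt ht
  · rw [tendsto_iff_norm_sub_tendsto_zero]
    refine Metric.tendsto_nhds.2 fun e he => ?_
    obtain ⟨r', hr', hd⟩ := happrox r.2 (e / 4) (by positivity)
    have hsmall : ∀ᶠ h : NNReal in 𝓝[>] 0, (h : ℝ) < e / (2 * (‖r'.2‖ + 1)) := by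
      refine nhdsWithin_le_nhds ?_
      have : Tendsto (fun h : NNReal => (h : ℝ)) (𝓝 0) (𝓝 0) :=
        NNReal.continuous_coe.tendsto' 0 0 rfl
      exact this.eventually_lt_const (by positivity)
    filter_upwards [hsmall, self_mem_nhdsWithin] with h hh hpos
    have hpos' : (0 : ℝ) < h := hpos
    have e1 : (h : ℝ)⁻¹ • (T h r.1 - r.1) - -r.2 =
        (h : ℝ)⁻¹ • (T h r.1 - r.1 + (h : ℝ) • r.2) := by
      rw [smul_add, smul_smul, inv_mul_cancel₀ hpos'.ne', one_smul, sub_neg_eq_add]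
    rw [Real.dist_eq, sub_zero, abs_of_nonneg (norm_nonneg _), e1, norm_smul,
      Real.norm_of_nonneg (by positivity), inv_mul_lt_iff₀ hpos']
    refine (hgen r hr r' hr' h).trans_lt ?_
    have h9 : (h : ℝ) * ‖r'.2‖ < e / 2 := by
      rw [lt_div_iff₀ (by positivity)] at hh
      nlinarith [norm_nonneg r'.2]
    nlinarith

end HilleYosida

/-! ### Orbits of semigroups, uniqueness, Yosida approximation, Hille-Yosida. -/

section Generator

open scoped InnerProductSpace

variable {H : Type*} [NormedAddCommGroup H] [InnerProductSpace ℝ H]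

/-- The orbits of a strongly continuous semigroup that start in the domain of its generator are
right differentiable. -/
theorem IsC0Semigroup.hasDerivWithinAt {T : NNReal → H →L[ℝ] H} (hT : IsC0Semigroup T) {u g : H}
    (h : Tendsto (fun h : NNReal => (h : ℝ)⁻¹ • (T h u - u)) (𝓝[>] 0) (𝓝 g)) {t : ℝ}
    (ht : 0 ≤ t) :
    HasDerivWithinAt (fun s : ℝ => T s.toNNReal u) (T t.toNNReal g) (Set.Ici t) t := by
  rw [← hasDerivWithinAt_Ioi_iff_Ici,
    hasDerivWithinAt_iff_tendsto_slope' Set.self_notMem_Ioi]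
  have h1 : Tendsto (fun s : ℝ => (s - t).toNNReal) (𝓝[>] t) (𝓝[>] 0) := by
    refine tendsto_nhdsWithin_iff.2 ⟨?_, ?_⟩
    · have : Tendsto (fun s : ℝ => (s - t).toNNReal) (𝓝 t) (𝓝 0) :=
        (continuous_real_toNNReal.comp (continuous_id.sub continuous_const)).tendsto' t 0 (by simp)
      exact this.mono_left nhdsWithin_le_nhds
    · filter_upwards [self_mem_nhdsWithin] with s hs
      simpa using hs
  have h2 := ((T t.toNNReal).continuous.tendsto g).comp (h.comp h1)
  refine h2.congr' ?_
  filter_upwards [self_mem_nhdsWithin] with s hs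
  have hs' : t < s := hs
  have e : s.toNNReal = t.toNNReal + (s - t).toNNReal := by
    rw [← Real.toNNReal_add ht (by linarith)]; congr 1; ring
  simp only [Function.comp_apply, map_smul, map_sub, slope, vsub_eq_sub]
  rw [Real.coe_toNNReal _ (by linarith), e, hT.add]
  rfl

theorem IsC0Semigroup.tendsto_slope_apply {T : NNReal → H →L[ℝ] H} (hT : IsC0Semigroup T)
    {u g : H} (h : Tendsto (fun h : NNReal => (h : ℝ)⁻¹ • (T h u - u)) (𝓝[>] 0) (𝓝 g))
    (t : NNReal) :
    Tendsto (fun h : NNReal => (h : ℝ)⁻¹ • (T h (T t u) - T t u)) (𝓝[>] 0) (𝓝 (T t g)) := by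
  have h2 := ((T t).continuous.tendsto g).comp h
  refine h2.congr fun s => ?_
  simp only [Function.comp_apply, map_smul, map_sub]
  rw [← ContinuousLinearMap.comp_apply (T s), ← hT.add, add_comm, hT.add]
  rfl

variable {D : Type*} [AddCommGroup D] [Module ℝ D] {K A : D →ₗ[ℝ] H}

/-- Solutions of `w' = -A w` for an accretive operator are determined by their initial value. -/
theorem IsAccretive.eq_of_rightDeriv (hA : IsAccretive K A) {v w a b : ℝ → H}
    (hv : Continuous v) (hw : Continuous w)
    (hdv : ∀ t, 0 ≤ t → HasDerivWithinAt v (-a t) (Set.Ici t) t)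
    (hdw : ∀ t, 0 ≤ t → HasDerivWithinAt w (-b t) (Set.Ici t) t)
    (ha : ∀ t, 0 ≤ t → (v t, a t) ∈ graphClosure K A)
    (hb : ∀ t, 0 ≤ t → (w t, b t) ∈ graphClosure K A) (h0 : v 0 = w 0) {t : ℝ} (ht : 0 ≤ t) :
    v t = w t := by
  have h := norm_le_of_inner_rightDeriv_nonpos (w := v - w) (g := fun t => -a t - -b t)
    (hv.sub hw) (fun t ht => (hdv t ht).sub (hdw t ht)) (fun t ht => ?_) ht
  · rw [Pi.sub_apply, Pi.sub_apply, h0, sub_self, norm_zero] at h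
    exact sub_eq_zero.1 (norm_le_zero_iff.1 h)
  · have h1 := hA.inner_nonneg (sub_mem (ha t ht) (hb t ht))
    have h2 : -a t - -b t = -(a t - b t) := by abel
    rw [h2, inner_neg_right]
    simpa using h1

/-- `T` is a strongly continuous semigroup whose generator is minus the closure of the operator
`K φ ↦ A φ`. -/
structure IsSemigroupOf (K A : D →ₗ[ℝ] H) (T : NNReal → H →L[ℝ] H) : Prop
    extends IsC0Semigroup T where
  generator : ∀ u g : H,
    Tendsto (fun h : NNReal => (h : ℝ)⁻¹ • (T h u - u)) (𝓝[>] 0) (𝓝 g) ↔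
      (u, -g) ∈ graphClosure K A

namespace IsSemigroupOf

variable {T : NNReal → H →L[ℝ] H} (hT : IsSemigroupOf K A T)
include hT

theorem tendsto_slope {r : H × H} (hr : r ∈ graphClosure K A) :
    Tendsto (fun h : NNReal => (h : ℝ)⁻¹ • (T h r.1 - r.1)) (𝓝[>] 0) (𝓝 (-r.2)) :=
  (hT.generator _ _).2 (by simpa using hr)

theorem map_mem {r : H × H} (hr : r ∈ graphClosure K A) (t : NNReal) :
    (T t r.1, T t r.2) ∈ graphClosure K A := by
  simpa using (hT.generator _ _).1 (hT.tendsto_slope_apply (hT.tendsto_slope hr) t)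

theorem continuous_orbit (u : H) : Continuous fun t : ℝ => T t.toNNReal u :=
  (hT.continuous u).comp continuous_real_toNNReal

theorem hasDerivWithinAt_orbit {r : H × H} (hr : r ∈ graphClosure K A) {t : ℝ} (ht : 0 ≤ t) :
    HasDerivWithinAt (fun s : ℝ => T s.toNNReal r.1) (-T t.toNNReal r.2) (Set.Ici t) t := by
  simpa using hT.toIsC0Semigroup.hasDerivWithinAt (hT.tendsto_slope hr) ht

/-- Both curves solve the same Cauchy problem in the closure of the graph. Besides uniqueness of the
semigroup, this identifies the flow constructed in the Sobolev space with the semigroup on L². -/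
theorem eq_orbit (hA : IsAccretive K A) {v a : ℝ → H} (hv : Continuous v)
    (hdv : ∀ t, 0 ≤ t → HasDerivWithinAt v (-a t) (Set.Ici t) t)
    (ha : ∀ t, 0 ≤ t → (v t, a t) ∈ graphClosure K A) {t : ℝ} (ht : 0 ≤ t) :
    v t = T t.toNNReal (v 0) := by
  have h0 := ha 0 le_rfl
  refine hA.eq_of_rightDeriv hv (hT.continuous_orbit (v 0)) hdv
    (fun s hs => hT.hasDerivWithinAt_orbit h0 hs) ha (fun s _ => hT.map_mem h0 _) ?_ ht
  simp [hT.zero]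

theorem unique (hA : IsAccretive K A) {S : NNReal → H →L[ℝ] H} (hS : IsSemigroupOf K A S) :
    S = T := by
  funext t
  refine ContinuousLinearMap.ext_on (s := Set.range K) (hA.dense.mono Submodule.subset_span) ?_
  rintro _ ⟨φ, rfl⟩
  have hφ := mem_graphClosure (K := K) (A := A) φ
  have := hT.eq_orbit hA (hS.continuous_orbit (K φ))
    (fun s hs => hS.hasDerivWithinAt_orbit hφ hs) (fun s _ => hS.map_mem hφ _) t.coe_nonneg
  simpa [hS.zero] using this

end IsSemigroupOf

variable [CompleteSpace H]

/-- With R_n = (c_n + A)⁻¹ and c_n → ∞, take P_n = c_n (1 - c_n R_n). On the domain P_n r.1 = c_n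
R_n r.2, where c_n R_n is a contraction and tends strongly to the identity; the last two claims
follow. -/
theorem IsAccretive.exists_yosida (hA : IsAccretive K A) : ∃ P : ℕ → H →L[ℝ] H,
    (∀ n u, 0 ≤ ⟪u, P n u⟫_ℝ) ∧ (∀ n k, Commute (P n) (P k)) ∧
    (∀ r ∈ graphClosure K A, Tendsto (fun n => P n r.1) atTop (𝓝 r.2)) ∧
    ∀ r ∈ graphClosure K A, ∀ n, ‖P n r.1‖ ≤ ‖r.2‖ := by
  obtain ⟨c₀, hc₀⟩ := eventually_atTop.1 hA.range
  let c : ℕ → ℝ := fun n => max c₀ 1 + n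
  have hc : ∀ n, 0 < c n := fun n => by
    have := le_max_right c₀ 1
    have : (0 : ℝ) ≤ n := n.cast_nonneg
    change 0 < max c₀ 1 + n
    linarith
  have hc' : ∀ n, DenseRange (c n • K + A) := fun n => hc₀ _ <|
    (le_max_left _ _).trans (le_add_of_nonneg_right n.cast_nonneg)
  choose R hR1 hR2 using fun n => hA.exists_resolvent (hc n) (hc' n)
  have hRn : ∀ n f, c n * ‖R n f‖ ≤ ‖f‖ := fun n f => by
    have := hA.le_norm (hR1 n f) (c n)
    simpa using this
  have hRg : ∀ n, ∀ r ∈ graphClosure K A, r.1 - c n • R n r.1 = R n r.2 := fun n r hr => by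
    nth_rw 1 [← hR2 n r hr]
    rw [map_add, map_smul]; abel
  have hRR : ∀ n k f, R n f - R k f = (c k - c n) • R n (R k f) := fun n k f => by
    have h1 := hRg n _ (hR1 k f)
    simp only [map_sub, map_smul] at h1
    have h2 : R n f = R k f - c n • R n (R k f) + c k • R n (R k f) := by rw [h1]; abel
    rw [h2, sub_smul]; abel
  -- The resolvent identity, read in both orders, gives commutation after division by `c k - c n`;
  -- if the two parameters coincide the resolvents do.
  have hcommR : ∀ n k, Commute (R n) (R k) := fun n k => by
    rcases eq_or_ne (c n) (c k) with h | h
    · have : R n = R k := by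
        ext f
        have := hRR n k f
        rw [h, sub_self, zero_smul] at this
        exact sub_eq_zero.1 this
      rw [this]
    · ext f
      have h1 := hRR n k f
      have h2 := hRR k n f
      have h3 : (c k - c n) • R n (R k f) = (c k - c n) • R k (R n f) := by
        rw [← h1, ← neg_sub, h2, ← neg_smul, neg_sub]
      exact smul_right_injective H (sub_ne_zero.2 h.symm) h3
  have hlim : ∀ g, Tendsto (fun n => c n • R n g) atTop (𝓝 g) := fun g => by
    rw [tendsto_iff_norm_sub_tendsto_zero]
    refine Metric.tendsto_atTop.2 fun e he => ?_
    obtain ⟨_, ⟨φ, rfl⟩, hφ⟩ := Metric.mem_closure_iff.1 (hA.dense g) (e / 4) (by positivity)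
    rw [dist_eq_norm] at hφ
    obtain ⟨N, hN⟩ := exists_nat_gt (2 * ‖A φ‖ / e)
    refine ⟨N, fun n hn => ?_⟩
    have h1 := hRg n _ (mem_graphClosure (K := K) (A := A) φ)
    have h2 := hRn n (A φ)
    have h3 := hRn n (g - K φ)
    have e1 : c n • R n g - g = c n • R n (g - K φ) - (g - K φ) - (K φ - c n • R n (K φ)) := by
      rw [map_sub, smul_sub]; abel
    have h4 : (N : ℝ) ≤ c n := by
      have : (N : ℝ) ≤ n := by exact_mod_cast hn
      have := le_max_right c₀ 1
      change (N : ℝ) ≤ max c₀ 1 + n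
      linarith
    have h5 : ‖R n (A φ)‖ < e / 2 := by
      rw [div_lt_iff₀ he] at hN
      have h6 : 2 * ‖A φ‖ < c n * e := by nlinarith
      by_contra! h7
      nlinarith [hc n]
    rw [Real.dist_eq, sub_zero, abs_of_nonneg (norm_nonneg _), e1, h1]
    have h8 := norm_sub_le (c n • R n (g - K φ) - (g - K φ)) (R n (A φ))
    have h9 := norm_sub_le (c n • R n (g - K φ)) (g - K φ)
    rw [norm_smul, Real.norm_of_nonneg (hc n).le] at h9
    linarith
  refine ⟨fun n => c n • (1 - c n • R n), fun n u => ?_, fun n k => ?_, fun r hr => ?_,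
    fun r hr n => ?_⟩
  · have h1 := hA.inner_nonneg (hR1 n u)
    -- Splitting u along the resolvent makes the pairing a square plus c times the accretive pairing
    -- of `(R n u, u - c n • R n u)`.
    have h2 : u = (u - c n • R n u) + c n • R n u := by abel
    have h3 : ⟪u, (c n • (1 - c n • R n)) u⟫_ℝ =
        c n * (⟪u - c n • R n u, u - c n • R n u⟫_ℝ + c n * ⟪R n u, u - c n • R n u⟫_ℝ) := by
      have h4 : (c n • (1 - c n • R n)) u = c n • (u - c n • R n u) := by simp
      rw [h4, inner_smul_right]
      congr 1
      rw [← real_inner_smul_left, ← inner_add_left, ← h2]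
    rw [h3]
    have h5 := real_inner_self_nonneg (x := u - c n • R n u)
    have := hc n
    positivity
  · exact (((Commute.one_left _).sub_left (((Commute.one_right _).sub_right
      ((hcommR n k).smul_right _)).smul_left _)).smul_left _).smul_right _
  · have := hlim r.2
    refine this.congr fun n => ?_
    rw [← hRg n r hr]; simp
  · have h1 := hRn n r.2
    have h2 : (c n • (1 - c n • R n)) r.1 = c n • R n r.2 := by
      rw [← hRg n r hr]; simp
    rw [h2, norm_smul, Real.norm_of_nonneg (hc n).le]
    exact h1

/-- The Hille-Yosida theorem for accretive operators in a Hilbert space. -/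
theorem IsAccretive.exists_semigroup (hA : IsAccretive K A) :
    ∃ T : NNReal → H →L[ℝ] H, IsSemigroupOf K A T := by
  obtain ⟨P, hP1, hP2, hP3, hP4⟩ := hA.exists_yosida
  obtain ⟨T, hT, hTn, hTg⟩ := exists_contraction_semigroup hP1 hP2
    (G := (graphClosure K A : Set (H × H)))
    (hA.dense.mono (by rintro _ ⟨φ, rfl⟩; exact ⟨_, mem_graphClosure φ⟩)) hP3 hP4
  refine ⟨T, hT, fun u g => ⟨fun h => ?_, fun h => by simpa using hTg _ h⟩⟩
  obtain ⟨c, hc, hcpos⟩ := (hA.range.and (eventually_gt_atTop 0)).exists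
  -- Maximality: the generator of a contraction semigroup is dissipative and extends -A. Solving the
  -- resolvent equation with data c u - g in the domain of A and testing dissipativity on u - r.1
  -- forces u = r.1, so the extension is not proper.
  obtain ⟨r, hr, hru⟩ := hA.exists_solution hcpos hc (c • u - g)
  have h1 := h.sub (hTg r hr)
  have h2 : ∀ k : NNReal, ⟪u - r.1, (k : ℝ)⁻¹ • (T k u - u) - (k : ℝ)⁻¹ • (T k r.1 - r.1)⟫_ℝ ≤ 0 :=
    fun k => by
    have e : (k : ℝ)⁻¹ • (T k u - u) - (k : ℝ)⁻¹ • (T k r.1 - r.1) =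
        (k : ℝ)⁻¹ • (T k (u - r.1) - (u - r.1)) := by
      rw [← smul_sub, map_sub]; congr 1; abel
    rw [e, inner_smul_right, inner_sub_right, real_inner_self_eq_norm_sq]
    have h3 := real_inner_le_norm (u - r.1) (T k (u - r.1))
    have h4 := hTn k (u - r.1)
    have h5 : (0 : ℝ) ≤ (k : ℝ)⁻¹ := by positivity
    refine mul_nonpos_of_nonneg_of_nonpos h5 ?_
    nlinarith [norm_nonneg (u - r.1)]
  have h3 := le_of_tendsto ((tendsto_const_nhds (x := u - r.1)).inner h1) (Eventually.of_forall h2)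
  have h4 : g - -r.2 = c • (u - r.1) := by
    have : r.2 = c • u - g - c • r.1 := by rw [← hru]; abel
    rw [this, smul_sub]; abel
  rw [h4, inner_smul_right, real_inner_self_eq_norm_sq] at h3
  have h5 : ‖u - r.1‖ ^ 2 ≤ 0 := by
    by_contra! h6
    exact absurd h3 (not_le.2 (mul_pos hcpos h6))
  have h6 : u = r.1 := by
    have : ‖u - r.1‖ = 0 := by nlinarith [norm_nonneg (u - r.1)]
    exact sub_eq_zero.1 (norm_eq_zero.1 this)
  rw [← h6, sub_self, smul_zero, sub_neg_eq_add] at h4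
  have h7 : r = (u, -g) := Prod.ext h6.symm (by rw [eq_neg_iff_add_eq_zero, add_comm]; exact h4)
  rw [← h7]; exact hr

end Generator

/-! ### Differential calculus on the phase space through its Euclidean cover. -/

section Calculus

variable {Q : Type} [NormedAddCommGroup Q] {d m : ℕ}

/-- `π : ℝ^d → Q` is a covering homomorphism that does not increase the norm. -/
structure IsCover (π : Vec d → Q) : Prop where
  map_add : ∀ a b, π (a + b) = π a + π b
  isOpenQuotientMap : IsOpenQuotientMap π
  norm_le : ∀ a, ‖π a‖ ≤ ‖a‖

/-- The covering map of the phase space. -/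
def proj (π : Vec d → Q) (y : Phase (Vec d) d m) : Phase Q d m := (π y.1, y.2)

/-- A function on the phase space, viewed as a function on `ℝ^d × ℝ^d × (ℝ^d)^m`. -/
def lift (π : Vec d → Q) (f : Phase Q d m → ℝ) (y : Phase (Vec d) d m) : ℝ := f (proj π y)

variable {π : Vec d → Q}

namespace IsCover

variable (hπ : IsCover π)
include hπ

theorem isOpenQuotientMap_proj : IsOpenQuotientMap (proj π : Phase (Vec d) d m → Phase Q d m) :=
  hπ.isOpenQuotientMap.prodMap IsOpenQuotientMap.id

theorem proj_surjective : Function.Surjective (proj π : Phase (Vec d) d m → Phase Q d m) :=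
  hπ.isOpenQuotientMap_proj.surjective

theorem proj_add (x y : Phase (Vec d) d m) : proj π (x + y) = proj π x + proj π y :=
  Prod.ext (hπ.map_add _ _) rfl

theorem norm_proj_le (y : Phase (Vec d) d m) : ‖proj π y‖ ≤ ‖y‖ :=
  max_le_max (hπ.norm_le _) le_rfl

theorem continuous_of_lift {f : Phase Q d m → ℝ} (h : Continuous (lift π f)) : Continuous f :=
  hπ.isOpenQuotientMap_proj.isQuotientMap.continuous_iff.2 h

theorem dir_proj_eq_deriv (f : Phase Q d m → ℝ) (v y : Phase (Vec d) d m) :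
    dir π v f (proj π y) = deriv (fun s : ℝ => lift π f (y + s • v)) 0 := by
  unfold dir
  congr 1
  funext s
  unfold lift
  rw [hπ.proj_add]
  rfl

theorem hasDerivAt_line {f : Phase Q d m → ℝ} (v y : Phase (Vec d) d m) (s : ℝ)
    (h : DifferentiableAt ℝ (lift π f) (y + s • v)) :
    HasDerivAt (fun s : ℝ => lift π f (y + s • v)) (fderiv ℝ (lift π f) (y + s • v) v) s := by
  have h1 : HasDerivAt (fun s : ℝ => y + s • v) v s := by
    simpa using ((hasDerivAt_id s).smul_const v).const_add y
  exact h.hasFDerivAt.comp_hasDerivAt s h1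

theorem dir_proj {f : Phase Q d m → ℝ} (v : Phase (Vec d) d m) {y : Phase (Vec d) d m}
    (h : DifferentiableAt ℝ (lift π f) y) :
    dir π v f (proj π y) = fderiv ℝ (lift π f) y v := by
  rw [hπ.dir_proj_eq_deriv]
  have := hπ.hasDerivAt_line v y 0 (by simpa using h)
  simpa using this.deriv

theorem lift_dir {f : Phase Q d m → ℝ} (v : Phase (Vec d) d m)
    (h : Differentiable ℝ (lift π f)) :
    lift π (dir π v f) = fun y => fderiv ℝ (lift π f) y v :=
  funext fun y => hπ.dir_proj v (h y)

theorem ext_lift {f g : Phase Q d m → ℝ} (h : ∀ y, lift π f y = lift π g y) : f = g := by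
  funext x
  obtain ⟨y, rfl⟩ := hπ.proj_surjective x
  exact h y

theorem contDiff_dir {f : Phase Q d m → ℝ} {k n : WithTop ℕ∞} (h : ContDiff ℝ n (lift π f))
    (hk : k + 1 ≤ n) (v : Phase (Vec d) d m) : ContDiff ℝ k (lift π (dir π v f)) := by
  have h0 : n ≠ 0 := by
    rintro rfl
    simp at hk
  rw [hπ.lift_dir v (h.differentiable h0)]
  exact (h.fderiv_right hk).clm_apply contDiff_const

theorem dir_support (f : Phase Q d m → ℝ) (v : Phase (Vec d) d m) :
    Function.support (dir π v f) ⊆ tsupport f := by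
  intro x hx
  by_contra hx'
  obtain ⟨y, rfl⟩ := hπ.proj_surjective x
  refine hx ?_
  rw [hπ.dir_proj_eq_deriv]
  have h1 : Tendsto (fun s : ℝ => proj π (y + s • v)) (𝓝 0) (𝓝 (proj π y)) := by
    have h2 : Continuous fun s : ℝ => proj π (y + s • v) :=
      hπ.isOpenQuotientMap_proj.continuous.comp (by fun_prop)
    exact h2.tendsto' 0 _ (by simp)
  have h3 : (fun s : ℝ => lift π f (y + s • v)) =ᶠ[𝓝 0] fun _ => 0 := by
    filter_upwards [h1.eventually ((isClosed_tsupport f).isOpen_compl.mem_nhds hx')] with s hs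
    exact image_eq_zero_of_notMem_tsupport (f := f) hs
  rw [h3.deriv_eq]
  simp

theorem hasCompactSupport_dir {f : Phase Q d m → ℝ} (h : HasCompactSupport f)
    (v : Phase (Vec d) d m) : HasCompactSupport (dir π v f) :=
  h.mono' (hπ.dir_support f v)

theorem dir_mul {f g : Phase Q d m → ℝ} (hf : Differentiable ℝ (lift π f))
    (hg : Differentiable ℝ (lift π g)) (v : Phase (Vec d) d m) :
    dir π v (f * g) = dir π v f * g + f * dir π v g := by
  refine hπ.ext_lift fun y => ?_
  have e : lift π (f * g) = lift π f * lift π g := rfl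
  have h := hπ.dir_proj (f := f * g) v (y := y) (by rw [e]; exact (hf y).mul (hg y))
  change dir π v (f * g) (proj π y) = _
  rw [h, e, fderiv_mul (hf y) (hg y)]
  change _ = dir π v f (proj π y) * lift π g y + lift π f y * dir π v g (proj π y)
  rw [hπ.dir_proj v (hf y), hπ.dir_proj v (hg y)]
  simp only [ContinuousLinearMap.add_apply, ContinuousLinearMap.smul_apply, smul_eq_mul]
  ring

theorem dir_add {f g : Phase Q d m → ℝ} (hf : Differentiable ℝ (lift π f))
    (hg : Differentiable ℝ (lift π g)) (v : Phase (Vec d) d m) :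
    dir π v (f + g) = dir π v f + dir π v g := by
  refine hπ.ext_lift fun y => ?_
  have e : lift π (f + g) = lift π f + lift π g := rfl
  have h := hπ.dir_proj (f := f + g) v (y := y) (by rw [e]; exact (hf y).add (hg y))
  change dir π v (f + g) (proj π y) = dir π v f (proj π y) + dir π v g (proj π y)
  rw [h, e, fderiv_add (hf y) (hg y), hπ.dir_proj v (hf y), hπ.dir_proj v (hg y)]
  rfl

theorem dir_const_smul {f : Phase Q d m → ℝ} (hf : Differentiable ℝ (lift π f)) (c : ℝ)
    (v : Phase (Vec d) d m) : dir π v (c • f) = c • dir π v f := by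
  refine hπ.ext_lift fun y => ?_
  have e : lift π (c • f) = c • lift π f := rfl
  have h := hπ.dir_proj (f := c • f) v (y := y) (by rw [e]; exact (hf y).const_smul c)
  change dir π v (c • f) (proj π y) = c • dir π v f (proj π y)
  rw [h, e, fderiv_const_smul (hf y), hπ.dir_proj v (hf y)]
  rfl

theorem dir_sum {ι : Type*} (s : Finset ι) {f : ι → Phase Q d m → ℝ}
    (hf : ∀ i ∈ s, Differentiable ℝ (lift π (f i))) (v : Phase (Vec d) d m) :
    dir π v (∑ i ∈ s, f i) = ∑ i ∈ s, dir π v (f i) := by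
  refine hπ.ext_lift fun y => ?_
  have e : lift π (∑ i ∈ s, f i) = fun y => ∑ i ∈ s, lift π (f i) y := by
    funext y; simp [lift]
  have h := hπ.dir_proj (f := ∑ i ∈ s, f i) v (y := y)
    (by rw [e]; exact DifferentiableAt.fun_sum fun i hi => hf i hi y)
  change dir π v (∑ i ∈ s, f i) (proj π y) = (∑ i ∈ s, dir π v (f i)) (proj π y)
  rw [h, e, fderiv_fun_sum fun i hi => hf i hi y, Finset.sum_apply, ContinuousLinearMap.sum_apply]
  exact Finset.sum_congr rfl fun i hi => (hπ.dir_proj v (hf i hi y)).symm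

theorem dir_comm {f : Phase Q d m → ℝ} (hf : ContDiff ℝ 2 (lift π f))
    (v w : Phase (Vec d) d m) : dir π v (dir π w f) = dir π w (dir π v f) := by
  have h1 : Differentiable ℝ (lift π f) := hf.differentiable (by norm_num)
  have h2 : Differentiable ℝ (fderiv ℝ (lift π f)) :=
    (hf.fderiv_right (m := 1) (by norm_num)).differentiable (by norm_num)
  have key : ∀ (v w y : Phase (Vec d) d m), lift π (dir π v (dir π w f)) y =
      fderiv ℝ (fderiv ℝ (lift π f)) y v w := fun v w y => by
    have h3 := hπ.contDiff_dir (k := 1) hf (by norm_num) w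
    rw [hπ.lift_dir v (h3.differentiable (by norm_num)), hπ.lift_dir w h1]
    change fderiv ℝ (fun y => (fderiv ℝ (lift π f) y) w) y v = _
    rw [fderiv_clm_apply (h2 y) (differentiableAt_const _)]
    simp
  refine hπ.ext_lift fun y => ?_
  rw [key, key]
  exact (hf.contDiffAt.isSymmSndFDerivAt (by simp)).eq v w

end IsCover

/-- The space of compactly supported functions of class `C^k`. -/
def compactC (π : Vec d → Q) (m : ℕ) (k : WithTop ℕ∞) : Submodule ℝ (Phase Q d m → ℝ) where
  carrier := {f | ContDiff ℝ k (lift π f) ∧ HasCompactSupport f}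
  add_mem' := fun hf hg => ⟨hf.1.add hg.1, hf.2.add hg.2⟩
  zero_mem' := ⟨contDiff_const, HasCompactSupport.zero⟩
  smul_mem' := fun c f hf => ⟨contDiff_const.smul hf.1, hf.2.smul_left (f := fun _ => c)⟩

theorem compactC_mono {k n : WithTop ℕ∞} (h : k ≤ n) {f : Phase Q d m → ℝ}
    (hf : f ∈ compactC π m n) : f ∈ compactC π m k := ⟨hf.1.of_le h, hf.2⟩

theorem mul_mem_compactC {k : WithTop ℕ∞} {f g : Phase Q d m → ℝ}
    (hf : ContDiff ℝ k (lift π f)) (hg : g ∈ compactC π m k) : f * g ∈ compactC π m k :=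
  ⟨hf.mul hg.1, hg.2.mul_left⟩

instance isAddHaarMeasure_volume_phase [ProperSpace Q] [MeasureSpace Q] [BorelSpace Q]
    [(volume : Measure Q).IsAddHaarMeasure] :
    (volume : Measure (Phase Q d m)).IsAddHaarMeasure := by
  have h : (volume : Measure (Vec d × (Fin m → Vec d))).IsAddHaarMeasure :=
    Measure.prod.instIsAddHaarMeasure (volume : Measure (Vec d)) (volume : Measure (Fin m → Vec d))
  exact Measure.prod.instIsAddHaarMeasure (volume : Measure Q)
    (volume : Measure (Vec d × (Fin m → Vec d)))

namespace IsCover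

variable (hπ : IsCover π)
include hπ

theorem dir_mem {k n : WithTop ℕ∞} {f : Phase Q d m → ℝ} (hf : f ∈ compactC π m n)
    (hk : k + 1 ≤ n) (v : Phase (Vec d) d m) : dir π v f ∈ compactC π m k :=
  ⟨hπ.contDiff_dir hf.1 hk v, hπ.hasCompactSupport_dir hf.2 v⟩

theorem continuous_of_mem {k : WithTop ℕ∞} {f : Phase Q d m → ℝ} (hf : f ∈ compactC π m k) :
    Continuous f := hπ.continuous_of_lift hf.1.continuous

variable [ProperSpace Q] [MeasureSpace Q] [BorelSpace Q]
  [(volume : Measure Q).IsAddHaarMeasure]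

/-- The integral of a directional derivative of a compactly supported function vanishes. -/
theorem integral_dir_eq_zero {f : Phase Q d m → ℝ} (hf : f ∈ compactC π m 1)
    (v : Phase (Vec d) d m) : ∫ x, dir π v f x = 0 := by
  have hD : Differentiable ℝ (lift π f) := hf.1.differentiable (by norm_num)
  have hg : dir π v f ∈ compactC π m 0 := hπ.dir_mem hf (by norm_num) v
  have hgc := hπ.continuous_of_mem hg
  obtain ⟨C, hC⟩ := hg.2.exists_bound_of_continuous hgc
  obtain ⟨R, hR⟩ := hg.2.isCompact.isBounded.subset_closedBall 0
  -- The ball contains the supports of all translates by `s • v` with |s| < 1, because the covering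
  -- map does not increase norms.
  let K : Set (Phase Q d m) := Metric.closedBall 0 (R + ‖v‖)
  have hK : volume K < ⊤ := (isCompact_closedBall _ _).measure_lt_top
  have hder : ∀ (x : Phase Q d m) (s : ℝ), HasDerivAt (fun s : ℝ => f (x + proj π (s • v)))
      (dir π v f (x + proj π (s • v))) s := fun x s => by
    obtain ⟨y, rfl⟩ := hπ.proj_surjective x
    have h := hπ.hasDerivAt_line v y s (hD _)
    rw [← hπ.dir_proj v (hD _)] at h
    simpa only [lift, hπ.proj_add] using h
  have hF := hasDerivAt_integral_of_dominated_loc_of_deriv_le (μ := volume) (𝕜 := ℝ)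
    (F := fun s x => f (x + proj π (s • v))) (F' := fun s x => dir π v f (x + proj π (s • v)))
    (x₀ := 0) (s := Metric.ball 0 1) (bound := K.indicator fun _ => C)
    (Metric.ball_mem_nhds _ one_pos)
    (Eventually.of_forall fun s => ((hπ.continuous_of_mem hf).comp
      (by fun_prop)).aestronglyMeasurable)
    (((hπ.continuous_of_mem hf).integrable_of_hasCompactSupport hf.2).comp_add_right _)
    (hgc.comp (by fun_prop)).aestronglyMeasurable
    (Eventually.of_forall fun x s hs => ?_)
    ((integrable_indicator_iff measurableSet_closedBall).2 (integrableOn_const hK.ne))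
    (Eventually.of_forall fun x s _ => hder x s)
  · have h1 : (fun s : ℝ => ∫ x, f (x + proj π (s • v))) = fun _ => ∫ x, f x :=
      funext fun s => integral_add_right_eq_self f (proj π (s • v))
    have h2 := hF.2
    rw [h1, integral_add_right_eq_self (dir π v f) (proj π ((0 : ℝ) • v))] at h2
    exact h2.unique (hasDerivAt_const _ _)
  · by_cases hx : x ∈ K
    · rw [Set.indicator_of_mem hx]; exact hC _
    · rw [Set.indicator_of_notMem hx]
      have : x + proj π (s • v) ∉ tsupport (dir π v f) := fun h => hx <| by
        have h1 := hR h
        rw [mem_closedBall_zero_iff] at h1 ⊢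
        have h2 : ‖proj π (s • v)‖ ≤ ‖v‖ := by
          refine (hπ.norm_proj_le _).trans ?_
          rw [norm_smul]
          rw [mem_ball_zero_iff] at hs
          nlinarith [norm_nonneg v]
        have h3 := norm_sub_le (x + proj π (s • v)) (proj π (s • v))
        rw [add_sub_cancel_right] at h3
        linarith
      rw [image_eq_zero_of_notMem_tsupport this, norm_zero]

end IsCover

end Calculus

/-! ### The generator in coordinates and its commutators with partial derivatives. -/

section Generator

variable {Q : Type} [NormedAddCommGroup Q] {d m : ℕ} (π : Vec d → Q)

/-- The coordinate directions `q_i`, `p_i` and `z_{j,i}` of the phase space. -/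
abbrev Coord (d m : ℕ) : Type := Fin d ⊕ Fin d ⊕ (Fin m × Fin d)

/-- The coordinate `q_i`. -/
abbrev cq (i : Fin d) : Coord d m := Sum.inl i

/-- The coordinate `p_i`. -/
abbrev cp (i : Fin d) : Coord d m := Sum.inr (Sum.inl i)

/-- The coordinate `z_{j,i}`. -/
abbrev cz (r : Fin m × Fin d) : Coord d m := Sum.inr (Sum.inr r)

/-- The unit vectors. -/
noncomputable def unitVec : Coord d m → Phase (Vec d) d m
  | .inl i => (EuclideanSpace.single i 1, 0, 0)
  | .inr (.inl i) => (0, EuclideanSpace.single i 1, 0)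
  | .inr (.inr r) => (0, 0, Pi.single r.1 (EuclideanSpace.single r.2 1))

/-- The partial derivatives. -/
noncomputable def der (v : Coord d m) : (Phase Q d m → ℝ) → Phase Q d m → ℝ :=
  dir π (unitVec v)

variable (V : Q → ℝ) (α lam : Fin m → ℝ) (β : ℝ)

/-- The components of the drift of the generalized Langevin system. -/
noncomputable def coef : Coord d m → Phase Q d m → ℝ
  | .inl i => fun x => x.2.1 i
  | .inr (.inl i) => fun x => -gradV π V i x.1 + ∑ j, lam j * x.2.2 j i
  | .inr (.inr r) => fun x => -lam r.1 * x.2.1 r.2 - α r.1 * x.2.2 r.1 r.2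

/-- The components of the gradient of the energy. -/
noncomputable def energyGrad : Coord d m → Phase Q d m → ℝ
  | .inl i => fun x => gradV π V i x.1
  | .inr (.inl i) => fun x => x.2.1 i
  | .inr (.inr r) => fun x => x.2.2 r.1 r.2

theorem sum_coord {M : Type*} [AddCommMonoid M] (f : Coord d m → M) :
    ∑ v, f v = ∑ i, f (cq i) + (∑ i, f (cp i) + ∑ r, f (cz r)) := by
  rw [Fintype.sum_sum_type, Fintype.sum_sum_type]

/-- The coefficients of -B are those of the drift with friction set to 0, so the single family
`coef` serves both B and `𝓛`. -/
theorem opB_eq (f : Phase Q d m → ℝ) (x : Phase Q d m) :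
    opB π V lam f x = -∑ v, coef π V 0 lam v x * der π v f x := by
  rw [sum_coord, Fintype.sum_prod_type_right, ← Finset.sum_add_distrib, ← Finset.sum_add_distrib,
    ← Finset.sum_neg_distrib]
  refine Finset.sum_congr rfl fun i _ => ?_
  change -(x.2.1 i * der π (cq i) f x) + gradV π V i x.1 * der π (cp i) f x
    - ∑ j : Fin m, lam j * (x.2.2 j i * der π (cp i) f x - x.2.1 i * der π (cz (j, i)) f x) =
    -(x.2.1 i * der π (cq i) f x + ((-gradV π V i x.1 + ∑ j, lam j * x.2.2 j i) * der π (cp i) f x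
      + ∑ j, (-lam j * x.2.1 i - (0 : Fin m → ℝ) j * x.2.2 j i) * der π (cz (j, i)) f x))
  rw [add_mul, Finset.sum_mul]
  have : ∑ j, lam j * (x.2.2 j i * der π (cp i) f x - x.2.1 i * der π (cz (j, i)) f x) =
      ∑ j, lam j * x.2.2 j i * der π (cp i) f x +
      ∑ j, (-lam j * x.2.1 i - (0 : Fin m → ℝ) j * x.2.2 j i) * der π (cz (j, i)) f x := by
    rw [← Finset.sum_add_distrib]
    refine Finset.sum_congr rfl fun j _ => ?_
    simp only [Pi.zero_apply]
    ring
  linear_combination -this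

theorem opL_eq (f : Phase Q d m → ℝ) (x : Phase Q d m) :
    opL π V α lam β f x = -∑ v, coef π V α lam v x * der π v f x -
      ∑ r : Fin m × Fin d, α r.1 * β⁻¹ * der π (cz r) (der π (cz r) f) x := by
  have h : ∑ j : Fin m, ∑ i : Fin d,
      α j * (x.2.2 j i * dz π j i f x - β⁻¹ * dz π j i (dz π j i f) x) =
      ∑ r : Fin m × Fin d, (α r.1 * x.2.2 r.1 r.2 * der π (cz r) f x -
        α r.1 * β⁻¹ * der π (cz r) (der π (cz r) f) x) := by
    rw [Fintype.sum_prod_type]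
    refine Finset.sum_congr rfl fun j _ => Finset.sum_congr rfl fun i _ => ?_
    change α j * (x.2.2 j i * der π (cz (j, i)) f x - β⁻¹ * der π (cz (j, i))
      (der π (cz (j, i)) f) x) = _
    ring
  rw [opL, opB_eq, h, Finset.sum_sub_distrib, sum_coord, sum_coord]
  have h2 : ∑ r : Fin m × Fin d, coef π V α lam (cz r) x * der π (cz r) f x =
      ∑ r : Fin m × Fin d, coef π V 0 lam (cz r) x * der π (cz r) f x -
      ∑ r : Fin m × Fin d, α r.1 * x.2.2 r.1 r.2 * der π (cz r) f x := by
    rw [← Finset.sum_sub_distrib]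
    refine Finset.sum_congr rfl fun r _ => ?_
    simp only [coef, Pi.zero_apply]
    ring
  rw [h2]
  have h3 : ∀ i, coef π V α lam (cq i) x = coef π V 0 lam (cq i) x := fun i => rfl
  have h4 : ∀ i, coef π V α lam (cp i) x = coef π V 0 lam (cp i) x := fun i => rfl
  simp only [h3, h4]
  ring

/-- The drift is divergence free up to friction and preserves the energy. -/
theorem sum_coef_energyGrad (x : Phase Q d m) :
    ∑ v, coef π V 0 lam v x * energyGrad π V v x = 0 := by
  rw [sum_coord, Fintype.sum_prod_type_right, ← Finset.sum_add_distrib, ← Finset.sum_add_distrib]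
  refine Finset.sum_eq_zero fun i _ => ?_
  simp only [coef, energyGrad, Pi.zero_apply, zero_mul, sub_zero]
  rw [add_mul, Finset.sum_mul]
  have : ∑ j, lam j * x.2.2 j i * x.2.1 i + ∑ j, -lam j * x.2.1 i * x.2.2 j i = 0 := by
    rw [← Finset.sum_add_distrib]
    exact Finset.sum_eq_zero fun j _ => by ring
  linear_combination this

variable {π V α lam β}

theorem IsCover.der_mul (hπ : IsCover π) {f g : Phase Q d m → ℝ}
    (hf : Differentiable ℝ (lift π f)) (hg : Differentiable ℝ (lift π g)) (v : Coord d m) :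
    der π v (f * g) = der π v f * g + f * der π v g :=
  hπ.dir_mul hf hg _

theorem IsCover.der_mem (hπ : IsCover π) {k n : WithTop ℕ∞} {f : Phase Q d m → ℝ}
    (hf : f ∈ compactC π m n) (hk : k + 1 ≤ n) (v : Coord d m) :
    der π v f ∈ compactC π m k := hπ.dir_mem hf hk _

theorem IsCover.dir_eq_const (hπ : IsCover π) {f : Phase Q d m → ℝ} {v : Phase (Vec d) d m}
    {c : ℝ} (h : ∀ (y : Phase (Vec d) d m) (s : ℝ), lift π f (y + s • v) = lift π f y + s * c)
    (x : Phase Q d m) : dir π v f x = c := by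
  obtain ⟨y, rfl⟩ := hπ.proj_surjective x
  rw [hπ.dir_proj_eq_deriv, funext (h y)]
  simp

section

variable (hπ : IsCover π) (hV : ContDiff ℝ 2 (fun q => V (π q)))
include hπ

theorem gradV_proj_eq_deriv (i : Fin d) (q : Vec d) :
    gradV π V i (π q) = deriv (fun s : ℝ => V (π (q + s • EuclideanSpace.single i 1))) 0 := by
  unfold gradV
  congr 1
  funext s
  rw [hπ.map_add]

include hV

theorem gradV_proj (i : Fin d) (q : Vec d) :
    gradV π V i (π q) = fderiv ℝ (fun q => V (π q)) q (EuclideanSpace.single i 1) := by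
  rw [gradV_proj_eq_deriv hπ]
  have h1 : HasDerivAt (fun s : ℝ => q + s • EuclideanSpace.single i (1 : ℝ))
      (EuclideanSpace.single i 1) 0 := by
    simpa using ((hasDerivAt_id (0 : ℝ)).smul_const (EuclideanSpace.single i (1 : ℝ))).const_add q
  have h2 := (hV.differentiable (by norm_num) (q + (0 : ℝ) • EuclideanSpace.single i 1)).hasFDerivAt
  have := (h2.comp_hasDerivAt 0 h1).deriv
  simpa [Function.comp_def] using this

theorem contDiff_gradV (i : Fin d) : ContDiff ℝ 1 (fun q => gradV π V i (π q)) := by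
  rw [funext (gradV_proj hπ hV i)]
  exact (hV.fderiv_right (by norm_num)).clm_apply contDiff_const

theorem contDiff_lift_gradV (i : Fin d) :
    ContDiff ℝ 1 (lift π fun x : Phase Q d m => gradV π V i x.1) :=
  (contDiff_gradV hπ hV i).comp contDiff_fst

theorem contDiff_lift_p (i : Fin d) {k : WithTop ℕ∞} :
    ContDiff ℝ k (lift π fun x : Phase Q d m => x.2.1 i) := by
  change ContDiff ℝ k fun y : Phase (Vec d) d m => y.2.1 i
  fun_prop

theorem contDiff_lift_z (r : Fin m × Fin d) {k : WithTop ℕ∞} :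
    ContDiff ℝ k (lift π fun x : Phase Q d m => x.2.2 r.1 r.2) := by
  change ContDiff ℝ k fun y : Phase (Vec d) d m => y.2.2 r.1 r.2
  fun_prop

theorem contDiff_lift_coef (v : Coord d m) : ContDiff ℝ 1 (lift π (coef π V α lam v)) := by
  rcases v with i | i | r
  · exact contDiff_lift_p hπ hV i
  · exact (contDiff_lift_gradV hπ hV i).neg.add (ContDiff.sum fun j _ =>
      contDiff_const.mul (contDiff_lift_z hπ hV (j, i)))
  · exact (contDiff_const.mul (contDiff_lift_p hπ hV r.2)).sub
      (contDiff_const.mul (contDiff_lift_z hπ hV r))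

theorem contDiff_lift_energyGrad (v : Coord d m) :
    ContDiff ℝ 1 (lift π (energyGrad π V v)) := by
  rcases v with i | i | r
  · exact contDiff_lift_gradV hπ hV i
  · exact contDiff_lift_p hπ hV i
  · exact contDiff_lift_z hπ hV r

omit hV in
theorem der_p (w : Coord d m) (i : Fin d) (x : Phase Q d m) :
    der π w (fun x => x.2.1 i) x = if w = cp i then 1 else 0 := by
  refine hπ.dir_eq_const (fun y s => ?_) x
  change (y.2.1 + s • (unitVec w).2.1) i = y.2.1 i + _
  rcases w with k | k | r <;> simp [unitVec, Pi.single_apply, eq_comm]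

omit hV in
theorem der_z (w : Coord d m) (r : Fin m × Fin d) (x : Phase Q d m) :
    der π w (fun x => x.2.2 r.1 r.2) x = if w = cz r then 1 else 0 := by
  refine hπ.dir_eq_const (fun y s => ?_) x
  change (y.2.2 r.1 + s • (unitVec w).2.2 r.1) r.2 = y.2.2 r.1 r.2 + _
  rcases w with k | k | l
  · simp [unitVec]
  · simp [unitVec]
  · obtain ⟨a, b⟩ := l
    obtain ⟨a', b'⟩ := r
    by_cases h : a = a'
    · subst h
      simp [unitVec, Pi.single_apply, eq_comm]
    · simp [unitVec, Pi.single_apply, h, Ne.symm h]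

omit hV in
theorem der_gradV_of_ne (w : Coord d m) (hw : ∀ k, w ≠ cq k) (i : Fin d) (x : Phase Q d m) :
    der π w (fun x => gradV π V i x.1) x = 0 := by
  refine hπ.dir_eq_const (fun y s => ?_) x
  change gradV π V i (π (y.1 + s • (unitVec w).1)) = gradV π V i (π y.1) + _
  rcases w with k | k | r
  · exact absurd rfl (hw k)
  · simp [unitVec]
  · simp [unitVec]

theorem differentiable_coef (v : Coord d m) : Differentiable ℝ (lift π (coef π V α lam v)) :=
  (contDiff_lift_coef hπ hV v).differentiable (by norm_num)

theorem der_coef_p (w : Coord d m) (i : Fin d) (x : Phase Q d m) :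
    der π w (coef π V α lam (cp i)) x = -der π w (fun x => gradV π V i x.1) x +
      ∑ j, lam j * if w = cz (j, i) then 1 else 0 := by
  have hg : Differentiable ℝ (lift π fun x : Phase Q d m => gradV π V i x.1) :=
    (contDiff_lift_gradV hπ hV i).differentiable (by norm_num)
  have hz : ∀ j, Differentiable ℝ (lift π fun x : Phase Q d m => x.2.2 j i) := fun j =>
    (contDiff_lift_z hπ hV (j, i) (k := 1)).differentiable (by norm_num)
  have e : coef π V α lam (cp i) = (-1 : ℝ) • (fun x : Phase Q d m => gradV π V i x.1) +
      ∑ j, lam j • fun x : Phase Q d m => x.2.2 j i := by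
    funext x
    simp [coef]
  have hs : Differentiable ℝ (lift π (∑ j, lam j • fun x : Phase Q d m => x.2.2 j i)) := by
    have : lift π (∑ j, lam j • fun x : Phase Q d m => x.2.2 j i) =
        fun y => ∑ j, lam j * lift π (fun x : Phase Q d m => x.2.2 j i) y := by
      funext y; simp [lift]
    rw [this]
    exact Differentiable.fun_sum fun j _ => (hz j).const_mul _
  have h1 : der π w (coef π V α lam (cp i)) = (-1 : ℝ) • der π w (fun x => gradV π V i x.1) +
      ∑ j, lam j • der π w fun x : Phase Q d m => x.2.2 j i := by
    rw [e]
    refine (hπ.dir_add (hg.const_smul _) hs _).trans ?_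
    rw [hπ.dir_const_smul hg, hπ.dir_sum _ fun j _ => (hz j).const_smul _]
    congr 1
    exact Finset.sum_congr rfl fun j _ => hπ.dir_const_smul (hz j) _ _
  rw [h1]
  simp only [Pi.add_apply, Pi.smul_apply, Finset.sum_apply, smul_eq_mul, neg_mul, one_mul]
  congr 1
  exact Finset.sum_congr rfl fun j _ => by rw [der_z hπ w (j, i)]

theorem der_coef_z (w : Coord d m) (r : Fin m × Fin d) (x : Phase Q d m) :
    der π w (coef π V α lam (cz r)) x = -lam r.1 * (if w = cp r.2 then 1 else 0) -
      α r.1 * if w = cz r then 1 else 0 := by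
  have hp : Differentiable ℝ (lift π fun x : Phase Q d m => x.2.1 r.2) :=
    (contDiff_lift_p hπ hV r.2 (k := 1)).differentiable (by norm_num)
  have hz : Differentiable ℝ (lift π fun x : Phase Q d m => x.2.2 r.1 r.2) :=
    (contDiff_lift_z hπ hV r (k := 1)).differentiable (by norm_num)
  have e : coef π V α lam (cz r) = (-lam r.1) • (fun x : Phase Q d m => x.2.1 r.2) +
      (-α r.1) • fun x : Phase Q d m => x.2.2 r.1 r.2 := by
    funext x
    simp [coef]
    ring
  have h1 : der π w (coef π V α lam (cz r)) = (-lam r.1) • der π w (fun x => x.2.1 r.2) +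
      (-α r.1) • der π w fun x : Phase Q d m => x.2.2 r.1 r.2 := by
    rw [e]
    refine (hπ.dir_add (hp.const_smul _) (hz.const_smul _) _).trans ?_
    rw [hπ.dir_const_smul hp, hπ.dir_const_smul hz]
    rfl
  rw [h1]
  simp only [Pi.add_apply, Pi.smul_apply, smul_eq_mul, der_p hπ w r.2, der_z hπ w r]
  ring

/-- Without friction no component of the drift depends on its own variable, so the divergence
vanishes term by term. -/
theorem der_coef_self (v : Coord d m) (x : Phase Q d m) :
    der π v (coef π V 0 lam v) x = 0 := by
  rcases v with i | i | r
  · rw [show coef π V 0 lam (Sum.inl i) = fun x : Phase Q d m => x.2.1 i from rfl, der_p hπ]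
    simp
  · rw [der_coef_p hπ hV, der_gradV_of_ne hπ _ (by simp)]
    simp
  · rw [der_coef_z hπ hV]
    simp

/-- The generator maps `C^3` functions to `C^1` functions, and more generally. -/
theorem opL_eq_fun (f : Phase Q d m → ℝ) :
    opL π V α lam β f = (-1 : ℝ) • ∑ v, coef π V α lam v * der π v f +
      ∑ r : Fin m × Fin d, (-(α r.1 * β⁻¹)) • der π (cz r) (der π (cz r) f) := by
  funext x
  rw [opL_eq]
  simp only [Pi.add_apply, Pi.smul_apply, Finset.sum_apply, Pi.mul_apply, smul_eq_mul, neg_mul,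
    one_mul, Finset.sum_neg_distrib]
  rw [sub_eq_add_neg]

theorem coef_mul_mem {f : Phase Q d m → ℝ} (hf : f ∈ compactC π m 1) (v : Coord d m) :
    coef π V α lam v * f ∈ compactC π m 1 :=
  mul_mem_compactC (contDiff_lift_coef hπ hV v) hf

theorem opL_mem {f : Phase Q d m → ℝ} (hf : f ∈ compactC π m 3) :
    opL π V α lam β f ∈ compactC π m 1 := by
  rw [opL_eq_fun hπ hV]
  refine add_mem (Submodule.smul_mem _ _ (Submodule.sum_mem _ fun v _ => ?_))
    (Submodule.sum_mem _ fun r _ => Submodule.smul_mem _ _ ?_)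
  · exact coef_mul_mem hπ hV (hπ.der_mem hf (by norm_num) v) v
  · exact hπ.der_mem (hπ.der_mem (k := 2) hf (by norm_num) _) (by norm_num) _

omit hV in
theorem der_comm {f : Phase Q d m → ℝ} (hf : ContDiff ℝ 2 (lift π f)) (v w : Coord d m) :
    der π v (der π w f) = der π w (der π v f) := hπ.dir_comm hf _ _

/-- The commutator of a partial derivative with the generator. -/
theorem der_opL {f : Phase Q d m → ℝ} (hf : f ∈ compactC π m 3) (w : Coord d m) :
    der π w (opL π V α lam β f) = opL π V α lam β (der π w f) -
      ∑ v, der π w (coef π V α lam v) * der π v f := by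
  have hd : ∀ {g : Phase Q d m → ℝ}, g ∈ compactC π m 1 → Differentiable ℝ (lift π g) :=
    fun hg => hg.1.differentiable (by norm_num)
  have h1 : ∀ v, der π v f ∈ compactC π m 2 := fun v => hπ.der_mem hf (by norm_num) v
  have h1' : ∀ v, der π v f ∈ compactC π m 1 := fun v => compactC_mono (by norm_num) (h1 v)
  have h2 : ∀ v, coef π V α lam v * der π v f ∈ compactC π m 1 := fun v =>
    coef_mul_mem hπ hV (h1' v) v
  have h3 : ∀ r : Fin m × Fin d, der π (cz r) (der π (cz r) f) ∈ compactC π m 1 := fun r =>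
    hπ.der_mem (h1 _) (by norm_num) _
  have hf2 : ContDiff ℝ 2 (lift π f) := hf.1.of_le (by norm_num)
  rw [opL_eq_fun hπ hV, opL_eq_fun hπ hV]
  refine (hπ.dir_add (hd (Submodule.smul_mem _ _ (Submodule.sum_mem _ fun v _ => h2 v)))
    (hd (Submodule.sum_mem _ fun r _ => Submodule.smul_mem _ _ (h3 r))) _).trans ?_
  rw [hπ.dir_const_smul (hd (Submodule.sum_mem _ fun v _ => h2 v)),
    hπ.dir_sum _ (fun v _ => hd (h2 v)),
    hπ.dir_sum _ (fun r _ => hd (Submodule.smul_mem _ _ (h3 r)))]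
  have e1 : ∀ v, dir π (unitVec w) (coef π V α lam v * der π v f) =
      der π w (coef π V α lam v) * der π v f + coef π V α lam v * der π v (der π w f) := fun v => by
    rw [der_comm hπ hf2 v w]
    exact hπ.dir_mul (differentiable_coef hπ hV v) (hd (h1' v)) _
  -- The second order part has constant coefficients and does not contribute to the commutator.
  have e2 : ∀ r : Fin m × Fin d,
      dir π (unitVec w) ((-(α r.1 * β⁻¹)) • der π (cz r) (der π (cz r) f)) =
      (-(α r.1 * β⁻¹)) • der π (cz r) (der π (cz r) (der π w f)) := fun r => by
    rw [hπ.dir_const_smul (hd (h3 r)), der_comm hπ hf2 (cz r) w,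
      der_comm hπ (h1 (cz r)).1 (cz r) w]
    rfl
  simp only [e1, e2, Finset.sum_add_distrib, smul_add]
  rw [neg_one_smul, neg_one_smul]
  abel

end

end Generator

/-! ### Integration by parts, invariance and the Dirichlet form of the Gibbs measure. -/

section GibbsMeasure

open scoped InnerProductSpace

variable {Q : Type} [NormedAddCommGroup Q] {d m : ℕ} {π : Vec d → Q} {V : Q → ℝ}
  {α lam : Fin m → ℝ} {β : ℝ}

/-- The exponent of the Gibbs weight. -/
noncomputable def gibbsExp (m : ℕ) (V : Q → ℝ) (β : ℝ) (x : Phase Q d m) : ℝ :=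
  -β * (V x.1 + ‖x.2.1‖ ^ 2 / 2 + (∑ j : Fin m, ‖x.2.2 j‖ ^ 2) / 2)

theorem contDiff_lift_gibbsExp (hV : ContDiff ℝ 2 (fun q => V (π q))) :
    ContDiff ℝ 2 (lift π (gibbsExp (d := d) m V β)) := by
  refine contDiff_const.mul (((hV.comp contDiff_fst).add (ContDiff.div_const ?_ _)).add
    (ContDiff.div_const (ContDiff.sum fun j _ => ?_) _))
  · change ContDiff ℝ 2 fun y : Phase (Vec d) d m => ‖y.2.1‖ ^ 2
    exact (by fun_prop : ContDiff ℝ 2 fun y : Phase (Vec d) d m => y.2.1).norm_sq ℝ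
  · change ContDiff ℝ 2 fun y : Phase (Vec d) d m => ‖y.2.2 j‖ ^ 2
    exact (by fun_prop : ContDiff ℝ 2 fun y : Phase (Vec d) d m => y.2.2 j).norm_sq ℝ

theorem der_gibbsExp (hπ : IsCover π) (hV : ContDiff ℝ 2 (fun q => V (π q))) (v : Coord d m)
    (x : Phase Q d m) : der π v (gibbsExp m V β) x = -β * energyGrad π V v x := by
  obtain ⟨y, rfl⟩ := hπ.proj_surjective x
  have key : ∀ w : Phase (Vec d) d m, HasDerivAt
      (fun s : ℝ => lift π (gibbsExp (d := d) m V β) (y + s • w))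
      (-β * (fderiv ℝ (fun q => V (π q)) y.1 w.1 + ⟪y.2.1, w.2.1⟫_ℝ +
        ∑ j, ⟪y.2.2 j, w.2.2 j⟫_ℝ)) 0 := fun w => by
    have line : ∀ {E : Type} [NormedAddCommGroup E] [NormedSpace ℝ E] (a b : E),
        HasDerivAt (fun s : ℝ => a + s • b) b 0 := fun a b => by
      simpa using ((hasDerivAt_id (0 : ℝ)).smul_const b).const_add a
    have h1 : HasDerivAt (fun s : ℝ => V (π (y.1 + s • w.1)))
        (fderiv ℝ (fun q => V (π q)) y.1 w.1) 0 := by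
      have h2 := (hV.differentiable (by norm_num) (y.1 + (0 : ℝ) • w.1)).hasFDerivAt
      simpa [Function.comp_def] using h2.comp_hasDerivAt 0 (line y.1 w.1)
    have h2 := ((line y.2.1 w.2.1).norm_sq).div_const 2
    have h3 := (HasDerivAt.fun_sum (u := Finset.univ)
      fun j _ => (line (y.2.2 j) (w.2.2 j)).norm_sq).div_const 2
    have h4 := ((h1.add h2).add h3).const_mul (-β)
    refine h4.congr_deriv ?_
    rw [← Finset.mul_sum]
    simp
  unfold der
  rw [hπ.dir_proj_eq_deriv, (key _).deriv]
  congr 1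
  rcases v with i | i | r
  · change _ = gradV π V i (π y.1)
    rw [gradV_proj hπ hV]
    simp [unitVec]
  · change _ = y.2.1 i
    simp [unitVec, EuclideanSpace.inner_single_right]
  · change _ = y.2.2 r.1 r.2
    rw [Finset.sum_eq_single r.1]
    · simp [unitVec, EuclideanSpace.inner_single_right]
    · intro j _ hj
      simp [unitVec, Pi.single_apply, hj]
    · simp

variable [ProperSpace Q] [MeasureSpace Q] [BorelSpace Q] [(volume : Measure Q).IsAddHaarMeasure]

/-- A potential of class `C^2` with bounded second derivatives, integrable Gibbs weight, and
square integrable gradient. -/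
structure IsPotential (π : Vec d → Q) (V : Q → ℝ) (β : ℝ) : Prop where
  contDiff : ContDiff ℝ 2 (fun q => V (π q))
  hessian : ∃ c, ∀ q, ‖fderiv ℝ (fderiv ℝ fun q => V (π q)) q‖ ≤ c
  integrable : Integrable fun q => Real.exp (-β * V q)
  integrable_grad : ∀ i, Integrable fun q => gradV π V i q ^ 2 * Real.exp (-β * V q)

theorem integrable_exp_neg_norm_sq {b : ℝ} (hb : 0 < b) :
    Integrable fun p : Vec d => Real.exp (-b * ‖p‖ ^ 2) := by
  have h := GaussianFourier.integrable_cexp_neg_mul_sq_norm_add (b := (b : ℂ)) (by simpa using hb)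
    0 (0 : Vec d)
  refine h.re.congr (Eventually.of_forall fun p => ?_)
  simp only [zero_mul, add_zero]
  rw [show (-(b : ℂ) * (‖p‖ : ℂ) ^ 2) = ((-b * ‖p‖ ^ 2 : ℝ) : ℂ) by push_cast; ring,
    ← Complex.ofReal_exp]
  rfl

theorem integrable_weight {g : Q → ℝ} (hg : Integrable g) {a b : ℝ} (ha : 0 < a) (hb : 0 < b) :
    Integrable fun x : Phase Q d m => g x.1 *
      (Real.exp (-a * ‖x.2.1‖ ^ 2) * ∏ j, Real.exp (-b * ‖x.2.2 j‖ ^ 2)) := by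
  have h1 : Integrable fun z : Fin m → Vec d => ∏ j, Real.exp (-b * ‖z j‖ ^ 2) :=
    Integrable.fintype_prod (f := fun _ (z : Vec d) => Real.exp (-b * ‖z‖ ^ 2))
      fun _ => integrable_exp_neg_norm_sq hb
  have h2 : Integrable (fun w : Vec d × (Fin m → Vec d) => Real.exp (-a * ‖w.1‖ ^ 2) *
      ∏ j, Real.exp (-b * ‖w.2 j‖ ^ 2)) :=
    (integrable_exp_neg_norm_sq ha).mul_prod h1
  exact hg.mul_prod h2

theorem exp_gibbsExp (x : Phase Q d m) : Real.exp (gibbsExp m V β x) =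
    Real.exp (-β * V x.1) *
      (Real.exp (-(β / 2) * ‖x.2.1‖ ^ 2) * ∏ j, Real.exp (-(β / 2) * ‖x.2.2 j‖ ^ 2)) := by
  rw [← Real.exp_sum, ← Real.exp_add, ← Real.exp_add, gibbsExp, ← Finset.mul_sum]
  congr 1
  ring

namespace IsPotential

variable (hV : IsPotential π V β) (hπ : IsCover π) (hβ : 0 < β)
include hV hβ

theorem integrable_exp : Integrable fun x : Phase Q d m => Real.exp (gibbsExp m V β x) := by
  simp only [exp_gibbsExp]
  exact integrable_weight hV.integrable (by positivity) (by positivity)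

theorem isProbabilityMeasure : IsProbabilityMeasure (gibbs (d := d) m V β) :=
  isProbabilityMeasure_tilted (hV.integrable_exp hβ)

omit hV hβ in
theorem integral_gibbs (g : Phase Q d m → ℝ) : ∫ x, g x ∂(gibbs m V β) =
    (∫ x : Phase Q d m, Real.exp (gibbsExp m V β x))⁻¹ *
      ∫ x, g x * Real.exp (gibbsExp m V β x) := by
  change ∫ x, g x ∂(volume.tilted (gibbsExp m V β)) = _
  rw [integral_tilted, ← integral_const_mul]
  refine integral_congr_ae (Eventually.of_forall fun x => ?_)
  simp only [smul_eq_mul]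
  ring

include hπ

theorem integrable_gibbs {k : WithTop ℕ∞} {f : Phase Q d m → ℝ} (hf : f ∈ compactC π m k) :
    Integrable f (gibbs m V β) := by
  have := hV.isProbabilityMeasure (d := d) (m := m) hβ
  exact (hπ.continuous_of_mem hf).integrable_of_hasCompactSupport hf.2

/-- Integration by parts for the Gibbs measure. -/
theorem integral_der {f : Phase Q d m → ℝ} (hf : f ∈ compactC π m 1) (v : Coord d m) :
    ∫ x, der π v f x ∂(gibbs m V β) = β * ∫ x, energyGrad π V v x * f x ∂(gibbs m V β) := by
  have hφ := contDiff_lift_gibbsExp (d := d) (m := m) (β := β) hV.contDiff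
  let ρ : Phase Q d m → ℝ := fun x => Real.exp (gibbsExp m V β x)
  have hρ : ContDiff ℝ 1 (lift π ρ) := (hφ.exp).of_le (by norm_num)
  have hfρ : ρ * f ∈ compactC π m 1 := mul_mem_compactC hρ hf
  have hD := hρ.differentiable (by norm_num)
  have hder : ∀ x, der π v ρ x = -β * energyGrad π V v x * ρ x := fun x => by
    have h1 := der_gibbsExp (β := β) hπ hV.contDiff v x
    obtain ⟨y, rfl⟩ := hπ.proj_surjective x
    unfold der at h1 ⊢
    rw [hπ.dir_proj _ (hφ.differentiable (by norm_num) y)] at h1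
    rw [hπ.dir_proj _ (hD y)]
    have e : lift π ρ = fun y => Real.exp (lift π (gibbsExp m V β) y) := rfl
    rw [e, (hφ.differentiable (by norm_num) y).hasFDerivAt.exp.fderiv]
    simp only [ContinuousLinearMap.smul_apply, smul_eq_mul, h1]
    change Real.exp _ * _ = _ * Real.exp _
    rw [mul_comm]; rfl
  -- For the density ρ the derivative of ρ f is (∂f - β (∂E) f) ρ, with E the energy, and it
  -- integrates to 0.
  have h0 := hπ.integral_dir_eq_zero hfρ (unitVec v)
  have e1 : ∀ x, dir π (unitVec v) (ρ * f) x =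
      der π v f x * ρ x - β * (energyGrad π V v x * f x * ρ x) := fun x => by
    rw [hπ.dir_mul hD (hf.1.differentiable (by norm_num))]
    have := hder x
    simp only [der, Pi.add_apply, Pi.mul_apply] at this ⊢
    rw [this]; ring
  have i1 : Integrable fun x => der π v f x * ρ x := by
    have h := mul_mem_compactC (hρ.of_le zero_le) (hπ.der_mem (k := 0) hf (by norm_num) v)
    have := (hπ.continuous_of_mem h).integrable_of_hasCompactSupport (μ := volume) h.2
    exact this.congr (Eventually.of_forall fun x => mul_comm _ _)
  have i2 : Integrable fun x => energyGrad π V v x * f x * ρ x := by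
    have h := mul_mem_compactC hρ (mul_mem_compactC (contDiff_lift_energyGrad hπ hV.contDiff v) hf)
    have := (hπ.continuous_of_mem h).integrable_of_hasCompactSupport (μ := volume) h.2
    exact this.congr (Eventually.of_forall fun x => mul_comm _ _)
  simp only [e1] at h0
  rw [integral_sub i1 (i2.const_mul _), integral_const_mul] at h0
  rw [integral_gibbs, integral_gibbs]
  change _ * ∫ x, der π v f x * ρ x = β * (_ * ∫ x, energyGrad π V v x * f x * ρ x)
  linear_combination (∫ x : Phase Q d m, Real.exp (gibbsExp m V β x))⁻¹ * h0

/-- The Gibbs measure is invariant. -/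
theorem integral_opL {f : Phase Q d m → ℝ} (hf : f ∈ compactC π m 2) :
    ∫ x, opL π V α lam β f x ∂(gibbs m V β) = 0 := by
  have hf1 : f ∈ compactC π m 1 := compactC_mono (by norm_num) hf
  have hd : ∀ v, der π v f ∈ compactC π m 1 := fun v => hπ.der_mem hf (by norm_num) v
  have hb : ∀ v, coef π V 0 lam v * f ∈ compactC π m 1 := fun v =>
    coef_mul_mem hπ hV.contDiff hf1 v
  have hder : ∀ v x, der π v (coef π V 0 lam v * f) x = coef π V 0 lam v x * der π v f x :=
    fun v x => by
      rw [hπ.der_mul (differentiable_coef hπ hV.contDiff v)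
        (hf1.1.differentiable (by norm_num))]
      simp [der_coef_self hπ hV.contDiff v x]
  -- The frictionless part is written as a divergence; each friction term is paired with its second
  -- derivative, and this pair integrates to 0 by one integration by parts.
  have e : ∀ x, opL π V α lam β f x = -∑ v, der π v (coef π V 0 lam v * f) x +
      ∑ r : Fin m × Fin d, (α r.1 * (energyGrad π V (cz r) x * der π (cz r) f x) -
        α r.1 * β⁻¹ * der π (cz r) (der π (cz r) f) x) := fun x => by
    rw [opL, opB_eq, Fintype.sum_prod_type]
    simp only [hder]
    congr 1
    refine Finset.sum_congr rfl fun j _ => Finset.sum_congr rfl fun i _ => ?_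
    change α j * (x.2.2 j i * der π (cz (j, i)) f x - β⁻¹ * der π (cz (j, i))
      (der π (cz (j, i)) f) x) = _
    simp only [energyGrad]
    ring
  have i1 : ∀ v, Integrable (der π v (coef π V 0 lam v * f)) (gibbs m V β) := fun v =>
    hV.integrable_gibbs hπ hβ (hπ.der_mem (k := 0) (hb v) (by norm_num) v)
  have i2 : ∀ r : Fin m × Fin d, Integrable
      (fun x => energyGrad π V (cz r) x * der π (cz r) f x) (gibbs m V β) := fun r =>
    hV.integrable_gibbs hπ hβ (mul_mem_compactC
      (contDiff_lift_energyGrad hπ hV.contDiff (cz r)) (hd (cz r)))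
  have i3 : ∀ r : Fin m × Fin d, Integrable (der π (cz r) (der π (cz r) f)) (gibbs m V β) :=
    fun r => hV.integrable_gibbs hπ hβ (hπ.der_mem (k := 0) (hd (cz r)) (by norm_num) _)
  simp only [e]
  have i4 : ∀ r : Fin m × Fin d, Integrable
      (fun x => α r.1 * (energyGrad π V (cz r) x * der π (cz r) f x) -
        α r.1 * β⁻¹ * der π (cz r) (der π (cz r) f) x) (gibbs m V β) :=
    fun r => ((i2 r).const_mul _).sub ((i3 r).const_mul _)
  have i5 : Integrable (fun x => -∑ v, der π v (coef π V 0 lam v * f) x) (gibbs m V β) :=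
    (integrable_finset_sum _ fun v _ => i1 v).neg
  rw [integral_add i5 (integrable_finset_sum _ fun r _ => i4 r), integral_neg,
    integral_finset_sum _ fun v _ => i1 v, integral_finset_sum _ fun r _ => i4 r]
  -- Integration by parts turns the divergence into the product of the frictionless drift with the
  -- energy gradient, which is 0 by conservation of energy.
  have s1 : ∑ v, ∫ x, der π v (coef π V 0 lam v * f) x ∂(gibbs m V β) = 0 := by
    have h1 : ∀ v, ∫ x, der π v (coef π V 0 lam v * f) x ∂(gibbs m V β) =
        β * ∫ x, energyGrad π V v x * (coef π V 0 lam v * f) x ∂(gibbs m V β) := fun v =>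
      hV.integral_der hπ hβ (hb v) v
    rw [Finset.sum_congr rfl fun v _ => h1 v, ← Finset.mul_sum, ← integral_finset_sum]
    · have h2 : ∀ x, ∑ v, energyGrad π V v x * (coef π V 0 lam v * f) x = 0 := fun x => by
        have := sum_coef_energyGrad π V lam x
        rw [← zero_mul (f x), ← this, Finset.sum_mul]
        refine Finset.sum_congr rfl fun v _ => ?_
        simp only [Pi.mul_apply]
        ring
      simp only [h2, integral_zero, mul_zero]
    · intro v _
      exact hV.integrable_gibbs hπ hβ (mul_mem_compactC
        (contDiff_lift_energyGrad hπ hV.contDiff v) (hb v))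
  rw [s1, neg_zero, zero_add]
  refine Finset.sum_eq_zero fun r _ => ?_
  rw [integral_sub ((i2 r).const_mul _) ((i3 r).const_mul _), integral_const_mul,
    integral_const_mul, hV.integral_der hπ hβ (hd (cz r)) (cz r)]
  field_simp
  ring

/-- The Dirichlet form of the generator. -/
theorem integral_mul_opL_add {f g : Phase Q d m → ℝ} (hf : f ∈ compactC π m 3)
    (hg : g ∈ compactC π m 3) :
    ∫ x, f x * opL π V α lam β g x ∂(gibbs m V β) + ∫ x, opL π V α lam β f x * g x ∂(gibbs m V β) =
      2 * ∑ r : Fin m × Fin d, α r.1 * β⁻¹ *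
        ∫ x, der π (cz r) f x * der π (cz r) g x ∂(gibbs m V β) := by
  have hfg : f * g ∈ compactC π m 2 := mul_mem_compactC (hf.1.of_le (by norm_num))
    (compactC_mono (by norm_num) hg)
  have hfd : Differentiable ℝ (lift π f) := hf.1.differentiable (by norm_num)
  have hgd : Differentiable ℝ (lift π g) := hg.1.differentiable (by norm_num)
  have hfm : ∀ v, der π v f ∈ compactC π m 2 := fun v => hπ.der_mem hf (by norm_num) v
  have hgm : ∀ v, der π v g ∈ compactC π m 2 := fun v => hπ.der_mem hg (by norm_num) v
  have hfm' : ∀ v, Differentiable ℝ (lift π (der π v f)) := fun v =>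
    (hfm v).1.differentiable (by norm_num)
  have hgm' : ∀ v, Differentiable ℝ (lift π (der π v g)) := fun v =>
    (hgm v).1.differentiable (by norm_num)
  have d1 : ∀ v, der π v (f * g) = der π v f * g + f * der π v g := fun v =>
    hπ.der_mul hfd hgd v
  have d2 : ∀ v, der π v (der π v f * g + f * der π v g) = der π v (der π v f) * g +
      f * der π v (der π v g) + (2 : ℝ) • (der π v f * der π v g) := fun v => by
    have h1 : Differentiable ℝ (lift π (der π v f * g)) := (hfm' v).mul hgd
    have h2 : Differentiable ℝ (lift π (f * der π v g)) := hfd.mul (hgm' v)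
    refine (hπ.dir_add h1 h2 _).trans ?_
    have h3 := hπ.der_mul (hfm' v) hgd v
    have h4 := hπ.der_mul hfd (hgm' v) v
    unfold der at h3 h4 ⊢
    rw [h3, h4, two_smul]
    ring
  -- The carré du champ identity; the mean of 𝓛(fg) vanishes by invariance.
  have e : ∀ x, f x * opL π V α lam β g x + opL π V α lam β f x * g x =
      opL π V α lam β (f * g) x + 2 * ∑ r : Fin m × Fin d, α r.1 * β⁻¹ *
        (der π (cz r) f x * der π (cz r) g x) := fun x => by
    rw [opL_eq, opL_eq, opL_eq]
    simp only [d2, d1, Pi.add_apply, Pi.mul_apply, Pi.smul_apply, smul_eq_mul, mul_add,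
      Finset.sum_add_distrib, mul_sub, sub_mul, neg_mul, mul_neg, Finset.mul_sum, Finset.sum_mul]
    have a1 : ∀ v, f x * (coef π V α lam v x * der π v g x) =
        coef π V α lam v x * (f x * der π v g x) := fun v => by ring
    have a2 : ∀ v, coef π V α lam v x * der π v f x * g x =
        coef π V α lam v x * (der π v f x * g x) := fun v => by ring
    have a3 : ∀ r : Fin m × Fin d, f x * (α r.1 * β⁻¹ * der π (cz r) (der π (cz r) g) x) =
        α r.1 * β⁻¹ * (f x * der π (cz r) (der π (cz r) g) x) := fun r => by ring
    have a4 : ∀ r : Fin m × Fin d, α r.1 * β⁻¹ * der π (cz r) (der π (cz r) f) x * g x =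
        α r.1 * β⁻¹ * (der π (cz r) (der π (cz r) f) x * g x) := fun r => by ring
    have a5 : ∀ r : Fin m × Fin d, α r.1 * β⁻¹ * (2 * (der π (cz r) f x * der π (cz r) g x)) =
        2 * (α r.1 * β⁻¹ * (der π (cz r) f x * der π (cz r) g x)) := fun r => by ring
    simp only [a1, a2, a3, a4, a5]
    ring
  have hL : ∀ {h : Phase Q d m → ℝ}, h ∈ compactC π m 3 → opL π V α lam β h ∈ compactC π m 1 :=
    fun h => opL_mem hπ hV.contDiff h
  have i1 : Integrable (fun x => f x * opL π V α lam β g x) (gibbs m V β) :=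
    hV.integrable_gibbs hπ hβ (mul_mem_compactC (hf.1.of_le (by norm_num)) (hL hg))
  have i2 : Integrable (fun x => opL π V α lam β f x * g x) (gibbs m V β) :=
    hV.integrable_gibbs hπ hβ (mul_mem_compactC (hL hf).1 (compactC_mono (by norm_num) hg))
  have i3 : ∀ r : Fin m × Fin d, Integrable
      (fun x => α r.1 * β⁻¹ * (der π (cz r) f x * der π (cz r) g x)) (gibbs m V β) := fun r =>
    (hV.integrable_gibbs hπ hβ (mul_mem_compactC (hfm (cz r)).1 (hgm (cz r)))).const_mul _
  have i4 : Integrable (opL π V α lam β (f * g)) (gibbs m V β) :=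
    (i1.add i2 |>.sub ((integrable_finset_sum _ fun r _ => i3 r).const_mul 2)).congr
      (Eventually.of_forall fun x => by
        simp only [Pi.add_apply, Pi.sub_apply, e]; ring)
  rw [← integral_add i1 i2]
  simp only [e]
  rw [integral_add i4 ((integrable_finset_sum _ fun r _ => i3 r).const_mul 2),
    hV.integral_opL hπ hβ hfg, zero_add, integral_const_mul, integral_finset_sum _ fun r _ => i3 r]
  simp only [integral_const_mul]

end IsPotential

end GibbsMeasure

/-! ### Weights and algebraic inequalities for the Lyapunov functional. -/

section Lyapunov

open scoped InnerProductSpace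

/-- The discriminant criterion for a binary quadratic form: multiply by u and complete the square.
-/
theorem two_mul_le_of_sq_le {p u v : ℝ} (hu : 0 < u) (h : p ^ 2 ≤ u * v) (x y : ℝ) :
    2 * (p * (x * y)) ≤ u * x ^ 2 + v * y ^ 2 := by
  have h1 : 0 ≤ u * (u * x ^ 2 + v * y ^ 2 - 2 * (p * (x * y))) := by
    have : u * (u * x ^ 2 + v * y ^ 2 - 2 * (p * (x * y))) =
        (u * x - p * y) ^ 2 + (u * v - p ^ 2) * y ^ 2 := by ring
    rw [this]
    have : 0 ≤ u * v - p ^ 2 := by linarith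
    positivity
  have := nonneg_of_mul_nonneg_right h1 hu
  linarith

/-- Weights for the hypocoercive Lyapunov functional. -/
structure IsWeight (s K a b c d e : ℝ) : Prop where
  apos : 0 < a
  bpos : 0 < b
  cpos : 0 < c
  dpos : 0 < d
  epos : 0 < e
  ba : b ≤ a
  cb : c ≤ b
  dc : d ≤ c
  ed : e ≤ d
  ha : (10 + 4 * K) * a ≤ s
  hab : ((10 + 4 * K) * a) ^ 2 ≤ s * b
  hbd : ((10 + 4 * K) * b) ^ 2 ≤ s * d
  hcb : 2 * ((10 + 4 * K) * c) ≤ b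
  hcd : ((10 + 4 * K) * c) ^ 2 ≤ b * d
  hed : 2 * ((10 + 4 * K) * e) ≤ d
  hbc : (2 * b) ^ 2 ≤ a * (c / 2)
  hdc : (2 * d) ^ 2 ≤ e * (c / 2)

/-- The weights are powers of one small number x with exponents 20, 35, 48, 56, 60. In these
exponents the quadratic conditions read 2·20 > 35, 2·35 > 56, 2·48 > 35+56, 2·35 > 20+48 and 2·56 >
60+48. Each leaves a spare power of x, which absorbs the numerical constants, since x is chosen with
M² x = min(s, 1). -/
theorem exists_isWeight {s K : ℝ} (hs : 0 < s) (hK : 0 ≤ K) :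
    ∃ a b c d e, IsWeight s K a b c d e := by
  obtain ⟨M, hM⟩ : ∃ M, M = 10 + 4 * K := ⟨_, rfl⟩
  have hM10 : 10 ≤ M := by linarith
  obtain ⟨x, hx⟩ : ∃ x, x = min s 1 / M ^ 2 := ⟨_, rfl⟩
  have hx0 : 0 < x := by rw [hx]; positivity
  have hxM : M ^ 2 * x = min s 1 := by rw [hx]; field_simp
  have hxs : M ^ 2 * x ≤ s := hxM ▸ min_le_left _ _
  have hx1 : M ^ 2 * x ≤ 1 := hxM ▸ min_le_right _ _
  have hx2 : M * x ≤ 1 / 10 := by nlinarith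
  have hx3 : x ≤ 1 / 100 := by nlinarith
  have hMxs : M * x ≤ s := by nlinarith [mul_pos (by linarith : 0 < M) hx0]
  have hp : ∀ n : ℕ, 0 < x ^ n := fun n => by positivity
  have hle : ∀ {k n : ℕ}, n ≤ k → x ^ k ≤ x ^ n := fun h =>
    pow_le_pow_of_le_one hx0.le (by linarith) h
  have h1 : ∀ n : ℕ, x ^ n ≤ 1 := fun n => pow_le_one₀ hx0.le (by linarith)
  refine ⟨x ^ 20, x ^ 35, x ^ 48, x ^ 56, x ^ 60, ⟨hp _, hp _, hp _, hp _, hp _, hle (by norm_num),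
    hle (by norm_num), hle (by norm_num), hle (by norm_num), ?_, ?_, ?_, ?_, ?_, ?_, ?_, ?_⟩⟩
  all_goals try rw [← hM]
  · calc M * x ^ 20 = (M * x) * x ^ 19 := by ring
      _ ≤ s * 1 := mul_le_mul hMxs (h1 _) (hp _).le hs.le
      _ = s := mul_one s
  · calc (M * x ^ 20) ^ 2 = (M ^ 2 * x) * x ^ 39 := by ring
      _ ≤ s * x ^ 35 := mul_le_mul hxs (hle (by norm_num)) (hp _).le hs.le
  · calc (M * x ^ 35) ^ 2 = (M ^ 2 * x) * x ^ 69 := by ring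
      _ ≤ s * x ^ 56 := mul_le_mul hxs (hle (by norm_num)) (hp _).le hs.le
  · calc 2 * (M * x ^ 48) = (2 * (M * x)) * x ^ 47 := by ring
      _ ≤ 1 * x ^ 35 := mul_le_mul (by linarith) (hle (by norm_num)) (hp _).le one_pos.le
      _ = x ^ 35 := one_mul _
  · calc (M * x ^ 48) ^ 2 = (M ^ 2 * x) * x ^ 95 := by ring
      _ ≤ 1 * x ^ 91 := mul_le_mul hx1 (hle (by norm_num)) (hp _).le one_pos.le
      _ = x ^ 35 * x ^ 56 := by ring
  · calc 2 * (M * x ^ 60) = (2 * (M * x)) * x ^ 59 := by ring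
      _ ≤ 1 * x ^ 56 := mul_le_mul (by linarith) (hle (by norm_num)) (hp _).le one_pos.le
      _ = x ^ 56 := one_mul _
  · calc (2 * x ^ 35) ^ 2 = (8 * x) * x ^ 69 / 2 := by ring
      _ ≤ 1 * x ^ 68 / 2 := by
        have := mul_le_mul (by linarith : 8 * x ≤ 1) (hle (by norm_num : 68 ≤ 69)) (hp _).le
          one_pos.le
        linarith
      _ = x ^ 20 * (x ^ 48 / 2) := by ring
  · calc (2 * x ^ 56) ^ 2 = (8 * x) * x ^ 111 / 2 := by ring
      _ ≤ 1 * x ^ 108 / 2 := by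
        have := mul_le_mul (by linarith : 8 * x ≤ 1) (hle (by norm_num : 108 ≤ 111)) (hp _).le
          one_pos.le
        linarith
      _ = x ^ 60 * (x ^ 48 / 2) := by ring

namespace IsWeight

variable {s K a b c d e : ℝ} (h : IsWeight s K a b c d e)
include h

/-- Here `xk` stands for t^k ‖C_k u‖ and `yk` for t^{k+1/2} times the norm of the noise derivatives
of C_k u. Each cross term is split by the discriminant conditions and absorbed in the six squares on
the right. -/
theorem scalar_le (hs : 0 < s) (hK : 0 ≤ K) {x0 x1 x2 : ℝ} (hx0 : 0 ≤ x0) (hx1 : 0 ≤ x1)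
    (hx2 : 0 ≤ x2) (y0 y1 y2 : ℝ) :
    a * x0 ^ 2 + 4 * b * (x0 * x1) + 3 * c * x1 ^ 2 + 8 * d * (x1 * x2) + 5 * e * x2 ^ 2 +
      2 * a * (x0 * x1 + K * x0 ^ 2) + 2 * b * (x0 * x2 + K * (x0 * x1)) + 2 * c * (x1 * x2) +
      2 * d * K * (x0 * x1 + x1 ^ 2) + 2 * e * K * (x0 * x2 + x1 * x2) +
      4 * b * (y0 * y1) + 4 * d * (y1 * y2) ≤
    2 * s * x0 ^ 2 + 2 * b * x1 ^ 2 + 2 * d * x2 ^ 2 +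
      2 * a * y0 ^ 2 + 2 * c * y1 ^ 2 + 2 * e * y2 ^ 2 := by
  obtain ⟨ha0, hb0, hc0, hd0, he0, hba, hcb', hdc', hed', ha, hab, hbd, hcb, hcd, hed, hbc, hdc⟩ := h
  have q1 := two_mul_le_of_sq_le hs hab x0 x1
  have q2 := two_mul_le_of_sq_le hs hbd x0 x2
  have q3 := two_mul_le_of_sq_le hb0 hcd x1 x2
  have q4 := two_mul_le_of_sq_le ha0 hbc y0 y1
  have q5 := two_mul_le_of_sq_le he0 hdc y2 y1
  have p01 : 0 ≤ x0 * x1 := mul_nonneg hx0 hx1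
  have p02 : 0 ≤ x0 * x2 := mul_nonneg hx0 hx2
  have p12 : 0 ≤ x1 * x2 := mul_nonneg hx1 hx2
  have kba : K * b ≤ K * a := mul_le_mul_of_nonneg_left hba hK
  have kcb : K * c ≤ K * b := mul_le_mul_of_nonneg_left hcb' hK
  have kdc : K * d ≤ K * c := mul_le_mul_of_nonneg_left hdc' hK
  have ked : K * e ≤ K * d := mul_le_mul_of_nonneg_left hed' hK
  have ke : 0 ≤ K * e := by positivity
  have r1 : (a + 2 * a * K) * x0 ^ 2 ≤ s * x0 ^ 2 :=
    mul_le_mul_of_nonneg_right (by linarith) (sq_nonneg _)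
  have r2 : (4 * b + 2 * a + 2 * b * K + 2 * d * K) * (x0 * x1) ≤ (10 + 4 * K) * a * (x0 * x1) :=
    mul_le_mul_of_nonneg_right (by linarith) p01
  have r3 : (2 * b + 2 * e * K) * (x0 * x2) ≤ (10 + 4 * K) * b * (x0 * x2) :=
    mul_le_mul_of_nonneg_right (by linarith) p02
  have r4 : (3 * c + 2 * d * K) * x1 ^ 2 ≤ b / 2 * x1 ^ 2 :=
    mul_le_mul_of_nonneg_right (by linarith) (sq_nonneg _)
  have r5 : (8 * d + 2 * c + 2 * e * K) * (x1 * x2) ≤ (10 + 4 * K) * c * (x1 * x2) :=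
    mul_le_mul_of_nonneg_right (by linarith) p12
  have r6 : 5 * e * x2 ^ 2 ≤ d / 2 * x2 ^ 2 :=
    mul_le_mul_of_nonneg_right (by linarith) (sq_nonneg _)
  have s1 : 0 ≤ b * x1 ^ 2 := by positivity
  have s2 : 0 ≤ d * x2 ^ 2 := by positivity
  have s3 : 0 ≤ a * y0 ^ 2 := by positivity
  have s4 : 0 ≤ c * y1 ^ 2 := by positivity
  have s5 : 0 ≤ e * y2 ^ 2 := by positivity
  linarith

variable {H H' : Type*} [NormedAddCommGroup H] [InnerProductSpace ℝ H] [NormedAddCommGroup H']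
  [InnerProductSpace ℝ H']

/-- The left side is the time derivative of the weights, the right side the dissipation after
commutation: `y0 y1 y2` are noise derivatives and `r0 r2` commutator remainders. The squares of `c1`
and `c2` on the right come from the two cross terms of the functional. The substitution of
`scalar_le` makes everything homogeneous in t, except the remainders, which carry extra powers of t
that are at most 1. -/
theorem dissipation_le (hs : 0 < s) (hK : 0 ≤ K) {t : ℝ} (ht0 : 0 ≤ t) (ht1 : t ≤ 1)
    {c0 c1 c2 r0 r2 : H} (y0 y1 y2 : H') (hr0 : ‖r0‖ ≤ K * ‖c0‖)
    (hr2 : ‖r2‖ ≤ K * (‖c0‖ + ‖c1‖)) :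
    a * ‖c0‖ ^ 2 + 4 * b * t * ⟪c0, c1⟫_ℝ + 3 * c * t ^ 2 * ‖c1‖ ^ 2 +
        8 * d * t ^ 3 * ⟪c1, c2⟫_ℝ + 5 * e * t ^ 4 * ‖c2‖ ^ 2 ≤
      2 * s * ‖c0‖ ^ 2 + a * t * (2 * ‖y0‖ ^ 2 + 2 * ⟪c0, c1 + r0⟫_ℝ) +
        2 * b * t ^ 2 * (2 * ⟪y0, y1⟫_ℝ + ⟪c0, c2⟫_ℝ + ⟪c1 + r0, c1⟫_ℝ) +
        c * t ^ 3 * (2 * ‖y1‖ ^ 2 + 2 * ⟪c1, c2⟫_ℝ) +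
        2 * d * t ^ 4 * (2 * ⟪y1, y2⟫_ℝ + ⟪c1, r2⟫_ℝ + ‖c2‖ ^ 2) +
        e * t ^ 5 * (2 * ‖y2‖ ^ 2 + 2 * ⟪c2, r2⟫_ℝ) := by
  obtain ⟨w, hw0, hw⟩ : ∃ w : ℝ, 0 ≤ w ∧ w ^ 2 = t := ⟨√t, Real.sqrt_nonneg t, Real.sq_sqrt ht0⟩
  have ha0 := h.apos
  have hb0 := h.bpos
  have hc0 := h.cpos
  have hd0 := h.dpos
  have he0 := h.epos
  have key := h.scalar_le hs hK (norm_nonneg c0) (mul_nonneg ht0 (norm_nonneg c1))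
    (mul_nonneg (pow_nonneg ht0 2) (norm_nonneg c2)) (w * ‖y0‖) (w ^ 3 * ‖y1‖) (w ^ 5 * ‖y2‖)
  have tn : ∀ n : ℕ, 0 ≤ t ^ n := fun n => pow_nonneg ht0 n
  have tle : ∀ {k n : ℕ}, n ≤ k → t ^ k ≤ t ^ n := fun h => pow_le_pow_of_le_one ht0 ht1 h
  have n0 := norm_nonneg c0
  have n1 := norm_nonneg c1
  have n2 := norm_nonneg c2
  have i01 := abs_le.1 (abs_real_inner_le_norm c0 c1)
  have i12 := abs_le.1 (abs_real_inner_le_norm c1 c2)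
  have i02 := abs_le.1 (abs_real_inner_le_norm c0 c2)
  have j01 := abs_le.1 (abs_real_inner_le_norm y0 y1)
  have j12 := abs_le.1 (abs_real_inner_le_norm y1 y2)
  have ir0 : -(K * ‖c0‖ ^ 2) ≤ ⟪c0, r0⟫_ℝ := by
    have h1 := (abs_le.1 (abs_real_inner_le_norm c0 r0)).1
    have := mul_le_mul_of_nonneg_left hr0 n0
    linarith
  have ir1 : -(K * (‖c0‖ * ‖c1‖)) ≤ ⟪r0, c1⟫_ℝ := by
    have h1 := (abs_le.1 (abs_real_inner_le_norm r0 c1)).1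
    have := mul_le_mul_of_nonneg_right hr0 n1
    linarith
  have ir2 : -(K * (‖c0‖ * ‖c1‖ + ‖c1‖ ^ 2)) ≤ ⟪c1, r2⟫_ℝ := by
    have h1 := (abs_le.1 (abs_real_inner_le_norm c1 r2)).1
    have := mul_le_mul_of_nonneg_left hr2 n1
    linarith
  have ir3 : -(K * (‖c0‖ * ‖c2‖ + ‖c1‖ * ‖c2‖)) ≤ ⟪c2, r2⟫_ℝ := by
    have h1 := (abs_le.1 (abs_real_inner_le_norm c2 r2)).1
    have := mul_le_mul_of_nonneg_left hr2 n2
    linarith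
  have e1 : ⟪c0, c1 + r0⟫_ℝ = ⟪c0, c1⟫_ℝ + ⟪c0, r0⟫_ℝ := inner_add_right _ _ _
  have e2 : ⟪c1 + r0, c1⟫_ℝ = ‖c1‖ ^ 2 + ⟪r0, c1⟫_ℝ := by
    rw [inner_add_left, real_inner_self_eq_norm_sq]
  rw [e1, e2]
  have m1 : 4 * b * t * ⟪c0, c1⟫_ℝ ≤ 4 * b * t * (‖c0‖ * ‖c1‖) := by gcongr; exact i01.2
  have m2 : 8 * d * t ^ 3 * ⟪c1, c2⟫_ℝ ≤ 8 * d * t ^ 3 * (‖c1‖ * ‖c2‖) := by gcongr; exact i12.2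
  have m3 : a * t * -(‖c0‖ * ‖c1‖) ≤ a * t * ⟪c0, c1⟫_ℝ := by gcongr; exact i01.1
  have m4 : a * t * -(K * ‖c0‖ ^ 2) ≤ a * t * ⟪c0, r0⟫_ℝ := by gcongr
  have m4' : a * t * (K * ‖c0‖ ^ 2) ≤ a * 1 * (K * ‖c0‖ ^ 2) := by gcongr
  have m5 : 4 * b * t ^ 2 * -(‖y0‖ * ‖y1‖) ≤ 4 * b * t ^ 2 * ⟪y0, y1⟫_ℝ := by gcongr; exact j01.1
  have m6 : b * t ^ 2 * -(‖c0‖ * ‖c2‖) ≤ b * t ^ 2 * ⟪c0, c2⟫_ℝ := by gcongr; exact i02.1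
  have m7 : b * t ^ 2 * -(K * (‖c0‖ * ‖c1‖)) ≤ b * t ^ 2 * ⟪r0, c1⟫_ℝ := by gcongr
  have m7' : b * t ^ 2 * (K * (‖c0‖ * ‖c1‖)) ≤ b * t ^ 1 * (K * (‖c0‖ * ‖c1‖)) :=
    mul_le_mul_of_nonneg_right (mul_le_mul_of_nonneg_left (tle (by norm_num)) hb0.le)
      (by positivity)
  have m8 : c * t ^ 3 * -(‖c1‖ * ‖c2‖) ≤ c * t ^ 3 * ⟪c1, c2⟫_ℝ := by gcongr; exact i12.1
  have m9 : 4 * d * t ^ 4 * -(‖y1‖ * ‖y2‖) ≤ 4 * d * t ^ 4 * ⟪y1, y2⟫_ℝ := by gcongr; exact j12.1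
  have m10 : d * t ^ 4 * -(K * (‖c0‖ * ‖c1‖ + ‖c1‖ ^ 2)) ≤ d * t ^ 4 * ⟪c1, r2⟫_ℝ := by gcongr
  have m10a : d * t ^ 4 * (K * (‖c0‖ * ‖c1‖)) ≤ d * t ^ 1 * (K * (‖c0‖ * ‖c1‖)) :=
    mul_le_mul_of_nonneg_right (mul_le_mul_of_nonneg_left (tle (by norm_num)) hd0.le)
      (by positivity)
  have m10b : d * t ^ 4 * (K * ‖c1‖ ^ 2) ≤ d * t ^ 2 * (K * ‖c1‖ ^ 2) :=
    mul_le_mul_of_nonneg_right (mul_le_mul_of_nonneg_left (tle (by norm_num)) hd0.le)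
      (by positivity)
  have m11 : e * t ^ 5 * -(K * (‖c0‖ * ‖c2‖ + ‖c1‖ * ‖c2‖)) ≤ e * t ^ 5 * ⟪c2, r2⟫_ℝ := by gcongr
  have m11a : e * t ^ 5 * (K * (‖c0‖ * ‖c2‖)) ≤ e * t ^ 2 * (K * (‖c0‖ * ‖c2‖)) :=
    mul_le_mul_of_nonneg_right (mul_le_mul_of_nonneg_left (tle (by norm_num)) he0.le)
      (by positivity)
  have m11b : e * t ^ 5 * (K * (‖c1‖ * ‖c2‖)) ≤ e * t ^ 3 * (K * (‖c1‖ * ‖c2‖)) :=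
    mul_le_mul_of_nonneg_right (mul_le_mul_of_nonneg_left (tle (by norm_num)) he0.le)
      (by positivity)
  have f1 : w * ‖y0‖ * (w ^ 3 * ‖y1‖) = t ^ 2 * (‖y0‖ * ‖y1‖) := by rw [← hw]; ring
  have f2 : w ^ 3 * ‖y1‖ * (w ^ 5 * ‖y2‖) = t ^ 4 * (‖y1‖ * ‖y2‖) := by rw [← hw]; ring
  have f3 : (w * ‖y0‖) ^ 2 = t * ‖y0‖ ^ 2 := by rw [← hw]; ring
  have f4 : (w ^ 3 * ‖y1‖) ^ 2 = t ^ 3 * ‖y1‖ ^ 2 := by rw [← hw]; ring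
  have f5 : (w ^ 5 * ‖y2‖) ^ 2 = t ^ 5 * ‖y2‖ ^ 2 := by rw [← hw]; ring
  rw [f1, f2, f3, f4, f5] at key
  linarith

/-- The cross terms are absorbed: (2b)² ≤ a c/2 and (2d)² ≤ e c/2 leave exactly half of each
diagonal term. -/
theorem le_functional {t : ℝ} (ht0 : 0 ≤ t) (c0 c1 c2 : H) :
    (a * t * ‖c0‖ ^ 2 + c * t ^ 3 * ‖c1‖ ^ 2 + e * t ^ 5 * ‖c2‖ ^ 2) / 2 ≤
      a * t * ‖c0‖ ^ 2 + 2 * b * t ^ 2 * ⟪c0, c1⟫_ℝ + c * t ^ 3 * ‖c1‖ ^ 2 +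
        2 * d * t ^ 4 * ⟪c1, c2⟫_ℝ + e * t ^ 5 * ‖c2‖ ^ 2 := by
  obtain ⟨w, hw0, hw⟩ : ∃ w : ℝ, 0 ≤ w ∧ w ^ 2 = t := ⟨√t, Real.sqrt_nonneg t, Real.sq_sqrt ht0⟩
  have hb0 := h.bpos
  have hd0 := h.dpos
  have i01 := (abs_le.1 (abs_real_inner_le_norm c0 c1)).1
  have i12 := (abs_le.1 (abs_real_inner_le_norm c1 c2)).1
  have m1 : 2 * b * t ^ 2 * -(‖c0‖ * ‖c1‖) ≤ 2 * b * t ^ 2 * ⟪c0, c1⟫_ℝ := by gcongr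
  have m2 : 2 * d * t ^ 4 * -(‖c1‖ * ‖c2‖) ≤ 2 * d * t ^ 4 * ⟪c1, c2⟫_ℝ := by gcongr
  have q1 := two_mul_le_of_sq_le h.apos h.hbc (w * ‖c0‖) (w ^ 3 * ‖c1‖)
  have q2 := two_mul_le_of_sq_le h.epos h.hdc (w ^ 5 * ‖c2‖) (w ^ 3 * ‖c1‖)
  have f1 : w * ‖c0‖ * (w ^ 3 * ‖c1‖) = t ^ 2 * (‖c0‖ * ‖c1‖) := by rw [← hw]; ring
  have f2 : w ^ 5 * ‖c2‖ * (w ^ 3 * ‖c1‖) = t ^ 4 * (‖c1‖ * ‖c2‖) := by rw [← hw]; ring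
  have f3 : (w * ‖c0‖) ^ 2 = t * ‖c0‖ ^ 2 := by rw [← hw]; ring
  have f4 : (w ^ 3 * ‖c1‖) ^ 2 = t ^ 3 * ‖c1‖ ^ 2 := by rw [← hw]; ring
  have f5 : (w ^ 5 * ‖c2‖) ^ 2 = t ^ 5 * ‖c2‖ ^ 2 := by rw [← hw]; ring
  rw [f1, f3, f4] at q1
  rw [f2, f4, f5] at q2
  linarith

end IsWeight

end Lyapunov

/-! ### Classes in L² of concrete functions. -/

section Classes

open scoped InnerProductSpace

variable {X : Type*} [MeasurableSpace X] {μ : Measure X}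

open Classical in
/-- The class in `L²(μ)` of a square integrable function. -/
noncomputable def cls (μ : Measure X) (f : X → ℝ) : Lp ℝ 2 μ :=
  if hf : MemLp f 2 μ then hf.toLp f else 0

theorem cls_eq {f : X → ℝ} (hf : MemLp f 2 μ) : cls μ f = hf.toLp f := dif_pos hf

theorem coeFn_cls {f : X → ℝ} (hf : MemLp f 2 μ) : cls μ f =ᵐ[μ] f := by
  rw [cls_eq hf]; exact hf.coeFn_toLp

theorem eq_cls_iff {u : Lp ℝ 2 μ} {f : X → ℝ} (hf : MemLp f 2 μ) : u = cls μ f ↔ u =ᵐ[μ] f :=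
  ⟨fun h => h ▸ coeFn_cls hf, fun h => Lp.ext (h.trans (coeFn_cls hf).symm)⟩

theorem cls_add {f g : X → ℝ} (hf : MemLp f 2 μ) (hg : MemLp g 2 μ) :
    cls μ (f + g) = cls μ f + cls μ g := by
  rw [cls_eq hf, cls_eq hg, cls_eq (hf.add hg), MemLp.toLp_add]

theorem cls_smul {f : X → ℝ} (hf : MemLp f 2 μ) (c : ℝ) : cls μ (c • f) = c • cls μ f := by
  rw [cls_eq hf, cls_eq (hf.const_smul c), MemLp.toLp_const_smul]

theorem cls_sub {f g : X → ℝ} (hf : MemLp f 2 μ) (hg : MemLp g 2 μ) :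
    cls μ (f - g) = cls μ f - cls μ g := by
  rw [cls_eq hf, cls_eq hg, cls_eq (hf.sub hg), MemLp.toLp_sub]

theorem memLp_sum {ι : Type*} (s : Finset ι) {f : ι → X → ℝ} (hf : ∀ i ∈ s, MemLp (f i) 2 μ) :
    MemLp (∑ i ∈ s, f i) 2 μ := memLp_finset_sum' s hf

theorem cls_sum {ι : Type*} (s : Finset ι) {f : ι → X → ℝ} (hf : ∀ i, MemLp (f i) 2 μ) :
    cls μ (∑ i ∈ s, f i) = ∑ i ∈ s, cls μ (f i) := by
  classical
  induction s using Finset.induction_on with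
  | empty =>
    have := cls_smul (μ := μ) (f := 0) MemLp.zero 0
    simpa using this
  | insert i s hi ih =>
    rw [Finset.sum_insert hi, Finset.sum_insert hi, cls_add (hf i) (memLp_sum s fun i _ => hf i),
      ih]

theorem inner_cls {f g : X → ℝ} (hf : MemLp f 2 μ) (hg : MemLp g 2 μ) :
    ⟪cls μ f, cls μ g⟫_ℝ = ∫ x, f x * g x ∂μ := by
  rw [L2.inner_def]
  refine integral_congr_ae ?_
  filter_upwards [coeFn_cls hf, coeFn_cls hg] with x h1 h2
  rw [h1, h2]
  exact mul_comm _ _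

theorem norm_cls_le {f g : X → ℝ} (hf : MemLp f 2 μ) (hg : MemLp g 2 μ) {C : ℝ}
    (h : ∀ x, |f x| ≤ C * |g x|) : ‖cls μ f‖ ≤ C * ‖cls μ g‖ := by
  refine Lp.norm_le_mul_norm_of_ae_le_mul ?_
  filter_upwards [coeFn_cls hf, coeFn_cls hg] with x h1 h2
  rw [h1, h2]
  exact h x

theorem norm_le_sum_norm {ι : Type*} [Fintype ι] {E : ι → Type*} [∀ i, NormedAddCommGroup (E i)]
    (x : PiLp 2 E) : ‖x‖ ≤ ∑ i, ‖x i‖ := by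
  rw [← pow_le_pow_iff_left₀ (norm_nonneg _) (Finset.sum_nonneg fun i _ => norm_nonneg _)
    two_ne_zero, PiLp.norm_sq_eq_of_L2]
  exact Finset.sum_sq_le_sq_sum_of_nonneg fun i _ => norm_nonneg _

end Classes

/-! ### The vector fields C_0, C_1, C_2 and their commutators with the generator. -/

section Commutators

variable {Q : Type} [NormedAddCommGroup Q] {d m : ℕ} {π : Vec d → Q} {V : Q → ℝ}
  {α lam : Fin m → ℝ} {β : ℝ}

/-- The constant coefficient vector field with coefficients `w`. -/
noncomputable def field (π : Vec d → Q) (w : Coord d m → ℝ) (f : Phase Q d m → ℝ) :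
    Phase Q d m → ℝ := ∑ v, w v • der π v f

/-- The coefficients of the vector fields `C_0`, `C_1`, `C_2`. -/
def fieldC (lam : Fin m → ℝ) : ℕ → Fin m × Fin d → Coord d m → ℝ
  | 0, r, .inr (.inr s) => if s = r then -1 else 0
  | 1, r, .inr (.inl i) => if i = r.2 then lam r.1 else 0
  | 2, r, .inl i => if i = r.2 then -lam r.1 else 0
  | 2, r, .inr (.inr s) => if s.2 = r.2 then lam r.1 * lam s.1 else 0
  | _, _, _ => 0

section

variable {M : Type*} [AddCommGroup M] [Module ℝ M] (r : Fin m × Fin d) (g : Coord d m → M)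

theorem sum_fieldC_zero : ∑ v, fieldC lam 0 r v • g v = -g (cz r) := by
  simp [fieldC, ite_smul]

theorem sum_fieldC_one : ∑ v, fieldC lam 1 r v • g v = lam r.1 • g (cp r.2) := by
  simp [fieldC, ite_smul]

theorem sum_fieldC_two : ∑ v, fieldC lam 2 r v • g v =
    lam r.1 • (∑ l, lam l • g (cz (l, r.2)) - g (cq r.2)) := by
  rw [sum_coord, Fintype.sum_prod_type]
  simp [fieldC, ite_smul, smul_sub, Finset.smul_sum, smul_smul]
  abel

end

theorem field_fieldC_zero (r : Fin m × Fin d) (f : Phase Q d m → ℝ) :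
    field π (fieldC lam 0 r) f = -der π (cz r) f := sum_fieldC_zero r _

theorem field_fieldC_one (r : Fin m × Fin d) (f : Phase Q d m → ℝ) :
    field π (fieldC lam 1 r) f = lam r.1 • der π (cp r.2) f := sum_fieldC_one r _

theorem field_fieldC_two (r : Fin m × Fin d) (f : Phase Q d m → ℝ) :
    field π (fieldC lam 2 r) f = lam r.1 • (∑ l, lam l • der π (cz (l, r.2)) f -
      der π (cq r.2) f) := sum_fieldC_two r _

variable (hπ : IsCover π)
include hπ

theorem field_mem {k n : WithTop ℕ∞} {f : Phase Q d m → ℝ} (hf : f ∈ compactC π m n)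
    (hk : k + 1 ≤ n) (w : Coord d m → ℝ) : field π w f ∈ compactC π m k :=
  Submodule.sum_mem _ fun v _ => Submodule.smul_mem _ _ (hπ.der_mem hf hk v)

theorem der_add {f g : Phase Q d m → ℝ} (hf : f ∈ compactC π m 1) (hg : g ∈ compactC π m 1)
    (v : Coord d m) : der π v (f + g) = der π v f + der π v g :=
  hπ.dir_add (hf.1.differentiable (by norm_num)) (hg.1.differentiable (by norm_num)) _

theorem der_smul {f : Phase Q d m → ℝ} (hf : f ∈ compactC π m 1) (c : ℝ)
    (v : Coord d m) : der π v (c • f) = c • der π v f :=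
  hπ.dir_const_smul (hf.1.differentiable (by norm_num)) _ _

variable (hV : ContDiff ℝ 2 (fun q => V (π q)))
include hV

theorem opL_add {f g : Phase Q d m → ℝ} (hf : f ∈ compactC π m 2) (hg : g ∈ compactC π m 2) :
    opL π V α lam β (f + g) = opL π V α lam β f + opL π V α lam β g := by
  have hf1 : f ∈ compactC π m 1 := compactC_mono (by norm_num) hf
  have hg1 : g ∈ compactC π m 1 := compactC_mono (by norm_num) hg
  rw [opL_eq_fun hπ hV, opL_eq_fun hπ hV, opL_eq_fun hπ hV]
  simp only [der_add hπ hf1 hg1, der_add hπ (hπ.der_mem hf (by norm_num) _)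
    (hπ.der_mem hg (by norm_num) _), mul_add, smul_add, Finset.sum_add_distrib]
  abel

theorem opL_smul {f : Phase Q d m → ℝ} (hf : f ∈ compactC π m 2) (c : ℝ) :
    opL π V α lam β (c • f) = c • opL π V α lam β f := by
  have hf1 : f ∈ compactC π m 1 := compactC_mono (by norm_num) hf
  rw [opL_eq_fun hπ hV, opL_eq_fun hπ hV]
  simp only [der_smul hπ hf1, der_smul hπ (hπ.der_mem hf (by norm_num) _), mul_smul_comm,
    ← Finset.smul_sum, smul_add]
  simp only [smul_comm _ c, ← Finset.smul_sum]

theorem opL_sum {ι : Type*} (s : Finset ι) {f : ι → Phase Q d m → ℝ}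
    (hf : ∀ i, f i ∈ compactC π m 2) :
    opL π V α lam β (∑ i ∈ s, f i) = ∑ i ∈ s, opL π V α lam β (f i) := by
  classical
  induction s using Finset.induction_on with
  | empty =>
    have := opL_smul hπ hV (α := α) (lam := lam) (β := β) (zero_mem (compactC π m 2)) 0
    simpa using this
  | insert i s hi ih =>
    rw [Finset.sum_insert hi, Finset.sum_insert hi,
      opL_add hπ hV (hf i) (Submodule.sum_mem _ fun i _ => hf i), ih]

/-- The commutator of a constant coefficient vector field with the generator. -/
theorem field_opL {f : Phase Q d m → ℝ} (hf : f ∈ compactC π m 3) (w : Coord d m → ℝ) :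
    field π w (opL π V α lam β f) = opL π V α lam β (field π w f) -
      ∑ v, w v • ∑ u, der π v (coef π V α lam u) * der π u f := by
  have hd : ∀ v, der π v f ∈ compactC π m 2 := fun v => hπ.der_mem hf (by norm_num) v
  unfold field
  rw [opL_sum hπ hV _ fun v => Submodule.smul_mem _ _ (hd v), ← Finset.sum_sub_distrib]
  refine Finset.sum_congr rfl fun v _ => ?_
  rw [opL_smul hπ hV (hd v), der_opL hπ hV hf, smul_sub]

/-- The variable z_r enters the drift in two places only: the force on p and the friction of z_r
itself. -/
theorem der_cz_coef (r : Fin m × Fin d) (f : Phase Q d m → ℝ) :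
    ∑ u, der π (cz r) (coef π V α lam u) * der π u f =
      lam r.1 • der π (cp r.2) f - α r.1 • der π (cz r) f := by
  funext x
  have h1 : ∀ i, der π (cz r) (coef π V α lam (cq i)) x = 0 := fun i => by
    rw [show coef π V α lam (cq i) = fun x : Phase Q d m => x.2.1 i from rfl, der_p hπ]
    simp
  rw [sum_coord]
  simp only [Pi.add_apply, Finset.sum_apply, Pi.mul_apply, Pi.sub_apply, Pi.smul_apply,
    smul_eq_mul, h1, der_coef_p hπ hV, der_coef_z hπ hV, der_gradV_of_ne hπ (cz r) (by simp)]
  have h2 : ∀ i : Fin d, ∑ j, lam j * (if (cz r : Coord d m) = cz (j, i) then 1 else 0) =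
      if i = r.2 then lam r.1 else 0 := fun i => by
    obtain ⟨a, b⟩ := r
    by_cases hb : i = b
    · subst hb; simp
    · simp [hb, Ne.symm hb]
  simp only [h2]
  simp [Finset.sum_sub_distrib]
  ring

theorem der_cp_coef (i : Fin d) (f : Phase Q d m → ℝ) :
    ∑ u, der π (cp i) (coef π V α lam u) * der π u f =
      der π (cq i) f - ∑ l, lam l • der π (cz (l, i)) f := by
  funext x
  have h1 : ∀ k, der π (cp i) (coef π V α lam (cq k)) x = if k = i then 1 else 0 := fun k => by
    rw [show coef π V α lam (cq k) = fun x : Phase Q d m => x.2.1 k from rfl, der_p hπ]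
    simp [eq_comm]
  rw [sum_coord, Fintype.sum_prod_type]
  simp only [Pi.add_apply, Finset.sum_apply, Pi.mul_apply, Pi.sub_apply, Pi.smul_apply,
    smul_eq_mul, h1, der_coef_p hπ hV, der_coef_z hπ hV, der_gradV_of_ne hπ (cp i) (by simp)]
  simp [sub_eq_add_neg, Finset.sum_neg_distrib]

/-- The only place where second derivatives of V enter the commutators. -/
theorem der_cq_coef (i : Fin d) (f : Phase Q d m → ℝ) :
    ∑ u, der π (cq i) (coef π V α lam u) * der π u f =
      -∑ k, der π (cq i) (fun x => gradV π V k x.1) * der π (cp k) f := by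
  funext x
  have h1 : ∀ k, der π (cq i) (coef π V α lam (cq k)) x = 0 := fun k => by
    rw [show coef π V α lam (cq k) = fun x : Phase Q d m => x.2.1 k from rfl, der_p hπ]
    simp
  rw [sum_coord, Fintype.sum_prod_type]
  simp only [Pi.add_apply, Finset.sum_apply, Pi.mul_apply, Pi.neg_apply,
    h1, der_coef_p hπ hV, der_coef_z hπ hV]
  simp

omit hV in
theorem abs_der_gradV_le (hV : ContDiff ℝ 2 (fun q => V (π q))) {c : ℝ}
    (hc : ∀ q, ‖fderiv ℝ (fderiv ℝ fun q => V (π q)) q‖ ≤ c) (i k : Fin d) (x : Phase Q d m) :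
    |der π (cq i) (fun x => gradV π V k x.1) x| ≤ c := by
  obtain ⟨y, rfl⟩ := hπ.proj_surjective x
  unfold der
  rw [hπ.dir_proj _ ((contDiff_lift_gradV hπ hV k).differentiable (by norm_num) y)]
  have e : lift π (fun x : Phase Q d m => gradV π V k x.1) = fun y =>
      fderiv ℝ (fun q => V (π q)) y.1 (EuclideanSpace.single k 1) :=
    funext fun y => gradV_proj hπ hV k y.1
  have h2 : DifferentiableAt ℝ (fderiv ℝ (fun q => V (π q))) y.1 :=
    (hV.fderiv_right (m := 1) (by norm_num)).differentiable (by norm_num) _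
  have h3 : HasFDerivAt (fun y : Phase (Vec d) d m => fderiv ℝ (fun q => V (π q)) y.1)
      ((fderiv ℝ (fderiv ℝ fun q => V (π q)) y.1).comp (ContinuousLinearMap.fst ℝ _ _)) y :=
    h2.hasFDerivAt.comp y hasFDerivAt_fst
  have h4 := h3.clm_apply (hasFDerivAt_const (EuclideanSpace.single k (1 : ℝ)) y)
  rw [e, h4.fderiv]
  simp only [unitVec, ContinuousLinearMap.add_apply, ContinuousLinearMap.comp_apply,
    ContinuousLinearMap.flip_apply, ContinuousLinearMap.zero_apply, map_zero, zero_add,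
    ContinuousLinearMap.coe_fst', ContinuousLinearMap.comp_zero, add_zero]
  have h5 := (fderiv ℝ (fderiv ℝ fun q => V (π q)) y.1 (EuclideanSpace.single i 1)).le_opNorm
    (EuclideanSpace.single k 1)
  have h6 := (fderiv ℝ (fderiv ℝ fun q => V (π q)) y.1).le_opNorm (EuclideanSpace.single i 1)
  simp only [EuclideanSpace.norm_single, norm_one, mul_one] at h5 h6
  exact h5.trans (h6.trans (hc _))

/-- The commutator with B gives C_1; the friction in `𝓛` adds a multiple of C_0. -/
theorem field_zero_opL {f : Phase Q d m → ℝ} (hf : f ∈ compactC π m 3) (r : Fin m × Fin d) :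
    field π (fieldC lam 0 r) (opL π V α lam β f) =
      opL π V α lam β (field π (fieldC lam 0 r) f) +
        (field π (fieldC lam 1 r) f + α r.1 • field π (fieldC lam 0 r) f) := by
  rw [field_opL hπ hV hf, sum_fieldC_zero, der_cz_coef hπ hV, field_fieldC_one,
    field_fieldC_zero, smul_neg]
  abel

theorem field_one_opL {f : Phase Q d m → ℝ} (hf : f ∈ compactC π m 3) (r : Fin m × Fin d) :
    field π (fieldC lam 1 r) (opL π V α lam β f) =
      opL π V α lam β (field π (fieldC lam 1 r) f) + field π (fieldC lam 2 r) f := by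
  rw [field_opL hπ hV hf, sum_fieldC_one, der_cp_coef hπ hV, field_fieldC_two, smul_sub, smul_sub]
  abel

/-- The remainder in the commutator of `C_2` with the generator. -/
noncomputable def fieldRem (π : Vec d → Q) (V : Q → ℝ) (α lam : Fin m → ℝ) (r : Fin m × Fin d)
    (f : Phase Q d m → ℝ) : Phase Q d m → ℝ :=
  (-∑ l, lam l ^ 2) • field π (fieldC lam 1 r) f +
    (∑ l, (-lam r.1 * lam l * α l) • field π (fieldC lam 0 (l, r.2)) f +
    ∑ k, (-der π (cq r.2) (fun x => gradV π V k x.1)) * field π (fieldC lam 1 (r.1, k)) f)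

/-- Here the hierarchy closes: no field beyond C_0 and C_1 occurs in the remainder. The factor λ of
C_2 is kept together with ∂_p, so that the Hessian multiplies C_1 and no division by λ is needed. -/
theorem field_two_opL {f : Phase Q d m → ℝ} (hf : f ∈ compactC π m 3) (r : Fin m × Fin d) :
    field π (fieldC lam 2 r) (opL π V α lam β f) =
      opL π V α lam β (field π (fieldC lam 2 r) f) + fieldRem π V α lam r f := by
  rw [field_opL hπ hV hf, sub_eq_add_neg]
  congr 1
  rw [sum_fieldC_two]
  simp only [der_cz_coef hπ hV, der_cq_coef hπ hV, fieldRem, field_fieldC_one, field_fieldC_zero]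
  funext x
  simp only [Pi.neg_apply, Pi.add_apply, Finset.sum_apply, Pi.smul_apply,
    Pi.mul_apply, Pi.sub_apply, smul_eq_mul]
  rw [mul_sub, Finset.mul_sum]
  have e1 : ∑ l, lam r.1 * (lam l * (lam l * der π (cp r.2) f x - α l * der π (cz (l, r.2)) f x)) =
      (∑ l, lam l ^ 2) * (lam r.1 * der π (cp r.2) f x) +
      ∑ l, -lam r.1 * lam l * α l * der π (cz (l, r.2)) f x := by
    rw [Finset.sum_mul, ← Finset.sum_add_distrib]
    exact Finset.sum_congr rfl fun l _ => by ring
  have e2 : ∑ l, -lam r.1 * lam l * α l * -der π (cz (l, r.2)) f x =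
      -∑ l, -lam r.1 * lam l * α l * der π (cz (l, r.2)) f x := by
    rw [← Finset.sum_neg_distrib]
    exact Finset.sum_congr rfl fun l _ => by ring
  have e3 : ∑ k, -der π (cq r.2) (fun x => gradV π V k x.1) x * (lam r.1 * der π (cp k) f x) =
      -(lam r.1 * ∑ k, der π (cq r.2) (fun x => gradV π V k x.1) x * der π (cp k) f x) := by
    rw [Finset.mul_sum, ← Finset.sum_neg_distrib]
    exact Finset.sum_congr rfl fun l _ => by ring
  rw [e1, e2, e3]
  ring

end Commutators

/-! ### The weighted Sobolev space and quasi-accretivity of the generator on it. -/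

section Sobolev

open scoped InnerProductSpace

variable {Q : Type} [NormedAddCommGroup Q] {d m : ℕ} {π : Vec d → Q} {V : Q → ℝ}
  {α lam : Fin m → ℝ} {β : ℝ} [ProperSpace Q] [MeasureSpace Q] [BorelSpace Q]
  [(volume : Measure Q).IsAddHaarMeasure]

/-- The standing assumptions on the position space and the potential. -/
structure IsSetting (π : Vec d → Q) (V : Q → ℝ) (β : ℝ) : Prop where
  cover : IsCover π
  potential : IsPotential π V β
  growth : ∃ K, ∀ i q, |gradV π V i q| ≤ K * (1 + ‖q‖)
  pos : 0 < β

/-- Smooth compactly supported functions on the phase space. -/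
abbrev testFun (π : Vec d → Q) (m : ℕ) : Submodule ℝ (Phase Q d m → ℝ) :=
  compactC π m ((⊤ : ℕ∞) : WithTop ℕ∞)

theorem test_mem {f : Phase Q d m → ℝ} (hf : f ∈ testFun π m) (k : ℕ) :
    f ∈ compactC π m k :=
  compactC_mono (by exact_mod_cast le_top) hf

/-- The first order Sobolev space over the Gibbs measure, as tuples of a function and its
partial derivatives. -/
abbrev SobolevTuple (d : ℕ) {Q : Type} [MeasureSpace Q] (m : ℕ) (V : Q → ℝ) (β : ℝ) : Type :=
  PiLp 2 fun _ : Option (Coord d m) => L2 d m V β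

/-- The vector fields with constant coefficients `w r` on tuples. -/
noncomputable def tupleField {ι : Type} [Fintype ι] (w : ι → Coord d m → ℝ) :
    SobolevTuple d m V β →L[ℝ] PiLp 2 fun _ : ι => L2 d m V β :=
  (PiLp.continuousLinearEquiv 2 ℝ fun _ : ι => L2 d m V β).symm.toContinuousLinearMap.comp
    (ContinuousLinearMap.pi fun r => ∑ v, w r v • PiLp.proj 2 _ (some v))

theorem tupleField_apply {ι : Type} [Fintype ι] (w : ι → Coord d m → ℝ)
    (U : SobolevTuple d m V β) (r : ι) : tupleField w U r = ∑ v, w r v • U (some v) := by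
  simp [tupleField]

namespace IsSetting

variable (h : IsSetting π V β)
include h

theorem isProbabilityMeasure : IsProbabilityMeasure (gibbs (d := d) m V β) :=
  h.potential.isProbabilityMeasure h.pos

theorem memLp {k : WithTop ℕ∞} {f : Phase Q d m → ℝ} (hf : f ∈ compactC π m k) :
    MemLp f 2 (gibbs m V β) := by
  have := h.isProbabilityMeasure (m := m)
  exact (h.cover.continuous_of_mem hf).memLp_of_hasCompactSupport hf.2

theorem memLp_der {f : Phase Q d m → ℝ} (hf : f ∈ compactC π m 1) (v : Coord d m) :
    MemLp (der π v f) 2 (gibbs m V β) :=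
  h.memLp (h.cover.der_mem (k := 0) hf (by norm_num) v)

/-- The tuple of a `C^1` function and its partial derivatives. -/
noncomputable def sobolev : compactC π m 1 →ₗ[ℝ] SobolevTuple d m V β where
  toFun f := WithLp.toLp 2 fun i => i.elim (cls _ f.1) fun v => cls _ (der π v f.1)
  map_add' f g := by
    refine PiLp.ext fun i => ?_
    rcases i with _ | v
    · exact cls_add (h.memLp f.2) (h.memLp g.2)
    · change cls _ (der π v (f.1 + g.1)) = _
      rw [der_add h.cover f.2 g.2]
      exact cls_add (h.memLp_der f.2 v) (h.memLp_der g.2 v)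
  map_smul' c f := by
    refine PiLp.ext fun i => ?_
    rcases i with _ | v
    · exact cls_smul (h.memLp f.2) c
    · change cls _ (der π v (c • f.1)) = _
      rw [der_smul h.cover f.2]
      exact cls_smul (h.memLp_der f.2 v) c

omit h in
theorem test_one {f : Phase Q d m → ℝ} (hf : f ∈ testFun π m) : f ∈ compactC π m 1 :=
  test_mem hf 1

omit h in
/-- Test functions are of class `C^1`. -/
noncomputable def incl : testFun π m →ₗ[ℝ] compactC π m 1 :=
  Submodule.inclusion fun _ hf => test_one hf

/-- The generator on test functions. -/
noncomputable def gen (α lam : Fin m → ℝ) : testFun π m →ₗ[ℝ] compactC π m 1 where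
  toFun f := ⟨opL π V α lam β f.1, opL_mem h.cover h.potential.contDiff (test_mem f.2 3)⟩
  map_add' f g := Subtype.ext <|
    opL_add h.cover h.potential.contDiff (test_mem f.2 2) (test_mem g.2 2)
  map_smul' c f := Subtype.ext <| opL_smul h.cover h.potential.contDiff (test_mem f.2 2) c

/-- The Dirichlet form. -/
theorem inner_cls_opL_add {f g : Phase Q d m → ℝ} (hf : f ∈ compactC π m 3)
    (hg : g ∈ compactC π m 3) :
    ⟪cls (gibbs m V β) f, cls _ (opL π V α lam β g)⟫_ℝ +
      ⟪cls (gibbs m V β) (opL π V α lam β f), cls _ g⟫_ℝ =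
      2 * ∑ r : Fin m × Fin d, α r.1 * β⁻¹ *
        ⟪cls (gibbs m V β) (der π (cz r) f), cls _ (der π (cz r) g)⟫_ℝ := by
  have hL : ∀ {f : Phase Q d m → ℝ}, f ∈ compactC π m 3 →
      MemLp (opL π V α lam β f) 2 (gibbs m V β) := fun hf =>
    h.memLp (opL_mem h.cover h.potential.contDiff hf)
  have hd : ∀ {f : Phase Q d m → ℝ}, f ∈ compactC π m 3 → ∀ v,
      MemLp (der π v f) 2 (gibbs m V β) := fun hf v =>
    h.memLp_der (compactC_mono (by norm_num) hf) v
  rw [inner_cls (h.memLp hf) (hL hg), inner_cls (hL hf) (h.memLp hg),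
    h.potential.integral_mul_opL_add h.cover h.pos hf hg]
  congr 1
  exact Finset.sum_congr rfl fun r _ => by rw [inner_cls (hd hf _) (hd hg _)]

theorem inner_cls_opL_nonneg (hα : ∀ j, 0 < α j) {f : Phase Q d m → ℝ}
    (hf : f ∈ compactC π m 3) :
    0 ≤ ⟪cls (gibbs m V β) f, cls _ (opL π V α lam β f)⟫_ℝ := by
  have h1 := h.inner_cls_opL_add (α := α) (lam := lam) hf hf
  rw [real_inner_comm (cls _ f)] at h1
  have h2 : 0 ≤ ∑ r : Fin m × Fin d, α r.1 * β⁻¹ *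
        ⟪cls (gibbs m V β) (der π (cz r) f), cls _ (der π (cz r) f)⟫_ℝ :=
    Finset.sum_nonneg fun r _ => mul_nonneg
      (mul_nonneg (hα _).le (inv_nonneg.2 h.pos.le)) real_inner_self_nonneg
  linarith

/-- The derivatives of the drift are bounded. -/
theorem exists_bound_der_coef (α lam : Fin m → ℝ) :
    ∃ M, 0 ≤ M ∧ ∀ (v u : Coord d m) x, |der π v (coef π V α lam u) x| ≤ M := by
  obtain ⟨c, hc⟩ := h.potential.hessian
  have key : ∀ v u : Coord d m, ∃ M, ∀ x, |der π v (coef π V α lam u) x| ≤ M := fun v u => by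
    rcases u with i | i | r
    · refine ⟨1, fun x => ?_⟩
      rw [show coef π V α lam (Sum.inl i) = fun x : Phase Q d m => x.2.1 i from rfl,
        der_p h.cover]
      split_ifs <;> simp
    · refine ⟨c + |∑ j, lam j * if v = cz (j, i) then 1 else 0|, fun x => ?_⟩
      rw [der_coef_p h.cover h.potential.contDiff]
      refine (abs_add_le _ _).trans ?_
      gcongr
      rw [abs_neg]
      rcases v with k | k | s
      · exact abs_der_gradV_le h.cover h.potential.contDiff hc k i x
      · rw [der_gradV_of_ne h.cover _ (by simp), abs_zero]
        exact le_trans (ContinuousLinearMap.opNorm_nonneg _) (hc 0)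
      · rw [der_gradV_of_ne h.cover _ (by simp), abs_zero]
        exact le_trans (ContinuousLinearMap.opNorm_nonneg _) (hc 0)
    · exact ⟨_, fun x => (congrArg abs (der_coef_z h.cover h.potential.contDiff v r x)).le⟩
  choose M hM using key
  refine ⟨∑ v, ∑ u, |M v u|, by positivity, fun v u x => (hM v u x).trans ?_⟩
  refine (le_abs_self _).trans ?_
  refine (Finset.single_le_sum (f := fun u => |M v u|) (fun _ _ => abs_nonneg _)
    (Finset.mem_univ u)).trans ?_
  exact Finset.single_le_sum (f := fun v => ∑ u, |M v u|)
    (fun _ _ => Finset.sum_nonneg fun _ _ => abs_nonneg _) (Finset.mem_univ v)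

/-- The generator is accretive in the Sobolev space, up to a constant. -/
theorem exists_le_inner_sobolev (hα : ∀ j, 0 < α j) : ∃ c : ℝ, ∀ f : testFun π m,
    0 ≤ ⟪h.sobolev (incl f), h.sobolev (h.gen α lam f) + c • h.sobolev (incl f)⟫_ℝ := by
  obtain ⟨M, hM0, hM⟩ := h.exists_bound_der_coef (d := d) α lam
  -- The commutator contributes at most ∑ M n_v n_u, with n_v the norm of the v-th partial
  -- derivative, and this is at most M times the number of coordinates times ∑ n_v².
  refine ⟨(Fintype.card (Coord d m)) * M, fun f => ?_⟩
  have hf := test_mem f.2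
  have hd : ∀ v, der π v f.1 ∈ compactC π m 3 := fun v =>
    h.cover.der_mem (hf 4) (by norm_num) v
  have hd1 : ∀ v, MemLp (der π v f.1) 2 (gibbs m V β) := fun v => h.memLp (hd v)
  have hcd : ∀ v u, der π v (coef π V α lam u) * der π u f.1 ∈ compactC π m 0 := fun v u =>
    mul_mem_compactC (h.cover.contDiff_dir
      (contDiff_lift_coef h.cover h.potential.contDiff u) (by norm_num) _)
      (compactC_mono (by norm_num) (hd u))
  have h0 : 0 ≤ ⟪cls (gibbs m V β) f.1, cls _ (opL π V α lam β f.1)⟫_ℝ :=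
    h.inner_cls_opL_nonneg hα (hf 3)
  -- After commuting the derivative through the generator, the main part is nonnegative by the
  -- Dirichlet form and the commutator is bounded because the drift has bounded first derivatives.
  have h1 : ∀ v, -(∑ u, M * (‖cls (gibbs m V β) (der π v f.1)‖ *
      ‖cls (gibbs m V β) (der π u f.1)‖)) ≤
      ⟪cls (gibbs m V β) (der π v f.1), cls _ (der π v (opL π V α lam β f.1))⟫_ℝ := fun v => by
    rw [der_opL h.cover h.potential.contDiff (hf 3), cls_sub
      (h.memLp (opL_mem h.cover h.potential.contDiff (hd v)))
      (memLp_sum _ fun u _ => h.memLp (hcd v u)), cls_sum _ (fun u => h.memLp (hcd v u)),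
      inner_sub_right, inner_sum]
    have h2 := h.inner_cls_opL_nonneg (lam := lam) hα (hd v)
    have h3 : ∑ u, ⟪cls (gibbs m V β) (der π v f.1),
        cls _ (der π v (coef π V α lam u) * der π u f.1)⟫_ℝ ≤
        ∑ u, M * (‖cls (gibbs m V β) (der π v f.1)‖ * ‖cls (gibbs m V β) (der π u f.1)‖) := by
      refine Finset.sum_le_sum fun u _ => (real_inner_le_norm _ _).trans ?_
      have h4 : ‖cls (gibbs m V β) (der π v (coef π V α lam u) * der π u f.1)‖ ≤
          M * ‖cls (gibbs m V β) (der π u f.1)‖ :=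
        norm_cls_le (h.memLp (hcd v u)) (hd1 u) fun x => by
          rw [Pi.mul_apply, abs_mul]
          gcongr
          exact hM v u x
      have := mul_le_mul_of_nonneg_left h4 (norm_nonneg (cls (gibbs m V β) (der π v f.1)))
      linarith
    linarith
  have e1 : ⟪h.sobolev (incl f), h.sobolev (h.gen α lam f)⟫_ℝ =
      ⟪cls (gibbs m V β) f.1, cls _ (opL π V α lam β f.1)⟫_ℝ +
      ∑ v, ⟪cls (gibbs m V β) (der π v f.1), cls _ (der π v (opL π V α lam β f.1))⟫_ℝ := by
    rw [PiLp.inner_apply, Fintype.sum_option]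
    rfl
  have e2 : ‖h.sobolev (incl f)‖ ^ 2 = ‖cls (gibbs m V β) f.1‖ ^ 2 +
      ∑ v, ‖cls (gibbs m V β) (der π v f.1)‖ ^ 2 := by
    rw [PiLp.norm_sq_eq_of_L2, Fintype.sum_option]
    rfl
  rw [inner_add_right, inner_smul_right, real_inner_self_eq_norm_sq, e1, e2]
  obtain ⟨n, hn⟩ : ∃ n : Coord d m → ℝ, n = fun v => ‖cls (gibbs m V β) (der π v f.1)‖ := ⟨_, rfl⟩
  have h5 : ∑ v, ∑ u, M * (n v * n u) ≤ Fintype.card (Coord d m) * M * ∑ v, n v ^ 2 := by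
    have h6 : ∀ v u, M * (n v * n u) ≤ M * (n v ^ 2 / 2 + n u ^ 2 / 2) := fun v u => by
      gcongr
      nlinarith [sq_nonneg (n v - n u)]
    refine (Finset.sum_le_sum fun v _ => Finset.sum_le_sum fun u _ => h6 v u).trans ?_
    simp only [mul_add, Finset.sum_add_distrib, Finset.sum_const, Finset.card_univ,
      nsmul_eq_mul, ← Finset.mul_sum, ← Finset.sum_div]
    apply le_of_eq
    ring
  have h7 : -∑ v, ∑ u, M * (n v * n u) ≤
      ∑ v, ⟪cls (gibbs m V β) (der π v f.1), cls _ (der π v (opL π V α lam β f.1))⟫_ℝ := by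
    rw [← Finset.sum_neg_distrib]
    refine Finset.sum_le_sum fun v _ => ?_
    have := h1 v
    rw [hn]
    exact this
  have h8 : (0 : ℝ) ≤ Fintype.card (Coord d m) * M * ‖cls (gibbs m V β) f.1‖ ^ 2 := by positivity
  have h9 : ∑ v, ‖cls (gibbs m V β) (der π v f.1)‖ ^ 2 = ∑ v, n v ^ 2 := by rw [hn]
  rw [h9]
  linarith

theorem tupleField_sobolev {ι : Type} [Fintype ι] (w : ι → Coord d m → ℝ) (f : compactC π m 1)
    (r : ι) : tupleField w (h.sobolev f) r = cls _ (field π (w r) f.1) := by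
  rw [tupleField_apply, field, cls_sum _ fun v => (h.memLp_der f.2 v).const_smul _]
  exact Finset.sum_congr rfl fun v _ => (cls_smul (h.memLp_der f.2 v) _).symm

/-- The derivatives of `C f` in the directions of the noise, weighted by the noise intensity. -/
noncomputable def noise (_ : IsSetting π V β) (α : Fin m → ℝ) {ι : Type} [Fintype ι]
    (w : ι → Coord d m → ℝ) (f : Phase Q d m → ℝ) :
    PiLp 2 fun _ : ι × (Fin m × Fin d) => L2 d m V β :=
  WithLp.toLp 2 fun rs => √(α rs.2.1 * β⁻¹) • cls _ (der π (cz rs.2) (field π (w rs.1) f))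

/-- The Dirichlet form of tuples of vector fields, with commutators. -/
theorem inner_tupleField_add {ι : Type} [Fintype ι] (hα : ∀ j, 0 < α j)
    {w w' : ι → Coord d m → ℝ} {f : testFun π m}
    {R R' : PiLp 2 fun _ : ι => L2 d m V β}
    (hR : ∀ r, cls _ (field π (w r) (opL π V α lam β f.1)) =
      cls _ (opL π V α lam β (field π (w r) f.1)) + R r)
    (hR' : ∀ r, cls _ (field π (w' r) (opL π V α lam β f.1)) =
      cls _ (opL π V α lam β (field π (w' r) f.1)) + R' r) :
    ⟪tupleField w (h.sobolev (incl f)), tupleField w' (h.sobolev (h.gen α lam f))⟫_ℝ +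
      ⟪tupleField w (h.sobolev (h.gen α lam f)), tupleField w' (h.sobolev (incl f))⟫_ℝ =
      2 * ⟪h.noise α w f.1, h.noise α w' f.1⟫_ℝ +
        ⟪tupleField w (h.sobolev (incl f)), R'⟫_ℝ + ⟪R, tupleField w' (h.sobolev (incl f))⟫_ℝ := by
  have hmem : ∀ w : Coord d m → ℝ, field π w f.1 ∈ compactC π m 3 := fun w =>
    field_mem h.cover (test_mem f.2 4) (by norm_num) w
  have e : ∀ rs : ι × (Fin m × Fin d), ⟪h.noise α w f.1 rs, h.noise α w' f.1 rs⟫_ℝ =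
      α rs.2.1 * β⁻¹ * ⟪cls (gibbs m V β) (der π (cz rs.2) (field π (w rs.1) f.1)),
        cls _ (der π (cz rs.2) (field π (w' rs.1) f.1))⟫_ℝ := fun rs => by
    have h1 : (0 : ℝ) ≤ α rs.2.1 * β⁻¹ := mul_nonneg (hα _).le (inv_nonneg.2 h.pos.le)
    simp only [noise, real_inner_smul_left, real_inner_smul_right]
    rw [← mul_assoc, Real.mul_self_sqrt h1]
  simp only [PiLp.inner_apply, e, Fintype.sum_prod_type]
  rw [← Finset.sum_add_distrib, Finset.mul_sum, ← Finset.sum_add_distrib, ← Finset.sum_add_distrib]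
  refine Finset.sum_congr rfl fun r _ => ?_
  simp only [tupleField_sobolev]
  -- The polarized Dirichlet form is applied to the two functions obtained from f by the fields; the
  -- commutators account for `R` and `R'`.
  have h2 := h.inner_cls_opL_add (α := α) (lam := lam) (hmem (w r)) (hmem (w' r))
  rw [Fintype.sum_prod_type] at h2
  change ⟪cls _ (field π (w r) f.1), cls _ (field π (w' r) (opL π V α lam β f.1))⟫_ℝ +
    ⟪cls _ (field π (w r) (opL π V α lam β f.1)), cls _ (field π (w' r) f.1)⟫_ℝ =
    _ + ⟪cls _ (field π (w r) f.1), R' r⟫_ℝ + ⟪R r, cls _ (field π (w' r) f.1)⟫_ℝ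
  rw [hR, hR', inner_add_right, inner_add_left, ← h2]
  ring

end IsSetting

end Sobolev

/-! ### Dissipation of the Lyapunov functional on test functions. -/

section Dissipation

open scoped InnerProductSpace

variable {Q : Type} [NormedAddCommGroup Q] {d m : ℕ} {π : Vec d → Q} {V : Q → ℝ}
  {α lam : Fin m → ℝ} {β : ℝ} [ProperSpace Q] [MeasureSpace Q] [BorelSpace Q]
  [(volume : Measure Q).IsAddHaarMeasure]

/-- The vector of operators `C_k` on tuples. -/
noncomputable abbrev tupleC (lam : Fin m → ℝ) (k : ℕ) :
    SobolevTuple d m V β →L[ℝ] PiLp 2 fun _ : Fin m × Fin d => L2 d m V β :=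
  tupleField (fieldC lam k)

/-- The polarization of the hypocoercive Lyapunov functional. -/
noncomputable def lyapunov (lam : Fin m → ℝ) (a b c d' e t : ℝ) (U W : SobolevTuple d m V β) : ℝ :=
  ⟪U none, W none⟫_ℝ + a * t * ⟪tupleC lam 0 U, tupleC lam 0 W⟫_ℝ +
    b * t ^ 2 * (⟪tupleC lam 0 U, tupleC lam 1 W⟫_ℝ + ⟪tupleC lam 0 W, tupleC lam 1 U⟫_ℝ) +
    c * t ^ 3 * ⟪tupleC lam 1 U, tupleC lam 1 W⟫_ℝ +
    d' * t ^ 4 * (⟪tupleC lam 1 U, tupleC lam 2 W⟫_ℝ + ⟪tupleC lam 1 W, tupleC lam 2 U⟫_ℝ) +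
    e * t ^ 5 * ⟪tupleC lam 2 U, tupleC lam 2 W⟫_ℝ

/-- The time derivative of the coefficients of the Lyapunov functional. -/
noncomputable def lyapunovDeriv (lam : Fin m → ℝ) (a b c d' e t : ℝ)
    (U : SobolevTuple d m V β) : ℝ :=
  a * ‖tupleC lam 0 U‖ ^ 2 + 4 * b * t * ⟪tupleC lam 0 U, tupleC lam 1 U⟫_ℝ +
    3 * c * t ^ 2 * ‖tupleC lam 1 U‖ ^ 2 + 8 * d' * t ^ 3 * ⟪tupleC lam 1 U, tupleC lam 2 U⟫_ℝ +
    5 * e * t ^ 4 * ‖tupleC lam 2 U‖ ^ 2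

namespace IsSetting

variable (h : IsSetting π V β)
include h

/-- The remainder tuple of the commutator of `C_2` and the generator. -/
noncomputable def remTuple (_ : IsSetting π V β) (α lam : Fin m → ℝ) (f : Phase Q d m → ℝ) :
    PiLp 2 fun _ : Fin m × Fin d => L2 d m V β :=
  WithLp.toLp 2 fun r => cls _ (fieldRem π V α lam r f)

/-- The remainder tuple of the commutator of `C_0` and the generator. -/
noncomputable def dampTuple (_ : IsSetting π V β) (α : Fin m → ℝ)
    (U : PiLp 2 fun _ : Fin m × Fin d => L2 d m V β) :
    PiLp 2 fun _ : Fin m × Fin d => L2 d m V β :=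
  WithLp.toLp 2 fun r => α r.1 • U r

theorem exists_norm_dampTuple_le (α : Fin m → ℝ) : ∃ K : ℝ, 0 ≤ K ∧
    ∀ U : PiLp 2 fun _ : Fin m × Fin d => L2 d m V β, ‖h.dampTuple α U‖ ≤ K * ‖U‖ := by
  refine ⟨∑ r : Fin m × Fin d, |α r.1|, by positivity, fun U => ?_⟩
  refine (norm_le_sum_norm _).trans ?_
  rw [Finset.sum_mul]
  refine Finset.sum_le_sum fun r _ => ?_
  simp only [dampTuple, norm_smul, Real.norm_eq_abs]
  gcongr
  exact PiLp.norm_apply_le U r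

theorem exists_norm_remTuple_le (α lam : Fin m → ℝ) : ∃ K : ℝ, 0 ≤ K ∧
    ∀ f : testFun π m, ‖h.remTuple α lam f.1‖ ≤
      K * (‖tupleC lam 0 (h.sobolev (incl f))‖ + ‖tupleC lam 1 (h.sobolev (incl f))‖) := by
  obtain ⟨c, hc⟩ := h.potential.hessian
  have hc0 : 0 ≤ c := le_trans (ContinuousLinearMap.opNorm_nonneg _) (hc 0)
  refine ⟨∑ r : Fin m × Fin d, (|∑ l, lam l ^ 2| + (∑ l, |(-lam r.1 * lam l * α l)| +
    ∑ _k : Fin d, c)), by positivity, fun f => ?_⟩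
  refine (norm_le_sum_norm _).trans ?_
  rw [Finset.sum_mul]
  refine Finset.sum_le_sum fun r _ => ?_
  obtain ⟨N, hN⟩ : ∃ N, N = ‖tupleC lam 0 (h.sobolev (incl f))‖ +
    ‖tupleC lam 1 (h.sobolev (incl f))‖ := ⟨_, rfl⟩
  have h0 : ∀ r, ‖cls (gibbs m V β) (field π (fieldC lam 0 r) f.1)‖ ≤ N := fun r => by
    have h1 := PiLp.norm_apply_le (tupleC lam 0 (h.sobolev (incl f))) r
    rw [h.tupleField_sobolev] at h1
    have h2 := norm_nonneg (tupleC lam 1 (h.sobolev (incl f)))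
    rw [hN]
    exact h1.trans (by linarith)
  have h1 : ∀ r, ‖cls (gibbs m V β) (field π (fieldC lam 1 r) f.1)‖ ≤ N := fun r => by
    have h1 := PiLp.norm_apply_le (tupleC lam 1 (h.sobolev (incl f))) r
    rw [h.tupleField_sobolev] at h1
    have h2 := norm_nonneg (tupleC lam 0 (h.sobolev (incl f)))
    rw [hN]
    exact h1.trans (by linarith)
  have hm : ∀ w : Coord d m → ℝ, MemLp (field π w f.1) 2 (gibbs m V β) := fun w =>
    h.memLp (field_mem h.cover (test_mem f.2 1) (k := 0) (by norm_num) w)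
  have hg : ∀ k s, MemLp (-der π (cq r.2) (fun x : Phase Q d m => gradV π V k x.1) *
      field π (fieldC lam 1 s) f.1) 2 (gibbs m V β) := fun k s => by
    refine h.memLp (k := 0) (mul_mem_compactC (f := -der π (cq r.2)
      (fun x : Phase Q d m => gradV π V k x.1)) ?_
      (field_mem h.cover (test_mem f.2 1) (k := 0) (by norm_num) _))
    exact (h.cover.contDiff_dir (k := 0)
      (contDiff_lift_gradV h.cover h.potential.contDiff k) (by norm_num) _).neg
  rw [← hN]
  simp only [remTuple, fieldRem]
  rw [cls_add ((hm _).const_smul _) ((memLp_sum _ fun l _ => (hm _).const_smul _).add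
    (memLp_sum _ fun k _ => hg k _)), cls_smul (hm _),
    cls_add (memLp_sum _ fun l _ => (hm _).const_smul _) (memLp_sum _ fun k _ => hg k _),
    cls_sum _ (fun l => (hm _).const_smul _), cls_sum _ (fun k => hg k _), add_mul, add_mul]
  refine (norm_add_le _ _).trans (add_le_add ?_ ((norm_add_le _ _).trans (add_le_add ?_ ?_)))
  · rw [norm_smul, norm_neg, Real.norm_eq_abs]
    gcongr
    exact h1 r
  · rw [Finset.sum_mul]
    refine (norm_sum_le _ _).trans (Finset.sum_le_sum fun l _ => ?_)
    rw [cls_smul (hm _), norm_smul, Real.norm_eq_abs]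
    gcongr
    exact h0 _
  · rw [Finset.sum_mul]
    refine (norm_sum_le _ _).trans (Finset.sum_le_sum fun k _ => ?_)
    refine (norm_cls_le (hg k _) (hm _) (C := c) fun x => ?_).trans
      (mul_le_mul_of_nonneg_left (h1 (r.1, k)) hc0)
    rw [Pi.mul_apply, abs_mul, Pi.neg_apply, abs_neg]
    gcongr
    exact abs_der_gradV_le h.cover h.potential.contDiff hc _ _ x

/-- The Lyapunov functional is dissipated along the equation. -/
theorem exists_lyapunovDeriv_le (hα : ∀ j, 0 < α j) : ∃ s K a b c d' e : ℝ,
    IsWeight s K a b c d' e ∧ ∀ t : ℝ, 0 ≤ t → t ≤ 1 → ∀ f : testFun π m,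
      lyapunovDeriv lam a b c d' e t (h.sobolev (incl f)) ≤
        2 * lyapunov lam a b c d' e t (h.sobolev (incl f)) (h.sobolev (h.gen α lam f)) := by
  obtain ⟨K0, hK0, hK0'⟩ := h.exists_norm_dampTuple_le (d := d) α
  obtain ⟨K2, hK2, hK2'⟩ := h.exists_norm_remTuple_le (d := d) α lam
  -- The weakest noise intensity; without auxiliary variables any positive number will do.
  obtain ⟨s, hs, hs'⟩ : ∃ s : ℝ, 0 < s ∧ ∀ j, s ≤ α j * β⁻¹ := by
    rcases isEmpty_or_nonempty (Fin m) with hm | hm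
    · exact ⟨1, one_pos, fun j => hm.elim j⟩
    · obtain ⟨j, hj⟩ := Finite.exists_min α
      exact ⟨α j * β⁻¹, mul_pos (hα j) (inv_pos.2 h.pos), fun i =>
        mul_le_mul_of_nonneg_right (hj i) (inv_pos.2 h.pos).le⟩
  have hK : 0 ≤ max K0 K2 := le_max_of_le_left hK0
  obtain ⟨a, b, c, d', e, hw⟩ := exists_isWeight hs hK
  refine ⟨s, max K0 K2, a, b, c, d', e, hw, fun t ht0 ht1 f => ?_⟩
  obtain ⟨U, hU⟩ : ∃ U, U = h.sobolev (incl f) := ⟨_, rfl⟩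
  obtain ⟨G, hG⟩ : ∃ G, G = h.sobolev (h.gen α lam f) := ⟨_, rfl⟩
  have hf := test_mem f.2
  have hm : ∀ w : Coord d m → ℝ, MemLp (field π w f.1) 2 (gibbs m V β) := fun w =>
    h.memLp (field_mem h.cover (test_mem f.2 1) (k := 0) (by norm_num) w)
  have hLm : ∀ w : Coord d m → ℝ, MemLp (opL π V α lam β (field π w f.1)) 2 (gibbs m V β) :=
    fun w => h.memLp (opL_mem h.cover h.potential.contDiff
      (field_mem h.cover (hf 4) (by norm_num) w))
  have hrem : ∀ r, MemLp (fieldRem π V α lam r f.1) 2 (gibbs m V β) := fun r => by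
    have := field_two_opL h.cover h.potential.contDiff (α := α) (lam := lam) (β := β) (hf 3) r
    rw [← sub_eq_iff_eq_add'] at this
    rw [← this]
    exact (h.memLp (field_mem h.cover (k := 0) (h.gen α lam f).2 (by norm_num) _)).sub (hLm _)
  have R0 : ∀ r, cls _ (field π (fieldC lam 0 r) (opL π V α lam β f.1)) =
      cls _ (opL π V α lam β (field π (fieldC lam 0 r) f.1)) +
        (tupleC lam 1 U + h.dampTuple α (tupleC lam 0 U)) r := fun r => by
    rw [field_zero_opL h.cover h.potential.contDiff (hf 3),
      cls_add (hLm _) ((hm _).add ((hm _).const_smul _)),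
      cls_add (hm _) ((hm _).const_smul _), cls_smul (hm _), PiLp.add_apply]
    simp only [dampTuple]
    rw [hU, h.tupleField_sobolev, h.tupleField_sobolev]
    rfl
  have R1 : ∀ r, cls _ (field π (fieldC lam 1 r) (opL π V α lam β f.1)) =
      cls _ (opL π V α lam β (field π (fieldC lam 1 r) f.1)) + tupleC lam 2 U r := fun r => by
    rw [field_one_opL h.cover h.potential.contDiff (hf 3), cls_add (hLm _) (hm _), hU,
      h.tupleField_sobolev]
    rfl
  have R2 : ∀ r, cls _ (field π (fieldC lam 2 r) (opL π V α lam β f.1)) =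
      cls _ (opL π V α lam β (field π (fieldC lam 2 r) f.1)) + h.remTuple α lam f.1 r := fun r => by
    rw [field_two_opL h.cover h.potential.contDiff (hf 3), cls_add (hLm _) (hrem _)]
    rfl
  have I00 := h.inner_tupleField_add hα R0 R0
  have I01 := h.inner_tupleField_add hα R0 R1
  have I11 := h.inner_tupleField_add hα R1 R1
  have I12 := h.inner_tupleField_add hα R1 R2
  have I22 := h.inner_tupleField_add hα R2 R2
  rw [← hU, ← hG] at I00 I01 I11 I12 I22
  -- The only coercivity given by the plain L² norm: it controls C_0 u and nothing else.
  have Inone : 2 * s * ‖tupleC lam 0 U‖ ^ 2 ≤ 2 * ⟪U none, G none⟫_ℝ := by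
    have h1 := h.inner_cls_opL_add (α := α) (lam := lam) (hf 3) (hf 3)
    rw [real_inner_comm (cls _ f.1)] at h1
    have h2 : ⟪U none, G none⟫_ℝ = ⟪cls (gibbs m V β) f.1, cls _ (opL π V α lam β f.1)⟫_ℝ := by
      rw [hU, hG]; rfl
    rw [← two_mul] at h1
    rw [h2, h1, PiLp.norm_sq_eq_of_L2, mul_assoc, Finset.mul_sum]
    refine mul_le_mul_of_nonneg_left (Finset.sum_le_sum fun r _ => ?_) two_pos.le
    rw [real_inner_self_eq_norm_sq, hU, h.tupleField_sobolev]
    change s * ‖cls _ (field π (fieldC lam 0 r) f.1)‖ ^ 2 ≤ _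
    rw [field_fieldC_zero, ← neg_one_smul ℝ (der π (cz r) f.1),
      cls_smul (h.memLp_der (hf 1) _), norm_smul, norm_neg, norm_one, one_mul]
    exact mul_le_mul_of_nonneg_right (hs' _) (sq_nonneg _)
  -- All second derivatives of f enter through the noise tuples, whose squares help to absorb the
  -- products between different levels.
  have key := hw.dissipation_le hs hK ht0 ht1 (c2 := tupleC lam 2 U)
    (h.noise α (fieldC lam 0) f.1) (h.noise α (fieldC lam 1) f.1) (h.noise α (fieldC lam 2) f.1)
    ((hK0' (tupleC lam 0 U)).trans
      (mul_le_mul_of_nonneg_right (le_max_left _ _) (norm_nonneg _)))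
    ((hU ▸ hK2' f).trans (mul_le_mul_of_nonneg_right (le_max_right _ _)
      (add_nonneg (norm_nonneg _) (norm_nonneg _))))
  rw [← hU, ← hG]
  unfold lyapunov lyapunovDeriv
  refine key.trans ?_
  have c0 := real_inner_comm (tupleC lam 0 U) (tupleC lam 0 G)
  have c1 := real_inner_comm (tupleC lam 1 U) (tupleC lam 1 G)
  have c2 := real_inner_comm (tupleC lam 2 U) (tupleC lam 2 G)
  have d0 := real_inner_comm (tupleC lam 0 U) (tupleC lam 1 U + h.dampTuple α (tupleC lam 0 U))
  have d1 := real_inner_comm (tupleC lam 1 U) (tupleC lam 2 U)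
  have d2 := real_inner_comm (tupleC lam 2 U) (h.remTuple α lam f.1)
  have n0 := real_inner_self_eq_norm_sq (h.noise α (fieldC lam 0) f.1)
  have n1 := real_inner_self_eq_norm_sq (h.noise α (fieldC lam 1) f.1)
  have n2 := real_inner_self_eq_norm_sq (h.noise α (fieldC lam 2) f.1)
  have m2 := real_inner_self_eq_norm_sq (tupleC lam 2 U)
  have J00 : 2 * ⟪tupleC lam 0 U, tupleC lam 0 G⟫_ℝ = 2 * ‖h.noise α (fieldC lam 0) f.1‖ ^ 2 +
      2 * ⟪tupleC lam 0 U, tupleC lam 1 U + h.dampTuple α (tupleC lam 0 U)⟫_ℝ := by linarith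
  have J11 : 2 * ⟪tupleC lam 1 U, tupleC lam 1 G⟫_ℝ = 2 * ‖h.noise α (fieldC lam 1) f.1‖ ^ 2 +
      2 * ⟪tupleC lam 1 U, tupleC lam 2 U⟫_ℝ := by linarith
  have J22 : 2 * ⟪tupleC lam 2 U, tupleC lam 2 G⟫_ℝ = 2 * ‖h.noise α (fieldC lam 2) f.1‖ ^ 2 +
      2 * ⟪tupleC lam 2 U, h.remTuple α lam f.1⟫_ℝ := by linarith
  rw [m2] at I12
  rw [← J00, ← J11, ← J22, ← I01, ← I12]
  linarith

end IsSetting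

end Dissipation

/-! ### Decay of the functional along curves in the Sobolev space. -/

section Decay

open scoped InnerProductSpace

variable {Q : Type} [NormedAddCommGroup Q] {d m : ℕ} {π : Vec d → Q} {V : Q → ℝ}
  {α lam : Fin m → ℝ} {β : ℝ} [ProperSpace Q] [MeasureSpace Q] [BorelSpace Q]
  [(volume : Measure Q).IsAddHaarMeasure]

/-- The functional is the diagonal of a symmetric bilinear form whose weights depend on time: the
two terms are the derivatives of the weights and of the curve. -/
theorem hasDerivWithinAt_lyapunov {a b c d' e t : ℝ} {u : ℝ → SobolevTuple d m V β}
    {u' : SobolevTuple d m V β} {s : Set ℝ} (hu : HasDerivWithinAt u u' s t) :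
    HasDerivWithinAt (fun t => lyapunov lam a b c d' e t (u t) (u t))
      (lyapunovDeriv lam a b c d' e t (u t) + 2 * lyapunov lam a b c d' e t (u t) u') s t := by
  have hC : ∀ k, HasDerivWithinAt (fun t => tupleC lam k (u t)) (tupleC lam k u') s t := fun k =>
    (tupleC lam k).hasFDerivAt.comp_hasDerivWithinAt t hu
  have hn : HasDerivWithinAt (fun t => u t none) (u' none) s t :=
    (PiLp.proj (𝕜 := ℝ) 2 (fun _ : Option (Coord d m) => L2 d m V β)
      none).hasFDerivAt.comp_hasDerivWithinAt t hu
  have hpow : ∀ n : ℕ, HasDerivWithinAt (fun t : ℝ => t ^ n) (n * t ^ (n - 1)) s t := fun n =>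
    (hasDerivAt_pow n t).hasDerivWithinAt
  have key := (((((hn.inner ℝ hn).add (((hpow 1).const_mul a).mul ((hC 0).inner ℝ (hC 0)))).add
    (((hpow 2).const_mul (2 * b)).mul ((hC 0).inner ℝ (hC 1)))).add
    (((hpow 3).const_mul c).mul ((hC 1).inner ℝ (hC 1)))).add
    (((hpow 4).const_mul (2 * d')).mul ((hC 1).inner ℝ (hC 2)))).add
    (((hpow 5).const_mul e).mul ((hC 2).inner ℝ (hC 2)))
  refine (key.congr_deriv ?_).congr_of_eventuallyEq ?_ ?_
  · unfold lyapunov lyapunovDeriv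
    simp only [← real_inner_self_eq_norm_sq]
    rw [real_inner_comm (u' none) (u t none), real_inner_comm (tupleC lam 0 u') (tupleC lam 0 (u t)),
      real_inner_comm (tupleC lam 1 u') (tupleC lam 1 (u t)),
      real_inner_comm (tupleC lam 2 u') (tupleC lam 2 (u t))]
    push_cast
    ring
  · refine Eventually.of_forall fun t => ?_
    simp only [lyapunov, Pi.add_apply, Pi.mul_apply]
    ring
  · simp only [lyapunov, Pi.add_apply, Pi.mul_apply]
    ring

theorem Continuous.lyapunov {X : Type*} [TopologicalSpace X] {a b c d' e : ℝ} {τ : X → ℝ}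
    {u w : X → SobolevTuple d m V β} (hτ : Continuous τ) (hu : Continuous u) (hw : Continuous w) :
    Continuous fun x => lyapunov lam a b c d' e (τ x) (u x) (w x) := by
  have hn : ∀ {u : X → SobolevTuple d m V β}, Continuous u → Continuous fun t => u t none :=
    fun hu => (PiLp.proj (𝕜 := ℝ) 2 (fun _ : Option (Coord d m) => L2 d m V β)
      none).continuous.comp hu
  have hC : ∀ {u : X → SobolevTuple d m V β}, Continuous u → ∀ k,
      Continuous fun t => tupleC lam k (u t) := fun hu k => (tupleC lam k).continuous.comp hu
  have i : ∀ {u w : X → SobolevTuple d m V β}, Continuous u → Continuous w → ∀ k l,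
      Continuous fun t => ⟪tupleC lam k (u t), tupleC lam l (w t)⟫_ℝ := fun hu hw k l =>
    (hC hu k).inner (hC hw l)
  have p : ∀ (a : ℝ) (n : ℕ), Continuous fun x => a * τ x ^ n := fun a n =>
    continuous_const.mul (hτ.pow n)
  exact ((((((hn hu).inner (hn hw)).add ((continuous_const.mul hτ).mul (i hu hw 0 0))).add
    ((p b 2).mul ((i hu hw 0 1).add (i hw hu 0 1)))).add ((p c 3).mul (i hu hw 1 1))).add
    ((p d' 4).mul ((i hu hw 1 2).add (i hw hu 1 2)))).add ((p e 5).mul (i hu hw 2 2))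

theorem continuous_lyapunovDeriv (a b c d' e t : ℝ) :
    Continuous fun u : SobolevTuple d m V β => lyapunovDeriv lam a b c d' e t u := by
  have hC : ∀ k, Continuous fun u : SobolevTuple d m V β => tupleC lam k u := fun k =>
    (tupleC lam k).continuous
  have h0 := hC 0
  have h1 := hC 1
  have h2 := hC 2
  exact (((((h0.norm.pow 2).const_mul a).add ((h0.inner h1).const_mul (4 * b * t))).add
    ((h1.norm.pow 2).const_mul (3 * c * t ^ 2))).add
    ((h1.inner h2).const_mul (8 * d' * t ^ 3))).add ((h2.norm.pow 2).const_mul (5 * e * t ^ 4))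

theorem le_sqrt_mul_of_weight {t w x y : ℝ} {n : ℕ} (ht0 : 0 < t) (hw0 : 0 < w) (hy : 0 ≤ y)
    (hle : w * t ^ n * x ^ 2 / 2 ≤ y ^ 2) : x ≤ √(2 / w) * (1 / t ^ ((n : ℝ) / 2)) * y := by
  have e1 : (t ^ ((n : ℝ) / 2)) ^ 2 = t ^ n := by
    rw [← Real.rpow_natCast (t ^ _), ← Real.rpow_mul ht0.le, ← Real.rpow_natCast t n]
    congr 1
    push_cast
    ring
  have e2 : 0 < t ^ ((n : ℝ) / 2) := Real.rpow_pos_of_pos ht0 _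
  refine le_of_sq_le_sq ?_ (by positivity)
  rw [mul_pow, mul_pow, div_pow, e1, Real.sq_sqrt (by positivity), one_pow]
  have e3 : 0 < w * t ^ n := by positivity
  rw [show 2 / w * (1 / t ^ n) * y ^ 2 = 2 * y ^ 2 / (w * t ^ n) by
    field_simp, le_div_iff₀ e3]
  linarith

namespace IsSetting

variable (h : IsSetting π V β)
include h

/-- Hypocoercive smoothing along curves in the Sobolev space. -/
theorem exists_norm_tupleC_le (hα : ∀ j, 0 < α j) : ∃ C : ℝ, ∀ u a : ℝ → SobolevTuple d m V β,
    Continuous u → (∀ t, 0 ≤ t → HasDerivWithinAt u (-a t) (Set.Ici t) t) →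
    (∀ t, 0 ≤ t → (u t, a t) ∈ closure (Set.range fun f : testFun π m =>
      (h.sobolev (incl f), h.sobolev (h.gen α lam f)))) →
    ∀ k ≤ 2, ∀ t : ℝ, 0 < t → t ≤ 1 →
      ‖tupleC lam k (u t)‖ ≤ C * (1 / t ^ ((1 + 2 * (k : ℝ)) / 2)) * ‖u 0 none‖ := by
  obtain ⟨s, K, a, b, c, d', e, hw, hdiss⟩ := h.exists_lyapunovDeriv_le (d := d) (lam := lam) hα
  have pa := hw.apos
  have pc := hw.cpos
  have pe := hw.epos
  refine ⟨√(2 / a) + √(2 / c) + √(2 / e), fun u v hu hdu hcl k hk t ht0 ht1 => ?_⟩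
  -- Both sides are continuous in the tuples of first derivatives of u and of the generator applied
  -- to u; the second derivatives of u were discarded with the dissipation. So the inequality
  -- extends to the closure of the graph.
  have hdiss' : ∀ t : ℝ, 0 ≤ t → t ≤ 1 →
      lyapunovDeriv lam a b c d' e t (u t) ≤ 2 * lyapunov lam a b c d' e t (u t) (v t) := by
    intro t h0 h1
    obtain ⟨S, hS⟩ : ∃ S, S = {p : SobolevTuple d m V β × SobolevTuple d m V β |
        lyapunovDeriv lam a b c d' e t p.1 ≤ 2 * lyapunov lam a b c d' e t p.1 p.2} := ⟨_, rfl⟩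
    have hc : IsClosed S := hS ▸
      isClosed_le ((continuous_lyapunovDeriv a b c d' e t).comp continuous_fst)
        ((Continuous.lyapunov continuous_const continuous_fst continuous_snd).const_mul 2)
    have hsub : (Set.range fun f : testFun π m =>
        (h.sobolev (incl f), h.sobolev (h.gen α lam f))) ⊆ S := by
      rintro _ ⟨f, rfl⟩
      rw [hS, Set.mem_setOf_eq]
      exact hdiss t h0 h1 f
    have hmem := closure_minimal hsub hc (hcl t h0)
    rwa [hS, Set.mem_setOf_eq] at hmem
  -- The functional is nonincreasing on [0,1], and at time 0 all weighted terms vanish: only the L²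
  -- norm of the initial value is needed.
  have hF : lyapunov lam a b c d' e t (u t) (u t) ≤ ‖u 0 none‖ ^ 2 := by
    refine image_le_of_deriv_right_le_deriv_boundary (a := 0) (b := 1)
      (f := fun t => lyapunov lam a b c d' e t (u t) (u t))
      (f' := fun t => lyapunovDeriv lam a b c d' e t (u t) +
        2 * lyapunov lam a b c d' e t (u t) (-v t)) (B := fun _ => ‖u 0 none‖ ^ 2)
      (B' := fun _ => 0) ?_ (fun x hx => hasDerivWithinAt_lyapunov (hdu x hx.1)) ?_
      continuousOn_const (fun x _ => hasDerivWithinAt_const _ _ _) (fun x hx => ?_) ⟨ht0.le, ht1⟩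
    · exact (Continuous.lyapunov continuous_id hu hu).continuousOn
    · simp [lyapunov]
    · have h1 := hdiss' x hx.1 hx.2.le
      have h2 : lyapunov lam a b c d' e x (u x) (-v x) = -lyapunov lam a b c d' e x (u x) (v x) := by
        simp only [lyapunov, map_neg, inner_neg_right, inner_neg_left, PiLp.neg_apply]
        ring
      rw [h2]
      linarith
  have hL := hw.le_functional ht0.le (tupleC lam 0 (u t)) (tupleC lam 1 (u t)) (tupleC lam 2 (u t))
  have hF' : (a * t * ‖tupleC lam 0 (u t)‖ ^ 2 + c * t ^ 3 * ‖tupleC lam 1 (u t)‖ ^ 2 +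
      e * t ^ 5 * ‖tupleC lam 2 (u t)‖ ^ 2) / 2 ≤ ‖u 0 none‖ ^ 2 := by
    refine hL.trans (le_trans ?_ hF)
    unfold lyapunov
    simp only [real_inner_self_eq_norm_sq]
    have := sq_nonneg ‖u t none‖
    linarith
  have q0 : 0 ≤ a * t * ‖tupleC lam 0 (u t)‖ ^ 2 := by positivity
  have q1 : 0 ≤ c * t ^ 3 * ‖tupleC lam 1 (u t)‖ ^ 2 := by positivity
  have q2 : 0 ≤ e * t ^ 5 * ‖tupleC lam 2 (u t)‖ ^ 2 := by positivity
  have r0 := Real.sqrt_nonneg (2 / a)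
  have r1 := Real.sqrt_nonneg (2 / c)
  have r2 := Real.sqrt_nonneg (2 / e)
  have fin' : ∀ (n : ℕ) (w x : ℝ), √(2 / w) ≤ √(2 / a) + √(2 / c) + √(2 / e) →
      x ≤ √(2 / w) * (1 / t ^ ((n : ℝ) / 2)) * ‖u 0 none‖ →
      x ≤ (√(2 / a) + √(2 / c) + √(2 / e)) * (1 / t ^ ((n : ℝ) / 2)) * ‖u 0 none‖ :=
    fun n w x hle hx => hx.trans (by gcongr)
  interval_cases k
  · have := fin' 1 a ‖tupleC lam 0 (u t)‖ (by linarith)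
      (le_sqrt_mul_of_weight ht0 pa (norm_nonneg _) (by linarith))
    norm_num at this ⊢
    exact this
  · have := fin' 3 c ‖tupleC lam 1 (u t)‖ (by linarith)
      (le_sqrt_mul_of_weight ht0 pc (norm_nonneg _) (by linarith))
    norm_num at this ⊢
    exact this
  · have := fin' 5 e ‖tupleC lam 2 (u t)‖ (by linarith)
      (le_sqrt_mul_of_weight ht0 pe (norm_nonneg _) (by linarith))
    norm_num at this ⊢
    exact this

end IsSetting

end Decay

/-! ### Mollification of Lipschitz functions at scale δ. -/

section Blur

open scoped Convolution

variable {Y : Type} [NormedAddCommGroup Y] [NormedSpace ℝ Y] [FiniteDimensional ℝ Y]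
  [MeasurableSpace Y] [BorelSpace Y] (μ : Measure Y) [μ.IsAddHaarMeasure]

/-- Derivatives of all orders of convolutions of Lipschitz functions with a smooth kernel. -/
theorem exists_norm_iteratedFDeriv_convolution_le (k : ℕ) :
    ∀ {E : Type} [NormedAddCommGroup E] [NormedSpace ℝ E] [CompleteSpace E] {κ : Y → E},
      ContDiff ℝ ((⊤ : ℕ∞) : WithTop ℕ∞) κ → HasCompactSupport κ → ∃ C : ℝ, 0 ≤ C ∧
      ∀ (c : ℝ) (H : Y → ℝ), 0 ≤ c → Continuous H → (∀ x y, |H x - H y| ≤ c * ‖x - y‖) → ∀ y,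
      ‖iteratedFDeriv ℝ (k + 1) (κ ⋆[(ContinuousLinearMap.lsmul ℝ ℝ).flip, μ] H) y‖ ≤ C * c := by
  -- One derivative is paid for by the Lipschitz bound on `H`, the other k fall on the kernel. The
  -- kernel takes values in an arbitrary space so that its derivative can serve as the next kernel.
  induction k with
  | zero =>
    intro E _ _ _ κ hκ hκc
    refine ⟨∫ t, ‖κ t‖ ∂μ, integral_nonneg fun t => norm_nonneg _, fun c H hc hH hL y => ?_⟩
    have hκi : Integrable κ μ := hκ.continuous.integrable_of_hasCompactSupport hκc
    rw [← norm_iteratedFDeriv_fderiv, norm_iteratedFDeriv_zero]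
    refine norm_fderiv_le_of_lip' ℝ
      (mul_nonneg (integral_nonneg fun t => norm_nonneg _) hc) (Eventually.of_forall fun x => ?_)
    have hfi : ∀ x, Integrable (fun t => H (x - t) • κ t) μ := fun x => by
      refine Continuous.integrable_of_hasCompactSupport ?_ (hκc.smul_left)
      exact (hH.comp (continuous_const.sub continuous_id)).smul hκ.continuous
    change ‖∫ t, H (x - t) • κ t ∂μ - ∫ t, H (y - t) • κ t ∂μ‖ ≤ _
    rw [← integral_sub (hfi x) (hfi y), mul_assoc, ← integral_mul_const]
    refine norm_integral_le_of_norm_le (hκi.norm.mul_const _) (Eventually.of_forall fun t => ?_)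
    rw [← sub_smul, norm_smul, mul_comm, Real.norm_eq_abs]
    gcongr
    have := hL (x - t) (y - t)
    rwa [sub_sub_sub_cancel_right] at this
  | succ k ih =>
    intro E _ _ _ κ hκ hκc
    obtain ⟨C, hC, hb⟩ := ih (κ := fderiv ℝ κ) (hκ.fderiv_right (by norm_num)) (hκc.fderiv ℝ)
    refine ⟨C, hC, fun c H hc hH hL y => ?_⟩
    have e : fderiv ℝ (κ ⋆[(ContinuousLinearMap.lsmul ℝ ℝ).flip, μ] H) =
        (fderiv ℝ κ ⋆[(ContinuousLinearMap.lsmul ℝ ℝ).flip, μ] H) := by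
      funext x
      rw [(hκc.hasFDerivAt_convolution_left (μ := μ) (ContinuousLinearMap.lsmul ℝ ℝ).flip
        (hκ.of_le (by exact_mod_cast le_top)) hH.locallyIntegrable x).fderiv]
      congr 1
    rw [← norm_iteratedFDeriv_fderiv, e]
    exact hb c H hc hH hL y

variable (Y) in
/-- A fixed even probability density, smooth and supported in the unit ball. -/
noncomputable def bump : Y → ℝ :=
  (⟨1 / 2, 1, by norm_num, by norm_num⟩ : ContDiffBump (0 : Y)).normed μ

theorem contDiff_bump : ContDiff ℝ ((⊤ : ℕ∞) : WithTop ℕ∞) (bump Y μ) := ContDiffBump.contDiff_normed _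

theorem continuous_bump : Continuous (bump Y μ) := ContDiffBump.continuous_normed _

theorem bump_nonneg (t : Y) : 0 ≤ bump Y μ t := ContDiffBump.nonneg_normed _ _

theorem bump_neg (t : Y) : bump Y μ (-t) = bump Y μ t := ContDiffBump.normed_neg _ _

theorem hasCompactSupport_bump : HasCompactSupport (bump Y μ) :=
  ContDiffBump.hasCompactSupport_normed _

theorem integral_bump : ∫ t, bump Y μ t ∂μ = 1 := ContDiffBump.integral_normed _

theorem integrable_bump : Integrable (bump Y μ) μ := ContDiffBump.integrable_normed _

theorem norm_le_of_bump_ne {t : Y} (h : bump Y μ t ≠ 0) : ‖t‖ ≤ 1 := by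
  have h1 : t ∈ Function.support (bump Y μ) := h
  rw [bump, ContDiffBump.support_normed_eq] at h1
  exact (mem_ball_zero_iff.1 h1).le

/-- Mollification at scale `δ`. -/
noncomputable def blur (δ : ℝ) (G : Y → ℝ) (y : Y) : ℝ := ∫ t, bump Y μ t * G (y - δ • t) ∂μ

theorem integrable_bump_mul {H : Y → ℝ} (hH : Continuous H) :
    Integrable (fun t => bump Y μ t * H t) μ :=
  ((continuous_bump μ).mul hH).integrable_of_hasCompactSupport (hasCompactSupport_bump μ).mul_right

theorem integrable_blur {G : Y → ℝ} (hG : Continuous G) (δ : ℝ) (y : Y) :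
    Integrable (fun t => bump Y μ t * G (y - δ • t)) μ :=
  integrable_bump_mul μ (hG.comp (continuous_const.sub (continuous_id.const_smul δ)))

/-- Rescaling reduces to a convolution with the unit kernel, so that powers of δ come from the chain
rule only. -/
theorem blur_eq {δ : ℝ} (hδ : δ ≠ 0) (G : Y → ℝ) :
    blur μ δ G = fun y => (bump Y μ ⋆[(ContinuousLinearMap.lsmul ℝ ℝ).flip, μ]
      fun s => G (δ • s)) (δ⁻¹ • y) := by
  funext y
  refine integral_congr_ae (Eventually.of_forall fun t => ?_)
  change _ = G (δ • (δ⁻¹ • y - t)) • bump Y μ t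
  rw [smul_sub, smul_inv_smul₀ hδ, smul_eq_mul, mul_comm]

theorem contDiff_blur {δ : ℝ} (hδ : δ ≠ 0) {G : Y → ℝ} (hG : Continuous G) :
    ContDiff ℝ ((⊤ : ℕ∞) : WithTop ℕ∞) (blur μ δ G) := by
  rw [blur_eq μ hδ]
  refine ContDiff.comp (g := bump Y μ ⋆[(ContinuousLinearMap.lsmul ℝ ℝ).flip, μ]
      fun s => G (δ • s)) ?_ (contDiff_const_smul δ⁻¹)
  exact (hasCompactSupport_bump μ).contDiff_convolution_left _ (contDiff_bump μ)
    (hG.comp (continuous_id.const_smul δ)).locallyIntegrable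

/-- After rescaling the Lipschitz constant is cδ and k+1 derivatives cost δ^{-(k+1)}. In particular
the first derivative is bounded independently of δ. -/
theorem exists_norm_iteratedFDeriv_blur_le (k : ℕ) : ∃ C : ℝ, 0 ≤ C ∧
    ∀ (c δ : ℝ) (G : Y → ℝ), 0 ≤ c → 0 < δ → Continuous G → (∀ x y, |G x - G y| ≤ c * ‖x - y‖) → ∀ y,
      ‖iteratedFDeriv ℝ (k + 1) (blur μ δ G) y‖ ≤ C * c * δ⁻¹ ^ k := by
  obtain ⟨C, hC, hb⟩ := exists_norm_iteratedFDeriv_convolution_le μ k (contDiff_bump μ)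
    (hasCompactSupport_bump μ)
  refine ⟨C, hC, fun c δ G hc hδ hG hL y => ?_⟩
  have hG' : Continuous fun s => G (δ • s) := hG.comp (continuous_id.const_smul δ)
  have hs := (hasCompactSupport_bump μ).contDiff_convolution_left (μ := μ)
    (ContinuousLinearMap.lsmul ℝ ℝ).flip (contDiff_bump μ) hG'.locallyIntegrable
  have e : blur μ δ G = (bump Y μ ⋆[(ContinuousLinearMap.lsmul ℝ ℝ).flip, μ]
      fun s => G (δ • s)) ∘ (δ⁻¹ • ContinuousLinearMap.id ℝ Y) := blur_eq μ hδ.ne' G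
  rw [e, ContinuousLinearMap.iteratedFDeriv_comp_right _ hs y (by exact_mod_cast le_top)]
  refine (ContinuousMultilinearMap.norm_compContinuousLinearMap_le _ _).trans ?_
  have h1 := hb (c * δ) (fun s => G (δ • s)) (mul_nonneg hc hδ.le) hG' (fun x y => by
    have := hL (δ • x) (δ • y)
    rwa [← smul_sub, norm_smul, Real.norm_eq_abs, abs_of_pos hδ, ← mul_assoc] at this)
    ((δ⁻¹ • ContinuousLinearMap.id ℝ Y) y)
  have h2 : ‖δ⁻¹ • ContinuousLinearMap.id ℝ Y‖ ≤ δ⁻¹ := by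
    rw [norm_smul, Real.norm_eq_abs, abs_of_pos (inv_pos.2 hδ)]
    exact mul_le_of_le_one_right (inv_pos.2 hδ).le ContinuousLinearMap.norm_id_le
  have h3 : ∏ _i : Fin (k + 1), ‖δ⁻¹ • ContinuousLinearMap.id ℝ Y‖ ≤ δ⁻¹ ^ (k + 1) := by
    rw [Finset.prod_const, Finset.card_univ, Fintype.card_fin]
    exact pow_le_pow_left₀ (norm_nonneg _) h2 _
  refine (mul_le_mul h1 h3 (Finset.prod_nonneg fun _ _ => norm_nonneg _)
    ((norm_nonneg _).trans h1)).trans (le_of_eq ?_)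
  rw [pow_succ]
  field_simp

theorem abs_blur_le {G : Y → ℝ} (hG : Continuous G) {M : ℝ} (hM : ∀ y, |G y| ≤ M) (δ : ℝ) (y : Y) :
    |blur μ δ G y| ≤ M := by
  have h := norm_integral_le_of_norm_le ((integrable_bump μ).mul_const M)
    (Eventually.of_forall fun t => (?_ : ‖bump Y μ t * G (y - δ • t)‖ ≤ bump Y μ t * M))
  · rw [integral_mul_const, integral_bump, one_mul] at h
    exact h
  · rw [norm_mul, Real.norm_eq_abs, Real.norm_eq_abs, abs_of_nonneg (bump_nonneg μ t)]
    exact mul_le_mul_of_nonneg_left (hM _) (bump_nonneg μ t)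

theorem blur_sub_eq {G : Y → ℝ} (hG : Continuous G) (δ : ℝ) (y : Y) :
    blur μ δ G y - G y = ∫ t, bump Y μ t * (G (y - δ • t) - G y) ∂μ := by
  have h1 : ∫ t, bump Y μ t * G y ∂μ = G y := by
    rw [integral_mul_const, integral_bump, one_mul]
  simp only [mul_sub]
  rw [integral_sub (integrable_blur μ hG δ y) ((integrable_bump μ).mul_const _), h1]
  rfl

theorem abs_blur_sub_le {G : Y → ℝ} (hG : Continuous G) {c : ℝ}
    (hL : ∀ x y, |G x - G y| ≤ c * ‖x - y‖) (hc : 0 ≤ c) {δ : ℝ} (hδ : 0 ≤ δ) (y : Y) :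
    |blur μ δ G y - G y| ≤ c * δ := by
  rw [blur_sub_eq μ hG]
  have h := norm_integral_le_of_norm_le ((integrable_bump μ).mul_const (c * δ))
    (Eventually.of_forall fun t => (?_ : ‖bump Y μ t * (G (y - δ • t) - G y)‖ ≤
      bump Y μ t * (c * δ)))
  · rw [integral_mul_const, integral_bump, one_mul] at h
    exact h
  · rw [norm_mul, Real.norm_eq_abs, Real.norm_eq_abs, abs_of_nonneg (bump_nonneg μ t)]
    by_cases ht : bump Y μ t = 0
    · simp [ht]
    · refine mul_le_mul_of_nonneg_left ((hL _ _).trans ?_) (bump_nonneg μ t)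
      rw [sub_sub_cancel_left, norm_neg, norm_smul, Real.norm_eq_abs, abs_of_nonneg hδ]
      have := norm_le_of_bump_ne μ ht
      gcongr
      exact mul_le_of_le_one_right hδ this

theorem tendsto_blur {G : Y → ℝ} (hG : Continuous G) (y : Y) :
    Tendsto (fun δ => blur μ δ G y) (𝓝 0) (𝓝 (G y)) := by
  obtain ⟨M, hM⟩ := (isCompact_closedBall y 1).exists_bound_of_continuousOn hG.continuousOn
  have h : Tendsto (fun δ => blur μ δ G y) (𝓝 0) (𝓝 (∫ t, bump Y μ t * G y ∂μ)) := by
    refine tendsto_integral_filter_of_dominated_convergence (fun t => bump Y μ t * M)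
      (Eventually.of_forall fun δ => (integrable_blur μ hG δ y).aestronglyMeasurable) ?_
      ((integrable_bump μ).mul_const M) (Eventually.of_forall fun t => ?_)
    · filter_upwards [Metric.closedBall_mem_nhds (0 : ℝ) one_pos] with δ hδ
      refine Eventually.of_forall fun t => ?_
      rw [norm_mul, Real.norm_eq_abs, abs_of_nonneg (bump_nonneg μ t)]
      by_cases ht : bump Y μ t = 0
      · simp [ht]
      · refine mul_le_mul_of_nonneg_left (hM _ ?_) (bump_nonneg μ t)
        rw [mem_closedBall_iff_norm, sub_sub_cancel_left, norm_neg, norm_smul]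
        exact mul_le_one₀ (mem_closedBall_zero_iff.1 hδ) (norm_nonneg _) (norm_le_of_bump_ne μ ht)
    · refine Tendsto.const_mul _ ((hG.tendsto y).comp ?_)
      have : Continuous fun δ : ℝ => y - δ • t := by fun_prop
      simpa using this.tendsto 0
  rwa [integral_mul_const, integral_bump, one_mul] at h

/-- Mollification with an even kernel is exact to first order. -/
theorem tendsto_blur_sub_div {G : Y → ℝ} (hG : Continuous G) {c : ℝ}
    (hL : ∀ x y, |G x - G y| ≤ c * ‖x - y‖) (y : Y) (hd : DifferentiableAt ℝ G y) :
    Tendsto (fun δ => δ⁻¹ * (blur μ δ G y - G y)) (𝓝[>] 0) (𝓝 0) := by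
  -- The kernel is even, so it integrates linear functions to 0.
  have h0 : ∫ t, bump Y μ t * -fderiv ℝ G y t ∂μ = 0 := by
    have h1 := integral_neg_eq_self (fun t => bump Y μ t * -fderiv ℝ G y t) μ
    simp only [bump_neg, map_neg, neg_neg] at h1
    have h2 : ∫ t, bump Y μ t * -fderiv ℝ G y t ∂μ = -∫ t, bump Y μ t * fderiv ℝ G y t ∂μ := by
      rw [← integral_neg]
      simp only [mul_neg]
    linarith
  suffices key : Tendsto (fun δ => δ⁻¹ * (blur μ δ G y - G y)) (𝓝[>] 0)
      (𝓝 (∫ t, bump Y μ t * -fderiv ℝ G y t ∂μ)) by rwa [h0] at key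
  simp only [blur_sub_eq μ hG, ← integral_const_mul]
  refine tendsto_integral_filter_of_dominated_convergence (fun t => bump Y μ t * (c * ‖t‖))
    (Eventually.of_forall fun δ => ?_) ?_ ?_ (Eventually.of_forall fun t => ?_)
  · exact (((continuous_bump μ).mul ((hG.comp (continuous_const.sub
      (continuous_id.const_smul δ))).sub continuous_const)).const_smul δ⁻¹).aestronglyMeasurable
  · filter_upwards [self_mem_nhdsWithin] with δ hδ
    refine Eventually.of_forall fun t => ?_
    have hδ' : 0 < δ := hδ
    rw [norm_mul, norm_mul, Real.norm_eq_abs, Real.norm_eq_abs, Real.norm_eq_abs,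
      abs_of_nonneg (bump_nonneg μ t), abs_of_pos (inv_pos.2 hδ'), mul_left_comm]
    refine mul_le_mul_of_nonneg_left ?_ (bump_nonneg μ t)
    rw [inv_mul_le_iff₀ hδ']
    refine (hL _ _).trans (le_of_eq ?_)
    rw [sub_sub_cancel_left, norm_neg, norm_smul, Real.norm_eq_abs, abs_of_pos hδ']
    ring
  · exact integrable_bump_mul μ (continuous_const.mul continuous_norm)
  · have h1 : HasDerivAt (fun δ : ℝ => G (y - δ • t)) (-fderiv ℝ G y t) 0 := by
      have h2 : HasDerivAt (fun δ : ℝ => y - δ • t) (-t) 0 := by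
        simpa using ((hasDerivAt_id (0 : ℝ)).smul_const t).const_sub y
      have h3 : HasFDerivAt G (fderiv ℝ G y) (y - (0 : ℝ) • t) := by
        simpa using hd.hasFDerivAt
      simpa [Function.comp_def] using h3.comp_hasDerivAt (0 : ℝ) h2
    have h2 := h1.tendsto_slope_zero_right
    simp only [zero_add, zero_smul, sub_zero, smul_eq_mul] at h2
    refine (h2.const_mul (bump Y μ t)).congr fun δ => ?_
    ring

theorem hasFDerivAt_blur {G : Y → ℝ} (hG : ContDiff ℝ 1 G) {c : ℝ}
    (hc : ∀ y, ‖fderiv ℝ G y‖ ≤ c) (δ : ℝ) (y : Y) :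
    HasFDerivAt (blur μ δ G) (∫ t, bump Y μ t • fderiv ℝ G (y - δ • t) ∂μ) y := by
  have hd := hG.differentiable (by norm_num)
  refine hasFDerivAt_integral_of_dominated_of_fderiv_le
    (F := fun y t => bump Y μ t * G (y - δ • t))
    (F' := fun y t => bump Y μ t • fderiv ℝ G (y - δ • t))
    (bound := fun t => bump Y μ t * c) univ_mem
    (Eventually.of_forall fun y => (integrable_blur μ hG.continuous δ y).aestronglyMeasurable)
    (integrable_blur μ hG.continuous δ y) ?_ ?_ ((integrable_bump μ).mul_const c) ?_
  · exact ((continuous_bump μ).smul ((hG.continuous_fderiv (by norm_num)).comp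
      (continuous_const.sub (continuous_id.const_smul δ)))).aestronglyMeasurable
  · refine Eventually.of_forall fun t x _ => ?_
    rw [norm_smul, Real.norm_eq_abs, abs_of_nonneg (bump_nonneg μ t)]
    exact mul_le_mul_of_nonneg_left (hc _) (bump_nonneg μ t)
  · refine Eventually.of_forall fun t x _ => ?_
    have h1 : HasFDerivAt (fun y => G (y - δ • t)) (fderiv ℝ G (x - δ • t)) x :=
      (hd (x - δ • t)).hasFDerivAt.comp x ((hasFDerivAt_id x).sub_const (δ • t))
    exact h1.const_mul (bump Y μ t)

theorem fderiv_blur {G : Y → ℝ} (hG : ContDiff ℝ 1 G) {c : ℝ}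
    (hc : ∀ y, ‖fderiv ℝ G y‖ ≤ c) (δ : ℝ) (y v : Y) :
    fderiv ℝ (blur μ δ G) y v = blur μ δ (fun y => fderiv ℝ G y v) y := by
  rw [(hasFDerivAt_blur μ hG hc δ y).fderiv, ContinuousLinearMap.integral_apply]
  · rfl
  · refine Continuous.integrable_of_hasCompactSupport ?_ (hasCompactSupport_bump μ).smul_right
    exact (continuous_bump μ).smul ((hG.continuous_fderiv (by norm_num)).comp
      (continuous_const.sub (continuous_id.const_smul δ)))

end Blur

/-! ### Dominated convergence in L² and density of test functions. -/

section

open scoped Pointwise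

section Convergence

open scoped InnerProductSpace

variable {X : Type*} [MeasurableSpace X] {μ : Measure X}

theorem norm_sq_cls {f : X → ℝ} (hf : MemLp f 2 μ) : ‖cls μ f‖ ^ 2 = ∫ x, f x ^ 2 ∂μ := by
  rw [← real_inner_self_eq_norm_sq, inner_cls hf hf]
  simp only [sq]

/-- Dominated convergence in `L²`. -/
theorem tendsto_norm_cls {ι : Type*} {l : Filter ι} [l.IsCountablyGenerated] {F : ι → X → ℝ}
    {B : X → ℝ} (hB : MemLp B 2 μ) (hF : ∀ᶠ n in l, MemLp (F n) 2 μ)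
    (hb : ∀ᶠ n in l, ∀ x, |F n x| ≤ B x) (h : ∀ x, Tendsto (fun n => F n x) l (𝓝 0)) :
    Tendsto (fun n => ‖cls μ (F n)‖) l (𝓝 0) := by
  have h1 : Tendsto (fun n => ∫ x, F n x ^ 2 ∂μ) l (𝓝 (∫ _, (0 : ℝ) ^ 2 ∂μ)) := by
    refine tendsto_integral_filter_of_dominated_convergence (fun x => B x ^ 2) ?_ ?_ ?_ ?_
    · filter_upwards [hF] with n hn
      exact hn.aestronglyMeasurable.pow 2
    · filter_upwards [hb] with n hn
      refine Eventually.of_forall fun x => ?_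
      rw [norm_pow, Real.norm_eq_abs]
      exact pow_le_pow_left₀ (abs_nonneg _) (hn x) 2
    · exact hB.integrable_sq
    · exact Eventually.of_forall fun x => (h x).pow 2
  have h2 : Tendsto (fun n => ‖cls μ (F n)‖ ^ 2) l (𝓝 0) := by
    refine Tendsto.congr' ?_ (by simpa using h1)
    filter_upwards [hF] with n hn
    rw [norm_sq_cls hn]
  have h3 := (Real.continuous_sqrt.tendsto 0).comp h2
  rw [Real.sqrt_zero] at h3
  exact h3.congr fun n => Real.sqrt_sq (norm_nonneg _)

end Convergence

section Density

variable {Q : Type} [NormedAddCommGroup Q] {d m : ℕ} {π : Vec d → Q} {V : Q → ℝ}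
  {α lam : Fin m → ℝ} {β : ℝ}

/-- Mollification on the phase space. -/
noncomputable def mollify (π : Vec d → Q) (δ : ℝ) (f : Phase Q d m → ℝ) (x : Phase Q d m) : ℝ :=
  ∫ t, bump (Phase (Vec d) d m) volume t * f (x - proj π (δ • t))

theorem sum_unitVec (y : Phase (Vec d) d m) :
    y = ∑ i, y.1 i • unitVec (cq i) + (∑ i, y.2.1 i • unitVec (cp i) +
      ∑ r : Fin m × Fin d, y.2.2 r.1 r.2 • unitVec (cz r)) := by
  have e : ∀ q : Vec d, ∑ i, q i • EuclideanSpace.single i (1 : ℝ) = q := fun q => by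
    ext k
    simp [Pi.single_apply]
  refine Prod.ext ?_ (Prod.ext ?_ ?_)
  · simp [unitVec, Prod.fst_sum, e]
  · simp [unitVec, Prod.fst_sum, Prod.snd_sum, e]
  · ext j k
    simp only [unitVec, Prod.snd_sum, Prod.snd_add, Prod.smul_mk, smul_zero, Finset.sum_const_zero,
      zero_add, Fintype.sum_prod_type, Pi.add_apply, Finset.sum_apply, Pi.smul_apply,
      WithLp.ofLp_sum]
    rw [Finset.sum_eq_single j]
    · simp [Pi.single_apply]
    · intro i _ hi
      simp [Pi.single_apply, Ne.symm hi]
    · simp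

theorem norm_le_sum_unitVec {E : Type*} [NormedAddCommGroup E] [NormedSpace ℝ E]
    (L : Phase (Vec d) d m →L[ℝ] E) : ‖L‖ ≤ ∑ v, ‖L (unitVec v)‖ := by
  refine L.opNorm_le_bound (Finset.sum_nonneg fun v _ => norm_nonneg _) fun y => ?_
  have h1 : ∀ i, |y.1 i| ≤ ‖y‖ := fun i => (PiLp.norm_apply_le y.1 i).trans (norm_fst_le y)
  have h2 : ∀ i, |y.2.1 i| ≤ ‖y‖ := fun i => (PiLp.norm_apply_le y.2.1 i).trans
    ((norm_fst_le y.2).trans (norm_snd_le y))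
  have h3 : ∀ j i, |y.2.2 j i| ≤ ‖y‖ := fun j i => (PiLp.norm_apply_le (y.2.2 j) i).trans
    ((norm_le_pi_norm y.2.2 j).trans ((norm_snd_le y.2).trans (norm_snd_le y)))
  conv_lhs => rw [sum_unitVec y]
  have h4 : ∀ (c : ℝ) (v : Phase (Vec d) d m), |c| ≤ ‖y‖ → ‖c • L v‖ ≤ ‖L v‖ * ‖y‖ :=
    fun c v hc => by
      rw [norm_smul, mul_comm]
      exact mul_le_mul_of_nonneg_left hc (norm_nonneg _)
  simp only [map_add, map_sum, map_smul]
  rw [sum_coord, add_mul, add_mul, Finset.sum_mul, Finset.sum_mul, Finset.sum_mul]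
  refine (norm_add_le _ _).trans (add_le_add ?_ ((norm_add_le _ _).trans (add_le_add ?_ ?_)))
  · exact (norm_sum_le _ _).trans (Finset.sum_le_sum fun i _ => h4 _ _ (h1 i))
  · exact (norm_sum_le _ _).trans (Finset.sum_le_sum fun i _ => h4 _ _ (h2 i))
  · exact (norm_sum_le _ _).trans (Finset.sum_le_sum fun r _ => h4 _ _ (h3 r.1 r.2))

namespace IsCover

variable (hπ : IsCover π)
include hπ

theorem proj_sub (x y : Phase (Vec d) d m) : proj π (x - y) = proj π x - proj π y := by
  rw [eq_sub_iff_add_eq, ← hπ.proj_add, sub_add_cancel]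

theorem lift_mollify (δ : ℝ) (f : Phase Q d m → ℝ) :
    lift π (mollify π δ f) = blur volume δ (lift π f) := by
  funext y
  simp only [lift, mollify, blur, hπ.proj_sub]

theorem tendsto_mollify {f : Phase Q d m → ℝ} (hf : Continuous (lift π f)) (x : Phase Q d m) :
    Tendsto (fun δ => mollify π δ f x) (𝓝 0) (𝓝 (f x)) := by
  obtain ⟨y, rfl⟩ := hπ.proj_surjective x
  refine (tendsto_blur volume hf y).congr fun δ => ?_
  rw [← hπ.lift_mollify]
  rfl

theorem abs_mollify_le {f : Phase Q d m → ℝ} (hf : Continuous (lift π f)) {M : ℝ}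
    (hM : ∀ x, |f x| ≤ M) (δ : ℝ) (x : Phase Q d m) : |mollify π δ f x| ≤ M := by
  obtain ⟨y, rfl⟩ := hπ.proj_surjective x
  have := abs_blur_le volume hf (fun y => hM (proj π y)) δ y
  rwa [← hπ.lift_mollify] at this

theorem mollify_mem {k : WithTop ℕ∞} {f : Phase Q d m → ℝ} (hf : f ∈ compactC π m k) {δ : ℝ}
    (hδ : δ ≠ 0) : mollify π δ f ∈ testFun π m := by
  refine ⟨?_, ?_⟩
  · rw [hπ.lift_mollify]
    exact contDiff_blur volume hδ hf.1.continuous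
  · have hK : IsCompact (tsupport f + proj π '' Metric.closedBall (0 : Phase (Vec d) d m) |δ|) :=
      IsCompact.add hf.2 ((isCompact_closedBall _ _).image
        hπ.isOpenQuotientMap_proj.continuous)
    refine HasCompactSupport.of_support_subset_isCompact hK fun x hx => ?_
    by_contra hx'
    refine hx ?_
    unfold mollify
    rw [← integral_zero (Phase (Vec d) d m) ℝ]
    congr 1
    funext t
    by_contra ht
    have h1 : bump (Phase (Vec d) d m) volume t ≠ 0 := left_ne_zero_of_mul ht
    have h2 : f (x - proj π (δ • t)) ≠ 0 := right_ne_zero_of_mul ht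
    refine hx' ⟨_, subset_tsupport _ h2, _, ⟨δ • t, ?_, rfl⟩, sub_add_cancel _ _⟩
    rw [mem_closedBall_zero_iff, norm_smul, Real.norm_eq_abs]
    exact mul_le_of_le_one_right (abs_nonneg _) (norm_le_of_bump_ne volume h1)

theorem exists_bound {k : WithTop ℕ∞} {f : Phase Q d m → ℝ} (hf : f ∈ compactC π m k) :
    ∃ M, ∀ x, |f x| ≤ M := hf.2.exists_bound_of_continuous (hπ.continuous_of_mem hf)

/-- On the torus the lift is not compactly supported; the partial derivatives, as functions on the
phase space, are. -/
theorem exists_norm_fderiv_le {f : Phase Q d m → ℝ} (hf : f ∈ compactC π m 1) :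
    ∃ c, ∀ y, ‖fderiv ℝ (lift π f) y‖ ≤ c := by
  have h : ∀ v, ∃ M, ∀ x, |der π v f x| ≤ M := fun v =>
    hπ.exists_bound (hπ.der_mem (k := 0) hf (by norm_num) v)
  choose M hM using h
  refine ⟨∑ v, M v, fun y => (norm_le_sum_unitVec _).trans (Finset.sum_le_sum fun v _ => ?_)⟩
  rw [← hπ.dir_proj _ (hf.1.differentiable (by norm_num) y)]
  exact hM v _

theorem der_mollify {f : Phase Q d m → ℝ} (hf : ContDiff ℝ 1 (lift π f)) {c : ℝ}
    (hc : ∀ y, ‖fderiv ℝ (lift π f) y‖ ≤ c) {δ : ℝ} (hδ : δ ≠ 0) (v : Coord d m) :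
    der π v (mollify π δ f) = mollify π δ (der π v f) := by
  refine hπ.ext_lift fun y => ?_
  have h1 : Differentiable ℝ (lift π (mollify π δ f)) := by
    rw [hπ.lift_mollify]
    exact (contDiff_blur volume hδ hf.continuous).differentiable (by simp)
  unfold der
  rw [hπ.lift_dir _ h1, hπ.lift_mollify, hπ.lift_mollify,
    hπ.lift_dir _ (hf.differentiable (by norm_num))]
  exact fderiv_blur volume hf hc δ y (unitVec v)

end IsCover

section Closure

variable [ProperSpace Q] [MeasureSpace Q] [BorelSpace Q] [(volume : Measure Q).IsAddHaarMeasure]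

namespace IsSetting

variable (h : IsSetting π V β)
include h

theorem tendsto_cls_mollify {k : WithTop ℕ∞} {f : Phase Q d m → ℝ} (hf : f ∈ compactC π m k) :
    Tendsto (fun δ => cls (gibbs m V β) (mollify π δ f)) (𝓝[>] 0) (𝓝 (cls _ f)) := by
  have := h.isProbabilityMeasure (m := m)
  obtain ⟨M, hM⟩ := h.cover.exists_bound hf
  have hmem : ∀ᶠ δ in 𝓝[>] (0 : ℝ), MemLp (mollify π δ f) 2 (gibbs m V β) := by
    filter_upwards [self_mem_nhdsWithin] with δ hδ
    exact h.memLp (h.cover.mollify_mem hf (ne_of_gt hδ))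
  rw [tendsto_iff_norm_sub_tendsto_zero]
  have key := tendsto_norm_cls (μ := gibbs m V β) (l := 𝓝[>] (0 : ℝ))
    (F := fun δ => mollify π δ f - f) (B := fun _ => M + M) (memLp_const _)
    (hmem.mono fun δ hδ => hδ.sub (h.memLp hf)) (Eventually.of_forall fun δ x => ?_) fun x => ?_
  · refine key.congr' ?_
    filter_upwards [hmem] with δ hδ
    rw [cls_sub hδ (h.memLp hf)]
  · exact (abs_sub _ _).trans (add_le_add (h.cover.abs_mollify_le hf.1.continuous hM δ x) (hM x))
  · have := ((h.cover.tendsto_mollify hf.1.continuous x).mono_left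
      (nhdsWithin_le_nhds (s := Set.Ioi 0))).sub_const (f x)
    rwa [sub_self] at this

/-- Test functions are dense in the Sobolev space. -/
theorem sobolev_mem_closure (f : compactC π m 1) :
    h.sobolev f ∈ closure (Set.range fun g : testFun π m => h.sobolev (incl g)) := by
  obtain ⟨c, hc⟩ := h.cover.exists_norm_fderiv_le f.2
  have hmem : ∀ δ : ℝ, δ ∈ Set.Ioi (0 : ℝ) → mollify π δ f.1 ∈ testFun π m := fun δ hδ =>
    h.cover.mollify_mem f.2 (ne_of_gt hδ)
  -- The value 0 for δ ≤ 0 only makes the family total; the limit is taken along δ > 0.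
  let g : ℝ → testFun π m := fun δ =>
    if hδ : δ ∈ Set.Ioi (0 : ℝ) then ⟨mollify π δ f.1, hmem δ hδ⟩ else 0
  have hg : ∀ δ ∈ Set.Ioi (0 : ℝ), (g δ).1 = mollify π δ f.1 := fun δ hδ => by
    simp only [g, dif_pos hδ]
  refine mem_closure_of_tendsto (f := fun δ => h.sobolev (incl (g δ))) (b := 𝓝[>] (0 : ℝ)) ?_
    (Eventually.of_forall fun δ => ⟨g δ, rfl⟩)
  refine (PiLp.continuous_toLp 2 _).continuousAt.tendsto.comp (tendsto_pi_nhds.2 fun i => ?_)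
  rcases i with _ | v
  · refine (h.tendsto_cls_mollify f.2).congr' ?_
    filter_upwards [self_mem_nhdsWithin] with δ hδ
    rw [← hg δ hδ]
    rfl
  · refine (h.tendsto_cls_mollify (h.cover.der_mem (k := 0) f.2 (by norm_num) v)).congr' ?_
    filter_upwards [self_mem_nhdsWithin] with δ hδ
    rw [← h.cover.der_mollify f.2.1 hc (ne_of_gt hδ), ← hg δ hδ]
    rfl

/-- Test functions are dense in `L²`. -/
theorem cls_test_dense : DenseRange fun g : testFun π m => cls (gibbs m V β) g.1 := by
  have := h.isProbabilityMeasure (m := m)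
  have h0 : ∀ f : compactC π m 0, cls (gibbs m V β) f.1 ∈
      closure (Set.range fun g : testFun π m => cls (gibbs m V β) g.1) := fun f => by
    refine mem_closure_of_tendsto (h.tendsto_cls_mollify f.2) ?_
    filter_upwards [self_mem_nhdsWithin] with δ hδ
    exact ⟨⟨_, h.cover.mollify_mem f.2 (ne_of_gt hδ)⟩, rfl⟩
  intro u
  rw [← closure_closure, Metric.mem_closure_iff]
  intro ε hε
  obtain ⟨g, hgc, hgn, hg, hgm⟩ := (Lp.memLp u).exists_hasCompactSupport_eLpNorm_sub_le
    (p := 2) (by simp) (ε := ENNReal.ofReal (ε / 2)) (by simpa using hε)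
  refine ⟨_, h0 ⟨g, ?_, hgc⟩, ?_⟩
  · rw [contDiff_zero]
    exact hg.comp h.cover.isOpenQuotientMap_proj.continuous
  · rw [cls_eq hgm, dist_eq_norm, Lp.norm_def]
    have e : eLpNorm (u - hgm.toLp g : Lp ℝ 2 (gibbs m V β)) 2 (gibbs m V β) =
        eLpNorm (⇑u - g) 2 (gibbs m V β) := by
      refine eLpNorm_congr_ae ?_
      filter_upwards [Lp.coeFn_sub u (hgm.toLp g), hgm.coeFn_toLp] with x h1 h2
      rw [h1, Pi.sub_apply, Pi.sub_apply, h2]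
    rw [e]
    refine (ENNReal.toReal_mono ENNReal.ofReal_ne_top hgn).trans_lt ?_
    rw [ENNReal.toReal_ofReal (by positivity)]
    linarith

end IsSetting

end Closure

end Density

end

/-! ### Derivative bounds with geometric weights, stable under small drifts. -/

section DerLE

variable {Y : Type} [NormedAddCommGroup Y] [NormedSpace ℝ Y]
  {W : Type} [NormedAddCommGroup W] [NormedSpace ℝ W]

/-- `F` is smooth and its derivatives of order `j ≤ k` are bounded by `M * γ ^ j`. -/
def DerLE (k : ℕ) (γ M : ℝ) (F : Y → W) : Prop :=
  ContDiff ℝ ((⊤ : ℕ∞) : WithTop ℕ∞) F ∧ ∀ j ≤ k, ∀ y, ‖iteratedFDeriv ℝ j F y‖ ≤ M * γ ^ j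

namespace DerLE

variable {k : ℕ} {γ M : ℝ} {F : Y → W}

theorem contDiff_nat (h : DerLE k γ M F) (n : ℕ) : ContDiff ℝ n F :=
  h.1.of_le (by exact_mod_cast le_top)

theorem norm_le (h : DerLE k γ M F) (y : Y) : ‖F y‖ ≤ M := by
  have := h.2 0 (Nat.zero_le _) y
  simpa using this

theorem mono {l : ℕ} {M' : ℝ} (h : DerLE k γ M F) (hl : l ≤ k) (hM : M ≤ M') (hγ : 0 ≤ γ) :
    DerLE l γ M' F :=
  ⟨h.1, fun j hj y => (h.2 j (hj.trans hl) y).trans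
    (mul_le_mul_of_nonneg_right hM (pow_nonneg hγ j))⟩

theorem mono_scale {γ' : ℝ} (h : DerLE k γ M F) (hM : 0 ≤ M) (hγ : 0 ≤ γ) (hγ' : γ ≤ γ') :
    DerLE k γ' M F :=
  ⟨h.1, fun j hj y => (h.2 j hj y).trans
    (mul_le_mul_of_nonneg_left (pow_le_pow_left₀ hγ hγ' j) hM)⟩

theorem der_right (h : DerLE (k + 1) γ M F) : DerLE k γ (M * γ) (fderiv ℝ F) := by
  refine ⟨h.1.fderiv_right (by norm_num), fun j hj y => ?_⟩
  rw [norm_iteratedFDeriv_fderiv, mul_assoc, ← pow_succ']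
  exact h.2 (j + 1) (by omega) y

theorem of_fderiv (hF : ContDiff ℝ ((⊤ : ℕ∞) : WithTop ℕ∞) F) (h0 : ∀ y, ‖F y‖ ≤ M)
    (h : DerLE k γ (M * γ) (fderiv ℝ F)) : DerLE (k + 1) γ M F := by
  refine ⟨hF, fun j hj y => ?_⟩
  rcases j with _ | j
  · simpa using h0 y
  · rw [← norm_iteratedFDeriv_fderiv, pow_succ', ← mul_assoc]
    exact h.2 j (by omega) y

theorem smul (h : DerLE k γ M F) (c : ℝ) : DerLE k γ (|c| * M) (fun y => c • F y) := by
  refine ⟨contDiff_const.smul h.1, fun j hj y => ?_⟩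
  rw [iteratedFDeriv_const_smul_apply' ((h.contDiff_nat j).contDiffAt), norm_smul, mul_assoc]
  exact mul_le_mul_of_nonneg_left (h.2 j hj y) (abs_nonneg c)

theorem sum {ι : Type*} (s : Finset ι) {F : ι → Y → W} {M : ι → ℝ}
    (h : ∀ i ∈ s, DerLE k γ (M i) (F i)) : DerLE k γ (∑ i ∈ s, M i) (fun y => ∑ i ∈ s, F i y) := by
  refine ⟨ContDiff.sum fun i hi => (h i hi).1, fun j hj y => ?_⟩
  rw [iteratedFDeriv_sum fun i hi => (h i hi).contDiff_nat j, Finset.sum_apply,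
    Finset.sum_mul]
  exact (norm_sum_le _ _).trans (Finset.sum_le_sum fun i hi => (h i hi).2 j hj y)

theorem add {G : Y → W} {M' : ℝ} (h : DerLE k γ M F) (h' : DerLE k γ M' G) :
    DerLE k γ (M + M') (fun y => F y + G y) := by
  refine ⟨h.1.add h'.1, fun j hj y => ?_⟩
  rw [show (fun y => F y + G y) = F + G from rfl,
    iteratedFDeriv_add_apply (h.contDiff_nat j).contDiffAt (h'.contDiff_nat j).contDiffAt, add_mul]
  exact (norm_add_le _ _).trans (add_le_add (h.2 j hj y) (h'.2 j hj y))

/-- In the Leibniz rule the weights γ^i and γ^{j-i} multiply to γ^j, and the binomial coefficients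
sum to 2^j ≤ 2^k. This is why geometric weights are used. -/
theorem compL {b : Y → Y →L[ℝ] Y} {G : Y → Y →L[ℝ] W} {L : ℝ} (hG : DerLE k γ M G)
    (hb : DerLE k γ L b) (hM : 0 ≤ M) (hL : 0 ≤ L) (hγ : 0 ≤ γ) :
    DerLE k γ (2 ^ k * L * M) (fun y => (G y).comp (b y)) := by
  refine ⟨hG.1.clm_comp hb.1, fun j hj y => ?_⟩
  refine (ContinuousLinearMap.norm_iteratedFDeriv_le_of_bilinear_of_le_one
    (ContinuousLinearMap.compL ℝ Y Y W) (hG.contDiff_nat j) (hb.contDiff_nat j) y le_rfl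
    (ContinuousLinearMap.norm_compL_le ℝ Y Y W)).trans ?_
  have h1 : ∀ i ∈ Finset.range (j + 1), (j.choose i : ℝ) * ‖iteratedFDeriv ℝ i G y‖ *
      ‖iteratedFDeriv ℝ (j - i) b y‖ ≤ (j.choose i : ℝ) * (L * M * γ ^ j) := fun i hi => by
    have hij : i ≤ j := Nat.lt_succ_iff.1 (Finset.mem_range.1 hi)
    rw [mul_assoc]
    refine mul_le_mul_of_nonneg_left ?_ (Nat.cast_nonneg _)
    calc ‖iteratedFDeriv ℝ i G y‖ * ‖iteratedFDeriv ℝ (j - i) b y‖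
        ≤ (M * γ ^ i) * (L * γ ^ (j - i)) := mul_le_mul (hG.2 i (hij.trans hj) y)
          (hb.2 (j - i) ((Nat.sub_le _ _).trans hj) y) (norm_nonneg _) (by positivity)
      _ = L * M * γ ^ j := by
        rw [← Nat.add_sub_cancel' hij, pow_add, Nat.add_sub_cancel_left]
        ring
  refine (Finset.sum_le_sum h1).trans ?_
  rw [← Finset.sum_mul, ← Nat.cast_sum, Nat.sum_range_choose, mul_assoc (2 ^ k), mul_assoc (2 ^ k)]
  push_cast
  refine mul_le_mul_of_nonneg_right ?_ (by positivity)
  exact pow_le_pow_right₀ (by norm_num) hj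

end DerLE

theorem fderiv_comp_shift {b : Y → Y} {F : Y → W} (hb : Differentiable ℝ b)
    (hF : Differentiable ℝ F) (τ : ℝ) (c : Y) : fderiv ℝ (fun y => F (y + τ • b y + c)) =
      fun y => fderiv ℝ F (y + τ • b y + c) +
        τ • (fderiv ℝ F (y + τ • b y + c)).comp (fderiv ℝ b y) := by
  funext y
  have h1 : HasFDerivAt (fun y => y + τ • b y + c)
      (ContinuousLinearMap.id ℝ Y + τ • fderiv ℝ b y) y :=
    ((hasFDerivAt_id y).add ((hb y).hasFDerivAt.const_smul τ)).add_const c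
  have h2 : HasFDerivAt (fun y => F (y + τ • b y + c)) _ y :=
    HasFDerivAt.comp (g := F) y (hF (y + τ • b y + c)).hasFDerivAt h1
  rw [h2.fderiv, ContinuousLinearMap.comp_add,
    ContinuousLinearMap.comp_id, ContinuousLinearMap.comp_smul]

variable {b : Y → Y} {γ L τ : ℝ} (hb : ContDiff ℝ ((⊤ : ℕ∞) : WithTop ℕ∞) b)
  (hL0 : 0 ≤ L) (hγ : 0 ≤ γ) (hτ : 0 ≤ τ)
include hb hL0 hγ hτ

/-- Weighted bounds of derivatives under a small drift. -/
theorem DerLE.comp_shift {k : ℕ} (hL : DerLE k γ L (fderiv ℝ b)) (c : Y) :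
    ∀ {W : Type} [NormedAddCommGroup W] [NormedSpace ℝ W] {F : Y → W} {M : ℝ}, 0 ≤ M →
      (DerLE k γ M F → DerLE k γ (Real.exp (k * 2 ^ k * L * τ) * M)
        (fun y => F (y + τ • b y + c))) ∧
      (ContDiff ℝ ((⊤ : ℕ∞) : WithTop ℕ∞) F → DerLE k γ M (fderiv ℝ F) →
        DerLE k γ (Real.exp ((k + 1) * 2 ^ (k + 1) * L * τ) * M)
        (fderiv ℝ (fun y => F (y + τ • b y + c)))) := by
  have hbd : Differentiable ℝ b := hb.differentiable (by simp)
  have hsm : ContDiff ℝ ((⊤ : ℕ∞) : WithTop ℕ∞) fun y => y + τ • b y + c :=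
    (contDiff_id.add (contDiff_const.smul hb)).add contDiff_const
  -- By the chain rule the derivative of the shifted function is the shifted derivative plus τ times
  -- its composition with the Jacobian of b. The factor 1 + τ 2^k L is dominated by an exponential,
  -- so that bounds for successive steps multiply well.
  have second : ∀ {k : ℕ}, DerLE k γ L (fderiv ℝ b) →
      ∀ {W : Type} [NormedAddCommGroup W] [NormedSpace ℝ W] {F : Y → W} {M : ℝ}, 0 ≤ M →
      ContDiff ℝ ((⊤ : ℕ∞) : WithTop ℕ∞) F →
      DerLE k γ (Real.exp (k * 2 ^ k * L * τ) * M) (fun y => fderiv ℝ F (y + τ • b y + c)) →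
      DerLE k γ (Real.exp ((k + 1) * 2 ^ (k + 1) * L * τ) * M)
        (fderiv ℝ (fun y => F (y + τ • b y + c))) := by
    intro k hL W _ _ F M hM hF h1
    rw [fderiv_comp_shift hbd (hF.differentiable (by simp))]
    have h2 := h1.add ((h1.compL hL (by positivity) hL0 hγ).smul τ)
    refine h2.mono le_rfl ?_ hγ
    rw [abs_of_nonneg hτ]
    have h3 : 1 + τ * (2 ^ k * L) ≤ Real.exp (2 ^ k * L * τ) := by
      have := Real.add_one_le_exp (2 ^ k * L * τ)
      linarith
    calc Real.exp (k * 2 ^ k * L * τ) * M + τ * (2 ^ k * L * (Real.exp (k * 2 ^ k * L * τ) * M))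
        = (1 + τ * (2 ^ k * L)) * (Real.exp (k * 2 ^ k * L * τ) * M) := by ring
      _ ≤ Real.exp (2 ^ k * L * τ) * (Real.exp (k * 2 ^ k * L * τ) * M) :=
        mul_le_mul_of_nonneg_right h3 (by positivity)
      _ = Real.exp (2 ^ k * L * τ + k * 2 ^ k * L * τ) * M := by rw [Real.exp_add]; ring
      _ ≤ Real.exp ((k + 1) * 2 ^ (k + 1) * L * τ) * M := by
        refine mul_le_mul_of_nonneg_right (Real.exp_le_exp.2 ?_) hM
        have h4 : (0 : ℝ) ≤ (k + 1) * (2 ^ k * L * τ) := by positivity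
        rw [pow_succ]
        linarith
  -- The two claims feed each other: order k for derivatives gives order k+1 for functions, which
  -- `second`, applied to the derivative, turns into order k+1 for derivatives. The target space
  -- changes, hence the quantification over `W` inside.
  induction k with
  | zero =>
    intro W _ _ F M hM
    have first : ∀ {W : Type} [NormedAddCommGroup W] [NormedSpace ℝ W] {F : Y → W} {M : ℝ}, 0 ≤ M →
        DerLE 0 γ M F → DerLE 0 γ (Real.exp ((0 : ℕ) * 2 ^ 0 * L * τ) * M)
        (fun y => F (y + τ • b y + c)) := fun hM h => by
      refine ⟨h.1.comp hsm, fun j hj y => ?_⟩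
      obtain rfl : j = 0 := Nat.le_zero.1 hj
      simpa using h.norm_le _
    exact ⟨first hM, fun hF h => second hL hM hF (first hM h)⟩
  | succ k ih =>
    intro W _ _ F M hM
    have first : ∀ {W : Type} [NormedAddCommGroup W] [NormedSpace ℝ W] {F : Y → W} {M : ℝ}, 0 ≤ M →
        DerLE (k + 1) γ M F → DerLE (k + 1) γ (Real.exp ((k + 1 : ℕ) * 2 ^ (k + 1) * L * τ) * M)
        (fun y => F (y + τ • b y + c)) := fun {W _ _ F M} hM h => by
      refine DerLE.of_fderiv (h.1.comp hsm) (fun y => (h.norm_le _).trans ?_) ?_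
      · exact le_mul_of_one_le_left hM (Real.one_le_exp (by positivity))
      · have := (ih (hL.mono (Nat.le_succ k) le_rfl hγ) (mul_nonneg hM hγ)).2 h.1 h.der_right
        rw [mul_assoc]
        exact_mod_cast this
    refine ⟨first hM, fun hF h => second hL hM hF (first hM h)⟩

end DerLE

/-! ### A Markov chain approximating the diffusion, and its consistency error. -/

section Chain

variable {Y : Type} [NormedAddCommGroup Y] [NormedSpace ℝ Y] {S : Type} [Fintype S]

/-- Directional derivatives on a normed space. -/
noncomputable def pd (e : Y) (F : Y → ℝ) (y : Y) : ℝ := fderiv ℝ F y e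

theorem contDiff_pd {F : Y → ℝ} (hF : ContDiff ℝ ((⊤ : ℕ∞) : WithTop ℕ∞) F) (e : Y) :
    ContDiff ℝ ((⊤ : ℕ∞) : WithTop ℕ∞) (pd e F) :=
  (hF.fderiv_right (by norm_num)).clm_apply contDiff_const

theorem fderiv_pd {F : Y → ℝ} (hF : ContDiff ℝ ((⊤ : ℕ∞) : WithTop ℕ∞) F) (e v y : Y) :
    fderiv ℝ (pd e F) y v = fderiv ℝ (fderiv ℝ F) y v e := by
  have h : DifferentiableAt ℝ (fderiv ℝ F) y :=
    (hF.fderiv_right (m := 1) (by norm_cast)).differentiable (by norm_num) y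
  have := (h.hasFDerivAt.clm_apply (hasFDerivAt_const e y)).fderiv
  unfold pd
  rw [this]
  simp

theorem pd_comm {F : Y → ℝ} (hF : ContDiff ℝ ((⊤ : ℕ∞) : WithTop ℕ∞) F) (e v : Y) :
    pd e (pd v F) = pd v (pd e F) := by
  funext y
  change fderiv ℝ (pd v F) y e = fderiv ℝ (pd e F) y v
  rw [fderiv_pd hF, fderiv_pd hF]
  exact (hF.contDiffAt.isSymmSndFDerivAt (by
    rw [minSmoothness_of_isRCLikeNormedField]
    exact WithTop.coe_le_coe.2 (le_top : (2 : ℕ∞) ≤ ⊤))) e v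

theorem norm_fderiv_pd_le {F : Y → ℝ} (hF : ContDiff ℝ ((⊤ : ℕ∞) : WithTop ℕ∞) F) {M : ℝ}
    (hM : ∀ y, ‖fderiv ℝ (fderiv ℝ F) y‖ ≤ M) (e y : Y) : ‖fderiv ℝ (pd e F) y‖ ≤ M * ‖e‖ := by
  refine ContinuousLinearMap.opNorm_le_bound _
    (mul_nonneg ((ContinuousLinearMap.opNorm_nonneg _).trans (hM y)) (norm_nonneg _)) fun v => ?_
  rw [fderiv_pd hF]
  calc ‖fderiv ℝ (fderiv ℝ F) y v e‖ ≤ ‖fderiv ℝ (fderiv ℝ F) y v‖ * ‖e‖ :=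
        ContinuousLinearMap.le_opNorm _ _
    _ ≤ ‖fderiv ℝ (fderiv ℝ F) y‖ * ‖v‖ * ‖e‖ := by
        gcongr
        exact ContinuousLinearMap.le_opNorm _ _
    _ ≤ M * ‖v‖ * ‖e‖ := by
        gcongr
        exact hM y
    _ = M * ‖e‖ * ‖v‖ := by ring

theorem norm_fderiv_sub_le {F : Y → ℝ} (hF : ContDiff ℝ ((⊤ : ℕ∞) : WithTop ℕ∞) F) {M : ℝ}
    (hM : ∀ y, ‖fderiv ℝ (fderiv ℝ F) y‖ ≤ M) (x y : Y) :
    ‖fderiv ℝ F x - fderiv ℝ F y‖ ≤ M * ‖x - y‖ :=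
  Convex.norm_image_sub_le_of_norm_fderiv_le (𝕜 := ℝ) (s := Set.univ) (fun z _ =>
    (hF.fderiv_right (m := 1) (by norm_cast)).differentiable (by norm_num) z)
    (fun z _ => hM z) convex_univ (Set.mem_univ _) (Set.mem_univ _)

/-- Second order Taylor expansion. -/
theorem abs_taylor_two_le {F : Y → ℝ} (hF : ContDiff ℝ ((⊤ : ℕ∞) : WithTop ℕ∞) F) {M : ℝ}
    (y v : Y) (hM : ∀ z, ‖fderiv ℝ (fderiv ℝ (pd v F)) z‖ ≤ M) {t : ℝ} (ht : 0 ≤ t) :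
    |F (y + t • v) - F y - t * pd v F y - t ^ 2 / 2 * pd v (pd v F) y| ≤
      M * ‖v‖ ^ 2 * t ^ 3 := by
  have hv := contDiff_pd hF v
  have hd : ∀ {G : Y → ℝ}, ContDiff ℝ ((⊤ : ℕ∞) : WithTop ℕ∞) G → ∀ s : ℝ,
      HasDerivAt (fun s : ℝ => G (y + s • v)) (pd v G (y + s • v)) s := fun {G} hG s => by
    have h1 : HasDerivAt (fun s : ℝ => y + s • v) v s := by
      simpa using ((hasDerivAt_id s).smul_const v).const_add y
    exact HasFDerivAt.comp_hasDerivAt (l := G) s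
      ((hG.differentiable (by simp) _).hasFDerivAt) h1
  have hM0 : 0 ≤ M := le_trans (ContinuousLinearMap.opNorm_nonneg _) (hM 0)
  have h1 : ∀ s : ℝ, 0 ≤ s →
      |pd v F (y + s • v) - pd v F y - s * pd v (pd v F) y| ≤ M * ‖v‖ ^ 2 * s ^ 2 := fun s hs => by
    have h2 := norm_image_sub_le_of_norm_deriv_le_segment' (a := 0) (b := s)
      (f := fun r : ℝ => pd v F (y + r • v) - pd v F y - r * pd v (pd v F) y)
      (f' := fun r => pd v (pd v F) (y + r • v) - pd v (pd v F) y) (C := M * ‖v‖ ^ 2 * s)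
      (fun r _ => by
        have h3 := ((hd hv r).sub_const (pd v F y)).sub
          ((hasDerivAt_id r).mul_const (pd v (pd v F) y))
        simp only [one_mul] at h3
        exact h3.hasDerivWithinAt) (fun r hr => by
        have h3 := norm_fderiv_sub_le hv hM (y + r • v) y
        have h4 : ‖(fderiv ℝ (pd v F) (y + r • v) - fderiv ℝ (pd v F) y) v‖ ≤
            M * ‖y + r • v - y‖ * ‖v‖ := (ContinuousLinearMap.le_opNorm _ _).trans
            (mul_le_mul_of_nonneg_right h3 (norm_nonneg _))
        refine h4.trans ?_
        rw [add_sub_cancel_left, norm_smul, Real.norm_eq_abs, abs_of_nonneg hr.1]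
        have : r ≤ s := hr.2.le
        calc M * (r * ‖v‖) * ‖v‖ = M * ‖v‖ ^ 2 * r := by ring
          _ ≤ _ := by gcongr) s ⟨hs, le_rfl⟩
    simp only [zero_smul, add_zero, sub_self, zero_mul, sub_zero, Real.norm_eq_abs] at h2
    exact h2.trans (le_of_eq (by ring))
  have h2 := norm_image_sub_le_of_norm_deriv_le_segment' (a := 0) (b := t)
    (f := fun r : ℝ => F (y + r • v) - F y - r * pd v F y - r ^ 2 / 2 * pd v (pd v F) y)
    (f' := fun r => pd v F (y + r • v) - pd v F y - r * pd v (pd v F) y) (C := M * ‖v‖ ^ 2 * t ^ 2)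
    (fun r _ => by
      have h3 := (((hd hF r).sub_const (F y)).sub
        ((hasDerivAt_id r).mul_const (pd v F y))).sub
        (((hasDerivAt_pow 2 r).div_const 2).mul_const (pd v (pd v F) y))
      refine (h3.congr_deriv ?_).hasDerivWithinAt
      push_cast
      ring) (fun r hr => by
      refine (h1 r hr.1).trans ?_
      have : r ≤ t := hr.2.le
      have := hr.1
      gcongr) t ⟨ht, le_rfl⟩
  simp only [zero_smul, add_zero, sub_self, zero_mul, sub_zero, Real.norm_eq_abs, ne_eq,
    OfNat.ofNat_ne_zero, not_false_eq_true, zero_pow, zero_div] at h2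
  exact h2.trans (le_of_eq (by ring))

/-- First order Taylor expansion around a nearby point. -/
theorem abs_taylor_one_le {F : Y → ℝ} (hF : ContDiff ℝ ((⊤ : ℕ∞) : WithTop ℕ∞) F) {M M' : ℝ}
    (hM : ∀ z, ‖fderiv ℝ F z‖ ≤ M) (hM' : ∀ z, ‖fderiv ℝ (fderiv ℝ F) z‖ ≤ M') (y z h : Y) :
    |F (z + h) - F z - fderiv ℝ F y h| ≤ min (2 * M) (M' * (‖h‖ + ‖z - y‖)) * ‖h‖ := by
  have hM0 : 0 ≤ M' := le_trans (ContinuousLinearMap.opNorm_nonneg _) (hM' 0)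
  have h1 := Convex.norm_image_sub_le_of_norm_fderiv_le' (𝕜 := ℝ) (s := segment ℝ z (z + h))
    (φ := fderiv ℝ F y) (f := F) (C := min (2 * M) (M' * (‖h‖ + ‖z - y‖)))
    (fun x _ => hF.differentiable (by simp) x) (fun x hx => le_min ?_ ?_)
    (convex_segment _ _) (left_mem_segment ℝ z (z + h)) (right_mem_segment ℝ z (z + h))
  · rwa [add_sub_cancel_left, Real.norm_eq_abs] at h1
  · exact (norm_sub_le _ _).trans (by linarith [hM x, hM y])
  · refine (norm_fderiv_sub_le hF hM' x y).trans (mul_le_mul_of_nonneg_left ?_ hM0)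
    have h2 : ‖x - z‖ ≤ ‖h‖ := by
      obtain ⟨θ, ⟨h0, h1⟩, rfl⟩ := (segment_eq_image' ℝ z (z + h)) ▸ hx
      rw [add_sub_cancel_left, add_sub_cancel_left, norm_smul, Real.norm_eq_abs, abs_of_nonneg h0]
      exact mul_le_of_le_one_left (norm_nonneg _) h1
    calc ‖x - y‖ = ‖(x - z) + (z - y)‖ := by rw [sub_add_sub_cancel]
      _ ≤ ‖x - z‖ + ‖z - y‖ := norm_add_le _ _
      _ ≤ _ := by linarith

/-- A finite symmetric noise. -/
structure IsNoise (w : S → ℝ) (v : S → Y) : Prop where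
  nonneg : ∀ s, 0 ≤ w s
  sum_eq : ∑ s, w s = 1
  mean_eq : ∑ s, w s • v s = 0

/-- One step of the Markov chain approximating the diffusion. -/
noncomputable def avg (w : S → ℝ) (v : S → Y) (b : Y → Y) (τ : ℝ) (F : Y → ℝ) (y : Y) : ℝ :=
  ∑ s, w s * F (y + τ • b y + √τ • v s)

/-- The error in the approximation of the generator by the Markov chain. -/
noncomputable def avgError (w : S → ℝ) (v : S → Y) (b : Y → Y) (τ : ℝ) (F : Y → ℝ) (y : Y) : ℝ :=
  τ⁻¹ * (avg w v b τ F y - F y) - fderiv ℝ F y (b y) -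
    (∑ s, w s * pd (v s) (pd (v s) F) y) / 2

variable {w : S → ℝ} {v : S → Y} (hw : IsNoise w v)
include hw

/-- The noise displacement is expanded to second order at y, the drift displacement to first order
from the displaced point; centred noise removes the terms of order √τ. The minimum keeps the bound
linear in ‖b y‖ for a fixed derivative bound M, so that it has a square integrable majorant,
although b is unbounded. -/
theorem abs_avgError_le (b : Y → Y) {τ : ℝ} (hτ : 0 < τ) {F : Y → ℝ}
    (hF : ContDiff ℝ ((⊤ : ℕ∞) : WithTop ℕ∞) F) {M M' M'' K : ℝ} (hK : ∀ s, ‖v s‖ ≤ K)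
    (hM : ∀ z, ‖fderiv ℝ F z‖ ≤ M) (hM' : ∀ z, ‖fderiv ℝ (fderiv ℝ F) z‖ ≤ M')
    (hM'' : ∀ s z, ‖fderiv ℝ (fderiv ℝ (pd (v s) F)) z‖ ≤ M'') (y : Y) :
    |avgError w v b τ F y| ≤
      min (2 * M) (M' * (τ * ‖b y‖ + √τ * K)) * ‖b y‖ + M'' * K ^ 2 * √τ := by
  have hM0 : 0 ≤ M' := le_trans (ContinuousLinearMap.opNorm_nonneg _) (hM' 0)
  have hs0 : 0 ≤ √τ := Real.sqrt_nonneg τ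
  have hsq : √τ ^ 2 = τ := Real.sq_sqrt hτ.le
  have key : ∀ s, |F (y + τ • b y + √τ • v s) - F y - τ * fderiv ℝ F y (b y) - √τ * pd (v s) F y -
      τ / 2 * pd (v s) (pd (v s) F) y| ≤
      τ * (min (2 * M) (M' * (τ * ‖b y‖ + √τ * K)) * ‖b y‖ + M'' * K ^ 2 * √τ) := fun s => by
    have hM2 : 0 ≤ M'' := le_trans (ContinuousLinearMap.opNorm_nonneg _) (hM'' s 0)
    have h1 := abs_taylor_one_le hF hM hM' y (y + √τ • v s) (τ • b y)
    have h2 := abs_taylor_two_le hF y (v s) (hM'' s) hs0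
    rw [hsq] at h2
    have e1 : y + √τ • v s + τ • b y = y + τ • b y + √τ • v s := by abel
    rw [e1, add_sub_cancel_left, norm_smul, norm_smul, Real.norm_eq_abs, Real.norm_eq_abs,
      abs_of_pos hτ, abs_of_nonneg hs0, map_smul, smul_eq_mul] at h1
    have h3 : min (2 * M) (M' * (τ * ‖b y‖ + √τ * ‖v s‖)) * (τ * ‖b y‖) ≤
        min (2 * M) (M' * (τ * ‖b y‖ + √τ * K)) * (τ * ‖b y‖) := by
      refine mul_le_mul_of_nonneg_right (min_le_min_left _ ?_) (by positivity)
      have := hK s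
      gcongr
    have h4 : M'' * ‖v s‖ ^ 2 * √τ ^ 3 ≤ M'' * K ^ 2 * (√τ * τ) := by
      rw [show √τ ^ 3 = √τ * τ by rw [pow_succ, hsq, mul_comm]]
      have := hK s
      gcongr
    rw [abs_le] at h1 h2 ⊢
    constructor <;> linarith [h1.1, h1.2, h2.1, h2.2]
  have e : avgError w v b τ F y = τ⁻¹ * ∑ s, w s * (F (y + τ • b y + √τ • v s) - F y -
      τ * fderiv ℝ F y (b y) - √τ * pd (v s) F y - τ / 2 * pd (v s) (pd (v s) F) y) := by
    have h0 : ∑ s, w s * pd (v s) F y = 0 := by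
      have := congrArg (fderiv ℝ F y) hw.mean_eq
      simpa [map_sum, pd] using this
    have h1 : ∑ s, w s * (F (y + τ • b y + √τ • v s) - F y - τ * fderiv ℝ F y (b y) -
        √τ * pd (v s) F y - τ / 2 * pd (v s) (pd (v s) F) y) =
        avg w v b τ F y - (∑ s, w s) * F y - (∑ s, w s) * (τ * fderiv ℝ F y (b y)) -
        √τ * ∑ s, w s * pd (v s) F y - τ / 2 * ∑ s, w s * pd (v s) (pd (v s) F) y := by
      simp only [avg, Finset.sum_mul, Finset.mul_sum, ← Finset.sum_sub_distrib]
      exact Finset.sum_congr rfl fun s _ => by ring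
    rw [h1, h0, hw.sum_eq, avgError]
    field_simp
    ring
  rw [e, abs_mul, abs_of_pos (inv_pos.2 hτ), inv_mul_le_iff₀ hτ]
  refine (Finset.abs_sum_le_sum_abs _ _).trans ?_
  refine (Finset.sum_le_sum fun s _ => (?_ : _ ≤ w s * (τ * (min (2 * M)
    (M' * (τ * ‖b y‖ + √τ * K)) * ‖b y‖ + M'' * K ^ 2 * √τ)))).trans ?_
  · rw [abs_mul, abs_of_nonneg (hw.nonneg s)]
    exact mul_le_mul_of_nonneg_left (key s) (hw.nonneg s)
  · rw [← Finset.sum_mul, hw.sum_eq, one_mul]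

omit hw in
theorem fderiv_avg {b : Y → Y} (hb : ContDiff ℝ ((⊤ : ℕ∞) : WithTop ℕ∞) b) (τ : ℝ) {F : Y → ℝ}
    (hF : ContDiff ℝ ((⊤ : ℕ∞) : WithTop ℕ∞) F) : fderiv ℝ (avg w v b τ F) =
      fun y => ∑ s, w s • fderiv ℝ (fun y => F (y + τ • b y + √τ • v s)) y := by
  funext y
  unfold avg
  have h : ∀ s, DifferentiableAt ℝ (fun y => F (y + τ • b y + √τ • v s)) y := fun s =>
    (hF.comp ((contDiff_id.add (contDiff_const.smul hb)).add contDiff_const)).differentiable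
      (by simp) y
  rw [fderiv_fun_sum fun s _ => (h s).const_mul (w s)]
  exact Finset.sum_congr rfl fun s _ => fderiv_const_mul (h s) (w s)

omit hw in
theorem contDiff_avg {b : Y → Y} (hb : ContDiff ℝ ((⊤ : ℕ∞) : WithTop ℕ∞) b) (τ : ℝ) {F : Y → ℝ}
    (hF : ContDiff ℝ ((⊤ : ℕ∞) : WithTop ℕ∞) F) :
    ContDiff ℝ ((⊤ : ℕ∞) : WithTop ℕ∞) (avg w v b τ F) :=
  ContDiff.sum fun s _ => contDiff_const.mul
    (hF.comp ((contDiff_id.add (contDiff_const.smul hb)).add contDiff_const))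

/-- Averaging with probability weights costs nothing, so a step multiplies the bound by exp(O(τ))
with a rate depending on b only through L. -/
theorem DerLE.avg {b : Y → Y} (hb : ContDiff ℝ ((⊤ : ℕ∞) : WithTop ℕ∞) b) {k : ℕ} {γ L τ M : ℝ}
    (hL0 : 0 ≤ L) (hγ : 0 ≤ γ) (hτ : 0 ≤ τ) (hL : DerLE k γ L (fderiv ℝ b)) {F : Y → ℝ}
    (hM : 0 ≤ M) (hF : ContDiff ℝ ((⊤ : ℕ∞) : WithTop ℕ∞) F) (h : DerLE k γ M (fderiv ℝ F)) :
    DerLE k γ (Real.exp ((k + 1) * 2 ^ (k + 1) * L * τ) * M) (fderiv ℝ (avg w v b τ F)) := by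
  rw [fderiv_avg hb τ hF]
  refine (DerLE.sum _ fun s _ => ((DerLE.comp_shift hb hL0 hγ hτ hL (√τ • v s) hM).2
    hF h).smul (w s)).mono le_rfl (le_of_eq ?_) hγ
  simp only [abs_of_nonneg (hw.nonneg _)]
  rw [← Finset.sum_mul, hw.sum_eq, one_mul]

theorem abs_avg_le (b : Y → Y) (τ : ℝ) {F : Y → ℝ} {M : ℝ} (hM : ∀ y, |F y| ≤ M) (y : Y) :
    |GLE.avg w v b τ F y| ≤ M := by
  unfold GLE.avg
  refine (Finset.abs_sum_le_sum_abs _ _).trans ?_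
  refine (Finset.sum_le_sum fun s _ => (?_ : _ ≤ w s * M)).trans ?_
  · rw [abs_mul, abs_of_nonneg (hw.nonneg s)]
    exact mul_le_mul_of_nonneg_left (hM _) (hw.nonneg s)
  · rw [← Finset.sum_mul, hw.sum_eq, one_mul]

/-- The noise vectors are constant, so the derivative of the error is the error for the derivative
plus a term from the Jacobian of the drift, which is small since the displacement is. -/
theorem fderiv_avgError {b : Y → Y} (hb : ContDiff ℝ ((⊤ : ℕ∞) : WithTop ℕ∞) b) {τ : ℝ}
    (hτ : 0 < τ) {F : Y → ℝ} (hF : ContDiff ℝ ((⊤ : ℕ∞) : WithTop ℕ∞) F) (y e : Y) :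
    fderiv ℝ (avgError w v b τ F) y e = avgError w v b τ (pd e F) y +
      ∑ s, w s * (fderiv ℝ F (y + τ • b y + √τ • v s) - fderiv ℝ F y) (fderiv ℝ b y e) := by
  have hbd : Differentiable ℝ b := hb.differentiable (by simp)
  have hd : ∀ {G : Y → ℝ}, ContDiff ℝ ((⊤ : ℕ∞) : WithTop ℕ∞) G → DifferentiableAt ℝ G y :=
    fun hG => hG.differentiable (by simp) y
  have hFd : Differentiable ℝ F := hF.differentiable (by simp)
  have h1 : HasFDerivAt (fun y => fderiv ℝ F y (b y)) _ y :=
    ((hF.fderiv_right (m := 1) (by norm_cast)).differentiable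
    (by norm_num) y).hasFDerivAt.clm_apply (hbd y).hasFDerivAt
  have h2 : HasFDerivAt (fun y => (∑ s, w s * pd (v s) (pd (v s) F) y) / 2) _ y :=
    (HasFDerivAt.fun_sum fun s _ =>
      ((hd (contDiff_pd (contDiff_pd hF (v s)) (v s))).hasFDerivAt.const_mul (w s))).mul_const
      (2⁻¹ : ℝ)
  have h3 : HasFDerivAt (avgError w v b τ F) _ y :=
    ((((hd (contDiff_avg (w := w) (v := v) hb τ hF)).hasFDerivAt.sub
      (hd hF).hasFDerivAt).const_mul τ⁻¹).sub h1).sub h2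
  rw [h3.fderiv, fderiv_avg hb τ hF]
  simp only [fderiv_comp_shift hbd hFd]
  simp only [ContinuousLinearMap.sub_apply, ContinuousLinearMap.smul_apply,
    ContinuousLinearMap.sum_apply, ContinuousLinearMap.add_apply, ContinuousLinearMap.comp_apply,
    ContinuousLinearMap.flip_apply, smul_eq_mul]
  have e1 : fderiv ℝ (fderiv ℝ F) y e (b y) = fderiv ℝ (pd e F) y (b y) := by
    rw [← fderiv_pd hF]
    exact congrFun (pd_comm hF e (b y)) y
  have e2 : ∀ s, fderiv ℝ (pd (v s) (pd (v s) F)) y e = pd (v s) (pd (v s) (pd e F)) y := fun s => by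
    have h4 := congrFun (pd_comm (contDiff_pd hF (v s)) e (v s)) y
    rw [pd_comm hF e (v s)] at h4
    exact h4
  simp only [e1, e2, avgError, GLE.avg, mul_add, mul_sub, Finset.sum_add_distrib,
    Finset.sum_sub_distrib]
  have e3 : ∑ s, w s * fderiv ℝ F y (fderiv ℝ b y e) = fderiv ℝ F y (fderiv ℝ b y e) := by
    rw [← Finset.sum_mul, hw.sum_eq, one_mul]
  have e4 : ∑ s, w s * (τ * fderiv ℝ F (y + τ • b y + √τ • v s) (fderiv ℝ b y e)) =
      τ * ∑ s, w s * fderiv ℝ F (y + τ • b y + √τ • v s) (fderiv ℝ b y e) := by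
    rw [Finset.mul_sum]
    exact Finset.sum_congr rfl fun s _ => by ring
  rw [e3, e4]
  simp only [pd]
  field_simp
  ring

end Chain

/-! ### The chain for the Langevin drift on the phase space. -/

section Drift

variable {Q : Type} [NormedAddCommGroup Q] {d m : ℕ} {π : Vec d → Q} {V : Q → ℝ}
  {α lam : Fin m → ℝ} {β : ℝ}

/-- The linear part of the drift. -/
noncomputable def linDrift (α lam : Fin m → ℝ) :
    (Vec d × (Fin m → Vec d)) →L[ℝ] Phase (Vec d) d m :=
  (ContinuousLinearMap.fst ℝ _ _).prod
    ((∑ j, lam j • (ContinuousLinearMap.proj j).comp (ContinuousLinearMap.snd ℝ _ _)).prod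
      (ContinuousLinearMap.pi fun j => -lam j • ContinuousLinearMap.fst ℝ _ _ -
        α j • (ContinuousLinearMap.proj j).comp (ContinuousLinearMap.snd ℝ _ _)))

/-- The drift with the force `-g`. -/
noncomputable def drift (α lam : Fin m → ℝ) (g : Fin d → Phase Q d m → ℝ) (x : Phase Q d m) :
    Phase (Vec d) d m := linDrift α lam x.2 - ∑ i, g i x • unitVec (cp i)

/-- The force of the potential. -/
noncomputable def force (π : Vec d → Q) (V : Q → ℝ) (m : ℕ) (i : Fin d) (x : Phase Q d m) : ℝ :=
  gradV π V i x.1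

theorem sum_coef_smul (x : Phase Q d m) :
    ∑ v, coef π V α lam v x • unitVec v = drift α lam (force π V m) x := by
  have h : linDrift α lam x.2 = ∑ i, x.2.1 i • unitVec (cq i) +
      (∑ i, (∑ j, lam j * x.2.2 j i) • unitVec (cp i) +
      ∑ r : Fin m × Fin d, (-lam r.1 * x.2.1 r.2 - α r.1 * x.2.2 r.1 r.2) • unitVec (cz r)) := by
    rw [sum_unitVec (linDrift α lam x.2)]
    simp [linDrift]
  rw [drift, h, sum_coord]
  simp only [coef, force, add_smul, neg_smul, Finset.sum_add_distrib, Finset.sum_neg_distrib]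
  abel

/-- The directions of the noise. -/
noncomputable def noiseVec (α : Fin m → ℝ) (β : ℝ) :
    Option (Fin m × Fin d) × Bool → Phase (Vec d) d m
  | (none, _) => 0
  | (some r, true) => √(Fintype.card (Option (Fin m × Fin d) × Bool) * (α r.1 * β⁻¹)) •
      unitVec (cz r)
  | (some r, false) => -√(Fintype.card (Option (Fin m × Fin d) × Bool) * (α r.1 * β⁻¹)) •
      unitVec (cz r)

/-- The uniform weights of the noise. -/
noncomputable def noiseWeight (d m : ℕ) (_ : Option (Fin m × Fin d) × Bool) : ℝ :=
  (Fintype.card (Option (Fin m × Fin d) × Bool) : ℝ)⁻¹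

theorem isNoise (α : Fin m → ℝ) (β : ℝ) :
    IsNoise (noiseWeight d m) (noiseVec (d := d) α β) where
  nonneg _ := inv_nonneg.2 (Nat.cast_nonneg _)
  sum_eq := by
    simp only [noiseWeight, Finset.sum_const, Finset.card_univ, nsmul_eq_mul]
    -- The index `none`, with zero noise vector, makes the index type nonempty even when there are
    -- no auxiliary coordinates.
    exact mul_inv_cancel₀ (Nat.cast_ne_zero.2 Fintype.card_ne_zero)
  mean_eq := by
    simp only [noiseWeight, ← Finset.smul_sum]
    rw [Fintype.sum_prod_type, Fintype.sum_option]
    simp [noiseVec]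

theorem pd_smul {Y : Type} [NormedAddCommGroup Y] [NormedSpace ℝ Y] {F : Y → ℝ}
    (hF : ContDiff ℝ ((⊤ : ℕ∞) : WithTop ℕ∞) F) (c : ℝ) (e y : Y) :
    pd (c • e) (pd (c • e) F) y = c ^ 2 * pd e (pd e F) y := by
  have h : pd (c • e) F = fun y => c * pd e F y := funext fun y => by simp [pd]
  have h2 : DifferentiableAt ℝ (pd e F) y := (contDiff_pd hF e).differentiable (by simp) y
  rw [h]
  unfold pd at h2 ⊢
  rw [fderiv_const_mul h2, map_smul]
  simp only [ContinuousLinearMap.smul_apply, smul_eq_mul]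
  ring

/-- The number of indices under the root in `noiseVec` cancels the uniform weight, and the two
opposite signs cancel the factor 1/2. -/
theorem sum_noise (hα : ∀ j, 0 < α j) (hβ : 0 < β) {F : Phase (Vec d) d m → ℝ}
    (hF : ContDiff ℝ ((⊤ : ℕ∞) : WithTop ℕ∞) F) (y : Phase (Vec d) d m) :
    (∑ s, noiseWeight d m s * pd (noiseVec α β s) (pd (noiseVec α β s) F) y) / 2 =
      ∑ r : Fin m × Fin d, α r.1 * β⁻¹ * pd (unitVec (cz r)) (pd (unitVec (cz r)) F) y := by
  rw [Fintype.sum_prod_type, Fintype.sum_option]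
  have h0 : (Fintype.card (Option (Fin m × Fin d) × Bool) : ℝ) ≠ 0 :=
    Nat.cast_ne_zero.2 Fintype.card_ne_zero
  have h1 : ∀ r : Fin m × Fin d, √(Fintype.card (Option (Fin m × Fin d) × Bool) *
      (α r.1 * β⁻¹)) ^ 2 = Fintype.card (Option (Fin m × Fin d) × Bool) * (α r.1 * β⁻¹) :=
    fun r => Real.sq_sqrt (mul_nonneg (Nat.cast_nonneg _)
      (mul_nonneg (hα _).le (inv_nonneg.2 hβ.le)))
  have h2 : pd (0 : Phase (Vec d) d m) (pd 0 F) y = 0 := by simp [pd]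
  simp only [Fintype.univ_bool, Finset.mem_singleton, Bool.true_eq_false, not_false_eq_true,
    Finset.sum_insert, Finset.sum_singleton, noiseVec, noiseWeight, pd_smul hF, neg_sq, h1, h2,
    mul_zero, add_zero, zero_add]
  rw [Finset.sum_div]
  refine Finset.sum_congr rfl fun r _ => ?_
  field_simp
  ring

/-- One step of the Markov chain with the drift given by the force `-g`. -/
noncomputable def chain (π : Vec d → Q) (α lam : Fin m → ℝ) (β : ℝ)
    (g : Fin d → Phase Q d m → ℝ) (τ : ℝ) : (Phase Q d m → ℝ) →ₗ[ℝ] (Phase Q d m → ℝ) where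
  toFun f x := ∑ s, noiseWeight d m s *
    f (x + proj π (τ • drift α lam g x + √τ • noiseVec α β s))
  map_add' f g := by
    funext x
    simp only [Pi.add_apply, mul_add, Finset.sum_add_distrib]
  map_smul' c f := by
    funext x
    simp only [Pi.smul_apply, smul_eq_mul, RingHom.id_apply, Finset.mul_sum]
    exact Finset.sum_congr rfl fun s _ => by ring

variable (hπ : IsCover π)
include hπ

theorem lift_chain (g : Fin d → Phase Q d m → ℝ) (τ : ℝ) (f : Phase Q d m → ℝ) :
    lift π (chain π α lam β g τ f) = avg (noiseWeight d m) (noiseVec α β)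
      (fun y => drift α lam g (proj π y)) τ (lift π f) := by
  funext y
  simp only [chain, lift, avg, LinearMap.coe_mk, AddHom.coe_mk, ← hπ.proj_add, add_assoc]

theorem lift_der {f : Phase Q d m → ℝ} (hf : Differentiable ℝ (lift π f)) (v : Coord d m) :
    lift π (der π v f) = pd (unitVec v) (lift π f) := hπ.lift_dir _ hf

/-- This puts the generator in the form against which `avgError` measures the chain. -/
theorem lift_opL (hα : ∀ j, 0 < α j) (hβ : 0 < β) {f : Phase Q d m → ℝ} (hf : f ∈ testFun π m)
    (y : Phase (Vec d) d m) : lift π (opL π V α lam β f) y =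
      -fderiv ℝ (lift π f) y (drift α lam (force π V m) (proj π y)) -
      (∑ s, noiseWeight d m s * pd (noiseVec α β s) (pd (noiseVec α β s) (lift π f)) y) / 2 := by
  have hd : Differentiable ℝ (lift π f) := hf.1.differentiable (by simp)
  have h1 : ∀ v, der π v f (proj π y) = fderiv ℝ (lift π f) y (unitVec v) := fun v =>
    congrFun (lift_der hπ hd v) y
  have h2 : ∀ v, der π v (der π v f) (proj π y) = pd (unitVec v) (pd (unitVec v) (lift π f)) y :=
    fun v => by
      have h3 := congrFun (lift_der hπ (f := der π v f) (by
        rw [lift_der hπ hd]; exact (contDiff_pd hf.1 _).differentiable (by simp)) v) y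
      rw [lift_der hπ hd] at h3
      exact h3
  rw [sum_noise hα hβ hf.1, ← sum_coef_smul, map_sum]
  simp only [map_smul, smul_eq_mul]
  change opL π V α lam β f (proj π y) = _
  rw [opL_eq]
  simp only [h1, h2]

variable [ProperSpace Q]

/-- Since the drift grows linearly and τK ≤ 1/2, one step moves x by at most half of 1 + ‖x‖ plus a
constant, so only points of a bounded set can reach the support of f. On a compact support thus
follows a compact support. -/
theorem chain_mem {g : Fin d → Phase Q d m → ℝ}
    (hg : ContDiff ℝ ((⊤ : ℕ∞) : WithTop ℕ∞) fun y : Phase (Vec d) d m =>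
      drift α lam g (proj π y)) {K : ℝ} (hK : ∀ x, ‖drift α lam g x‖ ≤ K * (1 + ‖x‖)) {τ : ℝ}
    (hτ : 0 ≤ τ) (hτK : τ * K ≤ 1 / 2) {f : Phase Q d m → ℝ} (hf : f ∈ testFun π m) :
    chain π α lam β g τ f ∈ testFun π m := by
  refine ⟨?_, ?_⟩
  · rw [lift_chain hπ]
    exact contDiff_avg hg τ hf.1
  · obtain ⟨R, hR⟩ := hf.2.isCompact.isBounded.subset_closedBall 0
    obtain ⟨K', hK'⟩ : ∃ K', ∀ s, ‖noiseVec (d := d) α β s‖ ≤ K' :=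
      ⟨∑ s, ‖noiseVec (d := d) α β s‖, fun s =>
        Finset.single_le_sum (fun s _ => norm_nonneg (noiseVec (d := d) α β s)) (Finset.mem_univ s)⟩
    refine HasCompactSupport.of_support_subset_isCompact
      (isCompact_closedBall (0 : Phase Q d m) (2 * R + 1 + 2 * (√τ * K'))) fun x hx => ?_
    obtain ⟨s, -, hs⟩ := Finset.exists_ne_zero_of_sum_ne_zero hx
    have h1 := hR (subset_tsupport _ (right_ne_zero_of_mul hs :
      f (x + proj π (τ • drift α lam g x + √τ • noiseVec α β s)) ≠ 0))
    rw [mem_closedBall_zero_iff] at h1 ⊢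
    have h2 : ‖proj π (τ • drift α lam g x + √τ • noiseVec α β s)‖ ≤
        1 / 2 * (1 + ‖x‖) + √τ * K' := by
      refine (hπ.norm_proj_le _).trans ((norm_add_le _ _).trans (add_le_add ?_ ?_))
      · rw [norm_smul, Real.norm_eq_abs, abs_of_nonneg hτ]
        refine (mul_le_mul_of_nonneg_left (hK x) hτ).trans ?_
        rw [← mul_assoc]
        gcongr
      · rw [norm_smul, Real.norm_eq_abs, abs_of_nonneg (Real.sqrt_nonneg τ)]
        exact mul_le_mul_of_nonneg_left (hK' s) (Real.sqrt_nonneg τ)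
    have h3 : ‖x‖ ≤ ‖x + proj π (τ • drift α lam g x + √τ • noiseVec α β s)‖ +
        ‖proj π (τ • drift α lam g x + √τ • noiseVec α β s)‖ := by
      have := norm_sub_le (x + proj π (τ • drift α lam g x + √τ • noiseVec α β s))
        (proj π (τ • drift α lam g x + √τ • noiseVec α β s))
      rwa [add_sub_cancel_right] at this
    linarith

end Drift

/-! ### Truncated Neumann series for the resolvent of the chain. -/

section Neumann

/-- The truncated Neumann series of the resolvent of `(1 - T) / τ`. -/
noncomputable def neumann {E : Type*} [AddCommGroup E] [Module ℝ E] (T : E →ₗ[ℝ] E) (τ l : ℝ)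
    (N : ℕ) (f : E) : E := τ • ∑ n ∈ Finset.range N, ((1 + l * τ)⁻¹) ^ (n + 1) • (T ^ n) f

/-- A telescoping sum, because (1 + lτ) κ = 1 for κ = (1 + lτ)⁻¹; the last term is the truncation
error. -/
theorem neumann_eq {E : Type*} [AddCommGroup E] [Module ℝ E] (T : E →ₗ[ℝ] E) {τ l : ℝ}
    (hτ : 0 < τ) (hl : 0 ≤ l) (N : ℕ) (f : E) :
    l • neumann T τ l N f + τ⁻¹ • (neumann T τ l N f - T (neumann T τ l N f)) =
      f - ((1 + l * τ)⁻¹) ^ N • (T ^ N) f := by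
  have hk : 1 + l * τ ≠ 0 := by positivity
  obtain ⟨κ, hκ⟩ : ∃ κ, κ = (1 + l * τ)⁻¹ := ⟨_, rfl⟩
  have hκ' : (1 + l * τ) * κ = 1 := by rw [hκ]; exact mul_inv_cancel₀ hk
  have h1 : ∀ N, ∑ n ∈ Finset.range N, (κ ^ n • (T ^ n) f - κ ^ (n + 1) • (T ^ (n + 1)) f) =
      f - κ ^ N • (T ^ N) f := fun N => by
    rw [Finset.sum_range_sub' fun n => κ ^ n • (T ^ n) f]
    simp
  unfold neumann
  rw [← hκ, ← h1, map_smul, map_sum, ← smul_sub, smul_smul τ⁻¹, inv_mul_cancel₀ hτ.ne', one_smul,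
    smul_smul, Finset.smul_sum, ← Finset.sum_sub_distrib, ← Finset.sum_add_distrib]
  refine Finset.sum_congr rfl fun n _ => ?_
  rw [map_smul, ← Module.End.mul_apply, ← pow_succ', smul_smul, ← add_sub_assoc, ← add_smul]
  congr 2
  calc l * τ * κ ^ (n + 1) + κ ^ (n + 1) = (1 + l * τ) * κ * κ ^ n := by ring
    _ = κ ^ n := by rw [hκ', one_mul]

/-- A geometric bound for the Neumann series. -/
theorem neumann_bound {τ l c : ℝ} (hτ : 0 < τ) (hc : 0 ≤ c) (hcτ : c * τ ≤ 1 / 2)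
    (hl : 2 * c + 1 ≤ l) : ∃ ρ, 0 ≤ ρ ∧ ρ < 1 ∧ (1 + l * τ)⁻¹ * Real.exp (c * τ) = ρ ∧
      ∀ N, τ * ∑ n ∈ Finset.range N, ((1 + l * τ)⁻¹) ^ (n + 1) * Real.exp (c * τ) ^ n ≤ 1 := by
  have hl0 : 0 < 1 + l * τ := by
    have : 0 ≤ l := by linarith
    positivity
  obtain ⟨κ, hκ⟩ : ∃ κ, κ = (1 + l * τ)⁻¹ := ⟨_, rfl⟩
  have hκ0 : 0 < κ := hκ ▸ inv_pos.2 hl0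
  have he : Real.exp (c * τ) ≤ 1 + 2 * (c * τ) := by
    have h1 := Real.one_sub_le_exp_neg (c * τ)
    rw [Real.exp_neg] at h1
    have h2 : 0 < 1 - c * τ := by linarith
    have h3 : Real.exp (c * τ) ≤ (1 - c * τ)⁻¹ := (le_inv_comm₀ h2 (Real.exp_pos _)).1 h1
    refine h3.trans ?_
    rw [inv_le_iff_one_le_mul₀ h2]
    have h4 : 0 ≤ c * τ := by positivity
    nlinarith
  -- With exp(cτ) ≤ 1 + 2cτ and l ≥ 2c + 1, the discount beats the growth by τκ. This makes the
  -- series τκ ∑ (1 - τκ)^n, whose partial sums are at most 1 whatever τ is.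
  have hρ : κ * Real.exp (c * τ) ≤ 1 - τ * κ := by
    have h1 : Real.exp (c * τ) + τ ≤ 1 + l * τ := by nlinarith
    have h2 := mul_le_mul_of_nonneg_left h1 hκ0.le
    have h3 : κ * (1 + l * τ) = 1 := hκ ▸ inv_mul_cancel₀ hl0.ne'
    rw [h3] at h2
    linarith
  have hτκ : 0 < τ * κ := mul_pos hτ hκ0
  have hρ0 : 0 ≤ κ * Real.exp (c * τ) := by positivity
  rw [← hκ]
  refine ⟨_, hρ0, by linarith, rfl, fun N => ?_⟩
  have h1 : ∀ n ∈ Finset.range N, κ ^ (n + 1) * Real.exp (c * τ) ^ n ≤ κ * (1 - τ * κ) ^ n :=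
    fun n _ => by
      rw [pow_succ', mul_assoc, ← mul_pow]
      exact mul_le_mul_of_nonneg_left (pow_le_pow_left₀ hρ0 hρ n) hκ0.le
  refine (mul_le_mul_of_nonneg_left (Finset.sum_le_sum h1) hτ.le).trans ?_
  rw [← Finset.mul_sum, ← mul_assoc]
  have h2 := mul_neg_geom_sum (1 - τ * κ) N
  rw [sub_sub_cancel] at h2
  rw [h2]
  have : 0 ≤ (1 - τ * κ) ^ N := pow_nonneg (by linarith) N
  linarith

end Neumann

/-! ### Bounds of the consistency error and of its first derivatives. -/

section Bounds

variable {Y : Type} [NormedAddCommGroup Y] [NormedSpace ℝ Y]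
  {W W' : Type} [NormedAddCommGroup W] [NormedSpace ℝ W] [NormedAddCommGroup W'] [NormedSpace ℝ W']

theorem DerLE.clm {k : ℕ} {γ M : ℝ} {F : Y → W} (h : DerLE k γ M F) (T : W →L[ℝ] W') :
    DerLE k γ (‖T‖ * M) (fun y => T (F y)) := by
  refine ⟨T.contDiff.comp h.1, fun j hj y => ?_⟩
  refine (T.norm_iteratedFDeriv_comp_left (h.contDiff_nat j).contDiffAt le_rfl).trans ?_
  rw [mul_assoc]
  exact mul_le_mul_of_nonneg_left (h.2 j hj y) (norm_nonneg _)

theorem derLE_const {k : ℕ} {γ : ℝ} (hγ : 0 ≤ γ) (A : W) :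
    DerLE k γ ‖A‖ (fun _ : Y => A) := by
  refine ⟨contDiff_const, fun j _ y => ?_⟩
  rcases j with _ | j
  · simp
  · rw [iteratedFDeriv_const_of_ne (Nat.succ_ne_zero j)]
    simp only [Pi.zero_apply, norm_zero]
    positivity

theorem DerLE.pd {k : ℕ} {γ A : ℝ} {F : Y → ℝ} (h : DerLE k γ A (fderiv ℝ F)) (hA : 0 ≤ A)
    (hγ : 0 ≤ γ) (e : Y) : DerLE k γ (‖e‖ * A) (pd e F) := by
  have h1 := h.clm (ContinuousLinearMap.apply ℝ ℝ e)
  refine h1.mono le_rfl (mul_le_mul_of_nonneg_right ?_ hA) hγ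
  refine ContinuousLinearMap.opNorm_le_bound _ (norm_nonneg _) fun L => ?_
  rw [mul_comm]
  exact L.le_opNorm e

theorem DerLE.norm_fderiv {k : ℕ} {A : ℝ} {F : Y → W} (h : DerLE (k + 1) 1 A F) (y : Y) :
    ‖_root_.fderiv ℝ F y‖ ≤ A := by
  have := h.der_right.norm_le y
  rwa [mul_one] at this

theorem DerLE.norm_fderiv_fderiv {k : ℕ} {A : ℝ} {F : Y → W} (h : DerLE (k + 2) 1 A F) (y : Y) :
    ‖_root_.fderiv ℝ (_root_.fderiv ℝ F) y‖ ≤ A := by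
  have := h.der_right
  rw [mul_one] at this
  exact this.norm_fderiv y

variable {S : Type} [Fintype S] {w : S → ℝ} {v : S → Y} (hw : IsNoise w v)
include hw

/-- Bounds of the error of the Markov chain, and of its derivatives. -/
theorem avgError_bounds {b : Y → Y} (hb : ContDiff ℝ ((⊤ : ℕ∞) : WithTop ℕ∞) b) {L K A τ : ℝ}
    (hL : ∀ y, ‖fderiv ℝ b y‖ ≤ L) (hK1 : 1 ≤ K) (hK : ∀ s, ‖v s‖ ≤ K) (hA : 0 ≤ A)
    (hτ : 0 < τ) {F : Y → ℝ} (hF : ContDiff ℝ ((⊤ : ℕ∞) : WithTop ℕ∞) F)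
    (h : DerLE 3 1 A (fderiv ℝ F)) (y : Y) :
    |avgError w v b τ F y| ≤ (2 * K + K ^ 3 + L * K) * A *
      (min 1 (τ * ‖b y‖ + √τ) * ‖b y‖ + √τ + τ * ‖b y‖) ∧
    ∀ e : Y, ‖e‖ ≤ 1 → |pd e (avgError w v b τ F) y| ≤ (2 * K + K ^ 3 + L * K) * A *
      (min 1 (τ * ‖b y‖ + √τ) * ‖b y‖ + √τ + τ * ‖b y‖) := by
  have hL0 : 0 ≤ L := (norm_nonneg _).trans (hL y)
  have hs0 : 0 ≤ √τ := Real.sqrt_nonneg τ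
  have hb0 : 0 ≤ ‖b y‖ := norm_nonneg _
  have hmin0 : 0 ≤ min 1 (τ * ‖b y‖ + √τ) := le_min zero_le_one (by positivity)
  have hmin : min (2 * A) (A * (τ * ‖b y‖ + √τ * K)) ≤ 2 * K * A * min 1 (τ * ‖b y‖ + √τ) := by
    rw [mul_min_of_nonneg _ _ (by positivity)]
    refine min_le_min ?_ ?_
    · nlinarith
    · have h1 : τ * ‖b y‖ + √τ * K ≤ K * (τ * ‖b y‖ + √τ) := by
        have : 0 ≤ τ * ‖b y‖ := by positivity
        nlinarith
      have h2 : 0 ≤ K * (τ * ‖b y‖ + √τ) := by positivity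
      nlinarith
  have hpd : ∀ (e : Y), ‖e‖ ≤ 1 → DerLE 3 1 A (pd e F) := fun e he =>
    (h.pd hA zero_le_one e).mono le_rfl (mul_le_of_le_one_left hA he) zero_le_one
  have main : ∀ {G : Y → ℝ}, ContDiff ℝ ((⊤ : ℕ∞) : WithTop ℕ∞) G → DerLE 2 1 A (fderiv ℝ G) →
      |avgError w v b τ G y| ≤ 2 * K * A * min 1 (τ * ‖b y‖ + √τ) * ‖b y‖ +
        K ^ 3 * A * √τ := fun {G} hG hGA => by
    have h1 := abs_avgError_le hw b hτ hG hK (fun z => hGA.norm_le z)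
      (fun z => hGA.norm_fderiv z) (M'' := K * A) (fun s z => by
        have h2 := (hGA.pd hA zero_le_one (v s)).norm_fderiv_fderiv z
        exact h2.trans (mul_le_mul_of_nonneg_right (hK s) hA)) y
    refine h1.trans (add_le_add (mul_le_mul_of_nonneg_right hmin hb0) (le_of_eq ?_))
    ring
  have hp1 : 0 ≤ K ^ 3 * A * (min 1 (τ * ‖b y‖ + √τ) * ‖b y‖) := by positivity
  have hp2 : 0 ≤ L * K * A * (min 1 (τ * ‖b y‖ + √τ) * ‖b y‖) := by positivity
  have hp3 : 0 ≤ (2 * K + L * K) * A * √τ := by positivity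
  have hp4 : 0 ≤ (2 * K + K ^ 3) * A * (τ * ‖b y‖) := by positivity
  have hp5 : 0 ≤ 2 * K * A * √τ := by positivity
  have hp6 : 0 ≤ (2 * K + K ^ 3 + L * K) * A * (τ * ‖b y‖) := by positivity
  refine ⟨(main hF (h.mono (by norm_num) le_rfl zero_le_one)).trans (by linarith), fun e he => ?_⟩
  unfold GLE.pd
  rw [fderiv_avgError hw hb hτ hF]
  -- The derivative of the error contains the error for ∂_e F, which costs one more derivative;
  -- hence the hypothesis of order 3 on `fderiv ℝ F`.
  have h1 := main (contDiff_pd hF e) (by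
    have := (hpd e he).der_right
    rwa [mul_one] at this)
  have h2 : |∑ s, w s * (fderiv ℝ F (y + τ • b y + √τ • v s) - fderiv ℝ F y) (fderiv ℝ b y e)| ≤
      L * K * A * (√τ + τ * ‖b y‖) := by
    refine (Finset.abs_sum_le_sum_abs _ _).trans ?_
    refine (Finset.sum_le_sum fun s _ => (?_ : _ ≤ w s * (L * K * A * (√τ + τ * ‖b y‖)))).trans ?_
    · rw [abs_mul, abs_of_nonneg (hw.nonneg s)]
      refine mul_le_mul_of_nonneg_left ?_ (hw.nonneg s)
      have h3 := norm_fderiv_sub_le hF (fun z => h.norm_fderiv z) (y + τ • b y + √τ • v s) y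
      have h4 : ‖y + τ • b y + √τ • v s - y‖ ≤ K * (√τ + τ * ‖b y‖) := by
        rw [show y + τ • b y + √τ • v s - y = τ • b y + √τ • v s by abel]
        refine (norm_add_le _ _).trans ?_
        rw [norm_smul, norm_smul, Real.norm_eq_abs, Real.norm_eq_abs, abs_of_pos hτ,
          abs_of_nonneg hs0]
        have h5 := mul_le_mul_of_nonneg_left (hK s) hs0
        have h6 : 0 ≤ τ * ‖b y‖ := by positivity
        nlinarith
      have h5 : ‖fderiv ℝ b y e‖ ≤ L := ((fderiv ℝ b y).le_opNorm e).trans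
        ((mul_le_mul (hL y) he (norm_nonneg _) hL0).trans (le_of_eq (mul_one L)))
      refine ((fderiv ℝ F (y + τ • b y + √τ • v s) - fderiv ℝ F y).le_opNorm
        (fderiv ℝ b y e)).trans ?_
      calc _ ≤ (A * (K * (√τ + τ * ‖b y‖))) * L :=
            mul_le_mul (h3.trans (mul_le_mul_of_nonneg_left h4 hA)) h5 (norm_nonneg _)
              (by positivity)
        _ = _ := by ring
    · rw [← Finset.sum_mul, hw.sum_eq, one_mul]
  refine (abs_add_le _ _).trans ((add_le_add h1 h2).trans ?_)
  linarith

end Bounds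

/-! ### The drift with mollified force. -/

section Force

variable {Q : Type} [NormedAddCommGroup Q] {d m : ℕ} {π : Vec d → Q} {α lam : Fin m → ℝ}

/-- Bounds of the derivatives of the mollified drift. -/
theorem exists_derLE_drift (hπ : IsCover π) {g : Fin d → Phase Q d m → ℝ}
    (hg : ∀ i, Continuous (lift π (g i))) {c : ℝ} (hc : 0 ≤ c)
    (hLip : ∀ i x y, |lift π (g i) x - lift π (g i) y| ≤ c * ‖x - y‖) :
    ∃ L : ℝ, 0 ≤ L ∧ ∀ δ : ℝ, 0 < δ →
      ContDiff ℝ ((⊤ : ℕ∞) : WithTop ℕ∞) (fun y : Phase (Vec d) d m =>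
        drift α lam (fun i => mollify π δ (g i)) (proj π y)) ∧
      DerLE 3 δ⁻¹ L (fderiv ℝ fun y : Phase (Vec d) d m =>
        drift α lam (fun i => mollify π δ (g i)) (proj π y)) := by
  choose C hC0 hC using fun k : ℕ =>
    exists_norm_iteratedFDeriv_blur_le (Y := Phase (Vec d) d m) volume k
  let A := (linDrift (d := d) α lam).comp (ContinuousLinearMap.snd ℝ (Vec d) _)
  let T : Fin d → (Phase (Vec d) d m →L[ℝ] ℝ) →L[ℝ] (Phase (Vec d) d m →L[ℝ] Phase (Vec d) d m) :=
    fun i => (ContinuousLinearMap.smulRightL ℝ _ _).flip (unitVec (cp i))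
  let C' := ∑ k ∈ Finset.range 4, C k
  have hC' : ∀ k ≤ 3, C k ≤ C' := fun k hk =>
    Finset.single_le_sum (f := C) (fun k _ => hC0 k) (Finset.mem_range.2 (by omega))
  have hC'0 : 0 ≤ C' := Finset.sum_nonneg fun k _ => hC0 k
  -- The constant does not involve δ: the factors δ⁻¹ from higher derivatives are exactly those
  -- allowed by the weights.
  refine ⟨‖A‖ + ∑ i, |(-1 : ℝ)| * (‖T i‖ * (C' * c)), by positivity, fun δ hδ => ?_⟩
  have hδ' : 0 ≤ δ⁻¹ := (inv_pos.2 hδ).le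
  have hsm : ∀ i, ContDiff ℝ ((⊤ : ℕ∞) : WithTop ℕ∞) (lift π (mollify π δ (g i))) := fun i => by
    rw [hπ.lift_mollify]
    exact contDiff_blur volume hδ.ne' (hg i)
  have e : (fun y : Phase (Vec d) d m => drift α lam (fun i => mollify π δ (g i)) (proj π y)) =
      fun y => A y - ∑ i, lift π (mollify π δ (g i)) y • unitVec (cp i) := rfl
  have hd : fderiv ℝ (fun y : Phase (Vec d) d m =>
      drift α lam (fun i => mollify π δ (g i)) (proj π y)) =
      fun y => A + ∑ i, (-1 : ℝ) • T i (fderiv ℝ (lift π (mollify π δ (g i))) y) := by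
    funext y
    rw [e]
    have h1 : HasFDerivAt (fun y => A y - ∑ i, lift π (mollify π δ (g i)) y • unitVec (cp i)) _ y :=
      A.hasFDerivAt.sub (HasFDerivAt.fun_sum fun i _ =>
        (((hsm i).differentiable (by simp)) y).hasFDerivAt.smul_const (unitVec (cp i)))
    rw [h1.fderiv, sub_eq_add_neg, ← Finset.sum_neg_distrib]
    congr 1
    refine Finset.sum_congr rfl fun i _ => ?_
    exact (neg_one_smul ℝ (T i (fderiv ℝ (lift π (mollify π δ (g i))) y))).symm
  refine ⟨?_, ?_⟩
  · rw [e]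
    exact A.contDiff.sub (ContDiff.sum fun i _ => (hsm i).smul contDiff_const)
  · rw [hd]
    refine (derLE_const hδ' A).add (DerLE.sum _ fun i _ => ((DerLE.clm ?_ (T i)).smul (-1)))
    refine ⟨(hsm i).fderiv_right (by norm_num), fun j hj y => ?_⟩
    rw [norm_iteratedFDeriv_fderiv, hπ.lift_mollify]
    refine (hC j c δ _ hc hδ (hg i) (hLip i) y).trans ?_
    have := hC' j hj
    gcongr

end Force

/-! ### Iterates of the chain, and square integrable majorants. -/

section Estimates

variable {Q : Type} [NormedAddCommGroup Q] {d m : ℕ} {π : Vec d → Q} {V : Q → ℝ}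
  {α lam : Fin m → ℝ} {β : ℝ}

theorem norm_unitVec_le (v : Coord d m) : ‖(unitVec v : Phase (Vec d) d m)‖ ≤ 1 := by
  have h0 : ‖(0 : Fin m → Vec d)‖ ≤ 1 := by simp
  rcases v with i | i | r
  · simp [unitVec, Prod.norm_def]
  · simp [unitVec, Prod.norm_def]
  · simp only [unitVec, Prod.norm_def, norm_zero]
    refine max_le zero_le_one (max_le zero_le_one ((pi_norm_le_iff_of_nonneg zero_le_one).2 ?_))
    intro j
    by_cases hj : j = r.1
    · subst hj; simp
    · simp [Pi.single_apply, hj]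

theorem drift_eq_add (g g' : Fin d → Phase Q d m → ℝ) (x : Phase Q d m) :
    drift α lam g x = drift α lam g' x + ∑ i, (g' i x - g i x) • unitVec (cp i) := by
  simp only [drift, sub_smul, Finset.sum_sub_distrib]
  abel

section

variable (hπ : IsCover π)
include hπ

theorem abs_der_le {f : Phase Q d m → ℝ} (hf : Differentiable ℝ (lift π f)) {M : ℝ}
    (hM : ∀ y, ‖fderiv ℝ (lift π f) y‖ ≤ M) (v : Coord d m) (x : Phase Q d m) :
    |der π v f x| ≤ M := by
  obtain ⟨y, rfl⟩ := hπ.proj_surjective x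
  have h1 : der π v f (proj π y) = fderiv ℝ (lift π f) y (unitVec v) :=
    congrFun (lift_der hπ hf v) y
  rw [h1]
  refine ((fderiv ℝ (lift π f) y).le_opNorm _).trans ?_
  exact (mul_le_of_le_one_right (norm_nonneg _) (norm_unitVec_le v)).trans (hM y)

theorem abs_der_der_le {f : Phase Q d m → ℝ}
    (hf : ContDiff ℝ ((⊤ : ℕ∞) : WithTop ℕ∞) (lift π f)) {M : ℝ}
    (hM : ∀ y, ‖fderiv ℝ (fderiv ℝ (lift π f)) y‖ ≤ M) (v w : Coord d m) (x : Phase Q d m) :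
    |der π v (der π w f) x| ≤ M := by
  have h1 := lift_der hπ (hf.differentiable (by simp)) w
  refine abs_der_le hπ (f := der π w f) ?_ (fun y => ?_) v x
  · rw [h1]
    exact (contDiff_pd hf _).differentiable (by simp)
  · rw [h1]
    refine (norm_fderiv_pd_le hf hM _ y).trans ?_
    exact mul_le_of_le_one_right ((ContinuousLinearMap.opNorm_nonneg _).trans (hM 0))
      (norm_unitVec_le w)

variable [ProperSpace Q]

/-- The iterates of the chain and the truncated resolvents are controlled. -/
theorem chain_pow {g : Fin d → Phase Q d m → ℝ} {K L γ M M0 τ : ℝ}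
    (hb : ContDiff ℝ ((⊤ : ℕ∞) : WithTop ℕ∞) fun y : Phase (Vec d) d m =>
      drift α lam g (proj π y)) (hK : ∀ x, ‖drift α lam g x‖ ≤ K * (1 + ‖x‖))
    (hτ : 0 ≤ τ) (hτK : τ * K ≤ 1 / 2) (hL : 0 ≤ L) (hγ : 0 ≤ γ)
    (hD : DerLE 3 γ L (fderiv ℝ fun y : Phase (Vec d) d m => drift α lam g (proj π y)))
    {f : Phase Q d m → ℝ} (hf : f ∈ testFun π m) (hM0 : ∀ x, |f x| ≤ M0) (hM : 0 ≤ M)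
    (hfM : DerLE 3 γ M (fderiv ℝ (lift π f))) (n : ℕ) :
    (chain π α lam β g τ ^ n) f ∈ testFun π m ∧ (∀ x, |(chain π α lam β g τ ^ n) f x| ≤ M0) ∧
      DerLE 3 γ (Real.exp (64 * L * τ) ^ n * M)
        (fderiv ℝ (lift π ((chain π α lam β g τ ^ n) f))) := by
  induction n with
  | zero =>
    rw [pow_zero, Module.End.one_apply, pow_zero, one_mul]
    exact ⟨hf, hM0, hfM⟩
  | succ n ih =>
    obtain ⟨h1, h2, h3⟩ := ih
    rw [pow_succ' (chain π α lam β g τ), Module.End.mul_apply]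
    refine ⟨chain_mem hπ hb hK hτ hτK h1, fun x => ?_, ?_⟩
    · obtain ⟨y, rfl⟩ := hπ.proj_surjective x
      have := abs_avg_le (isNoise (d := d) α β) (fun y => drift α lam g (proj π y)) τ
        (F := lift π ((chain π α lam β g τ ^ n) f)) (fun y => h2 (proj π y)) y
      rwa [← lift_chain hπ] at this
    · rw [lift_chain hπ]
      -- For derivatives of order up to k = 3 the rate (k+1) 2^{k+1} equals 64.
      have := DerLE.avg (isNoise (d := d) α β) hb hL hγ hτ hD (by positivity) h1.1 h3
      refine this.mono le_rfl (le_of_eq ?_) hγ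
      rw [pow_succ' (Real.exp _), mul_assoc (Real.exp (64 * L * τ)), show (((3 : ℕ) : ℝ) + 1) * 2 ^ (3 + 1) * L * τ = 64 * L * τ by
        norm_num]

/-- The growth exp(64Lτ) per step is beaten by the discount (1 + lτ)⁻¹ as soon as l ≥ 128L + 1. The
approximate resolvent therefore keeps the derivative bound M of f itself, and the truncation error
decays geometrically together with its first derivatives. -/
theorem neumann_spec {g : Fin d → Phase Q d m → ℝ} {K L γ M M0 τ l : ℝ}
    (hb : ContDiff ℝ ((⊤ : ℕ∞) : WithTop ℕ∞) fun y : Phase (Vec d) d m =>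
      drift α lam g (proj π y)) (hK : ∀ x, ‖drift α lam g x‖ ≤ K * (1 + ‖x‖))
    (hτ : 0 < τ) (hτK : τ * K ≤ 1 / 2) (hL : 0 ≤ L) (hγ : 0 ≤ γ)
    (hD : DerLE 3 γ L (fderiv ℝ fun y : Phase (Vec d) d m => drift α lam g (proj π y)))
    (hLτ : 64 * L * τ ≤ 1 / 2) (hl : 2 * (64 * L) + 1 ≤ l)
    {f : Phase Q d m → ℝ} (hf : f ∈ testFun π m) (hM0 : ∀ x, |f x| ≤ M0) (hM : 0 ≤ M)
    (hfM : DerLE 3 γ M (fderiv ℝ (lift π f))) :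
    (∀ N, neumann (chain π α lam β g τ) τ l N f ∈ testFun π m ∧
      DerLE 3 γ M (fderiv ℝ (lift π (neumann (chain π α lam β g τ) τ l N f)))) ∧
    ∃ ρ : ℝ, 0 ≤ ρ ∧ ρ < 1 ∧ ∀ N,
      ((1 + l * τ)⁻¹) ^ N • (chain π α lam β g τ ^ N) f ∈ testFun π m ∧
      (∀ x, |(((1 + l * τ)⁻¹) ^ N • (chain π α lam β g τ ^ N) f) x| ≤ ρ ^ N * M0) ∧
      ∀ v x, |der π v (((1 + l * τ)⁻¹) ^ N • (chain π α lam β g τ ^ N) f) x| ≤ ρ ^ N * M := by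
  have hp := chain_pow (β := β) hπ hb hK hτ.le hτK hL hγ hD hf hM0 hM hfM
  obtain ⟨ρ, hρ0, hρ1, hρ, hsum⟩ := neumann_bound hτ (by positivity) hLτ hl
  have hl0 : 0 ≤ l := le_trans (by positivity) hl
  have hκ : 0 ≤ (1 + l * τ)⁻¹ := inv_nonneg.2 (by positivity)
  refine ⟨fun N => ⟨Submodule.smul_mem _ _ (Submodule.sum_mem _ fun n _ =>
    Submodule.smul_mem _ _ (hp n).1), ?_⟩, ρ, hρ0, hρ1, fun N => ⟨Submodule.smul_mem _ _ (hp N).1,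
    fun x => ?_, fun v x => ?_⟩⟩
  · have e : fderiv ℝ (lift π (neumann (chain π α lam β g τ) τ l N f)) = fun y =>
        ∑ n ∈ Finset.range N, (τ * ((1 + l * τ)⁻¹) ^ (n + 1)) •
          fderiv ℝ (lift π ((chain π α lam β g τ ^ n) f)) y := by
      have e1 : lift π (neumann (chain π α lam β g τ) τ l N f) = fun y =>
        ∑ n ∈ Finset.range N, (τ * ((1 + l * τ)⁻¹) ^ (n + 1)) *
          lift π ((chain π α lam β g τ ^ n) f) y := by
        funext y
        simp only [lift, neumann, Pi.smul_apply, Finset.sum_apply, smul_eq_mul, Finset.mul_sum,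
          mul_assoc]
      funext y
      rw [e1, fderiv_fun_sum fun n _ =>
        (((hp n).1.1.differentiable (by simp)) y).const_mul _]
      exact Finset.sum_congr rfl fun n _ => fderiv_const_mul
        (((hp n).1.1.differentiable (by simp)) y) _
    rw [e]
    refine (DerLE.sum _ fun n _ => (hp n).2.2.smul _).mono le_rfl ?_ hγ
    have h1 := mul_le_mul_of_nonneg_right (hsum N) hM
    rw [one_mul, Finset.mul_sum, Finset.sum_mul] at h1
    refine le_trans (le_of_eq (Finset.sum_congr rfl fun n _ => ?_)) h1
    rw [abs_of_nonneg (by positivity)]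
    ring
  · rw [Pi.smul_apply, smul_eq_mul, abs_mul, abs_of_nonneg (by positivity)]
    have h2 : (1 + l * τ)⁻¹ ^ N ≤ ρ ^ N := by
      refine pow_le_pow_left₀ hκ ?_ N
      rw [← hρ]
      exact le_mul_of_one_le_right hκ (Real.one_le_exp (by positivity))
    exact mul_le_mul h2 ((hp N).2.1 x) (abs_nonneg _) (by positivity)
  · rw [der_smul hπ (compactC_mono (by exact_mod_cast le_top) (hp N).1), Pi.smul_apply, smul_eq_mul, abs_mul,
      abs_of_nonneg (by positivity), ← hρ, mul_pow, mul_assoc]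
    exact mul_le_mul_of_nonneg_left (abs_der_le hπ ((hp N).1.1.differentiable (by simp))
      (hp N).2.2.norm_le v x) (by positivity)

end

variable [ProperSpace Q] [MeasureSpace Q] [BorelSpace Q] [(volume : Measure Q).IsAddHaarMeasure]

namespace IsSetting

variable (h : IsSetting π V β)
include h

theorem norm_sobolev_le {f : compactC π m 1} {B : Phase Q d m → ℝ}
    (hB : MemLp B 2 (gibbs m V β)) (h0 : ∀ x, |f.1 x| ≤ B x) (h1 : ∀ v x, |der π v f.1 x| ≤ B x) :
    ‖h.sobolev f‖ ≤ Fintype.card (Option (Coord d m)) * ‖cls (gibbs m V β) B‖ := by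
  refine (norm_le_sum_norm _).trans ?_
  rw [← nsmul_eq_mul, ← Finset.card_univ, ← Finset.sum_const]
  refine Finset.sum_le_sum fun i _ => ?_
  rw [← one_mul ‖cls (gibbs m V β) B‖]
  rcases i with _ | v
  · exact norm_cls_le (h.memLp f.2) hB fun x => by
      rw [one_mul]
      exact (h0 x).trans (le_abs_self _)
  · exact norm_cls_le (h.memLp_der f.2 v) hB fun x => by
      rw [one_mul]
      exact (h1 v x).trans (le_abs_self _)

theorem integrable_of_weight {f : Phase Q d m → ℝ} (hf : Continuous f)
    (hi : Integrable fun x => f x * Real.exp (gibbsExp m V β x)) : Integrable f (gibbs m V β) := by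
  change Integrable f (volume.tilted (gibbsExp m V β))
  rw [integrable_tilted_iff]
  · refine hi.congr (Eventually.of_forall fun x => ?_)
    simp only [smul_eq_mul]
    ring
  all_goals exact (h.potential.integrable_exp h.pos)

theorem continuous_force (i : Fin d) : Continuous (force (d := d) π V m i) :=
  h.cover.continuous_of_lift (contDiff_lift_gradV h.cover h.potential.contDiff i).continuous

theorem memLp_force (i : Fin d) : MemLp (force (d := d) π V m i) 2 (gibbs m V β) := by
  rw [memLp_two_iff_integrable_sq (h.continuous_force i).aestronglyMeasurable]
  refine h.integrable_of_weight ((h.continuous_force i).pow 2) ?_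
  have hβ := h.pos
  refine (integrable_weight (d := d) (m := m) (h.potential.integrable_grad i) (half_pos hβ)
    (half_pos hβ)).congr (Eventually.of_forall fun x => ?_)
  simp only [exp_gibbsExp, force]
  ring

theorem memLp_norm_snd : MemLp (fun x : Phase Q d m => ‖x.2‖) 2 (gibbs m V β) := by
  have hβ := h.pos
  have hc : Continuous fun x : Phase Q d m => ‖x.2‖ := continuous_snd.norm
  rw [memLp_two_iff_integrable_sq hc.aestronglyMeasurable]
  refine h.integrable_of_weight (hc.pow 2) ?_
  have hV : Continuous V := by
    have := h.potential.contDiff.continuous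
    exact h.cover.isOpenQuotientMap.isQuotientMap.continuous_iff.2 this
  have hw := (integrable_weight (d := d) (m := m) h.potential.integrable
    (a := β / 4) (b := β / 4) (by positivity) (by positivity)).const_mul (4 / β)
  refine hw.mono' ?_ (Eventually.of_forall fun x => ?_)
  · refine (Continuous.aestronglyMeasurable ?_)
    refine (hc.pow 2).mul (Real.continuous_exp.comp ?_)
    unfold gibbsExp
    fun_prop
  · obtain ⟨s, hs⟩ : ∃ s, s = ‖x.2.1‖ ^ 2 + ∑ j, ‖x.2.2 j‖ ^ 2 := ⟨_, rfl⟩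
    have hs0 : 0 ≤ ∑ j, ‖x.2.2 j‖ ^ 2 := Finset.sum_nonneg fun j _ => by positivity
    have h1 : ‖x.2‖ ^ 2 ≤ s := by
      have h2 : ‖x.2‖ ≤ √s := by
        refine max_le ?_ ((pi_norm_le_iff_of_nonneg (Real.sqrt_nonneg _)).2 fun j => ?_)
        · exact Real.le_sqrt_of_sq_le (by rw [hs]; linarith)
        · refine Real.le_sqrt_of_sq_le ?_
          have h3 := Finset.single_le_sum (f := fun j => ‖x.2.2 j‖ ^ 2)
            (fun j _ => by positivity) (Finset.mem_univ j)
          rw [hs]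
          have := sq_nonneg ‖x.2.1‖
          linarith
      have h3 := pow_le_pow_left₀ (norm_nonneg _) h2 2
      rwa [Real.sq_sqrt (by rw [hs]; positivity)] at h3
    have e : ∀ c : ℝ, Real.exp (-c * ‖x.2.1‖ ^ 2) * ∏ j, Real.exp (-c * ‖x.2.2 j‖ ^ 2) =
        Real.exp (-c * s) := fun c => by
      rw [← Real.exp_sum, ← Real.exp_add, ← Finset.mul_sum, hs]
      ring_nf
    rw [exp_gibbsExp, e, e, Real.norm_eq_abs, abs_of_nonneg (by positivity)]
    -- Half of the Gaussian decay is traded for the factor s.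
    have h4 : s * Real.exp (-(β / 2) * s) ≤ 4 / β * Real.exp (-(β / 4) * s) := by
      have h5 : β / 4 * s ≤ Real.exp (β / 4 * s) := by
        linarith [Real.add_one_le_exp (β / 4 * s)]
      have h6 : Real.exp (-(β / 4) * s) = Real.exp (β / 4 * s) * Real.exp (-(β / 2) * s) := by
        rw [← Real.exp_add]; ring_nf
      rw [h6, ← mul_assoc]
      refine mul_le_mul_of_nonneg_right ?_ (Real.exp_pos _).le
      calc s = 4 / β * (β / 4 * s) := by field_simp
        _ ≤ _ := by gcongr
    calc ‖x.2‖ ^ 2 * (Real.exp (-β * V x.1) * Real.exp (-(β / 2) * s))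
        ≤ s * (Real.exp (-β * V x.1) * Real.exp (-(β / 2) * s)) := by gcongr
      _ = Real.exp (-β * V x.1) * (s * Real.exp (-(β / 2) * s)) := by ring
      _ ≤ Real.exp (-β * V x.1) * (4 / β * Real.exp (-(β / 4) * s)) := by gcongr
      _ = _ := by ring

omit h in
theorem norm_drift_le (g : Fin d → Phase Q d m → ℝ) (x : Phase Q d m) :
    ‖drift α lam g x‖ ≤ ‖linDrift (d := d) α lam‖ * ‖x.2‖ + ∑ i, |g i x| := by
  refine (norm_sub_le _ _).trans (add_le_add (ContinuousLinearMap.le_opNorm _ _)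
    ((norm_sum_le _ _).trans (Finset.sum_le_sum fun i _ => ?_)))
  rw [norm_smul, Real.norm_eq_abs]
  exact mul_le_of_le_one_right (abs_nonneg _) (norm_unitVec_le _)

omit h [ProperSpace Q] [MeasureSpace Q] [BorelSpace Q] [(volume : Measure Q).IsAddHaarMeasure] in
theorem continuous_drift {g : Fin d → Phase Q d m → ℝ} (hg : ∀ i, Continuous (g i)) :
    Continuous (drift α lam g) :=
  ((linDrift α lam).continuous.comp continuous_snd).sub
    (continuous_finset_sum _ fun i _ => (hg i).smul continuous_const)

/-- Provides the majorant for the discretization error; the square integrability of ∇V enters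
through `memLp_force`. -/
theorem memLp_drift {g : Fin d → Phase Q d m → ℝ} (hg : ∀ i, Continuous (g i)) {C : ℝ}
    (hgC : ∀ i x, |g i x - force π V m i x| ≤ C) :
    MemLp (fun x => ‖drift α lam g x‖) 2 (gibbs m V β) := by
  have := h.isProbabilityMeasure (m := m)
  have h1 : MemLp (fun x : Phase Q d m => ‖linDrift (d := d) α lam‖ * ‖x.2‖ +
      ∑ i : Fin d, (‖force π V m i x‖ + C)) 2 (gibbs m V β) :=
    ((h.memLp_norm_snd (d := d)).const_mul _).add (memLp_finset_sum _ fun i _ =>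
      (h.memLp_force i).norm.add (memLp_const C))
  refine h1.mono' (continuous_drift hg).norm.aestronglyMeasurable (Eventually.of_forall fun x => ?_)
  rw [norm_norm]
  refine (norm_drift_le g x).trans (add_le_add le_rfl (Finset.sum_le_sum fun i _ => ?_))
  have := abs_sub_abs_le_abs_sub (g i x) (force π V m i x)
  rw [Real.norm_eq_abs]
  linarith [hgC i x]

theorem exists_norm_drift_le (C : ℝ) : ∃ K, 0 ≤ K ∧ ∀ g : Fin d → Phase Q d m → ℝ,
    (∀ i x, |g i x - force π V m i x| ≤ C) → ∀ x, ‖drift α lam g x‖ ≤ K * (1 + ‖x‖) := by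
  obtain ⟨K, hK⟩ := h.growth
  refine ⟨‖linDrift (d := d) α lam‖ + ∑ _i : Fin d, (|K| + |C|), by positivity, fun g hg x => ?_⟩
  refine (norm_drift_le g x).trans ?_
  rw [add_mul, Finset.sum_mul]
  have h0 : 0 ≤ ‖x‖ := norm_nonneg x
  refine add_le_add (mul_le_mul_of_nonneg_left ?_ (norm_nonneg _))
    (Finset.sum_le_sum fun i _ => ?_)
  · exact (norm_snd_le x).trans (by linarith)
  · have h1 := abs_sub_abs_le_abs_sub (g i x) (force π V m i x)
    have h2 : |force π V m i x| ≤ |K| * (1 + ‖x‖) := (hK i x.1).trans (by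
      have : ‖x.1‖ ≤ ‖x‖ := norm_fst_le x
      have h3 := norm_nonneg x.1
      calc K * (1 + ‖x.1‖) ≤ |K| * (1 + ‖x.1‖) := by gcongr; exact le_abs_self K
        _ ≤ |K| * (1 + ‖x‖) := by gcongr)
    have h3 : C ≤ |C| * (1 + ‖x‖) := (le_abs_self C).trans
      (le_mul_of_one_le_right (abs_nonneg C) (by linarith))
    linarith [hg i x]

theorem exists_norm_fderiv_force_le : ∃ c, 0 ≤ c ∧
    ∀ i y, ‖fderiv ℝ (lift π (force (d := d) π V m i)) y‖ ≤ c := by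
  obtain ⟨c, hc⟩ := h.potential.hessian
  have hc0 : 0 ≤ c := le_trans (ContinuousLinearMap.opNorm_nonneg _) (hc 0)
  refine ⟨∑ _v : Coord d m, c, Finset.sum_nonneg fun _ _ => hc0, fun i y =>
    (norm_le_sum_unitVec _).trans (Finset.sum_le_sum fun v _ => ?_)⟩
  have hd : Differentiable ℝ (lift π (force (d := d) π V m i)) :=
    (contDiff_lift_gradV h.cover h.potential.contDiff i).differentiable (by norm_num)
  have h1 : fderiv ℝ (lift π (force (d := d) π V m i)) y (unitVec v) =
      der π v (force π V m i) (proj π y) := (congrFun (lift_der h.cover hd v) y).symm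
  rw [h1, Real.norm_eq_abs]
  rcases v with k | k | r
  · exact abs_der_gradV_le h.cover h.potential.contDiff hc k i _
  · unfold force
    rw [der_gradV_of_ne h.cover _ (by simp), abs_zero]
    exact hc0
  · unfold force
    rw [der_gradV_of_ne h.cover _ (by simp), abs_zero]
    exact hc0

end IsSetting

end Estimates

/-! ### Density of the range of l + 𝓛 in the Sobolev space. -/

section Range

variable {Q : Type} [NormedAddCommGroup Q] {d m : ℕ} {π : Vec d → Q} {V : Q → ℝ}
  {α lam : Fin m → ℝ} {β : ℝ}

theorem DerLE.one_scale {Y : Type} [NormedAddCommGroup Y] [NormedSpace ℝ Y]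
    {W : Type} [NormedAddCommGroup W] [NormedSpace ℝ W] {k : ℕ} {γ M : ℝ} {F : Y → W}
    (h : DerLE k γ M F) (hM : 0 ≤ M) (hγ : 1 ≤ γ) : DerLE k 1 (M * γ ^ k) F := by
  refine ⟨h.1, fun j hj y => (h.2 j hj y).trans ?_⟩
  rw [one_pow, mul_one]
  exact mul_le_mul_of_nonneg_left (pow_le_pow_right₀ hγ hj) hM

theorem IsCover.der_sub (hπ : IsCover π) {f g : Phase Q d m → ℝ}
    (hf : Differentiable ℝ (lift π f)) (hg : Differentiable ℝ (lift π g)) (v : Coord d m) :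
    der π v (f - g) = der π v f - der π v g := by
  have h := hπ.dir_add (g := (-1 : ℝ) • g) hf (hg.const_smul (-1)) (unitVec v)
  rw [hπ.dir_const_smul hg, neg_one_smul, neg_one_smul, ← sub_eq_add_neg, ← sub_eq_add_neg] at h
  exact h

/-- The lift of a compactly supported function need not have compact support, but the norm of its
derivative takes the same value at points with the same projection, so it descends to a continuous
compactly supported function. -/
theorem IsCover.exists_norm_iteratedFDeriv_le (hπ : IsCover π) {f : Phase Q d m → ℝ}
    (hf : f ∈ compactC π m ((⊤ : ℕ∞) : WithTop ℕ∞)) (j : ℕ) :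
    ∃ M, 0 ≤ M ∧ ∀ y, ‖iteratedFDeriv ℝ j (lift π f) y‖ ≤ M := by
  have hinv : ∀ y y' : Phase (Vec d) d m, proj π y = proj π y' →
      iteratedFDeriv ℝ j (lift π f) y = iteratedFDeriv ℝ j (lift π f) y' := fun y y' h => by
    have h1 : (fun z => lift π f (y + z)) = fun z => lift π f (y' + z) := by
      funext z
      simp only [lift, hπ.proj_add, h]
    have h2 := iteratedFDeriv_comp_add_left (𝕜 := ℝ) (f := lift π f) j y 0
    have h3 := iteratedFDeriv_comp_add_left (𝕜 := ℝ) (f := lift π f) j y' 0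
    rw [h1, h3, add_zero, add_zero] at h2
    exact h2.symm
  let n : Phase Q d m → ℝ := fun x =>
    ‖iteratedFDeriv ℝ j (lift π f) (hπ.proj_surjective x).choose‖
  have hn : ∀ y, n (proj π y) = ‖iteratedFDeriv ℝ j (lift π f) y‖ := fun y => by
    simp only [n, hinv _ y (hπ.proj_surjective (proj π y)).choose_spec]
  have hc : Continuous n := hπ.continuous_of_lift <| by
    rw [show lift π n = fun y => ‖iteratedFDeriv ℝ j (lift π f) y‖ from funext hn]
    exact (hf.1.continuous_iteratedFDeriv (by exact_mod_cast le_top)).norm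
  have hs : HasCompactSupport n := hf.2.mono' fun x hx => by
    obtain ⟨y, rfl⟩ := hπ.proj_surjective x
    have h1 : y ∈ Function.support (iteratedFDeriv ℝ j (lift π f)) := fun h0 => hx (by
      rw [hn, h0, norm_zero])
    have h2 : tsupport (lift π f) ⊆ proj π ⁻¹' tsupport f :=
      closure_minimal (fun z hz => subset_tsupport _ hz)
        ((isClosed_tsupport f).preimage hπ.isOpenQuotientMap_proj.continuous)
    exact h2 (support_iteratedFDeriv_subset (𝕜 := ℝ) j h1)
  obtain ⟨M, hM⟩ := hs.exists_bound_of_continuous hc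
  refine ⟨M, (norm_nonneg _).trans (hM 0), fun y => ?_⟩
  rw [← hn]
  exact (le_abs_self _).trans (hM _)

theorem IsCover.exists_derLE (hπ : IsCover π) {f : Phase Q d m → ℝ} (hf : f ∈ testFun π m)
    (k : ℕ) : ∃ M, 0 ≤ M ∧ DerLE k 1 M (fderiv ℝ (lift π f)) := by
  choose M hM0 hM using fun j => hπ.exists_norm_iteratedFDeriv_le hf j
  refine ⟨∑ j ∈ Finset.range (k + 1), M (j + 1), Finset.sum_nonneg fun j _ => hM0 _,
    hf.1.fderiv_right (by norm_num), fun j hj y => ?_⟩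
  rw [norm_iteratedFDeriv_fderiv, one_pow, mul_one]
  exact (hM _ y).trans (Finset.single_le_sum (f := fun j => M (j + 1)) (fun j _ => hM0 _)
    (Finset.mem_range.2 (by omega)))

variable [ProperSpace Q] [MeasureSpace Q] [BorelSpace Q] [(volume : Measure Q).IsAddHaarMeasure]

namespace IsSetting

variable (h : IsSetting π V β)
include h

theorem contDiff_lift_force (i : Fin d) : ContDiff ℝ 1 (lift π (force (d := d) π V m i)) :=
  contDiff_lift_gradV h.cover h.potential.contDiff i

theorem abs_lift_force_sub_le {c : ℝ}
    (hc : ∀ i y, ‖fderiv ℝ (lift π (force (d := d) π V m i)) y‖ ≤ c) (i : Fin d)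
    (x y : Phase (Vec d) d m) :
    |lift π (force π V m i) x - lift π (force π V m i) y| ≤ c * ‖x - y‖ :=
  convex_univ.norm_image_sub_le_of_norm_fderiv_le
    (fun z _ => (h.contDiff_lift_force i).differentiable (by norm_num) z) (fun z _ => hc i z)
    (Set.mem_univ y) (Set.mem_univ x)

theorem abs_mollify_force_sub_le {c : ℝ} (hc0 : 0 ≤ c)
    (hc : ∀ i y, ‖fderiv ℝ (lift π (force (d := d) π V m i)) y‖ ≤ c) (i : Fin d) {δ : ℝ}
    (hδ : 0 ≤ δ) (x : Phase Q d m) :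
    |mollify π δ (force π V m i) x - force π V m i x| ≤ c * δ := by
  obtain ⟨y, rfl⟩ := h.cover.proj_surjective x
  have := abs_blur_sub_le volume (h.contDiff_lift_force i).continuous
    (h.abs_lift_force_sub_le hc i) hc0 hδ y
  rwa [← h.cover.lift_mollify] at this

/-- The error caused by the mollification of the force. -/
theorem eventually_norm_forceError_le {M ε : ℝ} (hM : 0 ≤ M) (hε : 0 < ε) :
    ∀ᶠ δ in 𝓝[>] (0 : ℝ), ∀ (u : testFun π m) (e : compactC π m 1),
      DerLE 3 δ⁻¹ M (fderiv ℝ (lift π u.1)) →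
      e.1 = ∑ i, (force π V m i - mollify π δ (force π V m i)) * der π (cp i) u.1 →
      ‖h.sobolev e‖ ≤ ε := by
  have := h.isProbabilityMeasure (m := m)
  obtain ⟨c, hc0, hc⟩ := h.exists_norm_fderiv_force_le (m := m)
  have hF := h.contDiff_lift_force (m := m)
  have hFd := fun i => (hF i).differentiable (by norm_num)
  have hmol : ∀ {δ : ℝ}, 0 < δ → ∀ i,
      ContDiff ℝ ((⊤ : ℕ∞) : WithTop ℕ∞) (lift π (mollify π δ (force (d := d) π V m i))) :=
    fun hδ i => by
      rw [h.cover.lift_mollify]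
      exact contDiff_blur volume hδ.ne' (hF i).continuous
  let G : ℝ → Fin d → Phase Q d m → ℝ := fun δ i => force π V m i - mollify π δ (force π V m i)
  have hG1 : ∀ {δ : ℝ}, 0 < δ → ∀ i, ContDiff ℝ 1 (lift π (G δ i)) := fun hδ i =>
    (hF i).sub ((hmol hδ i).of_le (by exact_mod_cast le_top))
  have hdF : ∀ v i, Continuous (lift π (der π v (force (d := d) π V m i))) := fun v i =>
    (h.cover.contDiff_dir (k := 0) (hF i) (by norm_num) _).continuous
  have hdG : ∀ {δ : ℝ}, 0 < δ → ∀ i v, der π v (G δ i) =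
      der π v (force π V m i) - mollify π δ (der π v (force π V m i)) := fun hδ i v => by
    rw [h.cover.der_sub (hFd i) ((hmol hδ i).differentiable (by simp)),
      h.cover.der_mollify (hF i) (hc i) hδ.ne']
  have hb0 : ∀ {δ : ℝ}, 0 < δ → ∀ i x, |G δ i x| ≤ c * δ := fun hδ i x => by
    rw [← abs_neg]
    simpa [G] using h.abs_mollify_force_sub_le hc0 hc i hδ.le x
  have hbd : ∀ i v x, |der π v (force (d := d) π V m i) x| ≤ c := fun i v x =>
    abs_der_le h.cover (hFd i) (hc i) v x
  have hb1 : ∀ {δ : ℝ}, 0 < δ → ∀ i v x, |der π v (G δ i) x| ≤ c + c := fun hδ i v x => by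
    rw [hdG hδ]
    exact (abs_sub _ _).trans (add_le_add (hbd i v x)
      (h.cover.abs_mollify_le (hdF v i) (hbd i v) _ x))
  -- A majorant for the error and its first derivatives: first derivatives of u are at most M, but
  -- second derivatives may be as large as M δ⁻¹, hence the term δ⁻¹ |G|. The Lipschitz bound |G| ≤
  -- cδ keeps D bounded, so pointwise convergence suffices.
  let D : ℝ → Phase Q d m → ℝ := fun δ x =>
    ∑ i, M * (|G δ i x| + ∑ v, |der π v (G δ i) x| + δ⁻¹ * |G δ i x|)
  have hDc : ∀ {δ : ℝ}, 0 < δ → Continuous (D δ) := fun hδ => by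
    have h1 := fun i => h.cover.continuous_of_lift (hG1 hδ i).continuous
    have h2 := fun i v => h.cover.continuous_of_lift
      (h.cover.contDiff_dir (k := 0) (hG1 hδ i) (by norm_num) (unitVec v)).continuous
    exact continuous_finset_sum _ fun i _ => continuous_const.mul (((h1 i).abs.add
      (continuous_finset_sum _ fun v _ => (h2 i v).abs)).add (continuous_const.mul (h1 i).abs))
  have hD0 : ∀ {δ : ℝ}, 0 < δ → ∀ x, 0 ≤ D δ x := fun hδ x => by positivity
  have hDb : ∀ {δ : ℝ}, 0 < δ → δ ≤ 1 → ∀ x, |D δ x| ≤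
      ∑ _i : Fin d, M * (c + ∑ _v : Coord d m, (c + c) + c) := fun {δ} hδ hδ1 x => by
    rw [abs_of_nonneg (hD0 hδ x)]
    refine Finset.sum_le_sum fun i _ => mul_le_mul_of_nonneg_left (add_le_add (add_le_add ?_
      (Finset.sum_le_sum fun v _ => hb1 hδ i v x)) ?_) hM
    · exact (hb0 hδ i x).trans (mul_le_of_le_one_right hc0 hδ1)
    · rw [inv_mul_le_iff₀ hδ, mul_comm]
      exact hb0 hδ i x
  have hpos : ∀ᶠ δ in 𝓝[>] (0 : ℝ), 0 < δ := self_mem_nhdsWithin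
  have hle : ∀ᶠ δ in 𝓝[>] (0 : ℝ), δ ≤ 1 := mem_nhdsWithin_of_mem_nhds (Iic_mem_nhds one_pos)
  have hDm : ∀ {δ : ℝ}, 0 < δ → δ ≤ 1 → MemLp (D δ) 2 (gibbs m V β) := fun hδ hδ1 =>
    (memLp_const _).mono' (hDc hδ).aestronglyMeasurable (Eventually.of_forall (hDb hδ hδ1))
  have hle0 : 𝓝[>] (0 : ℝ) ≤ 𝓝 0 := nhdsWithin_le_nhds
  have hlim : ∀ x, Tendsto (fun δ => D δ x) (𝓝[>] 0) (𝓝 0) := fun x => by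
    have t1 : ∀ i, Tendsto (fun δ => |G δ i x|) (𝓝[>] 0) (𝓝 0) := fun i => by
      have := ((h.cover.tendsto_mollify (hF i).continuous x).mono_left hle0).const_sub
        (force π V m i x)
      rw [sub_self] at this
      simpa [G] using this.abs
    have t2 : ∀ i v, Tendsto (fun δ => |der π v (G δ i) x|) (𝓝[>] 0) (𝓝 0) := fun i v => by
      have := ((h.cover.tendsto_mollify (hdF v i) x).mono_left hle0).const_sub
        (der π v (force π V m i) x)
      rw [sub_self] at this
      have h2 := this.abs
      rw [abs_zero] at h2
      refine h2.congr' ?_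
      filter_upwards [hpos] with δ hδ
      rw [hdG hδ]
      rfl
    -- The decisive cancellation: the kernel is even and the force differentiable, so the
    -- mollification error is o(δ).
    have t3 : ∀ i, Tendsto (fun δ => δ⁻¹ * |G δ i x|) (𝓝[>] 0) (𝓝 0) := fun i => by
      obtain ⟨y, rfl⟩ := h.cover.proj_surjective x
      have := (tendsto_blur_sub_div volume (hF i).continuous (h.abs_lift_force_sub_le hc i) y
        (hFd i y)).abs
      rw [abs_zero] at this
      refine this.congr' ?_
      filter_upwards [hpos] with δ hδ
      rw [← h.cover.lift_mollify, abs_mul, abs_of_pos (inv_pos.2 hδ), abs_sub_comm]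
      rfl
    have h3 : Tendsto (fun δ => D δ x) (𝓝[>] 0)
        (𝓝 (∑ _i : Fin d, M * (0 + ∑ _v : Coord d m, 0 + 0))) :=
      tendsto_finset_sum _ fun i _ => (((t1 i).add (tendsto_finset_sum _ fun v _ => t2 i v)).add
        (t3 i)).const_mul M
    simpa using h3
  have key := (tendsto_norm_cls (μ := gibbs m V β) (l := 𝓝[>] (0 : ℝ)) (F := D)
    (memLp_const _) ((hpos.and hle).mono fun δ hδ => hDm hδ.1 hδ.2)
    ((hpos.and hle).mono fun δ hδ => hDb hδ.1 hδ.2) hlim).const_mul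
      (Fintype.card (Option (Coord d m)) : ℝ)
  rw [mul_zero] at key
  filter_upwards [hpos, hle, key.eventually (gt_mem_nhds hε)] with δ hδ hδ1 hδε u e hu he
  refine (h.norm_sobolev_le (hDm hδ hδ1) (fun x => ?_) fun v x => ?_).trans hδε.le
  · rw [he, Finset.sum_apply]
    refine (Finset.abs_sum_le_sum_abs _ _).trans (Finset.sum_le_sum fun i _ => ?_)
    rw [Pi.mul_apply, abs_mul, mul_comm]
    refine mul_le_mul (abs_der_le h.cover (u.2.1.differentiable (by simp)) hu.norm_le _ x) ?_
      (abs_nonneg _) hM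
    have h1 : 0 ≤ ∑ v, |der π v (G δ i) x| := by positivity
    have h2 : 0 ≤ δ⁻¹ * |G δ i x| := by positivity
    change |G δ i x| ≤ _
    linarith
  · have hdu : ∀ i, Differentiable ℝ (lift π (der π (cp i) u.1)) := fun i =>
      (h.cover.contDiff_dir (k := 1) u.2.1 (by norm_num; exact WithTop.coe_le_coe.2 le_top) _).differentiable (by norm_num)
    have hGd := fun i => (hG1 hδ i).differentiable (by norm_num)
    have e1 : der π v e.1 = ∑ i, (der π v (G δ i) * der π (cp i) u.1 +
        G δ i * der π v (der π (cp i) u.1)) := by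
      rw [he]
      refine (h.cover.dir_sum _ (fun i _ => (hGd i).mul (hdu i)) _).trans
        (Finset.sum_congr rfl fun i _ => h.cover.der_mul (hGd i) (hdu i) v)
    rw [e1, Finset.sum_apply]
    refine (Finset.abs_sum_le_sum_abs _ _).trans (Finset.sum_le_sum fun i _ => ?_)
    rw [Pi.add_apply, Pi.mul_apply, Pi.mul_apply]
    refine (abs_add_le _ _).trans ?_
    rw [abs_mul, abs_mul]
    have h1 := abs_der_le h.cover (u.2.1.differentiable (by simp)) hu.norm_le (cp i) x
    have h2 := abs_der_der_le h.cover u.2.1 (hu.der_right (k := 2)).norm_le v (cp i) x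
    have h3 : |der π v (G δ i) x| ≤ ∑ v, |der π v (G δ i) x| :=
      Finset.single_le_sum (f := fun v => |der π v (G δ i) x|) (fun _ _ => abs_nonneg _)
        (Finset.mem_univ v)
    have h4 := mul_le_mul h3 h1 (abs_nonneg _) ((abs_nonneg _).trans h3)
    have h5 := mul_le_mul_of_nonneg_left h2 (abs_nonneg (G δ i x))
    have h6 : 0 ≤ M * |G δ i x| := by positivity
    linarith

/-- The error caused by the discretization in time. -/
theorem eventually_norm_chainError_le {g : Fin d → Phase Q d m → ℝ} (hg : ∀ i, Continuous (g i))
    {C : ℝ} (hgC : ∀ i x, |g i x - force π V m i x| ≤ C)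
    (hb : ContDiff ℝ ((⊤ : ℕ∞) : WithTop ℕ∞) fun y : Phase (Vec d) d m =>
      drift α lam g (proj π y)) {L : ℝ}
    (hL : ∀ y, ‖fderiv ℝ (fun y : Phase (Vec d) d m => drift α lam g (proj π y)) y‖ ≤ L)
    {A ε : ℝ} (hA : 0 ≤ A) (hε : 0 < ε) :
    ∀ᶠ τ in 𝓝[>] (0 : ℝ), ∀ (u : testFun π m) (e : compactC π m 1),
      DerLE 3 1 A (fderiv ℝ (lift π u.1)) →
      lift π e.1 = avgError (noiseWeight d m) (noiseVec α β)
        (fun y => drift α lam g (proj π y)) τ (lift π u.1) →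
      ‖h.sobolev e‖ ≤ ε := by
  have := h.isProbabilityMeasure (m := m)
  obtain ⟨K, hK1, hK⟩ : ∃ K, 1 ≤ K ∧ ∀ s, ‖noiseVec (d := d) α β s‖ ≤ K :=
    ⟨1 + ∑ s, ‖noiseVec (d := d) α β s‖,
      le_add_of_nonneg_right (Finset.sum_nonneg fun s _ => norm_nonneg _), fun s =>
      (Finset.single_le_sum (fun s _ => norm_nonneg (noiseVec (d := d) α β s))
        (Finset.mem_univ s)).trans (le_add_of_nonneg_left zero_le_one)⟩
  have hL0 : 0 ≤ L := (norm_nonneg _).trans (hL 0)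
  obtain ⟨C0, hC0⟩ : ∃ C0, C0 = (2 * K + K ^ 3 + L * K) * A := ⟨_, rfl⟩
  have hC0' : 0 ≤ C0 := by rw [hC0]; positivity
  let b : Phase Q d m → ℝ := fun x => ‖drift α lam g x‖
  have hb0 : ∀ x, 0 ≤ b x := fun x => norm_nonneg _
  have hbm : MemLp b 2 (gibbs m V β) := h.memLp_drift hg hgC
  -- This majorant tends to 0 pointwise with τ and for τ ≤ 1 is at most C0 (2b + 1), which is square
  -- integrable.
  let D : ℝ → Phase Q d m → ℝ := fun τ x =>
    C0 * (min 1 (τ * b x + √τ) * b x + √τ + τ * b x)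
  have hDb : ∀ {τ : ℝ}, 0 < τ → τ ≤ 1 → ∀ x, |D τ x| ≤ C0 * (2 * b x + 1) :=
    fun {τ} hτ hτ1 x => by
      have h0 := hb0 x
      have h1 : 0 ≤ min 1 (τ * b x + √τ) := le_min zero_le_one (by positivity)
      rw [abs_of_nonneg (by positivity)]
      refine mul_le_mul_of_nonneg_left ?_ hC0'
      have h2 := mul_le_mul_of_nonneg_right (min_le_left 1 (τ * b x + √τ)) h0
      have h3 : √τ ≤ 1 := Real.sqrt_le_one.2 hτ1
      have h4 := mul_le_mul_of_nonneg_right hτ1 h0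
      linarith
  have hBm : MemLp (fun x => C0 * (2 * b x + 1)) 2 (gibbs m V β) :=
    ((hbm.const_mul 2).add (memLp_const 1)).const_mul C0
  have hDm : ∀ {τ : ℝ}, 0 < τ → τ ≤ 1 → MemLp (D τ) 2 (gibbs m V β) := fun {τ} hτ hτ1 => by
    refine hBm.mono' (Continuous.aestronglyMeasurable ?_) (Eventually.of_forall (hDb hτ hτ1))
    have : Continuous b := (continuous_drift hg).norm
    fun_prop
  have hpos : ∀ᶠ τ in 𝓝[>] (0 : ℝ), 0 < τ := self_mem_nhdsWithin
  have hle : ∀ᶠ τ in 𝓝[>] (0 : ℝ), τ ≤ 1 := mem_nhdsWithin_of_mem_nhds (Iic_mem_nhds one_pos)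
  have hlim : ∀ x, Tendsto (fun τ => D τ x) (𝓝[>] 0) (𝓝 0) := fun x => by
    have hc : Continuous fun τ => D τ x := by fun_prop
    exact (hc.tendsto' 0 0 (by simp [D])).mono_left nhdsWithin_le_nhds
  have key := (tendsto_norm_cls (μ := gibbs m V β) (l := 𝓝[>] (0 : ℝ)) (F := D)
    hBm ((hpos.and hle).mono fun τ hτ => hDm hτ.1 hτ.2)
    ((hpos.and hle).mono fun τ hτ => hDb hτ.1 hτ.2) hlim).const_mul
      (Fintype.card (Option (Coord d m)) : ℝ)
  rw [mul_zero] at key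
  filter_upwards [hpos, hle, key.eventually (gt_mem_nhds hε)] with τ hτ hτ1 hτε u e hu he
  have hE := avgError_bounds (isNoise (d := d) α β) hb hL hK1 hK hA hτ u.2.1 hu
  rw [← hC0] at hE
  refine (h.norm_sobolev_le (hDm hτ hτ1) (fun x => ?_) fun v x => ?_).trans hτε.le
  · obtain ⟨y, rfl⟩ := h.cover.proj_surjective x
    have := (hE y).1
    rw [← he] at this
    exact this
  · obtain ⟨y, rfl⟩ := h.cover.proj_surjective x
    have := (hE y).2 (unitVec v) (norm_unitVec_le v)
    rw [← he, ← lift_der h.cover (e.2.1.differentiable (by norm_num))] at this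
    exact this

/-- The range of the shifted generator is dense in the Sobolev space. -/
theorem exists_norm_sobolev_resolvent_lt (hα : ∀ j, 0 < α j) : ∃ l0 : ℝ, ∀ l ≥ l0,
    ∀ (f : testFun π m) (ε : ℝ), 0 < ε → ∃ u : testFun π m,
      ‖l • h.sobolev (incl u) + h.sobolev (h.gen α lam u) - h.sobolev (incl f)‖ < ε := by
  obtain ⟨c, hc0, hc⟩ := h.exists_norm_fderiv_force_le (m := m)
  have hF := h.contDiff_lift_force (m := m)
  obtain ⟨L, hL0, hL⟩ := exists_derLE_drift (α := α) (lam := lam) h.cover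
    (fun i => (hF i).continuous) hc0 (h.abs_lift_force_sub_le hc)
  obtain ⟨K, -, hK⟩ := h.exists_norm_drift_le (α := α) (lam := lam) (m := m) c
  -- The threshold depends on the Lipschitz constant of the force and the linear drift, not on δ, f
  -- or ε.
  refine ⟨2 * (64 * L) + 1, fun l hl f ε hε => ?_⟩
  obtain ⟨M, hM, hfM⟩ := h.cover.exists_derLE f.2 3
  obtain ⟨M0, hM0⟩ := h.cover.exists_bound f.2
  have hε4 : 0 < ε / 4 := by positivity
  have hpos : ∀ᶠ δ in 𝓝[>] (0 : ℝ), 0 < δ := self_mem_nhdsWithin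
  -- The order of choices matters: δ comes first, uniformly over all u with weighted bound M; then
  -- τ, for which the unweighted bound M δ⁻³ is admissible; the length N of the series comes last.
  obtain ⟨δ, hδE, hδ, hδ1⟩ := ((h.eventually_norm_forceError_le (m := m) hM hε4).and
    (hpos.and (mem_nhdsWithin_of_mem_nhds (Iic_mem_nhds one_pos)))).exists
  obtain ⟨g, hg⟩ : ∃ g : Fin d → Phase Q d m → ℝ, g = fun i => mollify π δ (force π V m i) :=
    ⟨_, rfl⟩
  have hgs : ∀ i, ContDiff ℝ ((⊤ : ℕ∞) : WithTop ℕ∞) (lift π (g i)) := fun i => by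
    rw [hg]
    simp only [h.cover.lift_mollify]
    exact contDiff_blur volume hδ.ne' (hF i).continuous
  have hgc : ∀ i x, |g i x - force π V m i x| ≤ c := fun i x => by
    rw [hg]
    exact (h.abs_mollify_force_sub_le hc0 hc i hδ.le x).trans (mul_le_of_le_one_right hc0 hδ1)
  obtain ⟨hb, hbL⟩ := hL δ hδ
  rw [← hg] at hb hbL
  have hγ : 1 ≤ δ⁻¹ := (one_le_inv₀ hδ).2 hδ1
  have hγ0 : 0 ≤ δ⁻¹ := zero_le_one.trans hγ
  have hfγ : DerLE 3 δ⁻¹ M (fderiv ℝ (lift π f.1)) := hfM.mono_scale hM zero_le_one hγ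
  have hsmall : ∀ a : ℝ, ∀ᶠ τ in 𝓝[>] (0 : ℝ), a * τ ≤ 1 / 2 := fun a => by
    have : Tendsto (fun τ : ℝ => a * τ) (𝓝[>] 0) (𝓝 0) :=
      ((continuous_const.mul continuous_id).tendsto' 0 0 (by simp)).mono_left nhdsWithin_le_nhds
    exact (this.eventually (gt_mem_nhds (by norm_num : (0 : ℝ) < 1 / 2))).mono fun τ h => h.le
  obtain ⟨τ, hτE, hτ, hτK, hτL⟩ := ((h.eventually_norm_chainError_le (m := m)
    (fun i => h.cover.continuous_of_lift (hgs i).continuous) hgc hb hbL.norm_le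
    (A := M * δ⁻¹ ^ 3) (by positivity) hε4).and (hpos.and
    ((hsmall K).and (hsmall (64 * L))))).exists
  obtain ⟨hu, ρ, hρ0, hρ1, hr⟩ := neumann_spec (β := β) h.cover hb (hK g hgc) hτ
    (by rwa [mul_comm]) hL0 hγ0 hbL hτL hl f.2 (fun x => (hM0 x).trans (le_abs_self M0)) hM hfγ
  obtain ⟨C, hC⟩ : ∃ C : ℝ, C = Fintype.card (Option (Coord d m)) *
    ((|M0| + M) * ‖cls (gibbs (d := d) m V β) fun _ => 1‖) := ⟨_, rfl⟩
  obtain ⟨N, hN⟩ : ∃ N : ℕ, ρ ^ N * C ≤ ε / 4 := by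
    have := (tendsto_pow_atTop_nhds_zero_of_lt_one hρ0 hρ1).mul_const C
    rw [zero_mul] at this
    obtain ⟨N, hN⟩ := (this.eventually (gt_mem_nhds hε4)).exists
    exact ⟨N, hN.le⟩
  have := h.isProbabilityMeasure (m := m)
  obtain ⟨hrm, hr0, hr1⟩ := hr N
  obtain ⟨hum, huD⟩ := hu N
  have hneu := neumann_eq (chain π α lam β g τ) hτ (l := l) (le_trans (by positivity) hl) N f.1
  obtain ⟨u, hu'⟩ : ∃ u : testFun π m, u.1 = neumann (chain π α lam β g τ) τ l N f.1 :=
    ⟨⟨_, hum⟩, rfl⟩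
  obtain ⟨r, hr'⟩ : ∃ r : testFun π m, r.1 =
    ((1 + l * τ)⁻¹) ^ N • (chain π α lam β g τ ^ N) f.1 := ⟨⟨_, hrm⟩, rfl⟩
  rw [← hu'] at huD hneu
  rw [← hr'] at hr0 hr1 hneu
  have hmem : ∑ i, (force π V m i - g i) * der π (cp i) u.1 ∈ compactC π m 1 :=
    Submodule.sum_mem _ fun i _ => mul_mem_compactC (f := force π V m i - g i)
      ((hF i).sub ((hgs i).of_le (by exact_mod_cast le_top)))
      (h.cover.der_mem (k := 1) (test_mem u.2 2) (by norm_num) _)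
  obtain ⟨e2, he2⟩ : ∃ e2 : compactC π m 1, e2.1 =
      ∑ i, (force π V m i - g i) * der π (cp i) u.1 := ⟨⟨_, hmem⟩, rfl⟩
  -- Defined so that l u + 𝓛u - f = e1 + e2 - r. The telescoping identity then shows that e1 is the
  -- discretization error, while e2 is the force error and r the truncation error.
  let e1 : compactC π m 1 := l • incl u + h.gen α lam u - incl f - e2 + incl r
  have he1 : lift π e1.1 = avgError (noiseWeight d m) (noiseVec α β)
      (fun y => drift α lam g (proj π y)) τ (lift π u.1) := by
    funext y
    have h1 := congrFun hneu (proj π y)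
    have h2 := lift_opL (α := α) (lam := lam) (V := V) h.cover hα h.pos u.2 y
    have h3 : fderiv ℝ (lift π u.1) y (drift α lam (force π V m) (proj π y)) =
        fderiv ℝ (lift π u.1) y (drift α lam g (proj π y)) - e2.1 (proj π y) := by
      rw [drift_eq_add (force π V m) g, map_add, map_sum, he2, Finset.sum_apply, sub_eq_add_neg,
        ← Finset.sum_neg_distrib]
      congr 1
      refine Finset.sum_congr rfl fun i _ => ?_
      have h4 := congrFun (lift_der h.cover (u.2.1.differentiable (by simp)) (cp i)) y
      change der π (cp i) u.1 (proj π y) = _ at h4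
      rw [map_smul, smul_eq_mul, Pi.mul_apply, Pi.sub_apply, h4, pd]
      ring
    have h4 := congrFun (lift_chain (β := β) (α := α) (lam := lam) h.cover g τ u.1) y
    have h5 : lift π e1.1 y = l * u.1 (proj π y) + lift π (opL π V α lam β u.1) y -
        f.1 (proj π y) - e2.1 (proj π y) + r.1 (proj π y) := rfl
    rw [h5, h2, h3]
    unfold avgError
    rw [← h4]
    simp only [Pi.add_apply, Pi.smul_apply, Pi.sub_apply, smul_eq_mul] at h1
    simp only [lift]
    linear_combination h1
  have hn1 := hτE u e1 (huD.one_scale hM hγ) he1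
  have hn2 := hδE u e2 huD (by rw [he2, hg])
  have hn3 : ‖h.sobolev (incl r)‖ ≤ ε / 4 := by
    have hB : MemLp (fun _ => ρ ^ N * (|M0| + M)) 2 (gibbs (d := d) m V β) := memLp_const _
    refine (h.norm_sobolev_le hB (fun x => (hr0 x).trans ?_)
      fun v x => (hr1 v x).trans ?_).trans (le_trans ?_ hN)
    · exact mul_le_mul_of_nonneg_left (le_add_of_nonneg_right hM) (by positivity)
    · exact mul_le_mul_of_nonneg_left (le_add_of_nonneg_left (abs_nonneg _)) (by positivity)
    · have h1 := norm_cls_le (C := ρ ^ N * (|M0| + M)) hB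
        (memLp_const (1 : ℝ) : MemLp (fun _ => (1 : ℝ)) 2 (gibbs (d := d) m V β)) fun x => by
          rw [abs_one, mul_one, abs_of_nonneg (by positivity)]
      rw [hC]
      refine (mul_le_mul_of_nonneg_left h1 (Nat.cast_nonneg _)).trans (le_of_eq ?_)
      ring
  refine ⟨u, ?_⟩
  have e : l • h.sobolev (incl u) + h.sobolev (h.gen α lam u) - h.sobolev (incl f) =
      h.sobolev e1 + h.sobolev e2 - h.sobolev (incl r) := by
    simp only [e1, map_add, map_sub, map_smul]
    abel
  rw [e]
  have h1 := norm_sub_le (h.sobolev e1 + h.sobolev e2) (h.sobolev (incl r))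
  have h2 := norm_add_le (h.sobolev e1) (h.sobolev e2)
  linarith

end IsSetting

end Range

/-! ### The commutators C_k on test functions, for V merely of class C². -/

section Mixed

variable {Q : Type} [NormedAddCommGroup Q] {d m : ℕ} {π : Vec d → Q} {V : Q → ℝ}
  {lam : Fin m → ℝ} {β : ℝ}

/-- `f` is `C^1` and its partial derivatives can be differentiated and commute with the one in
the direction of the coordinate `z_r`. -/
structure IsMixed (π : Vec d → Q) (r : Fin m × Fin d) (f : Phase Q d m → ℝ) : Prop where
  diff : Differentiable ℝ (lift π f)
  diff_der : Differentiable ℝ (lift π (der π (cz r) f))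
  comm : ∀ (v : Coord d m) (y : Phase (Vec d) d m),
    HasDerivAt (fun s : ℝ => lift π (der π v f) (y + s • unitVec (cz r)))
      (der π v (der π (cz r) f) (proj π y)) 0

/-- At zero friction β is irrelevant, so commutator formulas for the generator apply to B. -/
theorem opB_eq_opL (f : Phase Q d m → ℝ) : opB π V lam f = opL π V 0 lam β f := by
  funext x
  rw [opB_eq, opL_eq]
  simp

theorem der_neg (v : Coord d m) (f : Phase Q d m → ℝ) : der π v (-f) = -der π v f := by
  funext x
  exact deriv.fun_neg

theorem der_const (v : Coord d m) (c : ℝ) : der π v (fun _ : Phase Q d m => c) = 0 := by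
  funext x
  exact deriv_const _ _

variable (hπ : IsCover π)
include hπ

theorem hasDerivAt_lift_line {f : Phase Q d m → ℝ} (hf : Differentiable ℝ (lift π f))
    (v : Coord d m) (y : Phase (Vec d) d m) :
    HasDerivAt (fun s : ℝ => lift π f (y + s • unitVec v)) (der π v f (proj π y)) 0 := by
  have h := hπ.hasDerivAt_line (unitVec v) y 0 (hf _)
  unfold der
  rw [hπ.dir_proj _ (hf y)]
  simpa using h

namespace IsMixed

variable {r : Fin m × Fin d}

theorem of_contDiff {f : Phase Q d m → ℝ} (hf : ContDiff ℝ 2 (lift π f)) : IsMixed π r f := by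
  have hd : ∀ v, Differentiable ℝ (lift π (der π v f)) := fun v =>
    (hπ.contDiff_dir (k := 1) hf (by norm_num) _).differentiable (by norm_num)
  refine ⟨hf.differentiable (by norm_num), hd _, fun v y => ?_⟩
  rw [der_comm hπ hf]
  exact hasDerivAt_lift_line hπ (hd v) _ y

theorem mul {f g : Phase Q d m → ℝ} (hf : IsMixed π r f) (hg : IsMixed π r g) :
    IsMixed π r (f * g) := by
  have e := fun v => hπ.der_mul hf.diff hg.diff v
  refine ⟨hf.diff.mul hg.diff, ?_, fun v y => ?_⟩
  · rw [e]
    exact (hf.diff_der.mul hg.diff).add (hf.diff.mul hg.diff_der)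
  · have h1 := ((hf.comm v y).mul (hasDerivAt_lift_line hπ hg.diff (cz r) y)).add ((hasDerivAt_lift_line hπ hf.diff (cz r) y).mul (hg.comm v y))
    have e2 : der π v (der π (cz r) (f * g)) =
        der π v (der π (cz r) f) * g + der π (cz r) f * der π v g +
        (der π v f * der π (cz r) g + f * der π v (der π (cz r) g)) := by
      rw [e, ← hπ.der_mul hf.diff_der hg.diff, ← hπ.der_mul hf.diff hg.diff_der]
      exact hπ.dir_add (hf.diff_der.mul hg.diff) (hf.diff.mul hg.diff_der) _
    rw [e2, e]
    refine h1.congr_deriv ?_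
    simp only [lift, zero_smul, add_zero, Pi.add_apply, Pi.mul_apply]
    ring

theorem sum {ι : Type*} (s : Finset ι) {f : ι → Phase Q d m → ℝ} (hf : ∀ i, IsMixed π r (f i)) :
    IsMixed π r (∑ i ∈ s, f i) := by
  have e := fun v => hπ.dir_sum s (fun i _ => (hf i).diff) (unitVec v)
  refine ⟨?_, ?_, fun v y => ?_⟩
  · rw [show lift π (∑ i ∈ s, f i) = fun y => ∑ i ∈ s, lift π (f i) y by funext y; simp [lift]]
    exact Differentiable.fun_sum fun i _ => (hf i).diff
  · unfold der
    rw [e, show lift π (∑ i ∈ s, dir π (unitVec (cz r)) (f i)) =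
      fun y => ∑ i ∈ s, lift π (dir π (unitVec (cz r)) (f i)) y by funext y; simp [lift]]
    exact Differentiable.fun_sum fun i _ => (hf i).diff_der
  · have h1 := HasDerivAt.fun_sum (u := s) fun i _ => (hf i).comm v y
    unfold der at h1 ⊢
    have e2 := hπ.dir_sum s (fun i _ => (hf i).diff_der) (unitVec v)
    unfold der at e2
    rw [e, e, e2, Finset.sum_apply]
    refine h1.congr_of_eventuallyEq (Eventually.of_forall fun t => ?_)
    simp only [lift, Finset.sum_apply]

end IsMixed

variable (hV : ContDiff ℝ 2 (fun q => V (π q)))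
include hV

/-- The force ∂V need not be twice differentiable, but it does not depend on z: the z_r-derivatives
of the coefficients are constant, and their other derivatives are constant along the direction z_r.
-/
theorem isMixed_coef (r : Fin m × Fin d) (u : Coord d m) : IsMixed π r (coef π V 0 lam u) := by
  have hz : ∃ c, der π (cz r) (coef π V 0 lam u) = fun _ => c := by
    rcases u with i | i | s
    · exact ⟨_, funext fun x => der_p hπ _ i x⟩
    · exact ⟨_, funext fun x => (der_coef_p hπ hV _ i x).trans
        (congrArg (-· + _) (der_gradV_of_ne hπ (cz r) (by simp) i x))⟩
    · exact ⟨_, funext fun x => der_coef_z hπ hV _ s x⟩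
  obtain ⟨c, hc⟩ := hz
  refine ⟨differentiable_coef hπ hV u, ?_, fun v y => ?_⟩
  · rw [hc]
    exact differentiable_const c
  · rw [hc, der_const]
    have h0 : ∀ s : ℝ, lift π (der π v (coef π V 0 lam u)) (y + s • unitVec (cz r)) =
        lift π (der π v (coef π V 0 lam u)) y := fun s => by
      unfold lift
      rcases u with i | i | k
      · exact (der_p hπ v i _).trans (der_p hπ v i _).symm
      · rw [der_coef_p hπ hV, der_coef_p hπ hV]
        congr 2
        simp [der, dir, proj, unitVec]
      · exact (der_coef_z hπ hV v k _).trans (der_coef_z hπ hV v k _).symm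
    simp only [h0]
    exact hasDerivAt_const _ _

theorem isMixed_opB (r : Fin m × Fin d) {f : Phase Q d m → ℝ} (hf : ContDiff ℝ 3 (lift π f)) :
    IsMixed π r (opB π V lam f) := by
  have e : opB π V lam f = (fun _ => (-1 : ℝ)) * ∑ v, coef π V 0 lam v * der π v f := by
    funext x
    rw [opB_eq]
    simp
  rw [e]
  exact (IsMixed.of_contDiff hπ contDiff_const).mul hπ (IsMixed.sum hπ _ fun v =>
    (isMixed_coef hπ hV r v).mul hπ (IsMixed.of_contDiff hπ
      (hπ.contDiff_dir hf (by norm_num) _)))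

/-- Stated under `IsMixed` because C_2 f involves C_1 (B f), where B f is in general only C¹. All
derivatives that occur must be shown to exist, since `deriv` would otherwise silently be 0. -/
theorem opC_one {r : Fin m × Fin d} {f : Phase Q d m → ℝ} (hf : IsMixed π r f) :
    opC π V lam 1 r f = lam r.1 • der π (cp r.2) f := by
  funext x
  obtain ⟨y, rfl⟩ := hπ.proj_surjective x
  have h0 : opC π V lam 1 r f = fun x => -der π (cz r) (opB π V lam f) x -
    opB π V lam (-der π (cz r) f) x := rfl
  have h1 := (HasDerivAt.fun_sum (u := Finset.univ) fun v _ =>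
    (hasDerivAt_lift_line hπ (differentiable_coef (α := 0) (lam := lam) hπ hV v) (cz r) y).mul (hf.comm v y)).neg
  have h2 : der π (cz r) (opB π V lam f) (proj π y) = _ :=
    (hπ.dir_proj_eq_deriv (opB π V lam f) (unitVec (cz r)) y).trans
      (Eq.trans (congrArg (deriv · 0) (funext fun s => by
        unfold lift
        rw [opB_eq]
        rfl)) h1.deriv)
  have h3 := congrFun (der_cz_coef (α := 0) (lam := lam) hπ hV r f) (proj π y)
  rw [h0]
  simp only [h2, opB_eq, der_neg]
  simp only [Finset.sum_apply, Pi.mul_apply, Pi.sub_apply, Pi.smul_apply, smul_eq_mul,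
    Pi.zero_apply, zero_mul, sub_zero] at h3
  rw [Pi.smul_apply, smul_eq_mul, ← h3]
  simp only [Pi.neg_apply, mul_neg, Finset.sum_neg_distrib, neg_neg, Finset.sum_add_distrib]
  simp [lift]

/-- The explicit form of the operators `C_k`. -/
theorem opC_eq {f : Phase Q d m → ℝ} (hf : f ∈ testFun π m) {k : ℕ} (hk : k ≤ 2)
    (r : Fin m × Fin d) : opC π V lam k r f = field π (fieldC lam k r) f := by
  have hle : ∀ n : ℕ, (n : WithTop ℕ∞) ≤ ((⊤ : ℕ∞) : WithTop ℕ∞) := fun n =>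
    by exact_mod_cast le_top
  have h1 : ∀ {f : Phase Q d m → ℝ}, IsMixed π r f →
      opC π V lam 1 r f = field π (fieldC lam 1 r) f := fun hf => by
    rw [opC_one hπ hV hf, field_fieldC_one]
  interval_cases k
  · rw [field_fieldC_zero]
    rfl
  · exact h1 (IsMixed.of_contDiff hπ (hf.1.of_le (hle 2)))
  · have h2 : opC π V lam 2 r f = opC π V lam 1 r (opB π V lam f) -
      opB π V lam (opC π V lam 1 r f) := rfl
    rw [h2, h1 (isMixed_opB hπ hV r (hf.1.of_le (hle 3))),
      h1 (IsMixed.of_contDiff hπ (hf.1.of_le (hle 2))),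
      opB_eq_opL (β := 1), opB_eq_opL (β := 1),
      field_one_opL hπ hV (compactC_mono (hle 3) hf), add_sub_cancel_left]

end Mixed

/-! ### Flows of quasi-accretive operators. -/

section Flow

open scoped InnerProductSpace

variable {W : Type*} [NormedAddCommGroup W] [InnerProductSpace ℝ W] [CompleteSpace W]
  {D : Type*} [AddCommGroup D] [Module ℝ D]

/-- The flow of an operator that is accretive up to a shift on the closure of its domain. -/
theorem exists_flow {K A : D →ₗ[ℝ] W} {c l0 : ℝ} (hc : ∀ φ, 0 ≤ ⟪K φ, A φ + c • K φ⟫_ℝ)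
    (hA : ∀ φ, A φ ∈ closure (Set.range K))
    (hr : ∀ l ≥ l0, ∀ (φ : D) (ε : ℝ), 0 < ε → ∃ ψ, ‖l • K ψ + A ψ - K φ‖ < ε) :
    ∃ S : ℝ → D →ₗ[ℝ] W, ∀ φ, S 0 φ = K φ ∧ (Continuous fun t => S t φ) ∧ ∃ a : ℝ → W,
      (∀ t, 0 ≤ t → HasDerivWithinAt (fun t => S t φ) (-a t) (Set.Ici t) t) ∧
      ∀ t, 0 ≤ t → (S t φ, a t) ∈ graphClosure K A := by
  -- The Hille-Yosida theorem is applied in the closure of the domain, which A maps into by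
  -- hypothesis.
  let E : Submodule ℝ W := (LinearMap.range K).topologicalClosure
  have : CompleteSpace E := Submodule.topologicalClosure.completeSpace _
  have hE : ∀ w : W, w ∈ closure (Set.range K) → w ∈ E := fun w hw => by
    rw [← LinearMap.coe_range] at hw
    exact hw
  let K' : D →ₗ[ℝ] E := K.codRestrict E fun φ => hE _ (subset_closure ⟨φ, rfl⟩)
  let A' : D →ₗ[ℝ] E := A.codRestrict E fun φ => hE _ (hA φ)
  have hd : DenseRange K' := fun u => by
    rw [Metric.mem_closure_iff]
    intro ε hε
    obtain ⟨_, ⟨φ, rfl⟩, hφ⟩ := Metric.mem_closure_iff.1 u.2 ε hε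
    exact ⟨_, ⟨φ, rfl⟩, hφ⟩
  have hacc : IsAccretive K' (A' + c • K') := by
    refine ⟨hc, hd, ?_⟩
    filter_upwards [eventually_ge_atTop (l0 - c)] with l hl
    intro u
    rw [Metric.mem_closure_iff]
    intro ε hε
    obtain ⟨φ, hφ⟩ := Metric.denseRange_iff.1 hd u (ε / 2) (half_pos hε)
    obtain ⟨ψ, hψ⟩ := hr (l + c) (by linarith) φ (ε / 2) (half_pos hε)
    refine ⟨_, ⟨ψ, rfl⟩, ?_⟩
    have h1 : dist (K' φ) ((l • K' + (A' + c • K')) ψ) < ε / 2 := by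
      rw [dist_comm, dist_eq_norm]
      have e : l • K ψ + (A ψ + c • K ψ) - K φ = (l + c) • K ψ + A ψ - K φ := by
        rw [add_smul]
        abel
      rw [← e] at hψ
      exact hψ
    linarith [dist_triangle u (K' φ) ((l • K' + (A' + c • K')) ψ)]
  obtain ⟨S, hS⟩ := hacc.exists_semigroup
  -- The semigroup belongs to A + c; the factor e^{ct} removes the shift.
  refine ⟨fun t => (Real.exp (c * t) • (E.subtypeL ∘L S t.toNNReal).toLinearMap) ∘ₗ K',
    fun φ => ?_⟩
  have hφ := mem_graphClosure (K := K') (A := A' + c • K') φ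
  let v : ℝ → W := fun s => S s.toNNReal (K' φ)
  let w : ℝ → W := fun s => S s.toNNReal ((A' + c • K') φ)
  have hvc : Continuous v := continuous_subtype_val.comp (hS.continuous_orbit _)
  have hvd : ∀ s, 0 ≤ s → HasDerivWithinAt v (-w s) (Set.Ici s) s := fun s hs =>
    E.subtypeL.hasFDerivAt.comp_hasDerivWithinAt s (hS.hasDerivWithinAt_orbit hφ hs)
  refine ⟨?_, (by fun_prop : Continuous fun s => Real.exp (c * s)).smul hvc,
    fun s => Real.exp (c * s) • (w s - c • v s), fun s hs => ?_, fun s hs => ?_⟩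
  · simp [hS.zero, K']
  · have h1 : HasDerivAt (fun s => Real.exp (c * s)) (Real.exp (c * s) * (c * 1)) s :=
      ((hasDerivAt_id s).const_mul c).exp
    refine (h1.hasDerivWithinAt.smul (hvd s hs)).congr_deriv ?_
    simp only [smul_sub, smul_neg, neg_sub, mul_one, mul_smul]
    abel
  · have h1 : (v s, w s - c • v s) ∈ graphClosure K A := by
      refine graphClosure_induction
        (p := fun r : E × E => ((r.1 : W), (r.2 : W) - c • r.1.1) ∈ graphClosure K A)
        (IsClosed.preimage (by fun_prop) (Submodule.isClosed_topologicalClosure _)) (fun ψ => ?_)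
        (hS.map_mem hφ s.toNNReal)
      have h2 := mem_graphClosure (K := K) (A := A) ψ
      rw [← add_sub_cancel_right (A ψ) (c • K ψ)] at h2
      exact h2
    exact Submodule.smul_mem _ (Real.exp (c * s)) h1

end Flow

/-! ### The semigroup on L² and its regularizing effect. -/

section Regularization

open scoped InnerProductSpace

variable {Q : Type} [NormedAddCommGroup Q] {d m : ℕ} {π : Vec d → Q} {V : Q → ℝ}
  {α lam : Fin m → ℝ} {β : ℝ} [ProperSpace Q] [MeasureSpace Q] [BorelSpace Q]
  [(volume : Measure Q).IsAddHaarMeasure]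

namespace IsSetting

variable (h : IsSetting π V β)

/-- The value of a tuple. -/
noncomputable def tupleValue : SobolevTuple d m V β →L[ℝ] L2 d m V β := PiLp.proj 2 _ none

/-- Test functions in `L²`. -/
noncomputable def testL2 : testFun π m →ₗ[ℝ] L2 d m V β :=
  tupleValue.toLinearMap ∘ₗ h.sobolev ∘ₗ incl

/-- The generator on test functions, with values in `L²`. -/
noncomputable def genL2 (α lam : Fin m → ℝ) : testFun π m →ₗ[ℝ] L2 d m V β :=
  tupleValue.toLinearMap ∘ₗ h.sobolev ∘ₗ h.gen α lam

include h

/-- The range condition is inherited from the Sobolev space, whose norm dominates that of L². -/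
theorem isAccretive_L2 (hα : ∀ j, 0 < α j) :
    IsAccretive (h.testL2 (m := m)) (h.genL2 α lam) where
  nonneg f := h.inner_cls_opL_nonneg hα (test_mem f.2 3)
  dense := h.cls_test_dense
  range := by
    obtain ⟨l0, hl0⟩ := h.exists_norm_sobolev_resolvent_lt (lam := lam) hα
    filter_upwards [eventually_ge_atTop l0] with l hl
    intro u
    rw [Metric.mem_closure_iff]
    intro ε hε
    obtain ⟨f, hf⟩ := Metric.denseRange_iff.1 (h.cls_test_dense (m := m)) u (ε / 2) (half_pos hε)
    obtain ⟨v, hv⟩ := hl0 l hl f (ε / 2) (half_pos hε)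
    refine ⟨_, ⟨v, rfl⟩, ?_⟩
    have h1 := (PiLp.norm_apply_le _ none).trans_lt hv
    rw [dist_eq_norm] at hf ⊢
    have h2 := norm_sub_le (u - cls (gibbs m V β) f.1)
      ((l • h.sobolev (incl v) + h.sobolev (h.gen α lam v) - h.sobolev (incl f)) none)
    have e : u - cls (gibbs m V β) f.1 -
        (l • h.sobolev (incl v) + h.sobolev (h.gen α lam v) - h.sobolev (incl f)) none =
        u - (l • h.testL2 (m := m) + h.genL2 α lam) v := by
      change u - h.sobolev (incl f) none - (l • h.sobolev (incl v) none +
        h.sobolev (h.gen α lam v) none - h.sobolev (incl f) none) =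
        u - (l • h.sobolev (incl v) none + h.sobolev (h.gen α lam v) none)
      abel
    rw [e] at h2
    linarith

/-- The closure of the vector of operators `C_k`. -/
theorem closureC_eq {k : ℕ} (hk : k ≤ 2) : closureC π V lam β k =
    closure (Set.range fun f : testFun π m =>
      (h.testL2 f, tupleC lam k (h.sobolev (incl f)))) := by
  unfold closureC
  congr 1
  have key : ∀ {φ : Phase Q d m → ℝ} (hφ : φ ∈ testFun π m)
      (r : L2 d m V β × PiLp 2 fun _ : Fin m × Fin d => L2 d m V β),
      (r.1 =ᵐ[gibbs m V β] φ ∧ ∀ ji, r.2 ji =ᵐ[gibbs m V β] opC π V lam k ji φ) ↔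
      (h.testL2 ⟨φ, hφ⟩, tupleC lam k (h.sobolev (incl ⟨φ, hφ⟩))) = r := fun {φ} hφ r => by
    rw [eq_comm, Prod.ext_iff]
    refine and_congr (eq_cls_iff (h.memLp hφ)).symm ?_
    rw [PiLp.ext_iff]
    refine forall_congr' fun ji => ?_
    rw [h.tupleField_sobolev, opC_eq h.cover h.potential.contDiff hφ hk]
    exact (eq_cls_iff (h.memLp
      (field_mem h.cover (test_mem hφ 1) (k := 0) (by norm_num) _))).symm
  ext r
  constructor
  · rintro ⟨φ, hφ, hr⟩
    exact ⟨⟨φ, hφ⟩, (key hφ r).1 hr⟩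
  · rintro ⟨φ, hr⟩
    exact ⟨φ.1, φ.2, (key φ.2 r).2 hr⟩

theorem closureL_eq : closureL π V α lam β =
    (graphClosure (h.testL2 (m := m)) (h.genL2 α lam) : Set (L2 d m V β × L2 d m V β)) := by
  ext r
  rw [SetLike.mem_coe, mem_graphClosure_iff]
  unfold closureL
  congr! 2
  have key : ∀ {φ : Phase Q d m → ℝ} (hφ : φ ∈ testFun π m) (r : L2 d m V β × L2 d m V β),
      (r.1 =ᵐ[gibbs m V β] φ ∧ r.2 =ᵐ[gibbs m V β] opL π V α lam β φ) ↔
      (h.testL2 ⟨φ, hφ⟩, h.genL2 α lam ⟨φ, hφ⟩) = r := fun {φ} hφ r => by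
    rw [eq_comm, Prod.ext_iff]
    exact and_congr (eq_cls_iff (h.memLp hφ)).symm
      (eq_cls_iff (h.memLp (h.gen α lam ⟨φ, hφ⟩).2)).symm
  ext r
  constructor
  · rintro ⟨φ, hφ, hr⟩
    exact ⟨⟨φ, hφ⟩, (key hφ r).1 hr⟩
  · rintro ⟨φ, hr⟩
    exact ⟨φ.1, φ.2, (key φ.2 r).2 hr⟩

theorem isExpNegL_iff {T : NNReal → L2 d m V β →L[ℝ] L2 d m V β} :
    IsExpNegL π V α lam β T ↔ IsSemigroupOf h.testL2 (h.genL2 α lam) T := by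
  constructor
  · rintro ⟨h1, h2⟩
    refine ⟨h1, fun u g => ?_⟩
    rw [h2, h.closureL_eq]
    rfl
  · rintro ⟨h1, h2⟩
    refine ⟨h1, fun u g => ?_⟩
    rw [h2, h.closureL_eq]
    rfl

theorem existsUnique_isExpNegL (hα : ∀ j, 0 < α j) :
    ∃! T : NNReal → L2 d m V β →L[ℝ] L2 d m V β, IsExpNegL π V α lam β T := by
  have hA := h.isAccretive_L2 (m := m) (lam := lam) hα
  obtain ⟨T, hT⟩ := hA.exists_semigroup
  exact ⟨T, h.isExpNegL_iff.2 hT, fun S hS => hT.unique hA (h.isExpNegL_iff.1 hS)⟩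

/-- The formal adjoint of a vector field. -/
theorem inner_cls_field {f g : Phase Q d m → ℝ} (hf : f ∈ compactC π m 1)
    (hg : g ∈ compactC π m 1) (w : Coord d m → ℝ) :
    ⟪cls (gibbs m V β) (field π w f), cls _ g⟫_ℝ = ⟪cls (gibbs m V β) f,
      cls _ (∑ v, w v • (β • (energyGrad π V v * g) - der π v g))⟫_ℝ := by
  have hd : ∀ {f : Phase Q d m → ℝ}, f ∈ compactC π m 1 → ∀ v, der π v f ∈ compactC π m 0 :=
    fun hf v => h.cover.der_mem hf (by norm_num) v
  have he : ∀ {f : Phase Q d m → ℝ}, f ∈ compactC π m 1 → ∀ v,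
      energyGrad π V v * f ∈ compactC π m 1 := fun hf v =>
    mul_mem_compactC (contDiff_lift_energyGrad h.cover h.potential.contDiff v) hf
  have hm : ∀ v, β • (energyGrad π V v * g) - der π v g ∈ compactC π m 0 := fun v =>
    sub_mem (Submodule.smul_mem _ _ (compactC_mono (by norm_num) (he hg v))) (hd hg v)
  rw [field, cls_sum _ (fun v => (h.memLp (hd hf v)).const_smul _),
    cls_sum _ (fun v => (h.memLp (hm v)).const_smul _), sum_inner, inner_sum]
  refine Finset.sum_congr rfl fun v _ => ?_
  rw [cls_smul (h.memLp (hd hf v)), cls_smul (h.memLp (hm v)), real_inner_smul_left,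
    real_inner_smul_right, inner_cls (h.memLp (hd hf v)) (h.memLp hg),
    inner_cls (h.memLp hf) (h.memLp (hm v))]
  congr 1
  have hfg : f * g ∈ compactC π m 1 := mul_mem_compactC hf.1 hg
  have h1 := h.potential.integral_der h.cover h.pos hfg v
  have i1 : Integrable (der π v f * g) (gibbs m V β) := h.potential.integrable_gibbs h.cover h.pos
    (mul_mem_compactC (k := 0) (hd hf v).1 (compactC_mono (by norm_num) hg))
  have i2 : Integrable (f * der π v g) (gibbs m V β) := h.potential.integrable_gibbs h.cover h.pos
    (mul_mem_compactC (k := 0) (hf.1.of_le (by norm_num)) (hd hg v))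
  have i3 : Integrable (energyGrad π V v * (f * g)) (gibbs m V β) :=
    h.potential.integrable_gibbs h.cover h.pos (he hfg v)
  rw [h.cover.der_mul (hf.1.differentiable (by norm_num)) (hg.1.differentiable (by norm_num))] at h1
  have h2 : ∫ x, (der π v f * g + f * der π v g) x ∂(gibbs m V β) =
      ∫ x, (der π v f * g) x ∂(gibbs m V β) + ∫ x, (f * der π v g) x ∂(gibbs m V β) :=
    integral_add i1 i2
  have h3 : ∫ x, f x * (β • (energyGrad π V v * g) - der π v g) x ∂(gibbs m V β) =
      β * ∫ x, (energyGrad π V v * (f * g)) x ∂(gibbs m V β) -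
        ∫ x, (f * der π v g) x ∂(gibbs m V β) := by
    rw [← integral_const_mul, ← integral_sub (i3.const_mul β) i2]
    congr 1
    funext x
    simp only [Pi.sub_apply, Pi.smul_apply, Pi.mul_apply, smul_eq_mul]
    ring
  change ∫ x, (der π v f * g) x ∂(gibbs m V β) = _
  rw [h3]
  change _ = β * ∫ x, energyGrad π V v x * (f * g) x ∂(gibbs m V β) - _
  rw [← h1, h2]
  ring

/-- C_k is closable: its formal adjoint is defined on test functions, which are dense, so u
determines the value. -/
theorem eq_of_mem_closureC {k : ℕ} (hk : k ≤ 2) {u : L2 d m V β}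
    {g g' : PiLp 2 fun _ : Fin m × Fin d => L2 d m V β} (hg : (u, g) ∈ closureC π V lam β k)
    (hg' : (u, g') ∈ closureC π V lam β k) : g = g' := by
  rw [h.closureC_eq hk] at hg hg'
  have key : ∀ {g : PiLp 2 fun _ : Fin m × Fin d => L2 d m V β},
      (u, g) ∈ closure (Set.range fun f : testFun π m =>
        (h.testL2 f, tupleC lam k (h.sobolev (incl f)))) → ∀ r (f : testFun π m),
      ⟪g r, h.testL2 f⟫_ℝ = ⟪u, cls _ (∑ v, fieldC lam k r v •
        (β • (energyGrad π V v * f.1) - der π v f.1))⟫_ℝ := fun {g} hg r f => by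
    have hc : IsClosed {s : L2 d m V β × PiLp 2 fun _ : Fin m × Fin d => L2 d m V β |
        ⟪s.2 r, h.testL2 f⟫_ℝ = ⟪s.1, cls _ (∑ v, fieldC lam k r v •
          (β • (energyGrad π V v * f.1) - der π v f.1))⟫_ℝ} := by
      refine isClosed_eq ?_ (by fun_prop)
      exact (((PiLp.proj 2 _ r : (PiLp 2 fun _ : Fin m × Fin d => L2 d m V β) →L[ℝ]
        L2 d m V β).continuous).comp continuous_snd).inner continuous_const
    refine hc.closure_subset_iff.2 ?_ hg
    rintro _ ⟨ψ, rfl⟩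
    simp only [Set.mem_setOf_eq]
    rw [h.tupleField_sobolev]
    exact h.inner_cls_field (test_one ψ.2) (test_one f.2) _
  refine PiLp.ext fun r => ?_
  have hd : DenseRange (h.testL2 (m := m)) := h.cls_test_dense
  have hh : (fun v : L2 d m V β => ⟪g r, v⟫_ℝ) = fun v => ⟪g' r, v⟫_ℝ :=
    hd.equalizer (by fun_prop) (by fun_prop)
      (funext fun f => (key hg r f).trans (key hg' r f).symm)
  exact ext_inner_right (E := L2 d m V β) ℝ fun v => congrFun hh v

/-- The regularizing effect of the semigroup. -/
theorem exists_norm_le_closureC (hα : ∀ j, 0 < α j)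
    {T : NNReal → L2 d m V β →L[ℝ] L2 d m V β} (hT : IsExpNegL π V α lam β T) :
    ∃ C : ℝ, ∀ k ≤ 2, ∀ t : NNReal, 0 < t → t ≤ 1 → ∀ f : L2 d m V β,
      (∃ g, (T t f, g) ∈ closureC π V lam β k) ∧
      ∀ g, (T t f, g) ∈ closureC π V lam β k →
        ‖g‖ ≤ C * (1 / (t : ℝ) ^ ((1 + 2 * (k : ℝ)) / 2)) * ‖f‖ := by
  have hT' := h.isExpNegL_iff.1 hT
  have hA := h.isAccretive_L2 (m := m) (lam := lam) hα
  obtain ⟨C, hC⟩ := h.exists_norm_tupleC_le (m := m) (lam := lam) hα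
  obtain ⟨c, hc⟩ := h.exists_le_inner_sobolev (m := m) (lam := lam) hα
  obtain ⟨l0, hl0⟩ := h.exists_norm_sobolev_resolvent_lt (m := m) (lam := lam) hα
  -- The image of a test function under the generator is only C¹, so it is not in the range of the
  -- core but in its closure, by mollification.
  obtain ⟨S, hS⟩ := exists_flow (K := h.sobolev ∘ₗ incl (m := m)) (A := h.sobolev ∘ₗ h.gen α lam)
    hc (fun f => h.sobolev_mem_closure _) hl0
  refine ⟨C, fun k hk t ht0 ht1 f => ?_⟩
  obtain ⟨B, hB⟩ : ∃ B, B = C * (1 / (t : ℝ) ^ ((1 + 2 * (k : ℝ)) / 2)) := ⟨_, rfl⟩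
  -- The L² component of the Sobolev flow solves the equation in the L² closure, hence is the orbit
  -- of T; the smoothing bound is thereby transferred to T.
  have main : ∀ φ : testFun π m, tupleValue (S t φ) = T t (h.testL2 φ) ∧
      ‖tupleC lam k (S t φ)‖ ≤ B * ‖h.testL2 φ‖ := fun φ => by
    obtain ⟨h0, hcont, a, ha, hmem⟩ := hS φ
    have h1 := hC (fun s => S s φ) a hcont ha
      (fun s hs => mem_graphClosure_iff.1 (hmem s hs)) k hk t ht0 ht1
    rw [h0, ← hB] at h1
    refine ⟨?_, h1⟩
    have h2 := hT'.eq_orbit hA (v := fun s => tupleValue (S s φ)) (a := fun s => tupleValue (a s))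
      (tupleValue.continuous.comp hcont) (fun s hs => by
        have := tupleValue.hasFDerivAt.comp_hasDerivWithinAt s (ha s hs)
        rwa [map_neg] at this)
      (fun s hs => graphClosure_induction
        (K := h.sobolev ∘ₗ incl (m := m)) (A := h.sobolev ∘ₗ h.gen α lam)
        (p := fun r : SobolevTuple d m V β × SobolevTuple d m V β =>
          (tupleValue r.1, tupleValue r.2) ∈ graphClosure (h.testL2 (m := m)) (h.genL2 α lam))
        (IsClosed.preimage (by fun_prop) (Submodule.isClosed_topologicalClosure _))
        (fun ψ => mem_graphClosure (K := h.testL2 (m := m)) (A := h.genL2 α lam) ψ)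
        (hmem s hs)) t.coe_nonneg
    simp only [h0, Real.toNNReal_coe] at h2
    exact h2
  have hcl : ∀ φ, (tupleValue (S t φ), tupleC lam k (S t φ)) ∈ closureC π V lam β k := fun φ => by
    rw [h.closureC_eq hk]
    obtain ⟨-, -, a, -, hmem⟩ := hS φ
    have h1 : S t φ ∈ closure (Set.range fun f : testFun π m => h.sobolev (incl f)) := by
      refine map_mem_closure (f := Prod.fst) continuous_fst (mem_graphClosure_iff.1 (hmem t t.coe_nonneg)) ?_
      rintro _ ⟨ψ, rfl⟩
      exact ⟨ψ, rfl⟩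
    have hcont : Continuous fun W : SobolevTuple d m V β => (tupleValue W, tupleC lam k W) :=
      tupleValue.continuous.prodMk (tupleC lam k).continuous
    refine map_mem_closure (f := fun W : SobolevTuple d m V β => (tupleValue W, tupleC lam k W)) hcont h1 ?_
    rintro _ ⟨ψ, rfl⟩
    exact ⟨ψ, rfl⟩
  have hd : DenseRange (h.testL2 (m := m)) := h.cls_test_dense
  obtain ⟨φ, hφ⟩ : ∃ φ : ℕ → testFun π m, Tendsto (fun n => h.testL2 (φ n)) atTop (𝓝 f) := by
    obtain ⟨x, hx, hxf⟩ := mem_closure_iff_seq_limit.1 (hd f)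
    choose φ hφ using hx
    exact ⟨φ, by simpa only [hφ] using hxf⟩
  -- The bound is applied to differences, by linearity of the flow in φ; it involves only the L²
  -- norm of the initial value.
  have hcau : CauchySeq fun n => tupleC lam k (S t (φ n)) := by
    have h1 := hφ.cauchySeq
    rw [Metric.cauchySeq_iff'] at h1 ⊢
    intro ε hε
    have hB1 : 0 < |B| + 1 := by positivity
    obtain ⟨N, hN⟩ := h1 (ε / (|B| + 1)) (by positivity)
    refine ⟨N, fun n hn => ?_⟩
    have h2 := hN n hn
    rw [dist_eq_norm] at h2 ⊢
    rw [← map_sub, ← map_sub]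
    rw [← map_sub, lt_div_iff₀ hB1] at h2
    refine lt_of_le_of_lt ((main (φ n - φ N)).2.trans ?_) h2
    rw [mul_comm]
    exact mul_le_mul_of_nonneg_left ((le_abs_self B).trans (by linarith)) (norm_nonneg _)
  obtain ⟨g, hg⟩ := cauchySeq_tendsto_of_complete hcau
  have hTg : (T t f, g) ∈ closureC π V lam β k := by
    refine isClosed_closure.mem_of_tendsto (b := atTop) (f := fun n =>
      (tupleValue (S t (φ n)), tupleC lam k (S t (φ n)))) ?_ (Eventually.of_forall fun n => hcl _)
    refine Tendsto.prodMk_nhds ?_ hg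
    simp only [(main _).1]
    exact ((T t).continuous.tendsto f).comp hφ
  refine ⟨⟨g, hTg⟩, fun g' hg' => ?_⟩
  rw [h.eq_of_mem_closureC hk hg' hTg, ← hB]
  exact le_of_tendsto_of_tendsto hg.norm (hφ.norm.const_mul B)
    (Eventually.of_forall fun n => (main (φ n)).2)

end IsSetting

end Regularization

/-! ### Periodic potentials. -/

section Torus

theorem isCover_torusMk (d : ℕ) (ℓ : ℝ) : IsCover (torusMk d ℓ) where
  map_add _ _ := rfl
  isOpenQuotientMap :=
    (IsOpenQuotientMap.piMap fun _ => QuotientAddGroup.isOpenQuotientMap_mk).comp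
      (EuclideanSpace.equiv (Fin d) ℝ).toHomeomorph.isOpenQuotientMap
  norm_le q := (pi_norm_le_iff_of_nonneg (norm_nonneg q)).2 fun i =>
    QuotientAddGroup.norm_mk_le_norm.trans (PiLp.norm_apply_le q i)

/-- The norm of an invariant function descends to a continuous function on the compact quotient. It
is applied to the Hessian of the lifted potential. -/
theorem IsCover.exists_norm_le {Q : Type} [NormedAddCommGroup Q] [CompactSpace Q] {d : ℕ}
    {π : Vec d → Q} (hπ : IsCover π) {E : Type*} [NormedAddCommGroup E] {F : Vec d → E}
    (hF : Continuous F) (h : ∀ q a, π a = 0 → F (q + a) = F q) : ∃ c, ∀ q, ‖F q‖ ≤ c := by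
  have hπs := hπ.isOpenQuotientMap.surjective
  let n : Q → ℝ := fun x => ‖F (hπs x).choose‖
  have hn : ∀ q, n (π q) = ‖F q‖ := fun q => by
    have h1 : π ((hπs (π q)).choose - q) = 0 := by
      have h2 := hπ.map_add ((hπs (π q)).choose - q) q
      rw [sub_add_cancel, (hπs (π q)).choose_spec] at h2
      simpa using h2
    have h3 := h q _ h1
    rw [add_sub_cancel] at h3
    simp only [n, h3]
  have hc : Continuous n := hπ.isOpenQuotientMap.isQuotientMap.continuous_iff.2 <| by
    rw [show n ∘ π = fun q => ‖F q‖ from funext hn]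
    exact hF.norm
  obtain ⟨c, hc⟩ := isCompact_univ.exists_bound_of_continuousOn hc.continuousOn
  refine ⟨c, fun q => ?_⟩
  rw [← hn]
  exact (le_abs_self _).trans (hc _ (Set.mem_univ _))

theorem isSetting_torus {d : ℕ} {ℓ β : ℝ} [Fact (0 < ℓ)] (hβ : 0 < β) {V : Torus d ℓ → ℝ}
    (hV : ContDiff ℝ 2 fun q : Vec d => V (torusMk d ℓ q)) : IsSetting (torusMk d ℓ) V β := by
  have hπ := isCover_torusMk d ℓ
  have hVc : Continuous V := hπ.isOpenQuotientMap.isQuotientMap.continuous_iff.2 hV.continuous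
  have hg : ∀ i, Continuous (gradV (torusMk d ℓ) V i) := fun i =>
    hπ.isOpenQuotientMap.isQuotientMap.continuous_iff.2 (contDiff_gradV hπ hV i).continuous
  have hi : ∀ {f : Torus d ℓ → ℝ}, Continuous f → Integrable f := fun hf =>
    hf.integrable_of_hasCompactSupport (HasCompactSupport.of_compactSpace _)
  have he : Continuous fun q => Real.exp (-β * V q) :=
    Real.continuous_exp.comp (continuous_const.mul hVc)
  refine ⟨hπ, ⟨hV, ?_, hi he, fun i => hi (((hg i).pow 2).mul he)⟩, ?_, hβ⟩
  · refine hπ.exists_norm_le (((hV.fderiv_right (m := 1) (by norm_num)).continuous_fderiv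
      (by norm_num))) fun q a ha => ?_
    have h1 : (fun q => V (torusMk d ℓ (q + a))) = fun q => V (torusMk d ℓ q) := by
      funext q
      rw [hπ.map_add, ha, add_zero]
    have h2 : (fun q => fderiv ℝ (fun q => V (torusMk d ℓ q)) (q + a)) =
        fderiv ℝ fun q => V (torusMk d ℓ q) := by
      funext q
      rw [← fderiv_comp_add_right (f := fun q => V (torusMk d ℓ q)) a, h1]
    rw [← fderiv_comp_add_right, h2]
  · choose K hK using fun i => isCompact_univ.exists_bound_of_continuousOn (hg i).continuousOn
    have hK0 : ∀ i, 0 ≤ K i := fun i => (norm_nonneg _).trans (hK i 0 (Set.mem_univ _))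
    refine ⟨∑ i, K i, fun i q => (hK i q (Set.mem_univ _)).trans ?_⟩
    have h1 := Finset.single_le_sum (f := K) (fun i _ => hK0 i) (Finset.mem_univ i)
    have h2 : 0 ≤ (∑ i, K i) * ‖q‖ :=
      mul_nonneg (Finset.sum_nonneg fun i _ => hK0 i) (norm_nonneg q)
    linarith

end Torus

/-! ### Confining potentials with bounded Hessian. -/

section Confining

variable {d : ℕ} {β : ℝ} {V : Vec d → ℝ}

theorem isCover_id (d : ℕ) : IsCover (id : Vec d → Vec d) :=
  ⟨fun _ _ => rfl, IsOpenQuotientMap.id, fun _ => le_rfl⟩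

theorem gradV_id (hV : ContDiff ℝ 2 V) (i : Fin d) (q : Vec d) :
    gradV id V i q = fderiv ℝ V q (EuclideanSpace.single i 1) :=
  gradV_proj (isCover_id d) (V := V) hV i q

/-- The gradient of a function with bounded second derivatives has linear growth. -/
theorem exists_norm_fderiv_le_of_hessian (hV : ContDiff ℝ 2 V) {c : ℝ}
    (hc : ∀ q, ‖fderiv ℝ (fderiv ℝ V) q‖ ≤ c) :
    ∃ K, 0 ≤ K ∧ ∀ q, ‖fderiv ℝ V q‖ ≤ K * (1 + ‖q‖) := by
  have hc0 : 0 ≤ c := (ContinuousLinearMap.opNorm_nonneg _).trans (hc 0)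
  refine ⟨‖fderiv ℝ V 0‖ + c, by positivity, fun q => ?_⟩
  have h1 := convex_univ.norm_image_sub_le_of_norm_fderiv_le (𝕜 := ℝ) (f := fderiv ℝ V)
    (fun z _ => (hV.fderiv_right (m := 1) (by norm_num)).differentiable (by norm_num) z)
    (fun z _ => hc z) (Set.mem_univ 0) (Set.mem_univ q)
  rw [sub_zero] at h1
  have h2 := norm_sub_norm_le (fderiv ℝ V q) (fderiv ℝ V 0)
  have h3 : 0 ≤ ‖fderiv ℝ V 0‖ * ‖q‖ := by positivity
  linarith

/-- The gradient of the potential is square integrable for the Gibbs weight. -/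
theorem integrable_gradV_sq (hβ : 0 < β) (hV : ContDiff ℝ 2 V)
    (hfi : Integrable fun q => Real.exp (-β * V q)) {c : ℝ}
    (hc : ∀ q, ‖fderiv ℝ (fderiv ℝ V) q‖ ≤ c) (i : Fin d) :
    Integrable fun q => gradV id V i q ^ 2 * Real.exp (-β * V q) := by
  obtain ⟨K, hK0, hK⟩ := exists_norm_fderiv_le_of_hessian hV hc
  obtain ⟨v, hv⟩ : ∃ v : Vec d, v = EuclideanSpace.single i 1 := ⟨_, rfl⟩
  have hv1 : ‖v‖ = 1 := by simp [hv]
  let G : Vec d → ℝ := fun q => fderiv ℝ V q v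
  let e : Vec d → ℝ := fun q => Real.exp (-β * V q)
  have hG1 : ContDiff ℝ 1 G := (hV.fderiv_right (m := 1) (by norm_num)).clm_apply contDiff_const
  have hGd : Differentiable ℝ G := hG1.differentiable (by norm_num)
  have he1 : ContDiff ℝ 1 e := ((contDiff_const.mul hV).exp).of_le (by norm_num)
  have hed : Differentiable ℝ e := he1.differentiable (by norm_num)
  have he0 : ∀ q, 0 < e q := fun q => Real.exp_pos _
  have hGb : ∀ q, |G q| ≤ K * (1 + ‖q‖) := fun q => by
    have := (fderiv ℝ V q).le_opNorm v
    rw [hv1, mul_one] at this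
    exact this.trans (hK q)
  have hGG : ∀ q, |fderiv ℝ G q v| ≤ c := fun q => by
    have h1 : HasFDerivAt G _ q := (((hV.fderiv_right (m := 1) (by norm_num)).differentiable
      (by norm_num) q).hasFDerivAt).clm_apply (hasFDerivAt_const v q)
    rw [h1.fderiv]
    have h2 := (fderiv ℝ (fderiv ℝ V) q v).le_opNorm v
    have h3 := (fderiv ℝ (fderiv ℝ V) q).le_opNorm v
    rw [hv1, mul_one] at h2 h3
    simpa using h2.trans (h3.trans (hc q))
  have hde : ∀ q, fderiv ℝ e q v = -β * (G q * e q) := fun q => by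
    have h1 : HasFDerivAt e _ q :=
      ((hV.differentiable (by norm_num) q).hasFDerivAt.const_mul (-β)).exp
    rw [h1.fderiv]
    simp only [ContinuousLinearMap.smul_apply, smul_eq_mul, G, e]
    ring
  let χ : ContDiffBump (0 : Vec d) := ⟨1, 2, one_pos, one_lt_two⟩
  have hχs : ContDiff ℝ 1 χ := χ.contDiff
  obtain ⟨C, hC⟩ := (χ.hasCompactSupport.fderiv (𝕜 := ℝ)).exists_bound_of_continuous
    (hχs.continuous_fderiv (by norm_num))
  have hC0 : 0 ≤ C := (norm_nonneg _).trans (hC 0)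
  -- A bound uniform in R for the truncated integral: since G e is -β⁻¹ times the derivative of e,
  -- one factor G is integrated by parts against the cutoff, leaving the Hessian and the derivative
  -- of the cutoff.
  have key : ∀ R : ℝ, 1 ≤ R → ∫ q in Metric.closedBall 0 R, ‖G q ^ 2 * e q‖ ≤
      β⁻¹ * ((c + 3 * K * C) * ∫ q, e q) := fun R hR => by
    have hR0 : 0 < R := zero_lt_one.trans_le hR
    let ψ : Vec d → ℝ := fun q => χ (R⁻¹ • q)
    have hψ1 : ContDiff ℝ 1 ψ := hχs.comp (contDiff_const_smul R⁻¹)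
    have hψd : Differentiable ℝ ψ := hψ1.differentiable (by norm_num)
    have hψs : HasCompactSupport ψ := χ.hasCompactSupport.comp_smul (inv_ne_zero hR0.ne')
    have hψ0 : ∀ q, 0 ≤ ψ q := fun q => χ.nonneg
    have hψ2 : ∀ q, ψ q ≤ 1 := fun q => χ.le_one
    -- The cutoff has gradient at most C/R and lives on ‖q‖ ≤ 2R, where |G| ≤ K(1 + 2R) ≤ 3KR.
    have hdψ : ∀ q, |fderiv ℝ ψ q v * G q| ≤ 3 * K * C := fun q => by
      have h1 : fderiv ℝ ψ q = R⁻¹ • fderiv ℝ χ (R⁻¹ • q) := fderiv_comp_smul R⁻¹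
      rw [h1, abs_mul, ContinuousLinearMap.smul_apply, smul_eq_mul, abs_mul,
        abs_of_pos (inv_pos.2 hR0)]
      by_cases hq : R⁻¹ • q ∈ tsupport χ
      · rw [χ.tsupport_eq, mem_closedBall_zero_iff, norm_smul, norm_inv,
          Real.norm_of_nonneg hR0.le, inv_mul_le_iff₀ hR0] at hq
        change ‖q‖ ≤ R * 2 at hq
        have h2 : |fderiv ℝ χ (R⁻¹ • q) v| ≤ C := by
          have := (fderiv ℝ χ (R⁻¹ • q)).le_opNorm v
          rw [hv1, mul_one] at this
          exact this.trans (hC _)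
        have h3 : |G q| ≤ K * (3 * R) := (hGb q).trans
          (mul_le_mul_of_nonneg_left (by linarith) hK0)
        calc R⁻¹ * |fderiv ℝ χ (R⁻¹ • q) v| * |G q| ≤ R⁻¹ * C * (K * (3 * R)) := by gcongr
          _ = 3 * K * C := by field_simp
      · have h2 : fderiv ℝ χ (R⁻¹ • q) = 0 := by
          by_contra h3
          exact hq (support_fderiv_subset ℝ h3)
        rw [h2, ContinuousLinearMap.zero_apply, abs_zero, mul_zero, zero_mul]
        positivity
    have hfi' : ∀ {f : Vec d → ℝ}, Continuous f → HasCompactSupport f → Integrable f :=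
      fun hf hs => hf.integrable_of_hasCompactSupport hs
    have hψG : HasCompactSupport (fun q => ψ q * G q) := hψs.mul_right
    have hψG1 : ContDiff ℝ 1 fun q => ψ q * G q := hψ1.mul hG1
    have hcd : ∀ {f : Vec d → ℝ}, ContDiff ℝ 1 f → Continuous fun q => fderiv ℝ f q v :=
      fun hf => (hf.continuous_fderiv (by norm_num)).clm_apply continuous_const
    have ibp := integral_mul_fderiv_eq_neg_fderiv_mul_of_integrable (μ := volume)
      (f := fun q => ψ q * G q) (g := e) (v := v)
      (hfi' ((hcd hψG1).mul he1.continuous) (hψG.fderiv_apply (𝕜 := ℝ) v).mul_right)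
      (hfi' (hψG1.continuous.mul (hcd he1)) hψG.mul_right)
      (hfi' (hψG1.continuous.mul he1.continuous) hψG.mul_right)
      (fun x _ => hψG1.differentiable (by norm_num) x) (fun x _ => hed x)
    have e1 : ∀ q, fderiv ℝ (fun q => ψ q * G q) q v = ψ q * fderiv ℝ G q v +
        fderiv ℝ ψ q v * G q := fun q => by
      have h1 : HasFDerivAt (fun q => ψ q * G q) _ q :=
        (hψd q).hasFDerivAt.mul (hGd q).hasFDerivAt
      rw [h1.fderiv]
      simp only [ContinuousLinearMap.add_apply, ContinuousLinearMap.smul_apply, smul_eq_mul]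
      ring
    have e2 : ∫ q, ψ q * (G q ^ 2 * e q) =
        β⁻¹ * ∫ q, fderiv ℝ (fun q => ψ q * G q) q v * e q := by
      have h1 : ∀ q, ψ q * G q * fderiv ℝ e q v = -β * (ψ q * (G q ^ 2 * e q)) := fun q => by
        rw [hde]
        ring
      simp only [h1] at ibp
      rw [integral_const_mul] at ibp
      rw [eq_inv_mul_iff_mul_eq₀ hβ.ne']
      linarith
    have h1 : ∫ q in Metric.closedBall 0 R, ‖G q ^ 2 * e q‖ ≤ ∫ q, ψ q * (G q ^ 2 * e q) := by
      have h2 : ∀ q ∈ Metric.closedBall (0 : Vec d) R, ‖G q ^ 2 * e q‖ =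
          ψ q * (G q ^ 2 * e q) := fun q hq => by
        have h3 : ψ q = 1 := χ.one_of_mem_closedBall (by
          rw [mem_closedBall_zero_iff] at hq ⊢
          rw [norm_smul, norm_inv, Real.norm_of_nonneg hR0.le, inv_mul_le_iff₀ hR0]
          change ‖q‖ ≤ R * 1
          rwa [mul_one])
        have := he0 q
        rw [h3, one_mul, Real.norm_of_nonneg (by positivity)]
      rw [setIntegral_congr_fun measurableSet_closedBall h2]
      refine setIntegral_le_integral (hfi' (hψ1.continuous.mul
        ((hG1.continuous.pow 2).mul he1.continuous)) hψs.mul_right)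
        (Eventually.of_forall fun q => ?_)
      have := he0 q
      have := hψ0 q
      exact mul_nonneg this (by positivity)
    refine h1.trans ?_
    rw [e2]
    refine mul_le_mul_of_nonneg_left ?_ (inv_pos.2 hβ).le
    rw [← integral_const_mul]
    refine integral_mono (hfi' ((hcd hψG1).mul he1.continuous)
      (hψG.fderiv_apply (𝕜 := ℝ) v).mul_right) (hfi.const_mul _) fun q => ?_
    refine mul_le_mul_of_nonneg_right ?_ (he0 q).le
    rw [e1]
    refine add_le_add ?_ ((le_abs_self _).trans (hdψ q))
    refine (le_abs_self _).trans ?_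
    rw [abs_mul, abs_of_nonneg (hψ0 q)]
    exact (mul_le_of_le_one_left (abs_nonneg _) (hψ2 q)).trans (hGG q)
  have hfun : (fun q => gradV id V i q ^ 2 * Real.exp (-β * V q)) = fun q => G q ^ 2 * e q := by
    funext q
    rw [gradV_id hV, ← hv]
  rw [hfun]
  refine AECover.integrable_of_integral_norm_bounded (φ := fun n : ℕ =>
    Metric.closedBall (0 : Vec d) ((n : ℝ) + 1)) (l := atTop) (aecover_closedBall
      (tendsto_atTop_add_const_right _ _ tendsto_natCast_atTop_atTop)) _ (fun n => ?_)
    (Eventually.of_forall fun n => key _ (by simp))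
  exact ((hG1.continuous.pow 2).mul he1.continuous).continuousOn.integrableOn_compact
    (isCompact_closedBall _ _)

theorem isSetting_id (hβ : 0 < β) (hV : ContDiff ℝ 2 V)
    (hfi : Integrable fun q => Real.exp (-β * V q)) (hH : HasBoundedHessian V) :
    IsSetting id V β := by
  obtain ⟨c, hc⟩ := hH
  obtain ⟨K, -, hK⟩ := exists_norm_fderiv_le_of_hessian hV hc
  refine ⟨isCover_id d, ⟨hV, ⟨c, hc⟩, hfi, integrable_gradV_sq hβ hV hfi hc⟩,
    ⟨K, fun i q => ?_⟩, hβ⟩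
  rw [gradV_id hV]
  refine le_trans ?_ (hK q)
  have := (fderiv ℝ V q).le_opNorm (EuclideanSpace.single i (1 : ℝ))
  simpa using this

end Confining

end GLE

theorem mainTheorem4 (d m : ℕ) (α lam : Fin m → ℝ) (β : ℝ) (hα : ∀ j, 0 < α j) (hβ : 0 < β) :
    -- periodic potentials
    (∀ (ℓ : ℝ) [Fact (0 < ℓ)] (V : GLE.Torus d ℓ → ℝ),
      ContDiff ℝ 2 (fun q : GLE.Vec d => V (GLE.torusMk d ℓ q)) →
      (∃! T : NNReal → GLE.L2 d m V β →L[ℝ] GLE.L2 d m V β,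
        GLE.IsExpNegL (GLE.torusMk d ℓ) V α lam β T) ∧
      ∀ T : NNReal → GLE.L2 d m V β →L[ℝ] GLE.L2 d m V β,
        GLE.IsExpNegL (GLE.torusMk d ℓ) V α lam β T →
        ∃ C : ℝ, ∀ k ≤ 2, ∀ t : NNReal, 0 < t → t ≤ 1 → ∀ f : GLE.L2 d m V β,
          (∃ g, (T t f, g) ∈ GLE.closureC (GLE.torusMk d ℓ) V lam β k) ∧
          ∀ g, (T t f, g) ∈ GLE.closureC (GLE.torusMk d ℓ) V lam β k →
            ‖g‖ ≤ C * (1 / (t : ℝ) ^ ((1 + 2 * (k : ℝ)) / 2)) * ‖f‖) ∧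
    -- confining potentials
    (∀ V : GLE.Vec d → ℝ,
      ContDiff ℝ 2 V → GLE.IsConfining β V → GLE.HasBoundedHessian V →
      (∃! T : NNReal → GLE.L2 d m V β →L[ℝ] GLE.L2 d m V β,
        GLE.IsExpNegL id V α lam β T) ∧
      ∀ T : NNReal → GLE.L2 d m V β →L[ℝ] GLE.L2 d m V β,
        GLE.IsExpNegL id V α lam β T →
        ∃ C : ℝ, ∀ k ≤ 2, ∀ t : NNReal, 0 < t → t ≤ 1 → ∀ f : GLE.L2 d m V β,
          (∃ g, (T t f, g) ∈ GLE.closureC id V lam β k) ∧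
          ∀ g, (T t f, g) ∈ GLE.closureC id V lam β k →
            ‖g‖ ≤ C * (1 / (t : ℝ) ^ ((1 + 2 * (k : ℝ)) / 2)) * ‖f‖) := by
  -- Both cases are instances of one setting: a nonexpanding cover, a bounded Hessian, an integrable
  -- weight with square integrable gradient, and linear growth of the gradient.
  refine ⟨fun ℓ _ V hV => ?_, fun V hV hc hH => ?_⟩
  · have h := GLE.isSetting_torus hβ hV
    exact ⟨h.existsUnique_isExpNegL hα, fun T hT => h.exists_norm_le_closureC hα hT⟩
  · have h := GLE.isSetting_id hβ hV hc.2 hH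
    exact ⟨h.existsUnique_isExpNegL hα, fun T hT => h.exists_norm_le_closureC hα hT⟩
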